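/- Let $n\ge 2$ and use $\tilde u(\lambda)=\int u(t)e^{i\lambda t}dt$. Let $H:\mathbb R^n\to\mathbb R$ be $C^\infty$ on $\mathbb R^n\setminus\{0\}$ and positively homogeneous of degree $1$, let $\Theta_0\in S^{n-1}$ and $x_0=H'(\Theta_0)$. Let $\Omega\subset S^{n-1}$ be an open neighbourhood of $\Theta_0$, sufficiently small (how small depends only on $H,\Theta_0$), such that for $\alpha\in\Omega$ one has $H(-\alpha)=-H(\alpha)$ and $\check H''(\alpha)$, the Hessian of $H$ at $\alpha$ restricted to $\alpha^\perp$, is negative definite. Let $s\ge\frac{n+1}2$ and let $\beta$ be such that $\kappa_2:=\beta-s-\frac{n-3}2=0$. Let $\tilde B_0\in C^\infty(S^{n-1})$, $\tilde B(\alpha,\lambda)=\lambda^\beta\tilde B_0(\alpha)$ for $\lambda>0$, $\tilde B(-\alpha,-\lambda)=\tilde B(\alpha,\lambda)$, and let $B(\alpha,p)=\frac1{2\pi}\int\tilde B(\alpha,\lambda)e^{-i\lambda p}d\lambda$, a distribution in $p$ (the limit as $\delta\to+0$ of the integrals with the additional factor $e^{-\delta|\lambda|}$). Let $a_0\in C_0^\infty(\Omega\cup(-\Omega))$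 and $$g_0(\alpha,H(\alpha)+p)=a_0(\alpha)p_+^{s-1}+a_0(-\alpha)p_-^{s-1},\qquad \alpha\in\Omega\cup(-\Omega).$$ Put $c_\pm^{(1)}(\alpha)=\Gamma(s)\tilde B_0(\pm\alpha)\bigl(a_0(\alpha)e^{\pm i\pi s/2}+a_0(-\alpha)e^{\mp i\pi s/2}\bigr)$ and assume $c_-^{(1)}(\alpha)=e^{-i(\beta-s)\pi}c_+^{(1)}(\alpha)$ for all $\alpha\in\Omega$. Let $\varphi:\mathbb R\to\mathbb R$ be compactly supported with $\int\varphi=1$, $\varphi^{(j)}\in L^\infty(\mathbb R)$ for $0\le j\le\lfloor\beta\rfloor+1$, and $\sum_{j\in\mathbb Z}j^m\varphi(t-j)=t^m$ for all $t\in\mathbb R$ and integers $0\le m\le\lceil\beta\rceil$ (usual ceiling). Let $U\subset\mathbb R^{n-1}$ be open with $0\in U$, let $T:U\to\Omega$ be a smooth diffeomorphism with $T(0)=\Theta_0$, and for $\epsilon>0$ let $u_\epsilon\in[0,1)^{n-1}$. The available directions in $\Omega$ are $\alpha_{\vec k}=T(\epsilon(\vec k+u_\epsilon))$, $\vec k\in\mathbb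 Z^{n-1}$, $\epsilon(\vec k+u_\epsilon)\in U$, with elementary volumes $|\Delta\alpha_{\vec k}|=\epsilon^{n-1}|\det T'(\epsilon(\vec k+u_\epsilon))|(1+O(\epsilon))$, uniformly over grid points in compact subsets of $U$. Assume that $x_0$ is generic: the vector $\partial(T(u)\cdot x_0)/\partial u|_{u=0}$ has at least one irrational component. With $p_j=\epsilon j$ let $$(\mathcal B_\epsilon g_0)(x)=2\sum_{\alpha_{\vec k}\in\Omega}\sum_{j\in\mathbb Z}\int B(\alpha_{\vec k},\alpha_{\vec k}\cdot x-p)\,\varphi\Bigl(\frac{p-p_j}\epsilon\Bigr)dp\;g_0(\alpha_{\vec k},p_j)\,|\Delta\alpha_{\vec k}|.$$ Then all limits and series in this definition converge, and, uniformly for $\check x$ in bounded sets, with $h=\check x\cdot\Theta_0$, $$\lim_{\epsilon\to+0}(\mathcal B_\epsilon g_0)(x_0+\epsilon\check x)=(\varphi*\mu)(h),\qquad \mu(t)=\frac{2(2\pi)^{(n-1)/2}}{|\det\check H''(\Theta_0)|^{1/2}}\,e^{-i\frac{n-3}2\frac\pi2}c_+^{(1)}(\Theta_0)\,t_-^0,$$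 where $t_-^0=1$ for $t<0$ and $t_-^0=0$ for $t\geq0$. If $\varphi$ is even, the same holds when $\mathcal B_\epsilon g_0$ is instead the sum, without the factor $2$, over available directions in both $\Omega$ and $-\Omega$, those in $-\Omega$ being given by a diffeomorphism $T_-:U\to-\Omega$, $T_-(0)=-\Theta_0$, and by volumes with the same properties ($x_0$ being generic also with respect to $T_-$). In particular, suppose that $g_0=\hat f_0$ on $\Omega\cup(-\Omega)$ for some function $\tilde v_0$, i.e. $g_0(\alpha,H(\alpha)+p)=\hat f_0(\alpha,p)$, where, with $\omega(\alpha)=(2\pi)^{-(n-1)/2}|\det\check H''(\alpha)|^{1/2}e^{-\frac{i\pi}4\mathrm{sgn}\,\check H''(\alpha)}$ ($\mathrm{sgn}$ being the signature), $$\hat f_0(\alpha,p)=a_+(\alpha)p_+^{s-1}+a_-(\alpha)p_-^{s-1},\quad a_\pm(\alpha)=\frac{\omega(\alpha)\tilde v_0(\alpha)e^{\pm i(s-1)\frac\pi2}+\omega(-\alpha)\tilde v_0(-\alpha)e^{\mp i(s-1)\frac\pi2}}{2\sin(\pi s)\Gamma(s)}$$ if $s\notin\mathbb Z$, and $\hat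 f_0(\alpha,p)=\frac{\omega(\alpha)\tilde v_0(\alpha)}{2i^s(s-1)!}p^{s-1}\mathrm{sgn}(p)$ if $s\in\mathbb Z$. Then $\mu(p)=2\tilde B_0(\Theta_0)\tilde v_0(\Theta_0)\,i\,p_-^0$. -/

import Mathlib

open Filter Topology Set
open scoped Pointwise Manifold ContDiff NNReal

noncomputable section

namespace DTB

/-! Throughout, the ambient dimension is `n = d + 1`. -/

/-- The space `ℝⁿ`, `n = d + 1`. -/
abbrev Space (d : ℕ) : Type := EuclideanSpace ℝ (Fin (d + 1))

/-- The parameter space `ℝⁿ⁻¹` of the directions. -/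
abbrev Param (d : ℕ) : Type := EuclideanSpace ℝ (Fin d)

instance factFinrankSpace (d : ℕ) : Fact (Module.finrank ℝ (Space d) = d + 1) :=
  ⟨by simp⟩

/-- The unit sphere `Sⁿ⁻¹`. -/
abbrev unitSphere (d : ℕ) : Set (Space d) := Metric.sphere (0 : Space d) 1

/-- The restriction of `F` to the unit sphere is a `C^∞` function on that manifold.
(Only the values on the sphere matter.) -/
def SmoothOnSphere {d : ℕ} (F : Space d → ℂ) : Prop :=
  ContMDiff (𝓡 d) 𝓘(ℝ, ℂ) ∞ (fun α : Metric.sphere (0 : Space d) 1 => F α)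

/-- `F ∈ C₀^∞(W)` for a subset `W` of the unit sphere. -/
def SmoothCompactSupportIn {d : ℕ} (F : Space d → ℂ) (W : Set (Space d)) : Prop :=
  SmoothOnSphere F ∧
    ∃ K : Set (Space d), IsCompact K ∧ K ⊆ W ∧ ∀ α ∈ unitSphere d, α ∉ K → F α = 0

/-! ### The function `H` and its Hessian on the tangent plane -/

/-- The matrix of the second derivative of `H` at `α`, restricted to the hyperplane `α^⊥`, in an
orthonormal basis of that hyperplane.  Definiteness, determinant and signature do not depend on
the basis. -/
def tangentHessian {d : ℕ} (H : Space d → ℝ) (α : Space d) :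
    Matrix (Fin (Module.finrank ℝ (Submodule.span ℝ {α})ᗮ))
      (Fin (Module.finrank ℝ (Submodule.span ℝ {α})ᗮ)) ℝ :=
  Matrix.of fun i j =>
    iteratedFDeriv ℝ 2 H α
      ![((stdOrthonormalBasis ℝ (Submodule.span ℝ {α})ᗮ) i : Space d),
        ((stdOrthonormalBasis ℝ (Submodule.span ℝ {α})ᗮ) j : Space d)]

open Classical in
/-- Number of positive minus number of negative eigenvalues of a symmetric matrix. -/
def matrixSignature {ι : Type} [Fintype ι] (M : Matrix ι ι ℝ) : ℤ :=
  if h : M.IsHermitian then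
    ((Finset.univ.filter fun i => 0 < h.eigenvalues i).card : ℤ)
      - ((Finset.univ.filter fun i => h.eigenvalues i < 0).card : ℤ)
  else 0

/-- `ω(α) = |det Ȟ''(α)|^{1/2} e^{-iπ sgn Ȟ''(α) / 4} / (2π)^{(n-1)/2}`. -/
def omega {d : ℕ} (H : Space d → ℝ) (α : Space d) : ℂ :=
  ((Real.sqrt |(tangentHessian H α).det| : ℝ) : ℂ)
    * Complex.exp (-(Complex.I * Real.pi / 4) * (matrixSignature (tangentHessian H α) : ℂ))
    / (((2 * Real.pi) ^ ((d : ℝ) / 2) : ℝ) : ℂ)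

/-! ### The interpolation kernel -/

/-- The assumptions on the interpolation kernel, for an operator of order `β`.
Exactness is up to the degree `⌈β⌉` (which is `β` when `β` is an integer).  The condition
`φ^{(j)} ∈ L^∞` for `0 ≤ j ≤ ⌊β⌋ + 1` (i.e. `j ≤ β + 1` for integer `β` and `j ≤ ⌈β⌉` otherwise)
reads, for a compactly supported `φ`: `φ ∈ C^{⌊β⌋}` and `φ^{(⌊β⌋)}` is Lipschitz. -/
structure IsInterpolationKernel (β : ℝ) (φ : ℝ → ℝ) : Prop where
  exact : ∀ m : ℕ, m ≤ ⌈β⌉₊ → ∀ t : ℝ, ∑' j : ℤ, (j : ℝ) ^ m * φ (t - j) = t ^ m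
  compactSupport : HasCompactSupport φ
  smooth : ContDiff ℝ (⌊β⌋₊ : ℕ) φ
  lipschitz : ∃ C : ℝ≥0, LipschitzWith C (iteratedDeriv ⌊β⌋₊ φ)
  normalized : ∫ t, φ t = 1

/-! ### The directions -/

/-- `T : U → Ω` is a smooth diffeomorphism of the open set `U ⊆ ℝⁿ⁻¹` onto `Ω ⊆ Sⁿ⁻¹`, i.e. a
bijective smooth immersion (the dimensions are equal, so that the inverse is smooth). -/
structure IsDirectionChart {d : ℕ} (T : Param d → Space d) (U : Set (Param d))
    (Ω : Set (Space d)) : Prop where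
  smooth : ContDiffOn ℝ ∞ T U
  bijOn : Set.BijOn T U Ω
  immersion : ∀ v ∈ U, Function.Injective (fderiv ℝ T v)

/-- The grid point `ε (k + u)` in parameter space. -/
def gridPoint {d : ℕ} (ε : ℝ) (u : Fin d → ℝ) (k : Fin d → ℤ) : Param d :=
  WithLp.toLp 2 fun i => ε * ((k i : ℝ) + u i)

/-- The Jacobian `|det T'(v)|` of `T : ℝⁿ⁻¹ → Sⁿ⁻¹`: the square root of the Gram determinant of
the partial derivatives of `T`. -/
def jacobian {d : ℕ} (T : Param d → Space d) (v : Param d) : ℝ :=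
  Real.sqrt (Matrix.det (Matrix.of fun i j : Fin d =>
    inner ℝ (fderiv ℝ T v (EuclideanSpace.single i 1)) (fderiv ℝ T v (EuclideanSpace.single j 1))))

/-- The numbers `w ε k` are admissible volumes `|Δα_k|` of the elementary domains of the
directions `α_k = T(ε(k + u_ε))`:  `|Δα_k| = ε^{n-1} |det T'(ε(k + u_ε))| (1 + O(ε))`,
where the `O(ε)` is uniform as long as the grid points stay in a compact subset of `U`. -/
def IsCellVolume {d : ℕ} (T : Param d → Space d) (U : Set (Param d)) (u : ℝ → Fin d → ℝ)
    (w : ℝ → (Fin d → ℤ) → ℝ) : Prop :=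
  ∀ K : Set (Param d), IsCompact K → K ⊆ U → ∃ C : ℝ, ∃ ε₀ > 0, ∀ ε : ℝ, 0 < ε → ε < ε₀ →
    ∀ k : Fin d → ℤ, gridPoint ε (u ε) k ∈ K →
      |w ε k - ε ^ d * jacobian T (gridPoint ε (u ε) k)|
        ≤ C * ε * (ε ^ d * jacobian T (gridPoint ε (u ε) k))

/-- The point `x₀` is generic with respect to `T`: the vector `∂(T(v)·x₀)/∂v` at `v = 0` has an
irrational component. -/
def IsGeneric {d : ℕ} (T : Param d → Space d) (x₀ : Space d) : Prop :=
  ∃ i : Fin d, Irrational (inner ℝ (fderiv ℝ T 0 (EuclideanSpace.single i 1)) x₀)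

/-! ### The reconstruction from discrete data

The symbol `Bt α τ` is the Fourier transform of `B(α, ·)`.  As the symbol grows, the inverse
Fourier transform `B(α, p) = (2π)⁻¹ ∫ Bt α τ e^{-iτp} dτ` is a distribution: the limit as `δ → +0`
of the functions with the additional convergence factor `e^{-δ|τ|}` in the integrand. -/

/-- `(2π)⁻¹ ∫ e^{-δ|τ|} Bt(α,τ) e^{-iτp} dτ`. -/
def regularizedB {d : ℕ} (Bt : Space d → ℝ → ℂ) (δ : ℝ) (α : Space d) (p : ℝ) : ℂ :=
  1 / (2 * Real.pi) *
    ∫ τ : ℝ, (Real.exp (-δ * |τ|) : ℂ) * Bt α τ * Complex.exp (-(Complex.I * τ * p))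

/-- `∫ B(α, t - p) φ((p - q)/ε) dp`, with the regularized `B`. -/
def regularizedFilter {d : ℕ} (Bt : Space d → ℝ → ℂ) (φ : ℝ → ℝ) (δ ε q : ℝ) (α : Space d)
    (t : ℝ) : ℂ :=
  ∫ p : ℝ, regularizedB Bt δ α (t - p) * (φ ((p - q) / ε) : ℂ)

/-- `∫ B(α, t - p) φ((p - q)/ε) dp`. -/
def filter {d : ℕ} (Bt : Space d → ℝ → ℂ) (φ : ℝ → ℝ) (ε q : ℝ) (α : Space d) (t : ℝ) : ℂ :=
  limUnder (𝓝[>] 0) fun δ : ℝ => regularizedFilter Bt φ δ ε q α t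

/-- The term `∫ B(α, α·x - p) φ((p - p_j)/ε) dp g(α, p_j)`, `p_j = εj`. -/
def filteredTerm {d : ℕ} (Bt : Space d → ℝ → ℂ) (φ : ℝ → ℝ) (g : Space d → ℝ → ℂ) (ε : ℝ)
    (α x : Space d) (j : ℤ) : ℂ :=
  filter Bt φ ε (ε * j) α (inner ℝ α x) * g α (ε * j)

/-- The contribution to the reconstruction at `x` of the directions `α_k = T(ε(k + u_ε))`:
`∑_k ∑_j ∫ B(α_k, α_k·x - p) φ((p - p_j)/ε) dp g(α_k, p_j) |Δα_k|`. -/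
def backprojection {d : ℕ} (Bt : Space d → ℝ → ℂ) (φ : ℝ → ℝ) (g : Space d → ℝ → ℂ)
    (T : Param d → Space d) (U : Set (Param d)) (u : ℝ → Fin d → ℝ) (w : ℝ → (Fin d → ℤ) → ℝ)
    (ε : ℝ) (x : Space d) : ℂ :=
  ∑' k : {k : Fin d → ℤ // gridPoint ε (u ε) k ∈ U},
    (∑' j : ℤ, filteredTerm Bt φ g ε (T (gridPoint ε (u ε) k)) x j) * (w ε k : ℂ)

/-- All limits and series in the definition of `backprojection` converge. -/
def BackprojectionConverges {d : ℕ} (Bt : Space d → ℝ → ℂ) (φ : ℝ → ℝ) (g : Space d → ℝ → ℂ)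
    (T : Param d → Space d) (U : Set (Param d)) (u : ℝ → Fin d → ℝ) (w : ℝ → (Fin d → ℤ) → ℝ) :
    Prop :=
  ∀ ε : ℝ, 0 < ε → ∀ x : Space d,
    (∀ k : Fin d → ℤ, gridPoint ε (u ε) k ∈ U →
      (∀ j : ℤ, ∃ l : ℂ, Tendsto
        (fun δ : ℝ => regularizedFilter Bt φ δ ε (ε * j) (T (gridPoint ε (u ε) k))
          (inner ℝ (T (gridPoint ε (u ε) k)) x)) (𝓝[>] 0) (𝓝 l)) ∧
      Summable fun j : ℤ => filteredTerm Bt φ g ε (T (gridPoint ε (u ε) k)) x j) ∧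
    Summable fun k : {k : Fin d → ℤ // gridPoint ε (u ε) k ∈ U} =>
      (∑' j : ℤ, filteredTerm Bt φ g ε (T (gridPoint ε (u ε) k)) x j) * (w ε k : ℂ)

/-! ### The limit -/

/-- `c₊⁽¹⁾(α) = Γ(s) B̃₀(α) (a₀(α) e^{iπs/2} + a₀(-α) e^{-iπs/2})`. -/
def cPlus {d : ℕ} (B₀ a₀ : Space d → ℂ) (s : ℝ) (α : Space d) : ℂ :=
  (Real.Gamma s : ℂ) * B₀ α *
    (a₀ α * Complex.exp (Complex.I * Real.pi / 2 * s)
      + a₀ (-α) * Complex.exp (-(Complex.I * Real.pi / 2 * s)))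

/-- `c₋⁽¹⁾(α) = Γ(s) B̃₀(-α) (a₀(α) e^{-iπs/2} + a₀(-α) e^{iπs/2})`. -/
def cMinus {d : ℕ} (B₀ a₀ : Space d → ℂ) (s : ℝ) (α : Space d) : ℂ :=
  (Real.Gamma s : ℂ) * B₀ (-α) *
    (a₀ α * Complex.exp (-(Complex.I * Real.pi / 2 * s))
      + a₀ (-α) * Complex.exp (Complex.I * Real.pi / 2 * s))

/-- `c₊⁽³⁾(α) = e^{-i ((n-3)/2) (π/2)} c₊⁽¹⁾(α)`, where `n = d + 1`. -/
def cPlus₃ {d : ℕ} (B₀ a₀ : Space d → ℂ) (s : ℝ) (α : Space d) : ℂ :=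
  Complex.exp (-(Complex.I * ((((d : ℂ) + 1) - 3) / 2) * (Real.pi / 2))) * cPlus B₀ a₀ s α

/-- The step function `t₋⁰`. -/
def stepMinus (t : ℝ) : ℂ := if t < 0 then 1 else 0

/-- `μ(t) = 2 (2π)^{(n-1)/2} |det Ȟ''(Θ₀)|^{-1/2} c₊⁽³⁾(Θ₀) t₋⁰`. -/
def mu {d : ℕ} (H : Space d → ℝ) (B₀ a₀ : Space d → ℂ) (s : ℝ) (Θ₀ : Space d) (t : ℝ) : ℂ :=
  (2 * (2 * Real.pi) ^ ((d : ℝ) / 2) / Real.sqrt |(tangentHessian H Θ₀).det| : ℝ)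
    * cPlus₃ B₀ a₀ s Θ₀ * stepMinus t

/-- The convolution `(φ ∗ m)(h) = ∫ φ(h - t) m(t) dt`. -/
def conv (φ : ℝ → ℝ) (m : ℝ → ℂ) (h : ℝ) : ℂ := ∫ t : ℝ, (φ (h - t) : ℂ) * m t

/-! ### The leading singularity of the Radon transform -/

/-- The coefficient
`(2 sin(πs) Γ(s))⁻¹ (ω(α) v₀(α) e^{iσ(s-1)π/2} + ω(-α) v₀(-α) e^{-iσ(s-1)π/2})`, for `σ = ±1`. -/
def radonCoeff {d : ℕ} (H : Space d → ℝ) (v₀ : Space d → ℂ) (s σ : ℝ) (α : Space d) : ℂ :=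
  1 / (2 * Real.sin (Real.pi * s) * Real.Gamma s : ℝ) *
    (omega H α * v₀ α * Complex.exp (σ * Complex.I * (s - 1) * (Real.pi / 2))
      + omega H (-α) * v₀ (-α) * Complex.exp (-(σ * Complex.I * (s - 1) * (Real.pi / 2))))

open Classical in
/-- The leading singularity `f̂₀(α, p)`, in the variable `p` that is measured from `H(α)`, of the
Radon transform of a distribution
`f(x) = (2π)⁻ⁿ ∫ ṽ(ξ) e^{i(H(ξ) - ξ·x)} dξ` with `ṽ(λα) ~ ω(α) v₀(α) λ^{-s}`, `λ → +∞`. -/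
def radonLeading {d : ℕ} (H : Space d → ℝ) (v₀ : Space d → ℂ) (s : ℝ) (α : Space d) (p : ℝ) : ℂ :=
  if ∃ m : ℕ, s = m then
    omega H α * v₀ α / (2 * Complex.I ^ ⌊s⌋₊ * ((⌊s⌋₊ - 1).factorial : ℂ))
      * ((p ^ (⌊s⌋₊ - 1) * Real.sign p : ℝ) : ℂ)
  else
    radonCoeff H v₀ s 1 α * ((max p 0 ^ (s - 1) : ℝ) : ℂ)
      + radonCoeff H v₀ s (-1) α * ((max (-p) 0 ^ (s - 1) : ℝ) : ℂ)

end DTB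

end

open Filter Topology Set
open scoped Pointwise ContDiff

section

open Filter Topology Set MeasureTheory
open scoped Pointwise Manifold ContDiff NNReal

namespace DTB

/-! ### Gamma and Beta integrals in a half plane -/

/-! Write n = d + 1, b = d / 2 and κ = β + 1; the hypothesis κ₂ = 0 says κ = s + b.

One direction. The symbol is homogeneous, so the filter is Γ(κ) / (2π) times a combination of (0 ±
ip)^{-κ}. Rescaling p by ε turns the sum over the samples in a direction α into Γ(κ) / (2π) ε^{-b}
times a `profile`. Besides the coefficients at α, the profile depends on two scalars: q = (α·x -
H(α)) / ε, the scaled distance to the singularity of the data, and t = α·x / ε, the phase of the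
grid, in which it is 1-periodic (`hasSum_filteredTerm`).

All directions. H is homogeneous of degree one and H'(Θ₀) = x₀, so α·x₀ - H(α) vanishes to second
order at Θ₀, and on the sphere its quadratic part, minus half of the tangential Hessian, is positive
definite. Only directions at distance of order √ε from Θ₀ matter. With the parameter v = √ε w, the
factors ε^{-b} and ε^d combine to (√ε)^d: the double sum is a Riemann sum of step √ε over w in ℝ^d,
and q tends to half of a positive definite form in w plus h.

Tails. Exactness of φ up to degree ⌈β⌉ makes the interpolation error of the one-sided power small,
hence a sample sum equals a constant times (iq)^{-b} up to O(|q|^{-(b+1)}) (`sampleSum_decay`). The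
relation between c₋ and c₊ makes the terms of order q^{-b} cancel for q > 0 (`profile_bound`). What
remains decays like |w|^{-(d+2)} and dominates the Riemann sums (`gridTerm_bound`).

The phase t does not converge. Between neighbouring grid points in a coordinate direction it
advances by θ = ∂(T·x₀)/∂uᵢ up to a small error, and θ is irrational for some i. Averaging over
blocks of about ε^{-1/4} neighbours leaves the sum unchanged, and by Weyl's theorem it replaces the
profile by its mean over t (`tendsto_riemannSum`, `tendsto_average_gridTerm`).

The mean. Averaging over t turns the sum over samples into an integral. Fubini's theorem and a Beta
integral reduce it to the limit, as δ → 0, of the convolution of φ with (δ + iq)^{-b} - e^{-iπb} (δ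
- iq)^{-b}, called `jump`. Integrating over w leaves ∫ jump(h + r) r^{b-1} dr, which is i · i^{-b}
(π - 2 arctan(h / δ)) (`integral_jump`) and tends to a multiple of the step function. This gives φ ∗
μ; the constants are matched in `integral_average`.

The limits are taken jointly in ε and the point, so uniformity on bounded sets follows from
continuity of φ ∗ μ. The directions in -Ω are reduced to Ω by antipodal symmetry, and the statement
on the Radon transform is an evaluation of c₊ from the data at p = 1 and p = -1. -/

theorem integrableOn_rpow_mul_exp_neg_mul {a : ℝ} (ha : 0 < a) {z : ℂ} (hz : 0 < z.re) :
    IntegrableOn (fun τ : ℝ => ((τ ^ (a - 1) : ℝ) : ℂ) * Complex.exp (-(τ * z))) (Ioi 0) := by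
  have h := integrableOn_rpow_mul_exp_neg_mul_rpow (s := a - 1) (p := 1) (b := z.re)
    (by linarith) one_pos hz
  refine Integrable.mono h ?_ ?_
  · apply Measurable.aestronglyMeasurable
    fun_prop
  · refine (ae_restrict_mem measurableSet_Ioi).mono fun τ hτ => ?_
    have hτ' : (0 : ℝ) < τ := hτ
    simp only [norm_mul, Complex.norm_real, Complex.norm_exp, Real.norm_eq_abs, Complex.neg_re,
      Complex.re_ofReal_mul, Real.rpow_one, Real.abs_exp]
    apply le_of_eq
    congr 2
    ring

/-- Both sides are holomorphic in the right half plane and agree on the positive axis, where this is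
the real Gamma integral; the points 1 + 1/(k+1) accumulate at 1, so the identity theorem applies. -/
theorem integral_rpow_mul_exp_neg_mul {a : ℝ} (ha : 0 < a) {z : ℂ} (hz : 0 < z.re) :
    ∫ τ in Ioi (0 : ℝ), ((τ ^ (a - 1) : ℝ) : ℂ) * Complex.exp (-(τ * z))
      = (Real.Gamma a : ℂ) * z ^ (-(a : ℂ)) := by
  set S : Set ℂ := {z : ℂ | 0 < z.re} with hS
  have hSo : IsOpen S := isOpen_lt continuous_const Complex.continuous_re
  have hSc : IsPreconnected S := (convex_halfSpace_re_gt 0).isPreconnected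
  have h1 : AnalyticOnNhd ℂ (fun z : ℂ => ∫ τ in Ioi (0 : ℝ),
      ((τ ^ (a - 1) : ℝ) : ℂ) * Complex.exp (-(τ * z))) S := by
    apply DifferentiableOn.analyticOnNhd _ hSo
    intro z hz
    have hz' : 0 < z.re := hz
    apply DifferentiableAt.differentiableWithinAt
    have hb := integrableOn_rpow_mul_exp_neg_mul_rpow (s := a) (p := 1) (b := z.re / 2)
      (by linarith) one_pos (by linarith)
    have := hasDerivAt_integral_of_dominated_loc_of_deriv_le (μ := volume.restrict (Ioi (0 : ℝ)))
      (F := fun (z : ℂ) (τ : ℝ) => ((τ ^ (a - 1) : ℝ) : ℂ) * Complex.exp (-(τ * z)))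
      (F' := fun (z : ℂ) (τ : ℝ) => ((τ ^ (a - 1) : ℝ) : ℂ) * (Complex.exp (-(τ * z)) * (-τ)))
      (x₀ := z) (s := {w : ℂ | z.re / 2 < w.re})
      (bound := fun τ : ℝ => τ ^ a * Real.exp (-(z.re / 2) * τ ^ (1 : ℝ)))
      ((isOpen_lt continuous_const Complex.continuous_re).mem_nhds (by simp; linarith))
      (Eventually.of_forall fun w => by
        apply Measurable.aestronglyMeasurable
        fun_prop)
      (integrableOn_rpow_mul_exp_neg_mul ha hz')
      (by
        apply Measurable.aestronglyMeasurable
        fun_prop)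
      ((ae_restrict_mem measurableSet_Ioi).mono fun τ hτ w hw => by
        have hτ' : (0 : ℝ) < τ := hτ
        have hw' : z.re / 2 < w.re := hw
        simp only [norm_mul, Complex.norm_real, Complex.norm_exp, Real.norm_eq_abs, Complex.neg_re,
          Complex.re_ofReal_mul, Real.rpow_one, norm_neg]
        rw [abs_of_pos (Real.rpow_pos_of_pos hτ' _), abs_of_pos hτ']
        calc τ ^ (a - 1) * (Real.exp (-(τ * w.re)) * τ)
            = τ ^ a * Real.exp (-(τ * w.re)) := by
              rw [Real.rpow_sub_one hτ'.ne']; field_simp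
          _ ≤ _ := by
              gcongr
              nlinarith)
      hb
      ((ae_restrict_mem measurableSet_Ioi).mono fun τ hτ w hw => by
        apply HasDerivAt.const_mul
        apply HasDerivAt.cexp
        have h := ((hasDerivAt_id w).const_mul (τ : ℂ)).neg
        rw [mul_one] at h
        exact h)
    exact this.2.differentiableAt
  have h2 : AnalyticOnNhd ℂ (fun z : ℂ => (Real.Gamma a : ℂ) * z ^ (-(a : ℂ))) S := by
    apply DifferentiableOn.analyticOnNhd _ hSo
    intro z hz
    apply DifferentiableAt.differentiableWithinAt
    apply DifferentiableAt.const_mul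
    exact differentiableAt_id.cpow_const (Or.inl hz)
  refine h1.eqOn_of_preconnected_of_frequently_eq h2 hSc (z₀ := 1) (by simp [hS]) ?_ hz
  have h3 : ∀ x : ℝ, 0 < x → (∫ τ in Ioi (0 : ℝ),
      ((τ ^ (a - 1) : ℝ) : ℂ) * Complex.exp (-(τ * (x : ℂ))))
        = (Real.Gamma a : ℂ) * (x : ℂ) ^ (-(a : ℂ)) := by
    intro x hx
    have := Real.integral_rpow_mul_exp_neg_mul_Ioi ha hx
    have h4 : (∫ τ in Ioi (0 : ℝ), ((τ ^ (a - 1) : ℝ) : ℂ) * Complex.exp (-(τ * (x : ℂ))))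
        = ∫ τ in Ioi (0 : ℝ), ((τ ^ (a - 1) * Real.exp (-(x * τ)) : ℝ) : ℂ) := by
      congr 1; ext τ; push_cast; congr 3; ring
    rw [h4, integral_complex_ofReal, this, one_div, Real.inv_rpow hx.le, ← Real.rpow_neg hx.le]
    push_cast [Complex.ofReal_cpow hx.le]
    ring
  have h5 : Tendsto (fun k : ℕ => ((1 + 1 / ((k : ℝ) + 1) : ℝ) : ℂ)) atTop (𝓝[≠] 1) := by
    apply tendsto_nhdsWithin_iff.2 ⟨?_, Eventually.of_forall fun k => ?_⟩
    · have : Tendsto (fun k : ℕ => (1 + 1 / ((k : ℝ) + 1) : ℝ)) atTop (𝓝 (1 + 0)) :=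
        tendsto_const_nhds.add tendsto_one_div_add_atTop_nhds_zero_nat
      have := (Complex.continuous_ofReal.tendsto _).comp this
      rw [add_zero, Complex.ofReal_one] at this
      exact this
    · have : (0 : ℝ) < 1 / ((k : ℝ) + 1) := by positivity
      intro h
      have h' : ((1 + 1 / ((k : ℝ) + 1) : ℝ) : ℂ) = ((1 : ℝ) : ℂ) := by simpa using h
      have := Complex.ofReal_injective h'
      linarith
  refine h5.frequently (Frequently.of_forall fun k => h3 _ (by positivity))

/-- Behaves like r^{a-1} on (0, 1] and like r^{-b-1} at infinity. It serves as the dominating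
function for every integral over the half line below. -/
theorem integrableOn_one_add_rpow_neg_mul_rpow {a b : ℝ} (ha : 0 < a) (hb : 0 < b) :
    IntegrableOn (fun r : ℝ => (1 + r) ^ (-(a + b)) * r ^ (a - 1)) (Ioi 0) := by
  have hm : Measurable (fun r : ℝ => (1 + r) ^ (-(a + b)) * r ^ (a - 1)) := by fun_prop
  rw [← Ioc_union_Ioi_eq_Ioi (zero_le_one' ℝ)]
  apply IntegrableOn.union
  · have : IntegrableOn (fun r : ℝ => r ^ (a - 1)) (Ioc 0 1) :=
      ((intervalIntegral.intervalIntegrable_rpow' (by linarith)).1 : _)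
    refine Integrable.mono this hm.aestronglyMeasurable ?_
    refine (ae_restrict_mem measurableSet_Ioc).mono fun r hr => ?_
    have h0 : 0 < r := hr.1
    rw [norm_mul]
    have : ‖(1 + r) ^ (-(a + b))‖ ≤ 1 := by
      rw [Real.norm_of_nonneg (by positivity)]
      exact Real.rpow_le_one_of_one_le_of_nonpos (by linarith) (by linarith)
    exact mul_le_of_le_one_left (norm_nonneg _) this
  · have : IntegrableOn (fun r : ℝ => r ^ (-b - 1)) (Ioi 1) :=
      integrableOn_Ioi_rpow_of_lt (by linarith) one_pos
    refine Integrable.mono this hm.aestronglyMeasurable ?_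
    refine (ae_restrict_mem measurableSet_Ioi).mono fun r hr => ?_
    have h0 : 0 < r := lt_trans one_pos hr
    rw [Real.norm_of_nonneg (by positivity), Real.norm_of_nonneg (by positivity)]
    calc (1 + r) ^ (-(a + b)) * r ^ (a - 1) ≤ r ^ (-(a + b)) * r ^ (a - 1) := by
          gcongr ?_ * _
          exact Real.rpow_le_rpow_of_nonpos h0 (by linarith) (by linarith)
      _ = r ^ (-b - 1) := by rw [← Real.rpow_add h0]; congr 1; ring

theorem norm_cpow_neg_real (z : ℂ) (a : ℝ) : ‖z ^ (-(a : ℂ))‖ = ‖z‖ ^ (-a) := by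
  rw [← Complex.ofReal_neg, Complex.norm_cpow_real]

theorem ofReal_mul_cpow_neg {x : ℝ} (hx : 0 < x) {z : ℂ} (hz : z ≠ 0) (a : ℝ) :
    ((x : ℂ) * z) ^ (-(a : ℂ)) = ((x ^ (-a) : ℝ) : ℂ) * z ^ (-(a : ℂ)) := by
  have hx' : (x : ℂ) ≠ 0 := by exact_mod_cast hx.ne'
  rw [Complex.ofReal_cpow hx.le, Complex.ofReal_neg, Complex.cpow_def_of_ne_zero (mul_ne_zero hx' hz),
    Complex.cpow_def_of_ne_zero hx', Complex.cpow_def_of_ne_zero hz, Complex.log_ofReal_mul hx hz,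
    add_mul, Complex.exp_add, Complex.ofReal_log hx.le]

/-- Fubini for τ^{a+b-1} e^{-τz} r^{a-1} e^{-rτc} on the quadrant: integrating in r first gives Γ(a)
(τc)^{-a}, in τ first gives Γ(a+b) (z+cr)^{-(a+b)}. Absolute convergence needs Re c > 0; the
imaginary directions c = ±i are reached in `beta_integral` by a limit. -/
theorem beta_integral_of_re_pos {a b : ℝ} (ha : 0 < a) (hb : 0 < b) {z c : ℂ} (hz : 0 < z.re)
    (hc : 0 < c.re) :
    ∫ r in Ioi (0 : ℝ), (z + c * r) ^ (-((a + b : ℝ) : ℂ)) * ((r ^ (a - 1) : ℝ) : ℂ)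
      = (Real.Gamma a * Real.Gamma b / Real.Gamma (a + b) : ℝ) * c ^ (-(a : ℂ))
        * z ^ (-(b : ℂ)) := by
  have hab : 0 < a + b := by linarith
  have hG := (Real.Gamma_pos_of_pos hab).ne'
  set F : ℝ → ℝ → ℂ := fun τ r =>
    ((τ ^ (a + b - 1) : ℝ) : ℂ) * Complex.exp (-(τ * z)) *
      (((r ^ (a - 1) : ℝ) : ℂ) * Complex.exp (-(r * (τ * c)))) with hF
  have hFm : Measurable (Function.uncurry F) := by
    simp only [hF, Function.uncurry_def]
    fun_prop
  have hτc : ∀ τ : ℝ, 0 < τ → 0 < ((τ : ℂ) * c).re := fun τ hτ => by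
    rw [Complex.re_ofReal_mul]; positivity
  have hnorm : ∀ τ : ℝ, 0 < τ → ∫ r in Ioi (0 : ℝ), ‖F τ r‖
      = (Real.Gamma a * c.re ^ (-a)) * ‖((τ ^ (b - 1) : ℝ) : ℂ) * Complex.exp (-(τ * z))‖ := by
    intro τ hτ
    have : ∀ r ∈ Ioi (0 : ℝ), ‖F τ r‖ = ‖((τ ^ (a + b - 1) : ℝ) : ℂ) * Complex.exp (-(τ * z))‖ *
        (r ^ (a - 1) * Real.exp (-((τ * c.re) * r))) := by
      intro r hr
      have hr' : (0 : ℝ) < r := hr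
      simp only [hF]
      rw [norm_mul _ (((r ^ (a - 1) : ℝ) : ℂ) * _)]
      congr 1
      rw [norm_mul, Complex.norm_real, Complex.norm_exp, Real.norm_of_nonneg (by positivity)]
      congr 2
      simp
      ring
    rw [setIntegral_congr_fun measurableSet_Ioi this, integral_const_mul,
      Real.integral_rpow_mul_exp_neg_mul_Ioi ha (by positivity), norm_mul, norm_mul,
      Complex.norm_real, Complex.norm_real, Real.norm_of_nonneg (by positivity),
      Real.norm_of_nonneg (by positivity), one_div, Real.inv_rpow (by positivity),
      Real.mul_rpow hτ.le hc.le, Real.rpow_neg hc.le,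
      show a + b - 1 = a + (b - 1) by ring, Real.rpow_add hτ]
    have := Real.rpow_pos_of_pos hτ a
    have := Real.rpow_pos_of_pos hc a
    field_simp
  have hint : Integrable (Function.uncurry F)
      ((volume.restrict (Ioi (0 : ℝ))).prod (volume.restrict (Ioi (0 : ℝ)))) := by
    rw [integrable_prod_iff hFm.aestronglyMeasurable]
    constructor
    · refine (ae_restrict_mem measurableSet_Ioi).mono fun τ hτ => ?_
      exact (integrableOn_rpow_mul_exp_neg_mul ha (hτc τ hτ)).const_mul
        (((τ ^ (a + b - 1) : ℝ) : ℂ) * Complex.exp (-(τ * z)))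
    · refine (((integrableOn_rpow_mul_exp_neg_mul hb hz).norm.const_mul
        (Real.Gamma a * c.re ^ (-a)))).congr ?_
      refine (ae_restrict_mem measurableSet_Ioi).mono fun τ hτ => ?_
      exact (hnorm τ hτ).symm
  have hswap := integral_integral_swap hint
  have hl : ∫ τ in Ioi (0 : ℝ), ∫ r in Ioi (0 : ℝ), F τ r
      = (Real.Gamma a * Real.Gamma b : ℝ) * c ^ (-(a : ℂ)) * z ^ (-(b : ℂ)) := by
    have : ∀ τ ∈ Ioi (0 : ℝ), ∫ r in Ioi (0 : ℝ), F τ r = (Real.Gamma a * c ^ (-(a : ℂ))) *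
        (((τ ^ (b - 1) : ℝ) : ℂ) * Complex.exp (-(τ * z))) := by
      intro τ hτ
      have hτ' : (0 : ℝ) < τ := hτ
      simp only [hF]
      rw [integral_const_mul, integral_rpow_mul_exp_neg_mul ha (hτc τ hτ),
        ofReal_mul_cpow_neg hτ' (by rintro rfl; simp at hc),
        show a + b - 1 = a + (b - 1) by ring, Real.rpow_add hτ', Real.rpow_neg hτ'.le]
      have h0 : ((τ ^ a : ℝ) : ℂ) ≠ 0 := by exact_mod_cast (Real.rpow_pos_of_pos hτ' a).ne'
      push_cast at h0 ⊢
      field_simp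
    rw [setIntegral_congr_fun measurableSet_Ioi this, integral_const_mul,
      integral_rpow_mul_exp_neg_mul hb hz]
    push_cast
    ring
  have hr : ∫ r in Ioi (0 : ℝ), ∫ τ in Ioi (0 : ℝ), F τ r
      = (Real.Gamma (a + b) : ℂ) * ∫ r in Ioi (0 : ℝ), (z + c * r) ^ (-((a + b : ℝ) : ℂ)) *
        ((r ^ (a - 1) : ℝ) : ℂ) := by
    rw [← integral_const_mul]
    refine setIntegral_congr_fun measurableSet_Ioi fun r hr => ?_
    have hr' : (0 : ℝ) < r := hr
    have h1 : ∀ τ : ℝ, F τ r = ((r ^ (a - 1) : ℝ) : ℂ) *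
        (((τ ^ (a + b - 1) : ℝ) : ℂ) * Complex.exp (-(τ * (z + c * r)))) := by
      intro τ
      simp only [hF]
      rw [show -((τ : ℂ) * (z + c * r)) = -(τ * z) + -(r * (τ * c)) by ring, Complex.exp_add]
      ring
    have h2 : 0 < (z + c * r).re := by
      simp only [Complex.add_re, Complex.re_mul_ofReal]; positivity
    simp only [h1]
    rw [integral_const_mul, integral_rpow_mul_exp_neg_mul hab h2]
    push_cast
    ring
  rw [hl, hr] at hswap
  have hG' : (Real.Gamma (a + b) : ℂ) ≠ 0 := by exact_mod_cast hG
  push_cast at hswap ⊢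
  field_simp
  rw [hswap, mul_comm]

/-! ### The kernel `(δ + ix)^{-κ}` -/

/-- The kernel `(δ + ix)^{-κ}`. -/
noncomputable def powKernel (κ δ x : ℝ) : ℂ := ((δ : ℂ) + Complex.I * x) ^ (-(κ : ℂ))

theorem norm_powKernel (κ δ x : ℝ) :
    ‖powKernel κ δ x‖ = ‖(δ : ℂ) + Complex.I * x‖ ^ (-κ) := norm_cpow_neg_real _ _

theorem abs_le_norm_add_I_mul (δ x : ℝ) : |x| ≤ ‖(δ : ℂ) + Complex.I * x‖ := by
  simpa using Complex.abs_im_le_norm ((δ : ℂ) + Complex.I * x)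

theorem le_norm_add_I_mul (δ x : ℝ) : δ ≤ ‖(δ : ℂ) + Complex.I * x‖ := by
  simpa using Complex.re_le_norm ((δ : ℂ) + Complex.I * x)

/-- This bound is uniform in δ but singular at x = 0; `norm_powKernel_le` is finite at 0 with a
constant that depends on δ. Passing to the limit δ → 0 needs the former, mere integrability the
latter. -/
theorem norm_powKernel_le_abs {κ : ℝ} (hκ : 0 ≤ κ) (δ : ℝ) {x : ℝ} (hx : x ≠ 0) :
    ‖powKernel κ δ x‖ ≤ |x| ^ (-κ) := by
  rw [norm_powKernel]
  exact Real.rpow_le_rpow_of_nonpos (abs_pos.2 hx) (abs_le_norm_add_I_mul δ x) (by linarith)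

theorem norm_powKernel_le {κ : ℝ} (hκ : 0 ≤ κ) {δ : ℝ} (hδ : 0 < δ) (x : ℝ) :
    ‖powKernel κ δ x‖ ≤ (1 + 1 / δ) ^ κ * (1 + |x|) ^ (-κ) := by
  have h1 := abs_le_norm_add_I_mul δ x
  have h2 := le_norm_add_I_mul δ x
  have h3 : 1 + |x| ≤ (1 + 1 / δ) * ‖(δ : ℂ) + Complex.I * x‖ := by
    have : 1 ≤ 1 / δ * ‖(δ : ℂ) + Complex.I * x‖ := by
      rw [one_div, ← div_eq_inv_mul, le_div_iff₀ hδ]; simpa using h2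
    nlinarith
  have h4 : 0 < ‖(δ : ℂ) + Complex.I * x‖ := lt_of_lt_of_le hδ h2
  have h5 : 0 < 1 + |x| := by positivity
  rw [norm_powKernel, Real.rpow_neg h5.le, Real.rpow_neg h4.le, ← div_eq_mul_inv,
    le_div_iff₀ (by positivity), ← div_eq_inv_mul, div_le_iff₀ (by positivity),
    ← Real.mul_rpow (by positivity) h4.le]
  exact Real.rpow_le_rpow h5.le h3 hκ

theorem add_I_mul_mem_slitPlane {δ : ℝ} (hδ : 0 < δ) (x : ℝ) :
    (δ : ℂ) + Complex.I * x ∈ Complex.slitPlane := by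
  left; simpa using hδ

theorem continuous_powKernel (κ : ℝ) {δ : ℝ} (hδ : 0 < δ) : Continuous (powKernel κ δ) := by
  unfold powKernel
  rw [continuous_iff_continuousAt]
  intro x
  exact ContinuousAt.cpow (f := fun x : ℝ => (δ : ℂ) + Complex.I * x) (by fun_prop) (by fun_prop)
    (add_I_mul_mem_slitPlane hδ x)

@[fun_prop]
theorem measurable_powKernel (κ δ : ℝ) : Measurable (powKernel κ δ) := by
  unfold powKernel
  fun_prop

theorem tendsto_powKernel (κ : ℝ) {x : ℝ} (hx : x ≠ 0) :
    Tendsto (fun δ => powKernel κ δ x) (𝓝[>] 0) (𝓝 (powKernel κ 0 x)) := by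
  have : ContinuousAt (fun δ => powKernel κ δ x) 0 := by
    unfold powKernel
    apply ContinuousAt.cpow (by fun_prop) (by fun_prop)
    right; simpa using hx
  exact this.tendsto.mono_left nhdsWithin_le_nhds

/-- `∫_{-1}^1 (δ + ix)^{-κ} x^l dx`. -/
noncomputable def nearMoment (κ : ℝ) (l : ℕ) (δ : ℝ) : ℂ :=
  ∫ x in (-1 : ℝ)..1, powKernel κ δ x * (x : ℂ) ^ l

theorem tendsto_ofReal_add_cpow {c : ℂ} (hc : c ∈ Complex.slitPlane) (e : ℂ) :
    Tendsto (fun δ : ℝ => ((δ : ℂ) + c) ^ e) (𝓝[>] 0) (𝓝 (c ^ e)) := by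
  have : ContinuousAt (fun δ : ℝ => ((δ : ℂ) + c) ^ e) 0 := by
    apply ContinuousAt.cpow (by fun_prop) (by fun_prop)
    simpa using hc
  have h := this.tendsto
  simp only [Complex.ofReal_zero, zero_add] at h
  exact h.mono_left nhdsWithin_le_nhds

theorem hasDerivAt_powKernel_primitive {κ δ : ℝ} (hκ : κ ≠ 1) (hδ : 0 < δ) (x : ℝ) :
    HasDerivAt (fun x : ℝ => powKernel (κ - 1) δ x / (Complex.I * (1 - κ)))
      (powKernel κ δ x) x := by
  have hs := add_I_mul_mem_slitPlane hδ x
  have h1 : HasDerivAt (fun x : ℝ => (δ : ℂ) + Complex.I * x) Complex.I x := by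
    simpa using ((Complex.ofRealCLM.hasDerivAt (x := x)).const_mul Complex.I).const_add (δ : ℂ)
  have h3 := ((hasDerivAt_id _).cpow_const (c := -((κ - 1 : ℝ) : ℂ)) hs).comp x h1
  have h2 := h3.div_const (Complex.I * (1 - κ))
  have hne : (Complex.I * (1 - κ) : ℂ) ≠ 0 := by
    apply mul_ne_zero Complex.I_ne_zero
    rw [sub_ne_zero]
    exact_mod_cast hκ.symm
  refine HasDerivAt.congr_deriv (f := fun x : ℝ => powKernel (κ - 1) δ x / (Complex.I * (1 - κ)))
    h2 ?_
  unfold powKernel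
  push_cast
  rw [show (-((κ : ℂ) - 1) - 1) = -κ by ring, div_eq_iff hne]
  simp only [id]
  ring

/-- The integrand has no integrable majorant uniform in δ, so the limit comes from integration by
parts: each step lowers κ and l by one, and the boundary terms sit at x = ±1, where the kernel
converges. For l = 0 the primitive is explicit, a logarithm when κ = 1. -/
theorem exists_tendsto_nearMoment (l : ℕ) : ∀ {κ : ℝ}, (l : ℝ) + 1 ≤ κ →
    ∃ J, Tendsto (nearMoment κ l) (𝓝[>] 0) (𝓝 J) := by
  have hI : Complex.I ∈ Complex.slitPlane := by right; simp
  have hI' : -Complex.I ∈ Complex.slitPlane := by right; simp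
  have hker : ∀ κ : ℝ, ∃ J, Tendsto (fun δ => powKernel κ δ 1) (𝓝[>] 0) (𝓝 J) := fun κ =>
    ⟨_, tendsto_powKernel κ one_ne_zero⟩
  have hker' : ∀ κ : ℝ, ∃ J, Tendsto (fun δ => powKernel κ δ (-1)) (𝓝[>] 0) (𝓝 J) := fun κ =>
    ⟨_, tendsto_powKernel κ (by norm_num)⟩
  induction l with
  | zero =>
    intro κ hκ
    rcases eq_or_ne κ 1 with rfl | h1
    · refine ⟨(Complex.log Complex.I - Complex.log (-Complex.I)) / Complex.I, ?_⟩
      have : ∀ δ : ℝ, 0 < δ → nearMoment 1 0 δ =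
          (Complex.log (δ + Complex.I) - Complex.log (δ + -Complex.I)) / Complex.I := by
        intro δ hδ
        unfold nearMoment
        simp only [pow_zero, mul_one]
        have hd : ∀ x ∈ uIcc (-1 : ℝ) 1, HasDerivAt
            (fun x : ℝ => Complex.log ((δ : ℂ) + Complex.I * x) / Complex.I)
            (powKernel 1 δ x) x := by
          intro x _
          have h1 : HasDerivAt (fun x : ℝ => (δ : ℂ) + Complex.I * x) Complex.I x := by
            simpa using
              ((Complex.ofRealCLM.hasDerivAt (x := x)).const_mul Complex.I).const_add (δ : ℂ)
          have := (h1.clog_real (add_I_mul_mem_slitPlane hδ x)).div_const Complex.I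
          refine this.congr_deriv ?_
          unfold powKernel
          rw [Complex.ofReal_one, Complex.cpow_neg_one, div_div, mul_comm, ← div_div,
            div_self Complex.I_ne_zero, one_div]
        rw [intervalIntegral.integral_eq_sub_of_hasDerivAt hd
          ((continuous_powKernel 1 hδ).intervalIntegrable _ _)]
        simp
        ring
      have hlog : ∀ c ∈ Complex.slitPlane,
          Tendsto (fun δ : ℝ => Complex.log (δ + c)) (𝓝[>] 0) (𝓝 (Complex.log c)) := by
        intro c hc
        have : ContinuousAt (fun δ : ℝ => Complex.log ((δ : ℂ) + c)) 0 :=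
          ContinuousAt.clog (by fun_prop) (by simpa using hc)
        have h := this.tendsto
        simp only [Complex.ofReal_zero, zero_add] at h
        exact h.mono_left nhdsWithin_le_nhds
      refine (((hlog _ hI).sub (hlog _ hI')).div_const _).congr' ?_
      filter_upwards [self_mem_nhdsWithin] with δ hδ
      exact (this δ hδ).symm
    · obtain ⟨J, hJ⟩ := hker (κ - 1)
      obtain ⟨J', hJ'⟩ := hker' (κ - 1)
      refine ⟨J / (Complex.I * (1 - κ)) - J' / (Complex.I * (1 - κ)), ?_⟩
      refine ((hJ.div_const _).sub (hJ'.div_const _)).congr' ?_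
      filter_upwards [self_mem_nhdsWithin] with δ hδ
      unfold nearMoment
      simp only [pow_zero, mul_one]
      rw [intervalIntegral.integral_eq_sub_of_hasDerivAt
        (fun x _ => hasDerivAt_powKernel_primitive h1 hδ x)
        ((continuous_powKernel κ hδ).intervalIntegrable _ _)]
  | succ l ih =>
    intro κ hκ
    push_cast at hκ
    have h1 : κ ≠ 1 := by
      have : (0 : ℝ) ≤ l := by positivity
      intro h; linarith
    obtain ⟨J, hJ⟩ := hker (κ - 1)
    obtain ⟨J', hJ'⟩ := hker' (κ - 1)
    obtain ⟨J'', hJ''⟩ := ih (κ := κ - 1) (by linarith)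
    refine ⟨J / (Complex.I * (1 - κ)) * 1 ^ (l + 1) - J' / (Complex.I * (1 - κ)) * (-1) ^ (l + 1)
      - J'' * ((l + 1) / (Complex.I * (1 - κ))), ?_⟩
    refine ((((hJ.div_const _).mul_const _).sub ((hJ'.div_const _).mul_const _)).sub
      (hJ''.mul_const _)).congr' ?_
    filter_upwards [self_mem_nhdsWithin] with δ hδ
    have hδ' : 0 < δ := hδ
    have hv : ∀ x ∈ uIcc (-1 : ℝ) 1, HasDerivAt (fun x : ℝ => (x : ℂ) ^ (l + 1))
        ((l + 1 : ℂ) * (x : ℂ) ^ l) x := by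
      intro x _
      have := (Complex.ofRealCLM.hasDerivAt (x := x)).pow (l + 1)
      refine HasDerivAt.congr_deriv (f := fun x : ℝ => (x : ℂ) ^ (l + 1)) this ?_
      simp
    have := intervalIntegral.integral_mul_deriv_eq_deriv_mul (a := -1) (b := 1)
      (fun x _ => hasDerivAt_powKernel_primitive h1 hδ' x) hv
      ((continuous_powKernel κ hδ').intervalIntegrable _ _)
      (Continuous.intervalIntegrable (by fun_prop) _ _)
    unfold nearMoment
    have hc : ∀ x : ℝ, powKernel (κ - 1) δ x * (x : ℂ) ^ l * ((l + 1) / (Complex.I * (1 - κ))) =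
      powKernel (κ - 1) δ x / (Complex.I * (1 - κ)) * ((l + 1 : ℂ) * (x : ℂ) ^ l) := by
      intro x; ring
    rw [← intervalIntegral.integral_mul_const]
    simp only [hc]
    rw [this]
    push_cast
    ring

/-- A point moving along a ray of direction `±i + η`, `η ≥ 0`, that starts in the right half plane
goes to infinity linearly. -/
theorem one_add_le_mul_norm_add_mul {z c : ℂ} (hz : 0 < z.re) (hc0 : 0 ≤ c.re)
    (hc : |c.im| = 1) {r : ℝ} (hr : 0 ≤ r) :
    1 + r ≤ ((1 + |z.im|) / z.re + 1) * ‖z + c * r‖ := by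
  have h1 : z.re ≤ ‖z + c * r‖ := by
    refine le_trans ?_ (Complex.re_le_norm _)
    simp only [Complex.add_re, Complex.re_mul_ofReal]
    nlinarith [mul_nonneg hc0 hr]
  have h2 : r - |z.im| ≤ ‖z + c * r‖ := by
    refine le_trans ?_ (Complex.abs_im_le_norm _)
    simp only [Complex.add_im, Complex.im_mul_ofReal]
    have h3 : |c.im * r| = r := by rw [abs_mul, hc, one_mul, abs_of_nonneg hr]
    have := abs_sub_abs_le_abs_sub (c.im * r) (-z.im)
    rw [h3, abs_neg, sub_neg_eq_add, add_comm (c.im * r)] at this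
    exact this
  have h4 : 1 + |z.im| ≤ (1 + |z.im|) / z.re * ‖z + c * r‖ := by
    rw [div_mul_eq_mul_div, le_div_iff₀ hz]
    gcongr
  nlinarith

theorem norm_add_mul_cpow_le {z c : ℂ} (hz : 0 < z.re) (hc0 : 0 ≤ c.re)
    (hc : |c.im| = 1) {r : ℝ} (hr : 0 ≤ r) {κ : ℝ} (hκ : 0 ≤ κ) :
    ‖(z + c * r) ^ (-(κ : ℂ))‖ ≤ ((1 + |z.im|) / z.re + 1) ^ κ * (1 + r) ^ (-κ) := by
  have h := one_add_le_mul_norm_add_mul hz hc0 hc hr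
  have h5 : 0 < 1 + r := by positivity
  have h4 : 0 < ‖z + c * r‖ := by
    by_contra h0
    have : ‖z + c * r‖ = 0 := le_antisymm (not_lt.1 h0) (norm_nonneg _)
    rw [this, mul_zero] at h
    linarith
  rw [norm_cpow_neg_real, Real.rpow_neg h5.le, Real.rpow_neg h4.le, ← div_eq_mul_inv,
    le_div_iff₀ (by positivity), ← div_eq_inv_mul, div_le_iff₀ (by positivity),
    ← Real.mul_rpow (by positivity) h4.le]
  exact Real.rpow_le_rpow h5.le h hκ

theorem integrableOn_add_mul_cpow_mul_rpow {a b : ℝ} (ha : 0 < a) (hb : 0 < b) {z c : ℂ}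
    (hz : 0 < z.re) (hc0 : 0 ≤ c.re) (hc : |c.im| = 1) :
    IntegrableOn (fun r : ℝ => (z + c * r) ^ (-((a + b : ℝ) : ℂ)) * ((r ^ (a - 1) : ℝ) : ℂ))
      (Ioi 0) := by
  refine Integrable.mono' ((integrableOn_one_add_rpow_neg_mul_rpow ha hb).const_mul
    (((1 + |z.im|) / z.re + 1) ^ (a + b))) ?_ ?_
  · apply Measurable.aestronglyMeasurable
    fun_prop
  · refine (ae_restrict_mem measurableSet_Ioi).mono fun r hr => ?_
    have hr' : (0 : ℝ) < r := hr
    rw [norm_mul, Complex.norm_real, Real.norm_of_nonneg (by positivity), ← mul_assoc]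
    gcongr
    exact norm_add_mul_cpow_le hz hc0 hc hr'.le (by linarith)

/-- Apply `beta_integral_of_re_pos` to η + c and let η → 0. The majorant in `norm_add_mul_cpow_le`
only uses Re c ≥ 0 and |Im c| = 1, so it is uniform in η. -/
theorem beta_integral {a b : ℝ} (ha : 0 < a) (hb : 0 < b) {z c : ℂ} (hz : 0 < z.re)
    (hc0 : c.re = 0) (hc : |c.im| = 1) :
    ∫ r in Ioi (0 : ℝ), (z + c * r) ^ (-((a + b : ℝ) : ℂ)) * ((r ^ (a - 1) : ℝ) : ℂ)
      = (Real.Gamma a * Real.Gamma b / Real.Gamma (a + b) : ℝ) * c ^ (-(a : ℂ))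
        * z ^ (-(b : ℂ)) := by
  have hcs : c ∈ Complex.slitPlane := by
    right; intro h; rw [h] at hc; simp at hc
  have h1 : ∀ η : ℝ, 0 < η →
      ∫ r in Ioi (0 : ℝ), (z + (η + c) * r) ^ (-((a + b : ℝ) : ℂ)) * ((r ^ (a - 1) : ℝ) : ℂ)
      = (Real.Gamma a * Real.Gamma b / Real.Gamma (a + b) : ℝ) * (η + c) ^ (-(a : ℂ))
        * z ^ (-(b : ℂ)) := fun η hη =>
    beta_integral_of_re_pos ha hb hz (by simp [hc0, hη])
  have h2 : Tendsto (fun η : ℝ => ∫ r in Ioi (0 : ℝ),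
      (z + (η + c) * r) ^ (-((a + b : ℝ) : ℂ)) * ((r ^ (a - 1) : ℝ) : ℂ)) (𝓝[>] 0)
      (𝓝 (∫ r in Ioi (0 : ℝ),
        (z + c * r) ^ (-((a + b : ℝ) : ℂ)) * ((r ^ (a - 1) : ℝ) : ℂ))) := by
    refine tendsto_integral_filter_of_dominated_convergence
      (fun r => ((1 + |z.im|) / z.re + 1) ^ (a + b) * ((1 + r) ^ (-(a + b)) * r ^ (a - 1)))
      (Eventually.of_forall fun η => ?_) ?_
      ((integrableOn_one_add_rpow_neg_mul_rpow ha hb).const_mul _) ?_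
    · apply Measurable.aestronglyMeasurable
      fun_prop
    · filter_upwards [self_mem_nhdsWithin] with η hη
      have hη' : (0 : ℝ) < η := hη
      refine (ae_restrict_mem measurableSet_Ioi).mono fun r hr => ?_
      have hr' : (0 : ℝ) < r := hr
      rw [norm_mul, Complex.norm_real, Real.norm_of_nonneg (by positivity), ← mul_assoc]
      gcongr
      exact norm_add_mul_cpow_le hz (by simp [hc0, hη'.le]) (by simpa using hc) hr'.le
        (by linarith)
    · refine (ae_restrict_mem measurableSet_Ioi).mono fun r hr => ?_
      apply Tendsto.mul_const
      have : ContinuousAt (fun η : ℝ => (z + (η + c) * r) ^ (-((a + b : ℝ) : ℂ))) 0 := by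
        apply ContinuousAt.cpow (by fun_prop) (by fun_prop)
        left
        simp [hc0, hz]
      have h := this.tendsto
      simp only [Complex.ofReal_zero, zero_add] at h
      exact h.mono_left nhdsWithin_le_nhds
  have h3 : Tendsto (fun η : ℝ => (Real.Gamma a * Real.Gamma b / Real.Gamma (a + b) : ℝ)
      * ((η : ℂ) + c) ^ (-(a : ℂ)) * z ^ (-(b : ℂ))) (𝓝[>] 0)
      (𝓝 ((Real.Gamma a * Real.Gamma b / Real.Gamma (a + b) : ℝ) * c ^ (-(a : ℂ))
        * z ^ (-(b : ℂ)))) :=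
    ((tendsto_ofReal_add_cpow hcs _).const_mul _).mul_const _
  refine tendsto_nhds_unique h2 (h3.congr' ?_)
  filter_upwards [self_mem_nhdsWithin] with η hη
  exact (h1 η hη).symm

/-! ### One-sided powers -/

/-- `(σy)_+^{e}`. -/
noncomputable def sidePow (e σ y : ℝ) : ℝ := max (σ * y) 0 ^ e

theorem sidePow_nonneg (e σ y : ℝ) : 0 ≤ sidePow e σ y :=
  Real.rpow_nonneg (le_max_right _ _) _

theorem continuous_sidePow {e : ℝ} (he : 0 ≤ e) (σ : ℝ) : Continuous (sidePow e σ) := by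
  unfold sidePow
  exact Continuous.rpow_const (by fun_prop) fun _ => Or.inr he

theorem sidePow_le {e : ℝ} (he : 0 ≤ e) {σ : ℝ} (hσ : |σ| = 1) (q x : ℝ) :
    sidePow e σ (q - x) ≤ (1 + |q|) ^ e * (1 + |x|) ^ e := by
  unfold sidePow
  rw [← Real.mul_rpow (by positivity) (by positivity)]
  apply Real.rpow_le_rpow (le_max_right _ _) _ he
  apply max_le _ (by positivity)
  calc σ * (q - x) ≤ |σ * (q - x)| := le_abs_self _
    _ = |q - x| := by rw [abs_mul, hσ, one_mul]
    _ ≤ |q| + |x| := abs_sub _ _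
    _ ≤ _ := by nlinarith [abs_nonneg q, abs_nonneg x, mul_nonneg (abs_nonneg q) (abs_nonneg x)]

theorem integrable_one_add_abs_rpow {r : ℝ} (hr : 1 < r) :
    Integrable (fun x : ℝ => (1 + |x|) ^ (-r)) := by
  have := integrable_one_add_norm (E := ℝ) (μ := volume) (r := r) (by simpa using hr)
  simpa only [Real.norm_eq_abs] using this

theorem integrable_powKernel_mul_sidePow {s b δ : ℝ} (hs : 1 ≤ s) (hb : 0 < b) (hδ : 0 < δ)
    {σ : ℝ} (hσ : |σ| = 1) (q : ℝ) :
    Integrable fun x : ℝ => powKernel (s + b) δ x * (sidePow (s - 1) σ (q - x) : ℂ) := by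
  refine Integrable.mono' ((integrable_one_add_abs_rpow (r := b + 1) (by linarith)).const_mul
    ((1 + 1 / δ) ^ (s + b) * (1 + |q|) ^ (s - 1))) ?_ ?_
  · apply Continuous.aestronglyMeasurable
    have := continuous_powKernel (s + b) hδ
    have := continuous_sidePow (e := s - 1) (by linarith) σ
    fun_prop
  · refine Eventually.of_forall fun x => ?_
    rw [norm_mul, Complex.norm_real, Real.norm_of_nonneg (sidePow_nonneg _ _ _)]
    calc _ ≤ ((1 + 1 / δ) ^ (s + b) * (1 + |x|) ^ (-(s + b))) *
          ((1 + |q|) ^ (s - 1) * (1 + |x|) ^ (s - 1)) := by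
          gcongr
          · exact sidePow_nonneg _ _ _
          · exact norm_powKernel_le (by linarith) hδ x
          · exact sidePow_le (by linarith) hσ q x
      _ = _ := by
          rw [show -(b + 1) = -(s + b) + (s - 1) by ring,
            Real.rpow_add (x := 1 + |x|) (by positivity)]
          ring

/-- The substitution x = q - σr makes this the Beta integral along the ray δ + iq - σir; the factor
(-σi)^{-s} is the exponential. -/
theorem integral_powKernel_mul_sidePow {s b δ : ℝ} (hs : 1 < s) (hb : 0 < b) (hδ : 0 < δ)
    {σ : ℝ} (hσ : σ = 1 ∨ σ = -1) (q : ℝ) :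
    ∫ x : ℝ, powKernel (s + b) δ x * (sidePow (s - 1) σ (q - x) : ℂ)
      = (Real.Gamma s * Real.Gamma b / Real.Gamma (s + b) : ℝ) *
        Complex.exp (Complex.I * Real.pi / 2 * (σ * s)) * powKernel b δ q := by
  have hz : 0 < ((δ : ℂ) + Complex.I * q).re := by simpa using hδ
  have h1 : ∫ x : ℝ, powKernel (s + b) δ x * (sidePow (s - 1) σ (q - x) : ℂ)
      = ∫ r : ℝ, powKernel (s + b) δ (q - σ * r) * (sidePow (s - 1) σ (σ * r) : ℂ) := by
    rcases hσ with rfl | rfl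
    · rw [← integral_sub_left_eq_self _ volume q]
      simp
    · rw [← integral_add_left_eq_self _ q]
      simp
  have hσσ : σ * σ = 1 := by rcases hσ with rfl | rfl <;> norm_num
  have h2 : ∀ r : ℝ, powKernel (s + b) δ (q - σ * r) * (sidePow (s - 1) σ (σ * r) : ℂ)
      = (Ioi (0 : ℝ)).indicator (fun r : ℝ => ((δ + Complex.I * q) + (-(σ * Complex.I)) * r)
        ^ (-((s + b : ℝ) : ℂ)) * ((r ^ (s - 1) : ℝ) : ℂ)) r := by
    intro r
    unfold sidePow powKernel
    rw [← mul_assoc, hσσ, one_mul]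
    by_cases hr : r ∈ Ioi (0 : ℝ)
    · rw [indicator_of_mem hr, max_eq_left (le_of_lt hr)]
      congr 2
      push_cast
      ring
    -- Here s ≠ 1 matters: for s = 1 the convention 0 ^ 0 = 1 would make the one-sided power equal
    -- to 1 on the wrong half line.
    · rw [indicator_of_notMem hr, max_eq_right (not_lt.1 hr), Real.zero_rpow (by linarith)]
      simp
  rw [h1]
  simp only [h2]
  rw [integral_indicator measurableSet_Ioi, beta_integral (by linarith) hb hz (by simp)
    (by rcases hσ with rfl | rfl <;> simp)]
  unfold powKernel
  congr 2
  rcases hσ with rfl | rfl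
  · rw [Complex.cpow_def_of_ne_zero (by simp)]
    simp only [Complex.ofReal_one, one_mul, Complex.log_neg_I]
    congr 1; ring
  · rw [Complex.cpow_def_of_ne_zero (by simp)]
    simp only [Complex.ofReal_neg, Complex.ofReal_one, neg_mul, one_mul, neg_neg, Complex.log_I]
    congr 1; ring

/-! ### The filtered interpolation kernel -/

/-- Induction on m: the derivative in x of the remainder of f is the remainder of f' of one order
less, so the mean value inequality on the segment from 0 to x gains one power of |x|. The factorial
in the constant is given away. -/
theorem abs_sub_taylor_le {C : ℝ≥0} (m : ℕ) : ∀ {f : ℝ → ℝ}, ContDiff ℝ m f →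
    LipschitzWith C (iteratedDeriv m f) → ∀ t x : ℝ,
    |f (t + x) - ∑ l ∈ Finset.range (m + 1), iteratedDeriv l f t * x ^ l / (l.factorial : ℝ)|
      ≤ C * |x| ^ (m + 1) := by
  induction m with
  | zero =>
    intro f _ hL t x
    have := hL.dist_le_mul (t + x) t
    simp [Real.dist_eq] at this
    simpa using this
  | succ m ih =>
    intro f hf hL t x
    have hf' : ContDiff ℝ m (deriv f) := by
      have : ContDiff ℝ (m + 1) f := by exact_mod_cast hf
      exact (contDiff_succ_iff_deriv.1 this).2.2
    have hd : Differentiable ℝ f := hf.differentiable (by simp)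
    rw [iteratedDeriv_succ'] at hL
    have ih' := ih hf' hL t
    set g : ℝ → ℝ := fun x => f (t + x) -
      ∑ l ∈ Finset.range (m + 2), iteratedDeriv l f t * x ^ l / (l.factorial : ℝ) with hg
    set g' : ℝ → ℝ := fun x => deriv f (t + x) -
      ∑ l ∈ Finset.range (m + 1), iteratedDeriv l (deriv f) t * x ^ l / (l.factorial : ℝ) with hg'
    have hder : ∀ x, HasDerivAt g (g' x) x := by
      intro x
      have h1 : HasDerivAt (fun x => f (t + x)) (deriv f (t + x)) x :=
        (hd (t + x)).hasDerivAt.comp_const_add t x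
      refine h1.sub ?_
      have h2 : ∀ l ∈ Finset.range (m + 2), HasDerivAt
          (fun x : ℝ => iteratedDeriv l f t * x ^ l / (l.factorial : ℝ))
          (iteratedDeriv l f t * (l * x ^ (l - 1)) / (l.factorial : ℝ)) x := fun l _ =>
        ((hasDerivAt_pow l x).const_mul _).div_const _
      have h3 := HasDerivAt.fun_sum h2
      refine h3.congr_deriv ?_
      rw [Finset.sum_range_succ']
      simp only [Nat.cast_zero, zero_mul, mul_zero, zero_div, add_zero]
      refine Finset.sum_congr rfl fun l _ => ?_
      rw [iteratedDeriv_succ', Nat.factorial_succ]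
      push_cast
      have : (l.factorial : ℝ) ≠ 0 := by positivity
      have : (l + 1 : ℝ) ≠ 0 := by positivity
      field_simp
    have hg0 : g 0 = 0 := by
      simp only [hg]
      rw [Finset.sum_range_succ']
      simp
    have := Convex.norm_image_sub_le_of_norm_hasDerivWithin_le (f := g) (f' := g')
      (s := uIcc 0 x) (C := C * |x| ^ (m + 1)) (x := 0) (y := x)
      (fun y _ => (hder y).hasDerivWithinAt)
      (fun y hy => by
        refine (ih' y).trans ?_
        have h0 := abs_sub_left_of_mem_uIcc hy
        simp only [sub_zero] at h0
        gcongr)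
      (convex_uIcc 0 x) left_mem_uIcc right_mem_uIcc
    rw [hg0] at this
    simp only [sub_zero, Real.norm_eq_abs] at this
    rw [pow_succ, ← mul_assoc]
    exact this

theorem integrableOn_abs_rpow {e : ℝ} (he : -1 < e) :
    IntervalIntegrable (fun x : ℝ => |x| ^ e) volume (-1) 1 := by
  have h1 : IntervalIntegrable (fun x : ℝ => |x| ^ e) volume 0 1 := by
    refine (intervalIntegral.intervalIntegrable_rpow' he).congr fun x hx => ?_
    rw [uIoc_of_le zero_le_one] at hx
    simp only [abs_of_pos hx.1]
  refine IntervalIntegrable.trans (b := 0) ?_ h1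
  have := (IntervalIntegrable.iff_comp_neg (f := fun x : ℝ => |x| ^ e) (a := 0) (b := -1)).2
    (by simpa using h1)
  exact this.symm

section near

variable {κ : ℝ} {m : ℕ}

/-- Uniform in δ, and integrable near 0 as soon as κ < m + 2: this is why subtracting a Taylor
polynomial of degree m suffices to regularize the kernel. -/
theorem norm_powKernel_mul_le_of_taylor (hκ : 0 ≤ κ) {δ x L : ℝ} {r : ℂ}
    (hr : ‖r‖ ≤ L * |x| ^ (m + 1)) (hL : 0 ≤ L) :
    ‖powKernel κ δ x * r‖ ≤ L * |x| ^ ((m : ℝ) + 1 - κ) := by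
  rcases eq_or_ne x 0 with rfl | hx
  · have : r = 0 := by simpa using hr
    rw [this]
    simp only [mul_zero, norm_zero]
    positivity
  · have hx' : 0 < |x| := abs_pos.2 hx
    rw [norm_mul]
    calc _ ≤ |x| ^ (-κ) * (L * |x| ^ (m + 1)) := by
          gcongr
          exact norm_powKernel_le_abs hκ δ hx
      _ = _ := by
          rw [show (m : ℝ) + 1 - κ = -κ + ((m + 1 : ℕ) : ℝ) by push_cast; ring,
            Real.rpow_add hx', Real.rpow_natCast]
          ring

theorem integral_powKernel_mul_eq_add {δ : ℝ} (hδ : 0 < δ) {f : ℝ → ℂ} (hf : Continuous f)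
    (c : ℕ → ℂ) :
    ∫ x in (-1 : ℝ)..1, powKernel κ δ x * f x =
      (∑ l ∈ Finset.range (m + 1), c l * nearMoment κ l δ) +
      ∫ x in (-1 : ℝ)..1, powKernel κ δ x *
        (f x - ∑ l ∈ Finset.range (m + 1), c l * (x : ℂ) ^ l) := by
  have hk := continuous_powKernel κ hδ
  have h1 : ∀ l, c l * nearMoment κ l δ =
      ∫ x in (-1 : ℝ)..1, powKernel κ δ x * (c l * (x : ℂ) ^ l) := by
    intro l
    unfold nearMoment
    rw [← intervalIntegral.integral_const_mul]
    congr 1; ext x; ring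
  simp only [h1]
  rw [← intervalIntegral.integral_finsetSum
    (fun l _ => Continuous.intervalIntegrable (by fun_prop) _ _),
    ← intervalIntegral.integral_add (Continuous.intervalIntegrable (by fun_prop) _ _)
      (Continuous.intervalIntegrable (by fun_prop) _ _)]
  congr 1; ext x
  rw [← Finset.mul_sum]
  ring

/-- The limit of `nearMoment`. -/
noncomputable def nearMomentLim (κ : ℝ) (l : ℕ) : ℂ := limUnder (𝓝[>] 0) (nearMoment κ l)

theorem tendsto_nearMoment {l : ℕ} (h : (l : ℝ) + 1 ≤ κ) :
    Tendsto (nearMoment κ l) (𝓝[>] 0) (𝓝 (nearMomentLim κ l)) := by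
  obtain ⟨J, hJ⟩ := exists_tendsto_nearMoment l h
  unfold nearMomentLim
  rwa [hJ.limUnder_eq]

/-- The polynomial part is paired with the moments, which converge, and the remainder with an
integrable majorant. The threshold on δ is chosen before f, so a single δ serves all translates of φ
and all interpolation errors at once. -/
theorem near_bound (h1 : (m : ℝ) + 1 ≤ κ) (h2 : κ < m + 2) :
    ∃ C : ℝ, 0 ≤ C ∧ ∀ᶠ δ in 𝓝[>] (0 : ℝ), ∀ (f : ℝ → ℂ) (c : ℕ → ℂ) (L : ℝ), Continuous f →
      0 ≤ L → (∀ x : ℝ, |x| ≤ 1 →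
        ‖f x - ∑ l ∈ Finset.range (m + 1), c l * (x : ℂ) ^ l‖ ≤ L * |x| ^ (m + 1)) →
      ‖∫ x in (-1 : ℝ)..1, powKernel κ δ x * f x‖
        ≤ C * ((∑ l ∈ Finset.range (m + 1), ‖c l‖) + L) := by
  have hκ : 0 ≤ κ := by
    have : (0 : ℝ) ≤ m := by positivity
    linarith
  set K : ℝ := ∑ l ∈ Finset.range (m + 1), (‖nearMomentLim κ l‖ + 1) with hK
  set I : ℝ := ∫ x in (-1 : ℝ)..1, |x| ^ ((m : ℝ) + 1 - κ) with hI
  have hI0 : 0 ≤ I := intervalIntegral.integral_nonneg (by norm_num) fun x _ => by positivity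
  have hK0 : 0 ≤ K := by positivity
  refine ⟨K + I, by positivity, ?_⟩
  have hev : ∀ᶠ δ in 𝓝[>] (0 : ℝ), ∀ l ∈ Finset.range (m + 1), ‖nearMoment κ l δ‖ ≤ K := by
    rw [Filter.eventually_all_finset]
    intro l hl
    have hl' : (l : ℝ) + 1 ≤ κ := by
      have : (l : ℝ) ≤ m := by exact_mod_cast Nat.lt_succ_iff.1 (Finset.mem_range.1 hl)
      linarith
    have h3 : ‖nearMomentLim κ l‖ < ‖nearMomentLim κ l‖ + 1 := by linarith
    filter_upwards [(tendsto_nearMoment hl').norm.eventually_lt_const h3] with δ hδ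
    refine hδ.le.trans ?_
    exact Finset.single_le_sum (f := fun l => ‖nearMomentLim κ l‖ + 1)
      (fun i _ => by positivity) hl
  filter_upwards [hev, self_mem_nhdsWithin] with δ hδ hδ0 f c L hf hL hT
  rw [integral_powKernel_mul_eq_add (m := m) hδ0 hf c]
  refine (norm_add_le _ _).trans ?_
  have ha : ‖∑ l ∈ Finset.range (m + 1), c l * nearMoment κ l δ‖
      ≤ K * ∑ l ∈ Finset.range (m + 1), ‖c l‖ := by
    rw [Finset.mul_sum]
    refine norm_sum_le_of_le _ fun l hl => ?_
    rw [norm_mul, mul_comm]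
    gcongr
    exact hδ l hl
  have hb : ‖∫ x in (-1 : ℝ)..1, powKernel κ δ x *
        (f x - ∑ l ∈ Finset.range (m + 1), c l * (x : ℂ) ^ l)‖ ≤ L * I := by
    rw [hI, ← intervalIntegral.integral_const_mul]
    refine intervalIntegral.norm_integral_le_of_norm_le (by norm_num)
      (Eventually.of_forall fun x hx => ?_)
      ((integrableOn_abs_rpow (by linarith)).const_mul _)
    exact norm_powKernel_mul_le_of_taylor hκ (hT x (abs_le.2 ⟨hx.1.le, hx.2⟩)) hL
  have hs : 0 ≤ ∑ l ∈ Finset.range (m + 1), ‖c l‖ := by positivity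
  nlinarith [mul_nonneg hK0 hL, mul_nonneg hI0 hs]

theorem tendsto_near (h1 : (m : ℝ) + 1 ≤ κ) (h2 : κ < m + 2) {f : ℝ → ℂ} {c : ℕ → ℂ} {L : ℝ}
    (hf : Continuous f) (hL : 0 ≤ L) (hT : ∀ x : ℝ, |x| ≤ 1 →
        ‖f x - ∑ l ∈ Finset.range (m + 1), c l * (x : ℂ) ^ l‖ ≤ L * |x| ^ (m + 1)) :
    Tendsto (fun δ => ∫ x in (-1 : ℝ)..1, powKernel κ δ x * f x) (𝓝[>] 0)
      (𝓝 ((∑ l ∈ Finset.range (m + 1), c l * nearMomentLim κ l) +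
      ∫ x in (-1 : ℝ)..1, powKernel κ 0 x *
        (f x - ∑ l ∈ Finset.range (m + 1), c l * (x : ℂ) ^ l))) := by
  have hκ : 0 ≤ κ := by
    have : (0 : ℝ) ≤ m := by positivity
    linarith
  have h : Tendsto (fun δ => (∑ l ∈ Finset.range (m + 1), c l * nearMoment κ l δ) +
      ∫ x in (-1 : ℝ)..1, powKernel κ δ x *
        (f x - ∑ l ∈ Finset.range (m + 1), c l * (x : ℂ) ^ l)) (𝓝[>] 0)
      (𝓝 ((∑ l ∈ Finset.range (m + 1), c l * nearMomentLim κ l) +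
      ∫ x in (-1 : ℝ)..1, powKernel κ 0 x *
        (f x - ∑ l ∈ Finset.range (m + 1), c l * (x : ℂ) ^ l))) := by
    refine Tendsto.add ?_ ?_
    · refine tendsto_finsetSum _ fun l hl => ?_
      have hl' : (l : ℝ) + 1 ≤ κ := by
        have : (l : ℝ) ≤ m := by exact_mod_cast Nat.lt_succ_iff.1 (Finset.mem_range.1 hl)
        linarith
      exact (tendsto_nearMoment hl').const_mul _
    · refine intervalIntegral.tendsto_integral_filter_of_dominated_convergence
        (fun x => L * |x| ^ ((m : ℝ) + 1 - κ)) (Eventually.of_forall fun δ => ?_)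
        (Eventually.of_forall fun δ => Eventually.of_forall fun x hx => ?_)
        ((integrableOn_abs_rpow (by linarith)).const_mul _) ?_
      · apply Measurable.aestronglyMeasurable
        have := hf.measurable
        fun_prop
      · rw [uIoc_of_le (by norm_num)] at hx
        exact norm_powKernel_mul_le_of_taylor hκ (hT x (abs_le.2 ⟨hx.1.le, hx.2⟩)) hL
      · have h0 : ∀ᵐ x : ℝ, x ≠ 0 := by simp [ae_iff]
        filter_upwards [h0] with x hx _
        exact (tendsto_powKernel κ hx).mul_const _
  refine h.congr' ?_
  filter_upwards [self_mem_nhdsWithin] with δ hδ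
  exact (integral_powKernel_mul_eq_add (m := m) hδ hf c).symm

end near

/-- A `C^{m,1}` function supported in `[-R, R]`, and an exponent `κ ∈ [m + 1, m + 2)`. -/
structure IsFilterKernel (κ : ℝ) (m : ℕ) (φ : ℝ → ℝ) (L : ℝ≥0) (R : ℝ) : Prop where
  le_exponent : (m : ℝ) + 1 ≤ κ
  exponent_lt : κ < m + 2
  one_lt_exponent : 1 < κ
  smooth : ContDiff ℝ m φ
  lipschitz : LipschitzWith L (iteratedDeriv m φ)
  one_le_radius : 1 ≤ R
  eq_zero : ∀ t, R ≤ |t| → φ t = 0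

/-- `∫ (δ + ix)^{-κ} φ(t - x) dx`. -/
noncomputable def psiReg (κ : ℝ) (φ : ℝ → ℝ) (δ t : ℝ) : ℂ :=
  ∫ x : ℝ, powKernel κ δ x * (φ (t - x) : ℂ)

/-- The coefficients of the Taylor polynomial of `x ↦ φ(t - x)` at `0`. -/
noncomputable def taylorCoeff (φ : ℝ → ℝ) (t : ℝ) (l : ℕ) : ℂ :=
  (((-1) ^ l * iteratedDeriv l φ t / (l.factorial : ℝ) : ℝ) : ℂ)

/-- The limit of `psiReg κ φ δ t` as `δ → +0`. -/
noncomputable def psi (κ : ℝ) (m : ℕ) (φ : ℝ → ℝ) (t : ℝ) : ℂ :=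
  ((∑ l ∈ Finset.range (m + 1), taylorCoeff φ t l * nearMomentLim κ l) +
    ∫ x in (-1 : ℝ)..1, powKernel κ 0 x *
      ((φ (t - x) : ℂ) - ∑ l ∈ Finset.range (m + 1), taylorCoeff φ t l * (x : ℂ) ^ l)) +
  ∫ x in (Ioc (-1 : ℝ) 1)ᶜ, powKernel κ 0 x * (φ (t - x) : ℂ)

theorem one_le_abs_of_notMem_Ioc {x : ℝ} (hx : x ∈ (Ioc (-1 : ℝ) 1)ᶜ) : 1 ≤ |x| := by
  by_contra h
  rw [not_le, abs_lt] at h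
  exact hx ⟨h.1, h.2.le⟩

theorem integrableOn_abs_rpow_compl {κ : ℝ} (hκ : 1 < κ) :
    IntegrableOn (fun x : ℝ => |x| ^ (-κ)) (Ioc (-1 : ℝ) 1)ᶜ := by
  have := (integrable_one_add_abs_rpow hκ).integrableOn (s := (Ioc (-1 : ℝ) 1)ᶜ)
  refine Integrable.mono' (this.const_mul (2 ^ κ)) ?_ ?_
  · apply Measurable.aestronglyMeasurable
    fun_prop
  · refine (ae_restrict_mem measurableSet_Ioc.compl).mono fun x hx => ?_
    have h1 := one_le_abs_of_notMem_Ioc hx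
    have h2 : (0 : ℝ) < |x| := by linarith
    rw [Real.norm_of_nonneg (by positivity), Real.rpow_neg h2.le, Real.rpow_neg (by positivity),
      ← div_eq_mul_inv, le_div_iff₀ (by positivity), ← div_eq_inv_mul,
      div_le_iff₀ (by positivity), ← Real.mul_rpow (by norm_num) h2.le]
    exact Real.rpow_le_rpow (by positivity) (by linarith) (by linarith)

namespace IsFilterKernel

variable {κ : ℝ} {m : ℕ} {φ : ℝ → ℝ} {L : ℝ≥0} {R : ℝ}

theorem continuous (h : IsFilterKernel κ m φ L R) : Continuous φ := h.smooth.continuous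

theorem hasCompactSupport (h : IsFilterKernel κ m φ L R) : HasCompactSupport φ := by
  refine HasCompactSupport.intro (isCompact_closedBall (0 : ℝ) R) fun t ht => h.eq_zero t ?_
  rw [mem_closedBall_zero_iff, Real.norm_eq_abs, not_le] at ht
  exact ht.le

theorem integrable (h : IsFilterKernel κ m φ L R) : Integrable φ :=
  h.continuous.integrable_of_hasCompactSupport h.hasCompactSupport

theorem exists_bound (h : IsFilterKernel κ m φ L R) : ∃ D, 0 ≤ D ∧ ∀ t, |φ t| ≤ D := by
  obtain ⟨D, hD⟩ := h.continuous.bounded_above_of_compact_support h.hasCompactSupport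
  exact ⟨D, (norm_nonneg _).trans (hD 0), hD⟩

theorem continuous_iteratedDeriv (h : IsFilterKernel κ m φ L R) {l : ℕ} (hl : l ≤ m) :
    Continuous (iteratedDeriv l φ) :=
  h.smooth.continuous_iteratedDeriv l (by exact_mod_cast hl)

theorem continuous_taylorCoeff (h : IsFilterKernel κ m φ L R) {l : ℕ} (hl : l ≤ m) :
    Continuous fun t => taylorCoeff φ t l := by
  unfold taylorCoeff
  have := h.continuous_iteratedDeriv hl
  fun_prop

theorem exists_taylorCoeff_bound (h : IsFilterKernel κ m φ L R) :
    ∃ D, 0 ≤ D ∧ ∀ t, ∑ l ∈ Finset.range (m + 1), ‖taylorCoeff φ t l‖ ≤ D := by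
  have h1 : Continuous fun t => ∑ l ∈ Finset.range (m + 1), ‖taylorCoeff φ t l‖ :=
    continuous_finsetSum _ fun l hl =>
      (h.continuous_taylorCoeff (Nat.lt_succ_iff.1 (Finset.mem_range.1 hl))).norm
  have h2 : HasCompactSupport fun t => ∑ l ∈ Finset.range (m + 1), ‖taylorCoeff φ t l‖ := by
    refine HasCompactSupport.intro (isCompact_closedBall (0 : ℝ) R) fun t ht => ?_
    refine Finset.sum_eq_zero fun l _ => ?_
    rw [mem_closedBall_zero_iff, Real.norm_eq_abs, not_le] at ht
    have h3 : φ =ᶠ[𝓝 t] fun _ => 0 := by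
      have : ∀ᶠ s in 𝓝 t, R < |s| := continuous_abs.continuousAt.eventually_const_lt ht
      exact this.mono fun s hs => h.eq_zero s hs.le
    have h4 : iteratedDeriv l φ t = 0 := by
      rw [Filter.EventuallyEq.iteratedDeriv_eq l h3]
      simp
    simp [taylorCoeff, h4]
  obtain ⟨D, hD⟩ := h1.bounded_above_of_compact_support h2
  exact ⟨D, (norm_nonneg _).trans (hD 0), fun t => (le_abs_self _).trans (hD t)⟩

theorem norm_sub_taylor_le (h : IsFilterKernel κ m φ L R) (t x : ℝ) :
    ‖(φ (t - x) : ℂ) - ∑ l ∈ Finset.range (m + 1), taylorCoeff φ t l * (x : ℂ) ^ l‖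
      ≤ L * |x| ^ (m + 1) := by
  have := abs_sub_taylor_le m h.smooth h.lipschitz t (-x)
  rw [abs_neg] at this
  refine le_trans (le_of_eq ?_) this
  rw [← Real.norm_eq_abs, ← Complex.norm_real]
  congr 1
  push_cast
  rw [sub_eq_add_neg t x]
  congr 1
  refine Finset.sum_congr rfl fun l _ => ?_
  unfold taylorCoeff
  rw [neg_pow (x : ℂ)]
  push_cast
  ring

theorem exponent_nonneg (h : IsFilterKernel κ m φ L R) : 0 ≤ κ := by
  linarith [h.one_lt_exponent]

theorem integrable_psiReg (h : IsFilterKernel κ m φ L R) {δ : ℝ} (hδ : 0 < δ) (t : ℝ) :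
    Integrable fun x : ℝ => powKernel κ δ x * (φ (t - x) : ℂ) := by
  have hk := continuous_powKernel κ hδ
  have hc := h.continuous
  apply Continuous.integrable_of_hasCompactSupport (by fun_prop)
  have h2 : HasCompactSupport fun x : ℝ => φ (t - x) :=
    h.hasCompactSupport.comp_homeomorph (Homeomorph.subLeft t)
  exact (h2.comp_left (g := fun y : ℝ => (y : ℂ)) (by simp)).mul_left

theorem psiReg_eq (h : IsFilterKernel κ m φ L R) {δ : ℝ} (hδ : 0 < δ) (t : ℝ) :
    psiReg κ φ δ t = (∫ x in (-1 : ℝ)..1, powKernel κ δ x * (φ (t - x) : ℂ)) +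
      ∫ x in (Ioc (-1 : ℝ) 1)ᶜ, powKernel κ δ x * (φ (t - x) : ℂ) := by
  rw [intervalIntegral.integral_of_le (by norm_num),
    integral_add_compl measurableSet_Ioc (h.integrable_psiReg hδ t), psiReg]

theorem norm_far_le (h : IsFilterKernel κ m φ L R) {D : ℝ} (hD : ∀ t, |φ t| ≤ D) (δ t : ℝ)
    {x : ℝ} (hx : x ∈ (Ioc (-1 : ℝ) 1)ᶜ) :
    ‖powKernel κ δ x * (φ (t - x) : ℂ)‖ ≤ |x| ^ (-κ) * D := by
  have h1 := one_le_abs_of_notMem_Ioc hx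
  rw [norm_mul, Complex.norm_real]
  have hx0 : x ≠ 0 := abs_pos.1 (by linarith)
  gcongr
  · exact norm_powKernel_le_abs h.exponent_nonneg δ hx0
  · exact hD _

/-- Near the singularity `tendsto_near` applies to the Taylor polynomial of φ at t; on |x| ≥ 1 the
majorant |x|^{-κ} is integrable because κ > 1. -/
theorem tendsto_psiReg (h : IsFilterKernel κ m φ L R) (t : ℝ) :
    Tendsto (fun δ => psiReg κ φ δ t) (𝓝[>] 0) (𝓝 (psi κ m φ t)) := by
  have hc := h.continuous
  obtain ⟨D, hD0, hD⟩ := h.exists_bound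
  have h1 := tendsto_near (f := fun x => (φ (t - x) : ℂ)) (c := taylorCoeff φ t) (L := L)
    h.le_exponent h.exponent_lt (by fun_prop) L.2 (fun x _ => h.norm_sub_taylor_le t x)
  have h2 : Tendsto (fun δ => ∫ x in (Ioc (-1 : ℝ) 1)ᶜ, powKernel κ δ x * (φ (t - x) : ℂ))
      (𝓝[>] 0) (𝓝 (∫ x in (Ioc (-1 : ℝ) 1)ᶜ, powKernel κ 0 x * (φ (t - x) : ℂ))) := by
    refine tendsto_integral_filter_of_dominated_convergence
      (fun x => |x| ^ (-κ) * D) (Eventually.of_forall fun δ => ?_)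
      (Eventually.of_forall fun δ => ?_)
      ((integrableOn_abs_rpow_compl h.one_lt_exponent).mul_const D) ?_
    · apply Measurable.aestronglyMeasurable
      have := hc.measurable
      fun_prop
    · exact (ae_restrict_mem measurableSet_Ioc.compl).mono fun x hx => h.norm_far_le hD δ t hx
    · refine (ae_restrict_mem measurableSet_Ioc.compl).mono fun x hx => ?_
      have h1 := one_le_abs_of_notMem_Ioc hx
      have hx0 : x ≠ 0 := abs_pos.1 (by linarith)
      exact (tendsto_powKernel κ hx0).mul_const _
  refine (h1.add h2).congr' ?_
  filter_upwards [self_mem_nhdsWithin] with δ hδ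
  exact (h.psiReg_eq hδ t).symm

theorem continuous_psi (h : IsFilterKernel κ m φ L R) : Continuous (psi κ m φ) := by
  have hc := h.continuous
  obtain ⟨D, hD0, hD⟩ := h.exists_bound
  have hle : ∀ l ∈ Finset.range (m + 1), l ≤ m := fun l hl =>
    Nat.lt_succ_iff.1 (Finset.mem_range.1 hl)
  have htc : Continuous fun t => ∑ l ∈ Finset.range (m + 1), taylorCoeff φ t l * nearMomentLim κ l :=
    continuous_finsetSum _ fun l hl => (h.continuous_taylorCoeff (hle l hl)).mul_const _
  unfold psi
  refine (htc.add ?_).add ?_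
  · refine intervalIntegral.continuous_of_dominated_interval
      (bound := fun x => L * |x| ^ ((m : ℝ) + 1 - κ)) (fun t => ?_)
      (fun t => Eventually.of_forall fun x hx => ?_)
      ((integrableOn_abs_rpow (by linarith [h.exponent_lt])).const_mul _)
      (Eventually.of_forall fun x _ => ?_)
    · apply Measurable.aestronglyMeasurable
      have := hc.measurable
      fun_prop
    · exact norm_powKernel_mul_le_of_taylor h.exponent_nonneg (h.norm_sub_taylor_le t x) L.2
    · refine continuous_const.mul (Continuous.sub (by fun_prop) ?_)
      exact continuous_finsetSum _ fun l hl =>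
        (h.continuous_taylorCoeff (hle l hl)).mul_const _
  · refine continuous_of_dominated (bound := fun x => |x| ^ (-κ) * D) (fun t => ?_) (fun t => ?_)
      ((integrableOn_abs_rpow_compl h.one_lt_exponent).mul_const D)
      (Eventually.of_forall fun x => ?_)
    · apply Measurable.aestronglyMeasurable
      have := hc.measurable
      fun_prop
    · exact (ae_restrict_mem measurableSet_Ioc.compl).mono fun x hx => h.norm_far_le hD 0 t hx
    · fun_prop

/-- For |t| ≥ 2R the support of x ↦ φ(t - x) stays away from the singularity and the kernel is of
size |t|^{-κ} there; for smaller t the near and far parts are bounded separately. -/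
theorem psiReg_bound (h : IsFilterKernel κ m φ L R) :
    ∃ C, 0 ≤ C ∧ ∀ᶠ δ in 𝓝[>] (0 : ℝ), ∀ t, ‖psiReg κ φ δ t‖ ≤ C * (1 + |t|) ^ (-κ) := by
  have hc := h.continuous
  have hκ := h.exponent_nonneg
  have hR := h.one_le_radius
  obtain ⟨D, hD0, hD⟩ := h.exists_bound
  obtain ⟨D', hD'0, hD'⟩ := h.exists_taylorCoeff_bound
  obtain ⟨K, hK0, hK⟩ := near_bound h.le_exponent h.exponent_lt
  set I : ℝ := ∫ x in (Ioc (-1 : ℝ) 1)ᶜ, |x| ^ (-κ) * D with hI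
  have hI0 : 0 ≤ I := integral_nonneg fun x => by positivity
  set N : ℝ := ∫ x, |φ x| with hN
  have hN0 : 0 ≤ N := integral_nonneg fun x => by positivity
  set C₁ : ℝ := K * (D' + L) + I with hC₁
  have hC₁0 : 0 ≤ C₁ := by positivity
  refine ⟨C₁ * (1 + 2 * R) ^ κ + 4 ^ κ * N, by positivity, ?_⟩
  filter_upwards [hK, self_mem_nhdsWithin] with δ hδ hδ0 t
  have hδ0' : (0 : ℝ) < δ := hδ0
  have ht0 : 0 < 1 + |t| := by positivity
  rcases le_or_gt (2 * R) |t| with ht | ht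
  · have hb : ‖psiReg κ φ δ t‖ ≤ ∫ x, (|t| / 2) ^ (-κ) * |φ (t - x)| := by
      refine norm_integral_le_of_norm_le (((h.integrable.comp_sub_left t).abs).const_mul _)
        (Eventually.of_forall fun x => ?_)
      rw [norm_mul, Complex.norm_real, Real.norm_eq_abs]
      by_cases hx : R ≤ |t - x|
      · rw [h.eq_zero _ hx]; simp
      -- On the support |t - x| < R ≤ |t| / 2.
      · have h1 : |t| / 2 ≤ |x| := by
          have := abs_sub_abs_le_abs_sub t x
          linarith
        have h2 : 0 < |t| / 2 := by linarith
        have hx0 : x ≠ 0 := abs_pos.1 (by linarith)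
        gcongr
        exact (norm_powKernel_le_abs hκ δ hx0).trans
          (Real.rpow_le_rpow_of_nonpos h2 h1 (by linarith))
    rw [integral_const_mul, integral_sub_left_eq_self (fun x => |φ x|) volume t] at hb
    refine hb.trans ?_
    have h3 : (|t| / 2) ^ (-κ) ≤ 4 ^ κ * (1 + |t|) ^ (-κ) := by
      have h4 : 0 < |t| / 2 := by linarith
      rw [Real.rpow_neg h4.le, Real.rpow_neg ht0.le,
        ← div_eq_mul_inv, le_div_iff₀ (by positivity), ← div_eq_inv_mul,
        div_le_iff₀ (by positivity), ← Real.mul_rpow (by norm_num) h4.le]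
      exact Real.rpow_le_rpow (by positivity) (by linarith) hκ
    calc (|t| / 2) ^ (-κ) * N ≤ 4 ^ κ * (1 + |t|) ^ (-κ) * N := by gcongr
      _ = 4 ^ κ * N * (1 + |t|) ^ (-κ) := by ring
      _ ≤ _ := by
        gcongr
        have : 0 ≤ C₁ * (1 + 2 * R) ^ κ := by positivity
        linarith
  · have hb : ‖psiReg κ φ δ t‖ ≤ C₁ := by
      rw [h.psiReg_eq hδ0 t]
      refine (norm_add_le _ _).trans (add_le_add ?_ ?_)
      · refine (hδ (fun x => (φ (t - x) : ℂ)) (taylorCoeff φ t) L (by fun_prop) L.2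
          (fun x _ => h.norm_sub_taylor_le t x)).trans ?_
        gcongr
        exact hD' t
      · refine norm_integral_le_of_norm_le
          ((integrableOn_abs_rpow_compl h.one_lt_exponent).mul_const D) ?_
        exact (ae_restrict_mem measurableSet_Ioc.compl).mono fun x hx => h.norm_far_le hD δ t hx
    refine hb.trans ?_
    have h3 : 1 ≤ (1 + 2 * R) ^ κ * (1 + |t|) ^ (-κ) := by
      rw [Real.rpow_neg ht0.le, ← div_eq_mul_inv, le_div_iff₀ (by positivity), one_mul]
      exact Real.rpow_le_rpow ht0.le (by linarith) hκ
    calc C₁ ≤ C₁ * ((1 + 2 * R) ^ κ * (1 + |t|) ^ (-κ)) := le_mul_of_one_le_right hC₁0 h3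
      _ = C₁ * (1 + 2 * R) ^ κ * (1 + |t|) ^ (-κ) := by ring
      _ ≤ _ := by
        gcongr
        have : 0 ≤ 4 ^ κ * N := by positivity
        linarith

theorem psi_bound_of_psiReg_bound (h : IsFilterKernel κ m φ L R) {C : ℝ}
    (hC : ∀ᶠ δ in 𝓝[>] (0 : ℝ), ∀ t, ‖psiReg κ φ δ t‖ ≤ C * (1 + |t|) ^ (-κ)) (t : ℝ) :
    ‖psi κ m φ t‖ ≤ C * (1 + |t|) ^ (-κ) :=
  le_of_tendsto (h.tendsto_psiReg t).norm (hC.mono fun _ hδ => hδ t)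

end IsFilterKernel

/-! ### The sums over the sampled data -/

/-- `∑_j Ψ(t - j) (σ(q - (t - j)))_+^{s-1}`. -/
noncomputable def sampleSum (κ : ℝ) (m : ℕ) (φ : ℝ → ℝ) (s σ q t : ℝ) : ℂ :=
  ∑' j : ℤ, psi κ m φ (t - j) * (sidePow (s - 1) σ (q - (t - j)) : ℂ)

theorem summable_one_add_abs_int_rpow {r : ℝ} (hr : 1 < r) :
    Summable fun j : ℤ => (1 + |(j : ℝ)|) ^ (-r) := by
  refine Summable.of_norm_bounded_eventually (Real.summable_abs_int_rpow hr) ?_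
  have : {(0 : ℤ)}ᶜ ∈ (cofinite : Filter ℤ) := (finite_singleton 0).compl_mem_cofinite
  filter_upwards [this] with j hj
  have hj' : 0 < |(j : ℝ)| := abs_pos.2 (by exact_mod_cast hj)
  rw [Real.norm_of_nonneg (by positivity)]
  exact Real.rpow_le_rpow_of_nonpos hj' (by linarith) (by linarith)

theorem one_add_abs_rpow_neg_le {r : ℝ} (hr : 0 ≤ r) (x y : ℝ) :
    (1 + |y|) ^ (-r) ≤ (1 + |x - y|) ^ r * (1 + |x|) ^ (-r) := by
  have h1 : 0 < 1 + |x| := by positivity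
  have h2 : 0 < 1 + |y| := by positivity
  have h3 : 1 + |x| ≤ (1 + |x - y|) * (1 + |y|) := by
    have := abs_sub_abs_le_abs_sub x y
    nlinarith [abs_nonneg (x - y), abs_nonneg y]
  rw [Real.rpow_neg h1.le, Real.rpow_neg h2.le, ← div_eq_mul_inv, le_div_iff₀ (by positivity),
    ← div_eq_inv_mul, div_le_iff₀ (by positivity), ← Real.mul_rpow (by positivity) h2.le]
  exact Real.rpow_le_rpow h1.le h3 hr

/-- The decay s + b of the filtered kernel against the growth s - 1 of the data leaves the exponent
b + 1 > 1, which is both integrable and summable over the integers. -/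
theorem norm_mul_sidePow_le {s b C y q : ℝ} {w : ℂ} (hs : 1 ≤ s) {σ : ℝ} (hσ : |σ| = 1)
    (hw : ‖w‖ ≤ C * (1 + |y|) ^ (-(s + b))) :
    ‖w * (sidePow (s - 1) σ (q - y) : ℂ)‖ ≤ C * (1 + |q|) ^ (s - 1) * (1 + |y|) ^ (-(b + 1)) := by
  rw [norm_mul, Complex.norm_real, Real.norm_of_nonneg (sidePow_nonneg _ _ _)]
  calc _ ≤ (C * (1 + |y|) ^ (-(s + b))) * ((1 + |q|) ^ (s - 1) * (1 + |y|) ^ (s - 1)) := by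
        gcongr
        · exact sidePow_nonneg _ _ _
        · exact (norm_nonneg _).trans hw
        · exact sidePow_le (by linarith) hσ q y
    _ = _ := by
        rw [show -(b + 1) = -(s + b) + (s - 1) by ring,
          Real.rpow_add (x := 1 + |y|) (by positivity)]
        ring

theorem abs_eq_one_of_sign {σ : ℝ} (hσ : σ = 1 ∨ σ = -1) : |σ| = 1 := by
  rcases hσ with rfl | rfl <;> simp

theorem sampleSum_add_int (κ : ℝ) (m : ℕ) (φ : ℝ → ℝ) (s σ q t : ℝ) (n : ℤ) :
    sampleSum κ m φ s σ q (t + n) = sampleSum κ m φ s σ q t := by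
  unfold sampleSum
  rw [← (Equiv.addRight n).tsum_eq]
  congr 1
  ext j
  simp only [Equiv.coe_addRight, Int.cast_add, add_sub_add_right_eq_sub]

namespace IsFilterKernel

variable {s b : ℝ} {m : ℕ} {φ : ℝ → ℝ} {L : ℝ≥0} {R : ℝ} {σ : ℝ}

theorem exists_psi_bound (h : IsFilterKernel (s + b) m φ L R) :
    ∃ C, 0 ≤ C ∧ (∀ t, ‖psi (s + b) m φ t‖ ≤ C * (1 + |t|) ^ (-(s + b))) ∧
      ∀ᶠ δ in 𝓝[>] (0 : ℝ), ∀ t, ‖psiReg (s + b) φ δ t‖ ≤ C * (1 + |t|) ^ (-(s + b)) := by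
  obtain ⟨C, hC0, hC⟩ := h.psiReg_bound
  exact ⟨C, hC0, h.psi_bound_of_psiReg_bound hC, hC⟩

theorem norm_term_le {C : ℝ} (hC0 : 0 ≤ C) (hs : 1 ≤ s) (hb : 0 < b) (hσ : |σ| = 1) {w : ℝ → ℂ}
    (hw : ∀ y, ‖w y‖ ≤ C * (1 + |y|) ^ (-(s + b))) (q t : ℝ) (j : ℤ) :
    ‖w (t - j) * (sidePow (s - 1) σ (q - (t - j)) : ℂ)‖ ≤
      C * (1 + |q|) ^ (s - 1) * (1 + |t|) ^ (b + 1) * (1 + |(j : ℝ)|) ^ (-(b + 1)) := by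
  refine (norm_mul_sidePow_le hs hσ (hw (t - j))).trans ?_
  rw [mul_assoc (C * _)]
  gcongr
  have := one_add_abs_rpow_neg_le (r := b + 1) (by linarith) (j : ℝ) (t - j)
  have h2 := one_add_abs_rpow_neg_le (r := b + 1) (by linarith) (-(j : ℝ)) (t - j)
  rw [abs_neg, show (-(j : ℝ) - (t - j)) = -t by ring, abs_neg] at h2
  exact h2

theorem summable_term {C : ℝ} (hC0 : 0 ≤ C) (hs : 1 ≤ s) (hb : 0 < b) (hσ : |σ| = 1) {w : ℝ → ℂ}
    (hw : ∀ y, ‖w y‖ ≤ C * (1 + |y|) ^ (-(s + b))) (q t : ℝ) :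
    Summable fun j : ℤ => w (t - j) * (sidePow (s - 1) σ (q - (t - j)) : ℂ) :=
  Summable.of_norm_bounded ((summable_one_add_abs_int_rpow (by linarith)).mul_left _)
    (norm_term_le hC0 hs hb hσ hw q t)

theorem summable_sampleSum (h : IsFilterKernel (s + b) m φ L R) (hs : 1 ≤ s) (hb : 0 < b)
    (hσ : |σ| = 1) (q t : ℝ) :
    Summable fun j : ℤ => psi (s + b) m φ (t - j) * (sidePow (s - 1) σ (q - (t - j)) : ℂ) := by
  obtain ⟨C, hC0, hC, -⟩ := h.exists_psi_bound
  exact summable_term hC0 hs hb hσ hC q t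

theorem sampleSum_bound (h : IsFilterKernel (s + b) m φ L R) (hs : 1 ≤ s) (hb : 0 < b)
    (hσ : |σ| = 1) :
    ∃ C, 0 ≤ C ∧ ∀ q t, ‖sampleSum (s + b) m φ s σ q t‖ ≤ C * (1 + |q|) ^ (s - 1) := by
  obtain ⟨C, hC0, hC, -⟩ := h.exists_psi_bound
  set S := ∑' j : ℤ, (1 + |(j : ℝ)|) ^ (-(b + 1)) with hS
  have hS0 : 0 ≤ S := tsum_nonneg fun j => by positivity
  refine ⟨C * 2 ^ (b + 1) * S, by positivity, fun q t => ?_⟩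
  -- Periodicity reduces to t in [0, 1), which makes the bound uniform in t.
  have ht : sampleSum (s + b) m φ s σ q t = sampleSum (s + b) m φ s σ q (Int.fract t) := by
    have := sampleSum_add_int (s + b) m φ s σ q (Int.fract t) ⌊t⌋
    rw [Int.fract_add_floor] at this
    exact this
  rw [ht]
  have hsum := (summable_one_add_abs_int_rpow (r := b + 1) (by linarith)).mul_left
    (C * (1 + |q|) ^ (s - 1) * (1 + |Int.fract t|) ^ (b + 1))
  refine (tsum_of_norm_bounded hsum.hasSum (norm_term_le hC0 hs hb hσ hC q _)).trans ?_
  rw [tsum_mul_left]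
  have h1 : (1 + |Int.fract t|) ^ (b + 1) ≤ 2 ^ (b + 1) := by
    apply Real.rpow_le_rpow (by positivity) _ (by linarith)
    rw [Int.abs_fract]
    linarith [Int.fract_lt_one t]
  calc _ ≤ C * (1 + |q|) ^ (s - 1) * 2 ^ (b + 1) * S := by gcongr
    _ = _ := by ring

theorem continuous_sampleSum (h : IsFilterKernel (s + b) m φ L R) (hs : 1 ≤ s) (hb : 0 < b)
    (hσ : |σ| = 1) :
    Continuous fun p : ℝ × ℝ => sampleSum (s + b) m φ s σ p.1 p.2 := by
  obtain ⟨C, hC0, hC, -⟩ := h.exists_psi_bound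
  rw [continuous_iff_continuousAt]
  rintro ⟨q, t⟩
  have hsum := (summable_one_add_abs_int_rpow (r := b + 1) (by linarith)).mul_left
    (C * (2 + |q|) ^ (s - 1) * (2 + |t|) ^ (b + 1))
  refine tendsto_tsum_of_dominated_convergence hsum (fun j => ?_) ?_
  · have h1 := h.continuous_psi
    have h2 := continuous_sidePow (e := s - 1) (by linarith) σ
    have : Continuous fun p : ℝ × ℝ => psi (s + b) m φ (p.2 - j) *
        (sidePow (s - 1) σ (p.1 - (p.2 - j)) : ℂ) := by fun_prop
    exact this.tendsto (q, t)
  · have e1 : ∀ᶠ p : ℝ × ℝ in 𝓝 (q, t), |p.1| < 1 + |q| :=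
      (continuous_fst.abs.tendsto (q, t)).eventually_lt_const (by simp)
    have e2 : ∀ᶠ p : ℝ × ℝ in 𝓝 (q, t), |p.2| < 1 + |t| :=
      (continuous_snd.abs.tendsto (q, t)).eventually_lt_const (by simp)
    filter_upwards [e1, e2] with p hp1 hp2 j
    refine (norm_term_le hC0 hs hb hσ hC p.1 p.2 j).trans ?_
    have h1 : (1 + |p.1|) ^ (s - 1) ≤ (2 + |q|) ^ (s - 1) :=
      Real.rpow_le_rpow (by positivity) (by linarith) (by linarith)
    have h2 : (1 + |p.2|) ^ (b + 1) ≤ (2 + |t|) ^ (b + 1) :=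
      Real.rpow_le_rpow (by positivity) (by linarith) (by linarith)
    gcongr

theorem tendsto_sampleSum (h : IsFilterKernel (s + b) m φ L R) (hs : 1 ≤ s) (hb : 0 < b)
    (hσ : |σ| = 1) (q t : ℝ) :
    Tendsto (fun δ => ∑' j : ℤ, psiReg (s + b) φ δ (t - j) *
      (sidePow (s - 1) σ (q - (t - j)) : ℂ)) (𝓝[>] 0) (𝓝 (sampleSum (s + b) m φ s σ q t)) := by
  obtain ⟨C, hC0, -, hC⟩ := h.exists_psi_bound
  refine tendsto_tsum_of_dominated_convergence
    ((summable_one_add_abs_int_rpow (r := b + 1) (by linarith)).mul_left _) (fun j => ?_)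
    (hC.mono fun δ hδ => norm_term_le hC0 hs hb hσ hδ q t)
  exact (h.tendsto_psiReg _).mul_const _

theorem norm_powKernel_mul_le (h : IsFilterKernel (s + b) m φ L R) {δ : ℝ} (hδ : 0 < δ) (y x : ℝ) :
    ‖powKernel (s + b) δ x * (φ (y - x) : ℂ)‖ ≤
      (1 + 1 / δ) ^ (s + b) * (1 + R) ^ (s + b) * (1 + |y|) ^ (-(s + b)) * |φ (y - x)| := by
  rw [norm_mul, Complex.norm_real, Real.norm_eq_abs]
  by_cases hx : R ≤ |y - x|
  · rw [h.eq_zero _ hx]; simp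
  · have hκ := h.exponent_nonneg
    have hR := h.one_le_radius
    gcongr
    refine (norm_powKernel_le hκ hδ x).trans ?_
    rw [mul_assoc]
    gcongr
    refine (one_add_abs_rpow_neg_le hκ y x).trans ?_
    gcongr
    exact (not_le.1 hx).le

/-- Filtering the samples is the same as filtering the interpolant of the data. In this form the sum
can be compared with the filter applied to the exact one-sided power, the difference being the
filtered interpolation error. -/
theorem tsum_psiReg_eq_integral (h : IsFilterKernel (s + b) m φ L R) (hs : 1 ≤ s) (hb : 0 < b)
    (hσ : |σ| = 1) {δ : ℝ} (hδ : 0 < δ) (q t : ℝ) :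
    ∑' j : ℤ, psiReg (s + b) φ δ (t - j) * (sidePow (s - 1) σ (q - (t - j)) : ℂ) =
      ∫ x, powKernel (s + b) δ x * ∑' j : ℤ, (φ (t - j - x) : ℂ) *
        (sidePow (s - 1) σ (q - (t - j)) : ℂ) := by
  have hκ := h.exponent_nonneg
  have hR := h.one_le_radius
  set F : ℤ → ℝ → ℂ := fun j x => powKernel (s + b) δ x * (φ (t - j - x) : ℂ) *
    (sidePow (s - 1) σ (q - (t - j)) : ℂ) with hF
  set N : ℝ := ∫ x, |φ x| with hN
  have hFi : ∀ j, Integrable (F j) := fun j => (h.integrable_psiReg hδ _).mul_const _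
  have hsum : Summable fun j : ℤ => ∫ x, ‖F j x‖ := by
    refine Summable.of_nonneg_of_le (fun j => integral_nonneg fun x => norm_nonneg _)
      (fun j => ?_) ((summable_one_add_abs_int_rpow (r := b + 1) (by linarith)).mul_left
      ((1 + 1 / δ) ^ (s + b) * (1 + R) ^ (s + b) * N * (1 + |q|) ^ (s - 1) * (1 + |t|) ^ (b + 1)))
    have h1 : ∫ x, ‖F j x‖ ≤ ∫ x, (1 + 1 / δ) ^ (s + b) * (1 + R) ^ (s + b) *
        (1 + |t - j|) ^ (-(s + b)) * |φ (t - j - x)| * sidePow (s - 1) σ (q - (t - j)) := by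
      refine integral_mono (hFi j).norm
        ((((h.integrable.comp_sub_left (t - j)).abs).const_mul _).mul_const _) fun x => ?_
      simp only [hF]
      rw [norm_mul, Complex.norm_real, Real.norm_of_nonneg (sidePow_nonneg _ _ _)]
      gcongr
      · exact sidePow_nonneg _ _ _
      · exact h.norm_powKernel_mul_le hδ _ _
    rw [integral_mul_const, integral_const_mul,
      integral_sub_left_eq_self (fun x => |φ x|) volume (t - j)] at h1
    refine h1.trans ?_
    have h2 := norm_term_le (s := s) (b := b) (C := (1 + 1 / δ) ^ (s + b) * (1 + R) ^ (s + b) * N)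
      (by
        have : 0 ≤ N := integral_nonneg fun x => by positivity
        positivity) hs hb hσ
      (w := fun y => (((1 + 1 / δ) ^ (s + b) * (1 + R) ^ (s + b) * N * (1 + |y|) ^ (-(s + b)) : ℝ) : ℂ))
      (fun y => by
        rw [Complex.norm_real, Real.norm_of_nonneg]
        have : 0 ≤ N := integral_nonneg fun x => by positivity
        positivity) q t j
    refine le_trans ?_ h2
    rw [norm_mul, Complex.norm_real, Complex.norm_real,
      Real.norm_of_nonneg (sidePow_nonneg _ _ _), ← hN]
    refine mul_le_mul_of_nonneg_right ?_ (sidePow_nonneg _ _ _)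
    refine le_trans (le_of_eq ?_) (le_abs_self _)
    ring
  have hsumF : ∀ x, ∑' j : ℤ, F j x = powKernel (s + b) δ x * ∑' j : ℤ, (φ (t - j - x) : ℂ) *
        (sidePow (s - 1) σ (q - (t - j)) : ℂ) := by
    intro x
    rw [← tsum_mul_left]
    congr 1; ext j
    simp only [hF]; ring
  have key := hasSum_integral_of_summable_integral_norm hFi hsum
  simp only [hsumF] at key
  rw [← key.tsum_eq]
  congr 1; ext j
  simp only [hF]
  rw [integral_mul_const, psiReg]

end IsFilterKernel

/-- `∫ φ(p) (δ + i(q - p))^{-b} dp`. -/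
noncomputable def smoothedPow (b : ℝ) (φ : ℝ → ℝ) (δ q : ℝ) : ℂ :=
  ∫ p : ℝ, (φ p : ℂ) * powKernel b δ (q - p)

/-- `Γ(s)Γ(b)/Γ(s + b) e^{iσπs/2}`. -/
noncomputable def convConst (s b σ : ℝ) : ℂ :=
  (Real.Gamma s * Real.Gamma b / Real.Gamma (s + b) : ℝ) *
    Complex.exp (Complex.I * Real.pi / 2 * (σ * s))

theorem convConst_ne_zero {s b : ℝ} (hs : 0 < s) (hb : 0 < b) (σ : ℝ) : convConst s b σ ≠ 0 := by
  unfold convConst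
  refine mul_ne_zero ?_ (Complex.exp_ne_zero _)
  have := Real.Gamma_pos_of_pos hs
  have := Real.Gamma_pos_of_pos hb
  have := Real.Gamma_pos_of_pos (add_pos hs hb)
  exact_mod_cast (by positivity : Real.Gamma s * Real.Gamma b / Real.Gamma (s + b) ≠ 0)

namespace IsFilterKernel

variable {s b : ℝ} {m : ℕ} {φ : ℝ → ℝ} {L : ℝ≥0} {R : ℝ} {σ : ℝ}

theorem integrable_psi_mul_sidePow (h : IsFilterKernel (s + b) m φ L R) (hs : 1 ≤ s) (hb : 0 < b)
    (hσ : |σ| = 1) (q : ℝ) :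
    Integrable fun y : ℝ => psi (s + b) m φ y * (sidePow (s - 1) σ (q - y) : ℂ) := by
  obtain ⟨C, hC0, hC, -⟩ := h.exists_psi_bound
  have h1 := h.continuous_psi
  have h2 := continuous_sidePow (e := s - 1) (by linarith) σ
  refine Integrable.mono' ((integrable_one_add_abs_rpow (r := b + 1) (by linarith)).const_mul
    (C * (1 + |q|) ^ (s - 1))) (Continuous.aestronglyMeasurable (by fun_prop))
    (Eventually.of_forall fun y => norm_mul_sidePow_le hs hσ (hC y))

/-- Unfolding: the translates of the unit interval by the integers tile the line, so averaging over
the phase of the grid removes the discretization of the data. -/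
theorem integral_sampleSum (h : IsFilterKernel (s + b) m φ L R) (hs : 1 ≤ s) (hb : 0 < b)
    (hσ : |σ| = 1) (q : ℝ) :
    ∫ t in (0 : ℝ)..1, sampleSum (s + b) m φ s σ q t =
      ∫ y, psi (s + b) m φ y * (sidePow (s - 1) σ (q - y) : ℂ) := by
  obtain ⟨C, hC0, hC, -⟩ := h.exists_psi_bound
  have h1 := h.continuous_psi
  have h2 := continuous_sidePow (e := s - 1) (by linarith) σ
  set f : ℝ → ℂ := fun y => psi (s + b) m φ y * (sidePow (s - 1) σ (q - y) : ℂ) with hf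
  have hfc : Continuous f := by fun_prop
  have hfi : Integrable f := h.integrable_psi_mul_sidePow hs hb hσ q
  have hA := hfi.hasSum_intervalIntegral 0
  have hB : ∑' j : ℤ, ∫ t in (0 : ℝ)..1, f (t - j) = ∫ t in (0 : ℝ)..1, ∑' j : ℤ, f (t - j) := by
    have := intervalIntegral.tsum_intervalIntegral_eq_of_summable_norm (a := 0) (b := 1)
      (f := fun j : ℤ => (⟨fun t => f (t - j), by fun_prop⟩ : C(ℝ, ℂ))) ?_
    · simpa using this
    · refine Summable.of_nonneg_of_le (fun j => norm_nonneg _) (fun j => ?_)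
        ((summable_one_add_abs_int_rpow (r := b + 1) (by linarith)).mul_left
          (C * (1 + |q|) ^ (s - 1) * 2 ^ (b + 1)))
      rw [ContinuousMap.norm_le _ (by positivity)]
      rintro ⟨t, ht⟩
      have ht' : t ∈ Icc (0 : ℝ) 1 := by simpa using ht
      simp only [ContinuousMap.restrict_apply, ContinuousMap.coe_mk, hf]
      refine (norm_term_le hC0 hs hb hσ hC q t j).trans ?_
      gcongr
      rw [abs_of_nonneg ht'.1]
      linarith [ht'.2]
  unfold sampleSum
  rw [← hB, ← hA.tsum_eq, ← (Equiv.neg ℤ).tsum_eq]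
  congr 1
  ext j
  rw [intervalIntegral.integral_comp_sub_right (fun t => f t)]
  simp only [Equiv.neg_apply, Int.cast_neg, zero_add, sub_neg_eq_add]
  rw [add_comm]

/-- Associativity of convolution: the kernel is first convolved with the one-sided power, which is a
Beta integral, and φ is applied last. -/
theorem integral_psiReg_mul_sidePow (h : IsFilterKernel (s + b) m φ L R) (hs : 1 < s) (hb : 0 < b)
    (hσ : σ = 1 ∨ σ = -1) {δ : ℝ} (hδ : 0 < δ) (q : ℝ) :
    ∫ y, psiReg (s + b) φ δ y * (sidePow (s - 1) σ (q - y) : ℂ) =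
      convConst s b σ * smoothedPow b φ δ q := by
  have hσ' := abs_eq_one_of_sign hσ
  have hκ := h.exponent_nonneg
  have hR := h.one_le_radius
  have hkc := continuous_powKernel (s + b) hδ
  have hAc := continuous_sidePow (e := s - 1) (by linarith) σ
  have hφc := h.continuous
  set F : ℝ → ℝ → ℂ := fun y p => powKernel (s + b) δ (y - p) * (φ p : ℂ) *
    (sidePow (s - 1) σ (q - y) : ℂ) with hF
  have hl : ∀ y, psiReg (s + b) φ δ y * (sidePow (s - 1) σ (q - y) : ℂ) = ∫ p, F y p := by
    intro y
    rw [integral_mul_const, psiReg, ← integral_sub_left_eq_self _ volume y]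
    simp
  have hr : ∀ p, ∫ y, F y p = convConst s b σ * ((φ p : ℂ) * powKernel b δ (q - p)) := by
    intro p
    have := integral_powKernel_mul_sidePow hs hb hδ hσ (q - p)
    rw [← integral_sub_right_eq_self _ p] at this
    unfold convConst
    rw [mul_left_comm, ← this, ← integral_const_mul]
    congr 1; ext y
    simp only [hF]
    rw [show q - p - (y - p) = q - y by ring]
    ring
  have hint : Integrable (Function.uncurry F) (volume.prod volume) := by
    have hg : Integrable fun z : ℝ × ℝ => ((1 + 1 / δ) ^ (s + b) * (1 + R) ^ (s + b) *
        (1 + |q|) ^ (s - 1) * (1 + |z.1|) ^ (-(b + 1))) * |φ z.2| :=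
      ((integrable_one_add_abs_rpow (r := b + 1) (by linarith)).const_mul _).mul_prod
        h.integrable.abs
    refine hg.mono' (Continuous.aestronglyMeasurable (by
      simp only [hF, Function.uncurry_def]; fun_prop)) (Eventually.of_forall fun z => ?_)
    have h1 := h.norm_powKernel_mul_le hδ z.1 (z.1 - z.2)
    rw [sub_sub_cancel] at h1
    have h2 := norm_mul_sidePow_le (C := (1 + 1 / δ) ^ (s + b) * (1 + R) ^ (s + b) * |φ z.2|)
      (b := b) (y := z.1) (q := q) hs.le hσ' (h1.trans (le_of_eq (by ring)))
    refine h2.trans (le_of_eq (by ring))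
  simp only [hl]
  rw [integral_integral_swap hint]
  simp only [hr]
  rw [integral_const_mul, smoothedPow]

theorem tendsto_smoothedPow (h : IsFilterKernel (s + b) m φ L R) (hs : 1 < s) (hb : 0 < b)
    (hσ : σ = 1 ∨ σ = -1) (q : ℝ) :
    Tendsto (fun δ => convConst s b σ * smoothedPow b φ δ q) (𝓝[>] 0)
      (𝓝 (∫ t in (0 : ℝ)..1, sampleSum (s + b) m φ s σ q t)) := by
  have hσ' := abs_eq_one_of_sign hσ
  obtain ⟨C, hC0, -, hC⟩ := h.exists_psi_bound
  have hAc := continuous_sidePow (e := s - 1) (by linarith) σ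
  rw [h.integral_sampleSum hs.le hb hσ']
  have : Tendsto (fun δ => ∫ y, psiReg (s + b) φ δ y * (sidePow (s - 1) σ (q - y) : ℂ)) (𝓝[>] 0)
      (𝓝 (∫ y, psi (s + b) m φ y * (sidePow (s - 1) σ (q - y) : ℂ))) := by
    refine tendsto_integral_filter_of_dominated_convergence
      (fun y => C * (1 + |q|) ^ (s - 1) * (1 + |y|) ^ (-(b + 1))) ?_
      (hC.mono fun δ hδ => Eventually.of_forall fun y => norm_mul_sidePow_le hs.le hσ' (hδ y))
      ((integrable_one_add_abs_rpow (r := b + 1) (by linarith)).const_mul _)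
      (Eventually.of_forall fun y => (h.tendsto_psiReg y).mul_const _)
    filter_upwards [self_mem_nhdsWithin] with δ hδ
    have hkm : StronglyMeasurable fun y => psiReg (s + b) φ δ y := by
      apply StronglyMeasurable.integral_prod_right
      apply Measurable.stronglyMeasurable
      have := h.continuous.measurable
      fun_prop
    exact (hkm.mul (Continuous.stronglyMeasurable (by fun_prop))).aestronglyMeasurable
  refine this.congr' ?_
  filter_upwards [self_mem_nhdsWithin] with δ hδ
  exact h.integral_psiReg_mul_sidePow hs hb hσ hδ q

/-- For b ≥ 1 the kernel (δ + iq)^{-b} is not integrable near 0 uniformly in δ. The bound is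
therefore read off from the other side of `integral_psiReg_mul_sidePow`, where `psiReg` is already
controlled uniformly, and divided by the nonzero constant. -/
theorem smoothedPow_bound (h : IsFilterKernel (s + b) m φ L R) (hs : 1 < s) (hb : 0 < b) :
    ∃ C, 0 ≤ C ∧ ∀ᶠ δ in 𝓝[>] (0 : ℝ), ∀ q, ‖smoothedPow b φ δ q‖ ≤ C * (1 + |q|) ^ (s - 1) := by
  have hσ' : |(1 : ℝ)| = 1 := by simp
  obtain ⟨C, hC0, -, hC⟩ := h.exists_psi_bound
  set N : ℝ := ∫ y : ℝ, (1 + |y|) ^ (-(b + 1)) with hN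
  have hN0 : 0 ≤ N := integral_nonneg fun y => by positivity
  have hc : 0 < ‖convConst s b 1‖ := norm_pos_iff.2 (convConst_ne_zero (by linarith) hb 1)
  refine ⟨C * N / ‖convConst s b 1‖, by positivity, ?_⟩
  filter_upwards [hC, self_mem_nhdsWithin] with δ hδ hδ0 q
  have h1 := h.integral_psiReg_mul_sidePow hs hb (Or.inl rfl) hδ0 q
  have h2 : ‖∫ y, psiReg (s + b) φ δ y * (sidePow (s - 1) 1 (q - y) : ℂ)‖ ≤
      ∫ y, C * (1 + |q|) ^ (s - 1) * (1 + |y|) ^ (-(b + 1)) :=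
    norm_integral_le_of_norm_le ((integrable_one_add_abs_rpow (by linarith)).const_mul _)
      (Eventually.of_forall fun y => norm_mul_sidePow_le hs.le hσ' (hδ y))
  rw [h1, integral_const_mul, norm_mul] at h2
  rw [div_mul_eq_mul_div, le_div_iff₀ hc]
  calc _ = ‖convConst s b 1‖ * ‖smoothedPow b φ δ q‖ := by ring
    _ ≤ _ := h2
    _ = _ := by ring

end IsFilterKernel

/-! ### The interpolation error -/

theorem exists_polynomial_one_add_rpow (e : ℝ) (n : ℕ) :
    ∃ P : Polynomial ℝ, P.natDegree ≤ n ∧ ∃ C : ℝ, 0 ≤ C ∧ ∀ u : ℝ, |u| ≤ 1 / 2 →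
      |(1 + u) ^ e - P.eval u| ≤ C * |u| ^ (n + 1) := by
  -- Binomial series. The radius 3/4 lies between the range |u| ≤ 1/2 and the radius of convergence
  -- 1.
  obtain ⟨a, ha, C, hC, h⟩ := (Real.one_add_rpow_hasFPowerSeriesOnBall_zero
    (a := e)).uniform_geometric_approx' (r' := 3 / 4) (by
      rw [← ENNReal.coe_one, ENNReal.coe_lt_coe]
      rw [div_lt_one (by norm_num)]
      norm_num)
  refine ⟨∑ k ∈ Finset.range (n + 1), Polynomial.monomial k ((binomialSeries ℝ e).coeff k), ?_,
    C * (a / (3 / 4)) ^ (n + 1), by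
      have := ha.1
      positivity, fun u hu => ?_⟩
  · refine Polynomial.natDegree_sum_le_of_forall_le _ _ fun k hk => ?_
    exact (Polynomial.natDegree_monomial_le _).trans (Nat.lt_succ_iff.1 (Finset.mem_range.1 hk))
  · have := h u (by
      rw [mem_ball_zero_iff, Real.norm_eq_abs]
      refine hu.trans_lt ?_
      push_cast
      norm_num) (n + 1)
    rw [zero_add, Real.norm_eq_abs, Real.norm_eq_abs] at this
    have h2 : (binomialSeries ℝ e).partialSum (n + 1) u = (∑ k ∈ Finset.range (n + 1),
        Polynomial.monomial k ((binomialSeries ℝ e).coeff k)).eval u := by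
      rw [FormalMultilinearSeries.partialSum, Polynomial.eval_finsetSum]
      refine Finset.sum_congr rfl fun k _ => ?_
      rw [FormalMultilinearSeries.apply_eq_pow_smul_coeff, Polynomial.eval_monomial, smul_eq_mul,
        mul_comm]
    rw [h2] at this
    refine this.trans (le_of_eq ?_)
    push_cast
    rw [mul_assoc C, ← mul_pow]
    congr 2
    ring

/-- On the side where the power is nonzero, factor out |y₀|^{s-1} and use the binomial expansion in
u = (y - y₀) / y₀; on the other side the power vanishes on the whole interval and P = 0. By scaling,
C does not depend on y₀. -/
theorem exists_polynomial_sidePow {s : ℝ} (hs : 1 < s) {σ : ℝ} (hσ : σ = 1 ∨ σ = -1) (n : ℕ) :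
    ∃ C : ℝ, 0 ≤ C ∧ ∀ y₀ : ℝ, y₀ ≠ 0 → ∃ P : Polynomial ℝ, P.natDegree ≤ n ∧
      ∀ y : ℝ, |y - y₀| ≤ |y₀| / 2 →
        |sidePow (s - 1) σ y - P.eval y| ≤ C * |y₀| ^ (s - 2 - n) * |y - y₀| ^ (n + 1) := by
  obtain ⟨Q, hQ, C, hC, h⟩ := exists_polynomial_one_add_rpow (s - 1) n
  refine ⟨C, hC, fun y₀ hy₀ => ?_⟩
  have hy₀' : 0 < |y₀| := abs_pos.2 hy₀
  have hσ' := abs_eq_one_of_sign hσ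
  have hab : σ * y₀ = |y₀| ∨ σ * y₀ = -|y₀| := by
    rcases hσ with rfl | rfl <;> rcases abs_cases y₀ with h | h <;> simp [h.1]
  rcases hab with hp | hp
  · refine ⟨Polynomial.C (|y₀| ^ (s - 1)) *
      Q.comp (Polynomial.C (1 / y₀) * (Polynomial.X - Polynomial.C y₀)), ?_, fun y hy => ?_⟩
    · refine (Polynomial.natDegree_C_mul_le _ _).trans ?_
      refine Polynomial.natDegree_comp_le.trans ?_
      refine (Nat.mul_le_mul hQ (m₂ := 1) ?_).trans (by simp)
      exact (Polynomial.natDegree_C_mul_le _ _).trans (by simp)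
    · set u : ℝ := 1 / y₀ * (y - y₀) with hu
      have hu' : |u| ≤ 1 / 2 := by
        rw [hu, abs_mul, abs_div, abs_one, div_mul_eq_mul_div, one_mul, div_le_iff₀ hy₀']
        linarith
      have hyu : σ * y = |y₀| * (1 + u) := by
        rw [← hp, hu]; field_simp; ring
      have h1u : 0 ≤ 1 + u := by linarith [(abs_le.1 hu').1]
      have he : (Polynomial.C (|y₀| ^ (s - 1)) * Q.comp (Polynomial.C (1 / y₀) *
          (Polynomial.X - Polynomial.C y₀))).eval y = |y₀| ^ (s - 1) * Q.eval u := by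
        rw [Polynomial.eval_mul, Polynomial.eval_C, Polynomial.eval_comp, Polynomial.eval_mul,
          Polynomial.eval_sub, Polynomial.eval_C, Polynomial.eval_X, Polynomial.eval_C]
      rw [he, sidePow, hyu, max_eq_left (by positivity), Real.mul_rpow hy₀'.le h1u, ← mul_sub,
        abs_mul, abs_of_pos (Real.rpow_pos_of_pos hy₀' _)]
      calc _ ≤ |y₀| ^ (s - 1) * (C * |u| ^ (n + 1)) := by
            gcongr
            exact h u hu'
        _ = _ := by
            rw [hu, abs_mul, abs_div, abs_one, mul_pow, div_pow, one_pow,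
              show s - 2 - n = (s - 1) - ((n + 1 : ℕ) : ℝ) by push_cast; ring,
              Real.rpow_sub hy₀' (s - 1) ((n + 1 : ℕ) : ℝ), Real.rpow_natCast]
            field_simp
  · refine ⟨0, by simp, fun y hy => ?_⟩
    have : σ * y ≤ 0 := by
      have h1 : σ * (y - y₀) ≤ |y₀| / 2 :=
        (le_abs_self _).trans (by rw [abs_mul, hσ', one_mul]; exact hy)
      have : σ * y = σ * (y - y₀) + σ * y₀ := by ring
      linarith
    rw [sidePow, max_eq_right this, Real.zero_rpow (by linarith)]
    simp only [Polynomial.eval_zero, sub_zero, abs_zero]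
    positivity

/-- The integers at distance at most `R` from `τ`. -/
noncomputable def nearInts (τ R : ℝ) : Finset ℤ := Finset.Icc ⌈τ - R⌉ ⌊τ + R⌋

theorem mem_nearInts {τ R : ℝ} {j : ℤ} : j ∈ nearInts τ R ↔ |τ - j| ≤ R := by
  rw [nearInts, Finset.mem_Icc, Int.ceil_le, Int.le_floor, abs_le]
  constructor <;> rintro ⟨h1, h2⟩ <;> constructor <;> linarith

theorem card_nearInts_le {τ R : ℝ} (hR : 0 ≤ R) : ((nearInts τ R).card : ℝ) ≤ 2 * R + 1 := by
  rw [nearInts, Int.card_Icc]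
  have h1 := Int.floor_le (τ + R)
  have h2 := Int.le_ceil (τ - R)
  have h3 : (((⌊τ + R⌋ + 1 - ⌈τ - R⌉).toNat : ℤ) : ℝ) = ((max (⌊τ + R⌋ + 1 - ⌈τ - R⌉) 0 : ℤ) : ℝ) := by
    rw [Int.toNat_eq_max]
  rw [Int.cast_natCast] at h3
  rw [h3, Int.cast_max]
  apply max_le
  · push_cast; linarith
  · push_cast; linarith

/-- Exactness of the interpolation up to the degree `n`. -/
def IsExact (n : ℕ) (φ : ℝ → ℝ) : Prop :=
  ∀ k : ℕ, k ≤ n → ∀ t : ℝ, ∑' j : ℤ, (j : ℝ) ^ k * φ (t - j) = t ^ k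

namespace IsFilterKernel

variable {s b : ℝ} {m n : ℕ} {φ : ℝ → ℝ} {L : ℝ≥0} {R : ℝ} {σ κ : ℝ}

theorem eq_zero_of_notMem (h : IsFilterKernel κ m φ L R) {τ R' : ℝ} (hR' : R ≤ R') {j : ℤ}
    (hj : j ∉ nearInts τ R') : φ (τ - j) = 0 := by
  rw [mem_nearInts, not_le] at hj
  exact h.eq_zero _ (by linarith)

theorem tsum_eq_sum_nearInts (h : IsFilterKernel κ m φ L R) {τ R' : ℝ} (hR' : R ≤ R')
    (f : ℤ → ℝ) : ∑' j : ℤ, φ (τ - j) * f j = ∑ j ∈ nearInts τ R', φ (τ - j) * f j :=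
  tsum_eq_sum fun j hj => by rw [h.eq_zero_of_notMem hR' hj, zero_mul]

theorem sum_polynomial (h : IsFilterKernel κ m φ L R) (hex : IsExact n φ) (P : Polynomial ℝ)
    (hP : P.natDegree ≤ n) (τ : ℝ) {R' : ℝ} (hR' : R ≤ R') :
    ∑ j ∈ nearInts τ R', φ (τ - j) * P.eval (j : ℝ) = P.eval τ := by
  have h1 : ∀ k ≤ n, ∑ j ∈ nearInts τ R', φ (τ - j) * (j : ℝ) ^ k = τ ^ k := by
    intro k hk
    rw [← hex k hk τ, ← h.tsum_eq_sum_nearInts hR' fun j => (j : ℝ) ^ k]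
    simp only [mul_comm]
  have h2 : ∀ x, P.eval x = ∑ k ∈ Finset.range (n + 1), P.coeff k * x ^ k := fun x =>
    Polynomial.eval_eq_sum_range' (Nat.lt_succ_of_le hP) x
  simp only [h2, Finset.mul_sum]
  rw [Finset.sum_comm]
  refine Finset.sum_congr rfl fun k hk => ?_
  rw [← h1 k (Nat.lt_succ_iff.1 (Finset.mem_range.1 hk)), Finset.mul_sum]
  refine Finset.sum_congr rfl fun j _ => ?_
  ring

/-- The error is the interpolant of the remainder minus the remainder. -/
theorem interp_sub_eq (h : IsFilterKernel κ m φ L R) (hex : IsExact n φ) (A : ℝ → ℝ)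
    (P : Polynomial ℝ) (hP : P.natDegree ≤ n) (q t x : ℝ) {R' : ℝ} (hR' : R ≤ R') :
    ∑' j : ℤ, φ (t - j - x) * A (q - (t - j)) - A (q - x) =
      ∑ j ∈ nearInts (t - x) R',
        φ (t - j - x) * (A (q - (t - j)) - P.eval (q - (t - j))) - (A (q - x) - P.eval (q - x)) := by
  have h1 : ∀ j : ℤ, t - j - x = t - x - j := fun j => by ring
  simp only [h1]
  rw [h.tsum_eq_sum_nearInts hR' fun j => A (q - (t - j))]
  have h2 := h.sum_polynomial hex (P.comp (Polynomial.C (q - t) + Polynomial.X)) (by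
    refine Polynomial.natDegree_comp_le.trans ?_
    refine (Nat.mul_le_mul hP (m₂ := 1) ?_).trans (by simp)
    rw [Polynomial.natDegree_C_add]
    exact Polynomial.natDegree_X_le) (t - x) hR'
  simp only [Polynomial.eval_comp, Polynomial.eval_add, Polynomial.eval_C, Polynomial.eval_X] at h2
  have h3 : ∀ j : ℤ, q - t + (j : ℝ) = q - (t - j) := fun j => by ring
  simp only [h3] at h2
  rw [show q - t + (t - x) = q - x by ring] at h2
  simp only [mul_sub, Finset.sum_sub_distrib]
  rw [h2]
  ring

/-- By exactness the error only sees the remainder after a polynomial of degree n, chosen at q - x.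
That remainder is of order |q - x|^{s-2-n} at bounded distance, and n ≥ s + b - 1 makes the exponent
at most -(b + 1). For small |q - x| everything is bounded. -/
theorem interp_error_bound (h : IsFilterKernel (s + b) m φ L R) (hs : 1 < s) (hb : 0 < b)
    (hσ : σ = 1 ∨ σ = -1) (hex : IsExact n φ) (hn : s + b - 1 ≤ n) :
    ∃ C, 0 ≤ C ∧ ∀ q t x : ℝ,
      |∑' j : ℤ, φ (t - j - x) * sidePow (s - 1) σ (q - (t - j)) - sidePow (s - 1) σ (q - x)|
        ≤ C * (1 + |q - x|) ^ (-(b + 1)) := by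
  have hR := h.one_le_radius
  have hσ' := abs_eq_one_of_sign hσ
  obtain ⟨D, hD0, hD⟩ := h.exists_bound
  obtain ⟨K, hK0, hK⟩ := exists_polynomial_sidePow hs hσ n
  set C₁ : ℝ := (2 * R + 1) * (D * (K * R ^ (n + 1))) with hC₁
  set C₂ : ℝ := (2 * R + 1) * (D * (1 + 3 * R) ^ (s - 1)) + (1 + 3 * R) ^ (s - 1) with hC₂
  have hC₁0 : 0 ≤ C₁ := by positivity
  have hC₂0 : 0 ≤ C₂ := by positivity
  refine ⟨2 ^ (b + 1) * C₁ + (1 + 2 * R) ^ (b + 1) * C₂, by positivity, fun q t x => ?_⟩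
  have h1 : ∀ j : ℤ, t - j - x = t - x - j := fun j => by ring
  have hpos : 0 < 1 + |q - x| := by positivity
  rcases le_or_gt (2 * R) |q - x| with hq | hq
  · have hqx : 0 < |q - x| := by linarith
    obtain ⟨P, hP, hPr⟩ := hK (q - x) (abs_pos.1 hqx)
    rw [h.interp_sub_eq hex _ P hP q t x le_rfl]
    -- At the base point itself the remainder estimate contains the factor 0 ^ (n + 1).
    have h0 : sidePow (s - 1) σ (q - x) - P.eval (q - x) = 0 := by
      have := hPr (q - x) (by rw [sub_self, abs_zero]; positivity)
      simpa using this
    rw [h0, sub_zero]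
    have h2 : ∀ j ∈ nearInts (t - x) R, |φ (t - j - x) *
        (sidePow (s - 1) σ (q - (t - j)) - P.eval (q - (t - j)))| ≤
        D * (K * |q - x| ^ (s - 2 - n) * R ^ (n + 1)) := by
      intro j hj
      rw [mem_nearInts] at hj
      rw [abs_mul]
      have he : q - (t - j) - (q - x) = -(t - x - j) := by ring
      gcongr
      · exact hD _
      · refine (hPr _ ?_).trans ?_
        · rw [he, abs_neg]; linarith
        · rw [he, abs_neg]
          gcongr
    refine (Finset.abs_sum_le_sum_abs _ _).trans ((Finset.sum_le_sum h2).trans ?_)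
    rw [Finset.sum_const, nsmul_eq_mul]
    have h3 : |q - x| ^ (s - 2 - n) ≤ 2 ^ (b + 1) * (1 + |q - x|) ^ (-(b + 1)) := by
      calc |q - x| ^ (s - 2 - n) ≤ |q - x| ^ (-(b + 1)) :=
            Real.rpow_le_rpow_of_exponent_le (by linarith) (by linarith)
        _ ≤ _ := by
            rw [Real.rpow_neg hqx.le, Real.rpow_neg hpos.le, ← div_eq_mul_inv,
              le_div_iff₀ (by positivity), ← div_eq_inv_mul, div_le_iff₀ (by positivity),
              ← Real.mul_rpow (by norm_num) hqx.le]
            exact Real.rpow_le_rpow hpos.le (by linarith) (by linarith)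
    calc _ ≤ (2 * R + 1) * (D * (K * (2 ^ (b + 1) * (1 + |q - x|) ^ (-(b + 1))) * R ^ (n + 1))) := by
          gcongr
          exact card_nearInts_le (by linarith)
      _ = 2 ^ (b + 1) * C₁ * (1 + |q - x|) ^ (-(b + 1)) := by rw [hC₁]; ring
      _ ≤ _ := by
          gcongr
          have : 0 ≤ (1 + 2 * R) ^ (b + 1) * C₂ := by positivity
          linarith
  · have hA : ∀ y, |y| ≤ 3 * R → |sidePow (s - 1) σ y| ≤ (1 + 3 * R) ^ (s - 1) := by
      intro y hy
      have := sidePow_le (e := s - 1) (by linarith) hσ' y 0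
      rw [sub_zero] at this
      rw [abs_of_nonneg (sidePow_nonneg _ _ _)]
      refine this.trans ?_
      simp only [abs_zero, add_zero, Real.one_rpow, mul_one]
      exact Real.rpow_le_rpow (by positivity) (by linarith) (by linarith)
    have hb2 : |∑' j : ℤ, φ (t - j - x) * sidePow (s - 1) σ (q - (t - j)) -
        sidePow (s - 1) σ (q - x)| ≤ C₂ := by
      refine (abs_sub _ _).trans (add_le_add ?_ (hA _ (by linarith)))
      simp only [h1]
      rw [h.tsum_eq_sum_nearInts le_rfl fun j => sidePow (s - 1) σ (q - (t - j))]
      refine (Finset.abs_sum_le_sum_abs _ _).trans ?_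
      have h2 : ∀ j ∈ nearInts (t - x) R, |φ (t - x - j) * sidePow (s - 1) σ (q - (t - j))| ≤
          D * (1 + 3 * R) ^ (s - 1) := by
        intro j hj
        rw [mem_nearInts] at hj
        rw [abs_mul]
        gcongr
        · exact hD _
        · apply hA
          have : q - (t - j) = (q - x) - (t - x - j) := by ring
          rw [this]
          refine (abs_sub _ _).trans ?_
          linarith
      refine (Finset.sum_le_sum h2).trans ?_
      rw [Finset.sum_const, nsmul_eq_mul]
      gcongr
      exact card_nearInts_le (by linarith)
    refine hb2.trans ?_
    have h3 : 1 ≤ (1 + 2 * R) ^ (b + 1) * (1 + |q - x|) ^ (-(b + 1)) := by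
      rw [Real.rpow_neg hpos.le, ← div_eq_mul_inv, le_div_iff₀ (by positivity), one_mul]
      exact Real.rpow_le_rpow hpos.le (by linarith) (by linarith)
    calc C₂ ≤ C₂ * ((1 + 2 * R) ^ (b + 1) * (1 + |q - x|) ^ (-(b + 1))) :=
          le_mul_of_one_le_right hC₂0 h3
      _ = (1 + 2 * R) ^ (b + 1) * C₂ * (1 + |q - x|) ^ (-(b + 1)) := by ring
      _ ≤ _ := by
        gcongr
        have : 0 ≤ 2 ^ (b + 1) * C₁ := by positivity
        linarith

end IsFilterKernel

/-- The interpolation error of the one-sided power. -/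
noncomputable def interpError (φ : ℝ → ℝ) (s σ q t x : ℝ) : ℝ :=
  ∑' j : ℤ, φ (t - j - x) * sidePow (s - 1) σ (q - (t - j)) - sidePow (s - 1) σ (q - x)

namespace IsFilterKernel

variable {s b : ℝ} {m n : ℕ} {φ : ℝ → ℝ} {L : ℝ≥0} {R : ℝ} {σ κ : ℝ}

theorem measurable_interpError (h : IsFilterKernel κ m φ L R) (hs : 1 ≤ s) (q t : ℝ) :
    Measurable (interpError φ s σ q t) := by
  have h1 := h.continuous.measurable
  have h2 := (continuous_sidePow (e := s - 1) (by linarith) σ).measurable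
  unfold interpError
  refine Measurable.sub ?_ (by fun_prop)
  exact Measurable.tsum fun j => by fun_prop

/-- Near the singularity of the kernel smallness of the error is not enough; its Taylor coefficients
in x must be small as well. Subtracting one polynomial based at q, for all x, writes the error as a
combination of translates of φ with coefficients O(|q|^{s-2-n}), minus a remainder O(|q|^{s-2-n}
|x|^{n+1}), and m ≤ n. Then `near_bound` applies. -/
theorem near_error_bound (h : IsFilterKernel (s + b) m φ L R) (hs : 1 < s)
    (hσ : σ = 1 ∨ σ = -1) (hex : IsExact n φ) (hn : s + b - 1 ≤ n) :
    ∃ C, 0 ≤ C ∧ ∀ᶠ δ in 𝓝[>] (0 : ℝ), ∀ q t : ℝ, 2 * (R + 1) ≤ |q| →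
      ‖∫ x in (-1 : ℝ)..1, powKernel (s + b) δ x * (interpError φ s σ q t x : ℂ)‖
        ≤ C * |q| ^ (-(b + 1)) := by
  have hR := h.one_le_radius
  have hmn : m ≤ n := by
    have h1 := h.le_exponent
    have : (m : ℝ) ≤ n := by linarith
    exact_mod_cast this
  obtain ⟨K, hK0, hK⟩ := exists_polynomial_sidePow hs hσ n
  obtain ⟨D, hD0, hD⟩ := h.exists_taylorCoeff_bound
  obtain ⟨N, hN0, hN⟩ := near_bound h.le_exponent h.exponent_lt
  set W : ℝ := (2 * (R + 1) + 1) * (K * (R + 1) ^ (n + 1)) with hW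
  have hW0 : 0 ≤ W := by positivity
  refine ⟨N * (W * D + (W * L + K)), by positivity, ?_⟩
  filter_upwards [hN] with δ hδ q t hq
  have hq0 : 0 < |q| := by linarith
  obtain ⟨P, hP, hPr⟩ := hK q (abs_pos.1 hq0)
  -- The radius R + 1 instead of R makes the index set independent of x in [-1, 1]; the condition
  -- 2(R + 1) ≤ |q| keeps these samples within |q| / 2 of the base point.
  set J := nearInts t (R + 1) with hJ
  set e : ℝ := |q| ^ (s - 2 - n) with he
  have he0 : 0 < e := Real.rpow_pos_of_pos hq0 _
  set rem : ℤ → ℝ := fun j => sidePow (s - 1) σ (q - (t - j)) - P.eval (q - (t - j)) with hrem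
  have hremle : ∀ j ∈ J, |rem j| ≤ K * e * (R + 1) ^ (n + 1) := by
    intro j hj
    rw [hJ, mem_nearInts] at hj
    have h1 : |q - (t - j) - q| = |t - j| := by
      rw [← abs_neg]; congr 1; ring
    refine (hPr _ (by rw [h1]; linarith)).trans ?_
    rw [h1]
    gcongr
  have hremsum : ∑ j ∈ J, |rem j| ≤ W * e := by
    refine (Finset.sum_le_sum hremle).trans ?_
    rw [Finset.sum_const, nsmul_eq_mul]
    calc _ ≤ (2 * (R + 1) + 1) * (K * e * (R + 1) ^ (n + 1)) := by
          gcongr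
          exact card_nearInts_le (by linarith)
      _ = _ := by rw [hW]; ring
  set f : ℝ → ℝ := fun x => ∑ j ∈ J, φ (t - j - x) * rem j -
    (sidePow (s - 1) σ (q - x) - P.eval (q - x)) with hf
  have hfc : Continuous f := by
    have h1 := h.continuous
    have h2 := continuous_sidePow (e := s - 1) (by linarith) σ
    have h3 := P.continuous
    fun_prop
  have heq : ∀ x ∈ uIcc (-1 : ℝ) 1, powKernel (s + b) δ x * (interpError φ s σ q t x : ℂ) =
      powKernel (s + b) δ x * (f x : ℂ) := by
    intro x hx
    rw [uIcc_of_le (by norm_num)] at hx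
    have hx' : |x| ≤ 1 := abs_le.2 hx
    congr 2
    rw [interpError, h.interp_sub_eq hex _ P hP q t x le_rfl]
    simp only [hf]
    congr 1
    refine Finset.sum_subset (fun j hj => ?_) fun j _ hj => ?_
    · rw [mem_nearInts] at hj
      rw [hJ, mem_nearInts]
      have : t - j = (t - x - j) + x := by ring
      rw [this]
      exact (abs_add_le _ _).trans (add_le_add hj hx')
    · have := h.eq_zero_of_notMem le_rfl hj
      rw [show t - j - x = t - x - j by ring, this, zero_mul]
  rw [intervalIntegral.integral_congr heq]
  have hmain := hδ (fun x => (f x : ℂ)) (fun l => ∑ j ∈ J, (rem j : ℂ) * taylorCoeff φ (t - j) l)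
    (W * e * L + K * e) (by fun_prop) (by positivity) (fun x hx => by
      have h1 : (f x : ℂ) - ∑ l ∈ Finset.range (m + 1),
          (∑ j ∈ J, (rem j : ℂ) * taylorCoeff φ (t - j) l) * (x : ℂ) ^ l =
          ∑ j ∈ J, (rem j : ℂ) * ((φ (t - j - x) : ℂ) -
            ∑ l ∈ Finset.range (m + 1), taylorCoeff φ (t - j) l * (x : ℂ) ^ l) -
          ((sidePow (s - 1) σ (q - x) - P.eval (q - x) : ℝ) : ℂ) := by
        simp only [hf, Finset.sum_mul, mul_sub, Finset.sum_sub_distrib, Finset.mul_sum]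
        rw [Finset.sum_comm]
        push_cast
        simp only [mul_assoc]
        have : ∀ j ∈ J, (φ (t - j - x) : ℂ) * (rem j : ℂ) = (rem j : ℂ) * (φ (t - j - x) : ℂ) :=
          fun j _ => mul_comm _ _
        rw [Finset.sum_congr rfl this]
        ring
      rw [h1]
      refine (norm_sub_le _ _).trans ?_
      rw [add_mul]
      refine add_le_add ?_ ?_
      · refine (norm_sum_le_of_le J (f := fun j => (rem j : ℂ) * ((φ (t - j - x) : ℂ) -
          ∑ l ∈ Finset.range (m + 1), taylorCoeff φ (t - j) l * (x : ℂ) ^ l))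
          (n := fun j => |rem j| * (L * |x| ^ (m + 1))) fun j _ => ?_).trans ?_
        · rw [norm_mul, Complex.norm_real, Real.norm_eq_abs]
          gcongr
          exact h.norm_sub_taylor_le _ _
        · rw [← Finset.sum_mul]
          calc _ ≤ W * e * (L * |x| ^ (m + 1)) := by gcongr
            _ = _ := by ring
      · rw [Complex.norm_real, Real.norm_eq_abs]
        have h2 : |q - x - q| = |x| := by rw [← abs_neg]; congr 1; ring
        refine (hPr _ (by rw [h2]; linarith)).trans ?_
        rw [h2]
        gcongr ?_ * ?_
        exact pow_le_pow_of_le_one (abs_nonneg _) hx (by omega))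
  refine hmain.trans ?_
  have hc : ∑ l ∈ Finset.range (m + 1), ‖∑ j ∈ J, (rem j : ℂ) * taylorCoeff φ (t - j) l‖
      ≤ W * e * D := by
    calc _ ≤ ∑ l ∈ Finset.range (m + 1), ∑ j ∈ J, |rem j| * ‖taylorCoeff φ (t - j) l‖ := by
          refine Finset.sum_le_sum fun l _ => norm_sum_le_of_le _ fun j _ => ?_
          rw [norm_mul, Complex.norm_real, Real.norm_eq_abs]
      _ = ∑ j ∈ J, |rem j| * ∑ l ∈ Finset.range (m + 1), ‖taylorCoeff φ (t - j) l‖ := by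
          rw [Finset.sum_comm]
          simp only [Finset.mul_sum]
      _ ≤ ∑ j ∈ J, |rem j| * D := by
          refine Finset.sum_le_sum fun j _ => ?_
          gcongr
          exact hD _
      _ ≤ _ := by
          rw [← Finset.sum_mul]
          gcongr
  have hee : e ≤ |q| ^ (-(b + 1)) :=
    Real.rpow_le_rpow_of_exponent_le (by linarith) (by linarith)
  calc _ ≤ N * (W * e * D + (W * e * L + K * e)) := by gcongr
    _ = N * (W * D + (W * L + K)) * e := by ring
    _ ≤ _ := by gcongr

/-- For δ > 0 the filtered interpolant splits into the filtered one-sided power, given exactly by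
the Beta integral, and the filtered interpolation error, estimated separately on |x| ≤ 1 and outside
with bounds uniform in δ. -/
theorem sampleSum_decay (h : IsFilterKernel (s + b) m φ L R) (hs : 1 < s) (hb : 0 < b)
    (hσ : σ = 1 ∨ σ = -1) (hex : IsExact n φ) (hn : s + b - 1 ≤ n) :
    ∃ C, 0 ≤ C ∧ ∀ q t : ℝ, 2 * (R + 1) ≤ |q| →
      ‖sampleSum (s + b) m φ s σ q t - convConst s b σ * powKernel b 0 q‖
        ≤ C * |q| ^ (-(b + 1)) := by
  have hR := h.one_le_radius
  have hσ' := abs_eq_one_of_sign hσ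
  have hκ := h.exponent_nonneg
  obtain ⟨C₁, hC₁0, hC₁⟩ := h.near_error_bound hs hσ hex hn
  obtain ⟨C₂, hC₂0, hC₂⟩ := h.interp_error_bound hs hb hσ hex hn
  have hi1 := integrableOn_abs_rpow_compl h.one_lt_exponent
  have hi2 := integrable_one_add_abs_rpow (r := b + 1) (by linarith)
  set I : ℝ := ∫ x in (Ioc (-1 : ℝ) 1)ᶜ, |x| ^ (-(s + b)) with hI
  set N : ℝ := ∫ x : ℝ, (1 + |x|) ^ (-(b + 1)) with hN
  have hI0 : 0 ≤ I := integral_nonneg fun x => by positivity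
  have hN0 : 0 ≤ N := integral_nonneg fun x => by positivity
  refine ⟨C₁ + C₂ * (2 ^ (b + 1) * (I + N)), by positivity, fun q t hq => ?_⟩
  have hq0 : 0 < |q| := by linarith
  set E := interpError φ s σ q t with hE
  have hEm : Measurable E := h.measurable_interpError hs.le q t
  have hEb : ∀ x, ‖(E x : ℂ)‖ ≤ C₂ * (1 + |q - x|) ^ (-(b + 1)) := fun x => by
    rw [Complex.norm_real]; exact hC₂ q t x
  have hi3 : Integrable fun x : ℝ => (1 + |q - x|) ^ (-(b + 1)) := hi2.comp_sub_left q
  have hlim1 := h.tendsto_sampleSum hs.le hb hσ' q t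
  have hlim2 : Tendsto (fun δ => convConst s b σ * powKernel b δ q) (𝓝[>] 0)
      (𝓝 (convConst s b σ * powKernel b 0 q)) :=
    (tendsto_powKernel b (abs_pos.1 hq0)).const_mul _
  refine le_of_tendsto (hlim1.sub hlim2).norm ?_
  filter_upwards [hC₁, self_mem_nhdsWithin] with δ hδ hδ0
  have hδ0' : (0 : ℝ) < δ := hδ0
  have hkm := (measurable_powKernel (s + b) δ)
  have hEi : Integrable fun x => powKernel (s + b) δ x * (E x : ℂ) := by
    refine (hi3.const_mul ((1 + 1 / δ) ^ (s + b) * C₂)).mono'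
      (Measurable.aestronglyMeasurable (by fun_prop)) (Eventually.of_forall fun x => ?_)
    rw [norm_mul, mul_assoc]
    refine mul_le_mul ?_ (hEb x) (norm_nonneg _) (by positivity)
    refine (norm_powKernel_le hκ hδ0' x).trans ?_
    refine mul_le_of_le_one_right (by positivity) ?_
    exact Real.rpow_le_one_of_one_le_of_nonpos (by linarith [abs_nonneg x]) (by linarith)
  have hAi := integrable_powKernel_mul_sidePow hs.le hb hδ0' hσ' q
  rw [h.tsum_psiReg_eq_integral hs.le hb hσ' hδ0' q t]
  have hsplit : ∀ x, powKernel (s + b) δ x * ∑' j : ℤ, (φ (t - j - x) : ℂ) *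
      (sidePow (s - 1) σ (q - (t - j)) : ℂ) = powKernel (s + b) δ x *
        (sidePow (s - 1) σ (q - x) : ℂ) + powKernel (s + b) δ x * (E x : ℂ) := by
    intro x
    rw [hE, interpError, ← mul_add]
    congr 1
    push_cast [Complex.ofReal_tsum]
    ring
  simp only [hsplit]
  rw [integral_add hAi hEi, integral_powKernel_mul_sidePow hs hb hδ0' hσ q]
  unfold convConst
  rw [add_sub_cancel_left, ← integral_add_compl measurableSet_Ioc (s := Ioc (-1 : ℝ) 1) hEi,
    ← intervalIntegral.integral_of_le (by norm_num), add_mul]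
  refine (norm_add_le _ _).trans (add_le_add (hδ q t hq) ?_)
  have hq2 : 0 < |q| / 2 := by linarith
  have hq2' : 1 ≤ |q| / 2 := by linarith
  set g : ℝ := (|q| / 2) ^ (-(b + 1)) with hg
  have hg0 : 0 < g := Real.rpow_pos_of_pos hq2 _
  have hfar : ‖∫ x in (Ioc (-1 : ℝ) 1)ᶜ, powKernel (s + b) δ x * (E x : ℂ)‖ ≤
      ∫ x in (Ioc (-1 : ℝ) 1)ᶜ,
        C₂ * (g * (|x| ^ (-(s + b)) + (1 + |q - x|) ^ (-(b + 1)))) := by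
    refine norm_integral_le_of_norm_le (((hi1.add hi3.integrableOn).const_mul g).const_mul C₂) ?_
    refine (ae_restrict_mem measurableSet_Ioc.compl).mono fun x hx => ?_
    have hx1 := one_le_abs_of_notMem_Ioc hx
    have hx0 : 0 < |x| := by linarith
    have hk : ‖powKernel (s + b) δ x‖ ≤ |x| ^ (-(s + b)) :=
      norm_powKernel_le_abs hκ δ (abs_pos.1 hx0)
    rw [norm_mul]
    have h1 : |x| ^ (-(s + b)) * (1 + |q - x|) ^ (-(b + 1)) ≤
        g * (|x| ^ (-(s + b)) + (1 + |q - x|) ^ (-(b + 1))) := by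
      have hp1 : 0 ≤ |x| ^ (-(s + b)) := by positivity
      have hp2 : 0 ≤ (1 + |q - x|) ^ (-(b + 1)) := by positivity
      -- One of |x| and |q - x| is at least |q| / 2; the corresponding factor supplies the decay in
      -- q and the other one stays integrable.
      rcases le_or_gt (|q| / 2) |q - x| with hc | hc
      · have : (1 + |q - x|) ^ (-(b + 1)) ≤ g :=
          Real.rpow_le_rpow_of_nonpos hq2 (by linarith) (by linarith)
        nlinarith
      · have hxq : |q| / 2 ≤ |x| := by
          have := abs_sub_abs_le_abs_sub q x
          linarith
        have : |x| ^ (-(s + b)) ≤ g :=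
          calc |x| ^ (-(s + b)) ≤ |x| ^ (-(b + 1)) :=
                Real.rpow_le_rpow_of_exponent_le hx1 (by linarith)
            _ ≤ g := Real.rpow_le_rpow_of_nonpos hq2 hxq (by linarith)
        nlinarith
    calc _ ≤ |x| ^ (-(s + b)) * (C₂ * (1 + |q - x|) ^ (-(b + 1))) := by
          gcongr
          exact hEb x
      _ = C₂ * (|x| ^ (-(s + b)) * (1 + |q - x|) ^ (-(b + 1))) := by ring
      _ ≤ _ := by gcongr
  refine hfar.trans ?_
  rw [integral_const_mul, integral_const_mul, integral_add hi1 hi3.integrableOn]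
  have h4 : ∫ x in (Ioc (-1 : ℝ) 1)ᶜ, (1 + |q - x|) ^ (-(b + 1)) ≤ N := by
    refine (setIntegral_le_integral hi3 (Eventually.of_forall fun x => by positivity)).trans ?_
    rw [integral_sub_left_eq_self (fun x : ℝ => (1 + |x|) ^ (-(b + 1))) volume q]
  have h5 : g = 2 ^ (b + 1) * |q| ^ (-(b + 1)) := by
    rw [hg, Real.div_rpow hq0.le (by norm_num), Real.rpow_neg (by norm_num : (0 : ℝ) ≤ 2)]
    field_simp
  calc _ ≤ C₂ * (g * (I + N)) := by gcongr
    _ = _ := by rw [h5]; ring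

end IsFilterKernel

/-! ### Integrating out the quadratic phase -/

theorem conj_powKernel (κ : ℝ) {δ x : ℝ} (hδ : 0 < δ ∨ x ≠ 0) :
    starRingEnd ℂ (powKernel κ δ x) = powKernel κ δ (-x) := by
  unfold powKernel
  have h := Complex.slitPlane_arg_ne_pi (z := (δ : ℂ) + Complex.I * x)
    (hδ.imp (fun h => by simpa using h) fun h => by simpa using h)
  have h2 := Complex.conj_cpow _ (-(κ : ℂ)) h
  rw [map_neg, Complex.conj_ofReal] at h2
  rw [← h2]
  congr 1
  simp

/-- `(δ + iq)^{-b} - e^{-iπb} (δ - iq)^{-b}`. -/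
noncomputable def jump (b δ q : ℝ) : ℂ :=
  powKernel b δ q - Complex.exp (-(Complex.I * Real.pi * b)) * powKernel b δ (-q)

theorem norm_exp_neg_I_mul_pi (b : ℝ) : ‖Complex.exp (-(Complex.I * Real.pi * b))‖ = 1 := by
  rw [Complex.norm_exp]; simp

theorem I_cpow_neg (b : ℝ) :
    Complex.I ^ (-(b : ℂ)) = Complex.exp (-(Complex.I * Real.pi * b / 2)) := by
  rw [Complex.cpow_def_of_ne_zero Complex.I_ne_zero, Complex.log_I]
  congr 1; ring

theorem neg_I_cpow_neg (b : ℝ) :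
    (-Complex.I) ^ (-(b : ℂ)) = Complex.exp (Complex.I * Real.pi * b / 2) := by
  rw [Complex.cpow_def_of_ne_zero (neg_ne_zero.2 Complex.I_ne_zero), Complex.log_neg_I]
  congr 1; ring

theorem exp_mul_neg_I_cpow_neg (b : ℝ) :
    Complex.exp (-(Complex.I * Real.pi * b)) * (-Complex.I) ^ (-(b : ℂ)) =
      Complex.I ^ (-(b : ℂ)) := by
  rw [neg_I_cpow_neg, I_cpow_neg, ← Complex.exp_add]
  congr 1; ring

theorem powKernel_zero_of_pos (b : ℝ) {q : ℝ} (hq : 0 < q) :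
    powKernel b 0 q = ((q ^ (-b) : ℝ) : ℂ) * Complex.I ^ (-(b : ℂ)) := by
  rw [← ofReal_mul_cpow_neg hq Complex.I_ne_zero, powKernel]
  congr 1
  push_cast; ring

theorem powKernel_zero_neg_of_pos (b : ℝ) {q : ℝ} (hq : 0 < q) :
    powKernel b 0 (-q) = ((q ^ (-b) : ℝ) : ℂ) * (-Complex.I) ^ (-(b : ℂ)) := by
  rw [← ofReal_mul_cpow_neg hq (neg_ne_zero.2 Complex.I_ne_zero), powKernel]
  congr 1
  push_cast; ring

/-- The branches i^{-b} and e^{-iπb} (-i)^{-b} coincide. The assumption relating c₋ to c₊ is used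
only through this cancellation on the positive side. -/
theorem jump_zero {b q : ℝ} (hq : 0 < q) : jump b 0 q = 0 := by
  rw [jump, powKernel_zero_of_pos b hq, powKernel_zero_neg_of_pos b hq, mul_left_comm,
    exp_mul_neg_I_cpow_neg, sub_self]

theorem hasDerivAt_powKernel_reg (b δ : ℝ) {q : ℝ} (hq : q ≠ 0) :
    HasDerivAt (fun δ => powKernel b δ q) (-b * powKernel (b + 1) δ q) δ := by
  have hs : (δ : ℂ) + Complex.I * q ∈ Complex.slitPlane := by right; simpa using hq
  have h1 : HasDerivAt (fun δ : ℝ => (δ : ℂ) + Complex.I * q) 1 δ := by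
    simpa using (Complex.ofRealCLM.hasDerivAt (x := δ)).add_const (Complex.I * q)
  have h3 := ((hasDerivAt_id _).cpow_const (c := -(b : ℂ)) hs).comp δ h1
  refine HasDerivAt.congr_deriv (f := fun δ => powKernel b δ q) h3 ?_
  unfold powKernel
  push_cast
  rw [show (-((b : ℂ) + 1)) = -b - 1 by ring]
  simp only [id]
  ring

theorem hasDerivAt_powKernel (b : ℝ) {δ : ℝ} (hδ : 0 < δ) (q : ℝ) :
    HasDerivAt (powKernel b δ) (-(Complex.I * b) * powKernel (b + 1) δ q) q := by
  have hs := add_I_mul_mem_slitPlane hδ q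
  have h1 : HasDerivAt (fun x : ℝ => (δ : ℂ) + Complex.I * x) Complex.I q := by
    simpa using ((Complex.ofRealCLM.hasDerivAt (x := q)).const_mul Complex.I).const_add (δ : ℂ)
  have h3 := ((hasDerivAt_id _).cpow_const (c := -(b : ℂ)) hs).comp q h1
  refine HasDerivAt.congr_deriv (f := powKernel b δ) h3 ?_
  unfold powKernel
  push_cast
  rw [show (-((b : ℂ) + 1)) = -b - 1 by ring]
  simp only [id]
  ring

/-- The jump vanishes at δ = 0 and its derivative in δ is at most 2b q^{-(b+1)}, so the cancellation
gains one power of decay over each of its two terms. -/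
theorem norm_jump_le_of_pos {b δ q : ℝ} (hb : 0 < b) (hδ : 0 ≤ δ) (hq : 0 < q) :
    ‖jump b δ q‖ ≤ 2 * b * δ * q ^ (-(b + 1)) := by
  have hd : ∀ x ∈ Icc (0 : ℝ) δ, HasDerivWithinAt (fun δ => jump b δ q)
      (-b * powKernel (b + 1) x q - Complex.exp (-(Complex.I * Real.pi * b)) *
        (-b * powKernel (b + 1) x (-q))) (Icc 0 δ) x := fun x _ =>
    ((hasDerivAt_powKernel_reg b x hq.ne').sub
      ((hasDerivAt_powKernel_reg b x (neg_ne_zero.2 hq.ne')).const_mul _)).hasDerivWithinAt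
  have := Convex.norm_image_sub_le_of_norm_hasDerivWithin_le (C := 2 * b * q ^ (-(b + 1))) hd
    (fun x _ => by
      refine (norm_sub_le _ _).trans ?_
      rw [norm_mul, norm_mul, norm_mul, norm_exp_neg_I_mul_pi, one_mul, norm_neg,
        Complex.norm_real, Real.norm_of_nonneg hb.le]
      have h1 := norm_powKernel_le_abs (κ := b + 1) (by linarith) x hq.ne'
      have h2 := norm_powKernel_le_abs (κ := b + 1) (by linarith) x (neg_ne_zero.2 hq.ne')
      rw [abs_neg] at h2
      rw [abs_of_pos hq] at h1 h2
      nlinarith)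
    (convex_Icc 0 δ) (left_mem_Icc.2 hδ) (right_mem_Icc.2 hδ)
  rw [jump_zero hq, sub_zero, sub_zero, Real.norm_of_nonneg hδ] at this
  linarith

theorem norm_powKernel_le_rpow {κ : ℝ} (hκ : 0 ≤ κ) {δ : ℝ} (hδ : 0 < δ) (x : ℝ) :
    ‖powKernel κ δ x‖ ≤ δ ^ (-κ) := by
  rw [norm_powKernel]
  exact Real.rpow_le_rpow_of_nonpos hδ (le_norm_add_I_mul δ x) (by linarith)

theorem norm_jump_le {b δ : ℝ} (hb : 0 ≤ b) (hδ : 0 < δ) (q : ℝ) :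
    ‖jump b δ q‖ ≤ 2 * δ ^ (-b) := by
  refine (norm_sub_le _ _).trans ?_
  rw [norm_mul, norm_exp_neg_I_mul_pi, one_mul, two_mul]
  exact add_le_add (norm_powKernel_le_rpow hb hδ _) (norm_powKernel_le_rpow hb hδ _)

/-- From a bound on a bounded set and a decaying bound to the right of `Q`, a decaying bound on the
translates. -/
theorem le_one_add_rpow_of_bounds {v : ℝ → ℝ} {b Q A B S : ℝ} (hb : 0 ≤ b) (hA : 0 ≤ A)
    (hB : 0 ≤ B) (hQ : 0 ≤ Q) (hS : 0 ≤ S) (h1 : ∀ q, Q + 1 ≤ q → v q ≤ A * (q - Q) ^ (-(b + 1)))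
    (h2 : ∀ q, |q| ≤ Q + 1 + S → v q ≤ B) {h r : ℝ} (hh : |h| ≤ S) (hr : 0 ≤ r) :
    v (h + r) ≤ (A + B) * (2 + Q + S) ^ (b + 1) * (1 + r) ^ (-(b + 1)) := by
  have hr1 : 0 < 1 + r := by linarith
  have hh' := abs_le.1 hh
  rcases le_or_gt (Q + 1) (h + r) with hc | hc
  · have hpos : 0 < h + r - Q := by linarith
    have h3 : (h + r - Q) ^ (-(b + 1)) ≤ (2 + Q + S) ^ (b + 1) * (1 + r) ^ (-(b + 1)) := by
      rw [Real.rpow_neg hpos.le, Real.rpow_neg hr1.le, ← div_eq_mul_inv,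
        le_div_iff₀ (by positivity), ← div_eq_inv_mul, div_le_iff₀ (by positivity),
        ← Real.mul_rpow (by positivity) hpos.le]
      refine Real.rpow_le_rpow hr1.le ?_ (by linarith)
      nlinarith
    calc v (h + r) ≤ A * (h + r - Q) ^ (-(b + 1)) := h1 _ hc
      _ ≤ A * ((2 + Q + S) ^ (b + 1) * (1 + r) ^ (-(b + 1))) := by gcongr
      _ = A * (2 + Q + S) ^ (b + 1) * (1 + r) ^ (-(b + 1)) := by ring
      _ ≤ _ := by
        gcongr
        linarith
  · have h3 : 1 ≤ (2 + Q + S) ^ (b + 1) * (1 + r) ^ (-(b + 1)) := by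
      rw [Real.rpow_neg hr1.le, ← div_eq_mul_inv, le_div_iff₀ (by positivity), one_mul]
      exact Real.rpow_le_rpow hr1.le (by linarith) (by linarith)
    calc v (h + r) ≤ B := h2 _ (abs_le.2 ⟨by linarith, by linarith⟩)
      _ ≤ B * ((2 + Q + S) ^ (b + 1) * (1 + r) ^ (-(b + 1))) := le_mul_of_one_le_right hB h3
      _ = B * (2 + Q + S) ^ (b + 1) * (1 + r) ^ (-(b + 1)) := by ring
      _ ≤ _ := by
        gcongr
        linarith

theorem norm_jump_add_le {b δ : ℝ} (hb : 0 < b) (hδ : 0 < δ) {S h r : ℝ} (hS : 0 ≤ S)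
    (hh : |h| ≤ S) (hr : 0 ≤ r) :
    ‖jump b δ (h + r)‖ ≤ (2 * b * δ + 2 * δ ^ (-b)) * (2 + 0 + S) ^ (b + 1) *
      (1 + r) ^ (-(b + 1)) :=
  le_one_add_rpow_of_bounds (v := fun q => ‖jump b δ q‖) hb.le (by positivity) (by positivity)
    le_rfl hS (fun q hq => by
      rw [sub_zero]; exact norm_jump_le_of_pos hb hδ.le (by linarith))
    (fun q _ => norm_jump_le hb.le hδ q) hh hr

@[fun_prop]
theorem measurable_jump (b δ : ℝ) : Measurable (jump b δ) := by
  unfold jump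
  have := measurable_powKernel b δ
  fun_prop

theorem integrableOn_jump {b δ : ℝ} (hb : 0 < b) (hδ : 0 < δ) (h : ℝ) :
    IntegrableOn (fun r : ℝ => jump b δ (h + r) * ((r ^ (b - 1) : ℝ) : ℂ)) (Ioi 0) := by
  have hi := integrableOn_one_add_rpow_neg_mul_rpow hb one_pos
  refine (hi.const_mul ((2 * b * δ + 2 * δ ^ (-b)) * (2 + 0 + |h|) ^ (b + 1))).mono'
    (Measurable.aestronglyMeasurable (by fun_prop)) ?_
  refine (ae_restrict_mem measurableSet_Ioi).mono fun r hr => ?_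
  have hr' : (0 : ℝ) < r := hr
  rw [norm_mul, Complex.norm_real, Real.norm_of_nonneg (by positivity), ← mul_assoc]
  gcongr
  exact norm_jump_add_le hb hδ (abs_nonneg _) le_rfl hr'.le

/-- Differentiation raises the exponent to b + 1, so each term becomes a Beta integral with
remaining exponent 1. The sum 1/(δ + ih) + 1/(δ - ih) is a multiple of the Poisson kernel. -/
theorem integral_deriv_jump {b δ : ℝ} (hb : 0 < b) (hδ : 0 < δ) (h : ℝ) :
    ∫ r in Ioi (0 : ℝ), (-(Complex.I * b) * (powKernel (b + 1) δ (h + r) +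
      Complex.exp (-(Complex.I * Real.pi * b)) * powKernel (b + 1) δ (-(h + r)))) *
        ((r ^ (b - 1) : ℝ) : ℂ)
      = -(Complex.I * Complex.I ^ (-(b : ℂ))) * ((2 * δ / (δ ^ 2 + h ^ 2) : ℝ) : ℂ) := by
  have hz1 : 0 < ((δ : ℂ) + Complex.I * h).re := by simpa using hδ
  have hz2 : 0 < ((δ : ℂ) - Complex.I * h).re := by simpa using hδ
  have e1 := beta_integral hb one_pos hz1 (c := Complex.I) (by simp) (by simp)
  have e2 := beta_integral hb one_pos hz2 (c := -Complex.I) (by simp) (by simp)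
  have i1 := integrableOn_add_mul_cpow_mul_rpow hb one_pos hz1 (c := Complex.I) (by simp) (by simp)
  have i2 := integrableOn_add_mul_cpow_mul_rpow hb one_pos hz2 (c := -Complex.I) (by simp)
    (by simp)
  have hbC : (b : ℂ) ≠ 0 := by exact_mod_cast hb.ne'
  have hG : Real.Gamma b * Real.Gamma 1 / Real.Gamma (b + 1) = 1 / b := by
    rw [Real.Gamma_one, Real.Gamma_add_one hb.ne']
    have := (Real.Gamma_pos_of_pos hb).ne'
    field_simp
  rw [hG] at e1 e2
  have : ∀ r : ℝ, (-(Complex.I * b) * (powKernel (b + 1) δ (h + r) +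
      Complex.exp (-(Complex.I * Real.pi * b)) * powKernel (b + 1) δ (-(h + r)))) *
        ((r ^ (b - 1) : ℝ) : ℂ) = -(Complex.I * b) *
        ((((δ : ℂ) + Complex.I * h) + Complex.I * r) ^ (-((b + 1 : ℝ) : ℂ)) *
          ((r ^ (b - 1) : ℝ) : ℂ) +
        Complex.exp (-(Complex.I * Real.pi * b)) *
          ((((δ : ℂ) - Complex.I * h) + -Complex.I * r) ^ (-((b + 1 : ℝ) : ℂ)) *
          ((r ^ (b - 1) : ℝ) : ℂ))) := by
    intro r
    unfold powKernel
    rw [show (δ : ℂ) + Complex.I * ((h + r : ℝ) : ℂ) = δ + Complex.I * h + Complex.I * r by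
        push_cast; ring,
      show (δ : ℂ) + Complex.I * ((-(h + r) : ℝ) : ℂ) = δ - Complex.I * h + -Complex.I * r by
        push_cast; ring]
    ring
  simp only [this]
  rw [integral_const_mul, integral_add i1 (i2.const_mul _), integral_const_mul, e1, e2]
  have hn1 : (δ : ℂ) + Complex.I * h ≠ 0 := by
    intro h0; rw [h0] at hz1; simp at hz1
  have hn2 : (δ : ℂ) - Complex.I * h ≠ 0 := by
    intro h0; rw [h0] at hz2; simp at hz2
  have hn3 : (δ : ℂ) ^ 2 + (h : ℂ) ^ 2 ≠ 0 := by
    have : δ ^ 2 + h ^ 2 ≠ 0 := by positivity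
    exact_mod_cast this
  have h4 : ∀ A : ℂ, Complex.exp (-(Complex.I * Real.pi * b)) *
      (((1 / b : ℝ) : ℂ) * (-Complex.I) ^ (-(b : ℂ)) * A) =
      ((1 / b : ℝ) : ℂ) * Complex.I ^ (-(b : ℂ)) * A := by
    intro A
    rw [← exp_mul_neg_I_cpow_neg]; ring
  rw [h4, Complex.ofReal_one, Complex.cpow_neg_one, Complex.cpow_neg_one]
  have h5 : ((δ : ℂ) + Complex.I * h)⁻¹ + ((δ : ℂ) - Complex.I * h)⁻¹ =
      2 * δ / (δ ^ 2 + h ^ 2) := by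
    rw [inv_add_inv hn1 hn2]
    congr 1
    · ring
    · ring_nf
      simp
  push_cast
  rw [← mul_add, h5]
  field_simp

theorem tendsto_integral_jump_atTop {b δ : ℝ} (hb : 0 < b) (hδ : 0 < δ) :
    Tendsto (fun h => ∫ r in Ioi (0 : ℝ), jump b δ (h + r) * ((r ^ (b - 1) : ℝ) : ℂ)) atTop
      (𝓝 0) := by
  have hi := integrableOn_one_add_rpow_neg_mul_rpow hb one_pos
  have : (0 : ℂ) = ∫ r in Ioi (0 : ℝ), (0 : ℂ) := by simp
  rw [this]
  refine tendsto_integral_filter_of_dominated_convergence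
    (fun r => 2 * b * δ * ((1 + r) ^ (-(b + 1)) * r ^ (b - 1)))
    (Eventually.of_forall fun h => Measurable.aestronglyMeasurable (by fun_prop)) ?_
    (hi.const_mul _) ?_
  · filter_upwards [eventually_ge_atTop (1 : ℝ)] with h hh
    refine (ae_restrict_mem measurableSet_Ioi).mono fun r hr => ?_
    have hr' : (0 : ℝ) < r := hr
    rw [norm_mul, Complex.norm_real, Real.norm_of_nonneg (by positivity), ← mul_assoc]
    gcongr
    refine (norm_jump_le_of_pos hb hδ.le (by linarith)).trans ?_
    gcongr ?_ * ?_
    exact Real.rpow_le_rpow_of_nonpos (by linarith) (by linarith) (by linarith)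
  · refine (ae_restrict_mem measurableSet_Ioi).mono fun r hr => ?_
    have hr' : (0 : ℝ) < r := hr
    have h1 : Tendsto (fun h => jump b δ (h + r)) atTop (𝓝 0) := by
      have h2 : Tendsto (fun h : ℝ => 2 * b * δ * (h + r) ^ (-(b + 1))) atTop (𝓝 (2 * b * δ * 0)) :=
        ((tendsto_rpow_neg_atTop (by linarith)).comp
          (tendsto_atTop_add_const_right _ r tendsto_id)).const_mul _
      rw [mul_zero] at h2
      refine squeeze_zero_norm' ?_ h2
      filter_upwards [eventually_ge_atTop (1 : ℝ)] with h hh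
      exact norm_jump_le_of_pos hb hδ.le (by linarith)
    simpa using h1.mul_const ((r ^ (b - 1) : ℝ) : ℂ)

/-- The derivative in h is a multiple of the Poisson kernel, whose primitive is 2 arctan(h / δ); the
constant is fixed as h → +∞, where the integral tends to 0. As δ → 0 this is where the step function
of the limit arises. -/
theorem integral_jump {b δ : ℝ} (hb : 0 < b) (hδ : 0 < δ) (h : ℝ) :
    ∫ r in Ioi (0 : ℝ), jump b δ (h + r) * ((r ^ (b - 1) : ℝ) : ℂ)
      = Complex.I * Complex.I ^ (-(b : ℂ)) * ((Real.pi - 2 * Real.arctan (h / δ) : ℝ) : ℂ) := by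
  have hi := integrableOn_one_add_rpow_neg_mul_rpow hb one_pos
  set G : ℝ → ℂ := fun h => (∫ r in Ioi (0 : ℝ), jump b δ (h + r) * ((r ^ (b - 1) : ℝ) : ℂ)) +
    Complex.I * Complex.I ^ (-(b : ℂ)) * ((2 * Real.arctan (h / δ) : ℝ) : ℂ) with hG
  have hder : ∀ h, HasDerivAt G 0 h := by
    intro h
    have h1 := hasDerivAt_integral_of_dominated_loc_of_deriv_le
      (μ := volume.restrict (Ioi (0 : ℝ)))
      (F := fun (h r : ℝ) => jump b δ (h + r) * ((r ^ (b - 1) : ℝ) : ℂ))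
      (F' := fun (h r : ℝ) => (-(Complex.I * b) * (powKernel (b + 1) δ (h + r) +
        Complex.exp (-(Complex.I * Real.pi * b)) * powKernel (b + 1) δ (-(h + r)))) *
        ((r ^ (b - 1) : ℝ) : ℂ)) (x₀ := h) (s := Metric.ball h 1)
      (bound := fun r => (2 * b * ((1 + 1 / δ) ^ (b + 1) * (2 + |h|) ^ (b + 1))) *
        ((1 + r) ^ (-(b + 1)) * r ^ (b - 1)))
      (Metric.ball_mem_nhds h one_pos)
      (Eventually.of_forall fun h => Measurable.aestronglyMeasurable (by fun_prop))
      (integrableOn_jump hb hδ h) (Measurable.aestronglyMeasurable (by fun_prop))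
      ((ae_restrict_mem measurableSet_Ioi).mono fun r hr x hx => by
        have hr' : (0 : ℝ) < r := hr
        rw [norm_mul, Complex.norm_real, Real.norm_of_nonneg (r := r ^ (b - 1)) (by positivity),
          ← mul_assoc]
        gcongr
        rw [norm_mul, norm_neg, norm_mul, Complex.norm_I, one_mul, Complex.norm_real,
          Real.norm_of_nonneg hb.le]
        have hx' : |x| ≤ 1 + |h| := by
          rw [Metric.mem_ball, Real.dist_eq] at hx
          have := abs_sub_abs_le_abs_sub x h
          linarith
        have hk : (1 + |x + r|) ^ (-(b + 1)) ≤ (2 + |h|) ^ (b + 1) * (1 + r) ^ (-(b + 1)) := by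
          have := one_add_abs_rpow_neg_le (r := b + 1) (by linarith) r (x + r)
          rw [show r - (x + r) = -x by ring, abs_neg, abs_of_pos hr'] at this
          refine this.trans ?_
          gcongr ?_ * _
          exact Real.rpow_le_rpow (by positivity) (by linarith) (by linarith)
        have k1 := norm_powKernel_le (κ := b + 1) (by linarith) hδ (x + r)
        have k2 := norm_powKernel_le (κ := b + 1) (by linarith) hδ (-(x + r))
        rw [abs_neg] at k2
        have k3 : ‖powKernel (b + 1) δ (x + r) + Complex.exp (-(Complex.I * Real.pi * b)) *
            powKernel (b + 1) δ (-(x + r))‖ ≤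
            2 * ((1 + 1 / δ) ^ (b + 1) * ((2 + |h|) ^ (b + 1) * (1 + r) ^ (-(b + 1)))) := by
          refine (norm_add_le _ _).trans ?_
          rw [norm_mul, norm_exp_neg_I_mul_pi, one_mul, two_mul]
          refine add_le_add (k1.trans ?_) (k2.trans ?_) <;> gcongr
        calc _ ≤ b * (2 * ((1 + 1 / δ) ^ (b + 1) *
              ((2 + |h|) ^ (b + 1) * (1 + r) ^ (-(b + 1))))) := by gcongr
          _ = _ := by ring)
      (hi.const_mul _)
      ((ae_restrict_mem measurableSet_Ioi).mono fun r hr x hx => by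
        apply HasDerivAt.mul_const
        have d1 := (hasDerivAt_powKernel b hδ (x + r)).comp_add_const x r
        have d2 := HasDerivAt.scomp x (hasDerivAt_powKernel b hδ (-(x + r)))
          ((hasDerivAt_id x).add_const r).neg
        have d3 := d1.sub (d2.const_mul (Complex.exp (-(Complex.I * Real.pi * b))))
        refine HasDerivAt.congr_deriv (f := fun x => jump b δ (x + r)) d3 ?_
        simp only [neg_smul, one_smul]
        ring)
    have h2 : HasDerivAt (fun h : ℝ => 2 * Real.arctan (h / δ)) (2 * δ / (δ ^ 2 + h ^ 2)) h := by
      have := (((hasDerivAt_id h).div_const δ).arctan).const_mul 2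
      refine this.congr_deriv ?_
      simp only [id]
      field_simp
    have h3 := h1.2.add (h2.ofReal_comp.const_mul (Complex.I * Complex.I ^ (-(b : ℂ))))
    refine HasDerivAt.congr_deriv (f := G) h3 ?_
    rw [integral_deriv_jump hb hδ h]
    ring
  have hconst : ∀ x, G x = G h := fun x =>
    is_const_of_deriv_eq_zero (fun x => (hder x).differentiableAt) (fun x => (hder x).deriv) x h
  have hlim : Tendsto G atTop (𝓝 (0 + Complex.I * Complex.I ^ (-(b : ℂ)) *
      ((2 * (Real.pi / 2) : ℝ) : ℂ))) := by
    refine (tendsto_integral_jump_atTop hb hδ).add (Tendsto.const_mul _ ?_)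
    refine (Complex.continuous_ofReal.tendsto _).comp (Tendsto.const_mul _ ?_)
    exact (tendsto_nhds_of_tendsto_nhdsWithin Real.tendsto_arctan_atTop).comp
      (tendsto_id.atTop_div_const hδ)
  have hlim2 : Tendsto G atTop (𝓝 (G h)) := by
    exact tendsto_const_nhds.congr fun x => (hconst x).symm
  have := tendsto_nhds_unique hlim2 hlim
  simp only [hG] at this
  rw [eq_sub_of_add_eq this]
  push_cast
  ring

/-! ### The profile of one direction: decay, phase average and integral -/

/-- The normalized sum over the samples, at the scaled distance `q` from the singularity of the
data and the phase `t` of the grid. -/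
noncomputable def profile (κ : ℝ) (m : ℕ) (φ : ℝ → ℝ) (s : ℝ) (B₁ B₂ a₁ a₂ : ℂ) (q t : ℝ) : ℂ :=
  B₁ * (a₁ * sampleSum κ m φ s 1 q t + a₂ * sampleSum κ m φ s (-1) q t) +
  B₂ * (a₁ * starRingEnd ℂ (sampleSum κ m φ s 1 q t) +
    a₂ * starRingEnd ℂ (sampleSum κ m φ s (-1) q t))

/-- `B₁ (a₁ e^{iπs/2} + a₂ e^{-iπs/2})`. -/
noncomputable def upperCoeff (s : ℝ) (B₁ a₁ a₂ : ℂ) : ℂ :=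
  B₁ * (a₁ * Complex.exp (Complex.I * Real.pi / 2 * s) +
    a₂ * Complex.exp (-(Complex.I * Real.pi / 2 * s)))

/-- `B₂ (a₁ e^{-iπs/2} + a₂ e^{iπs/2})`. -/
noncomputable def lowerCoeff (s : ℝ) (B₂ a₁ a₂ : ℂ) : ℂ :=
  B₂ * (a₁ * Complex.exp (-(Complex.I * Real.pi / 2 * s)) +
    a₂ * Complex.exp (Complex.I * Real.pi / 2 * s))

/-- `Γ(s)Γ(b)/Γ(s + b)`. -/
noncomputable def betaConst (s b : ℝ) : ℝ := Real.Gamma s * Real.Gamma b / Real.Gamma (s + b)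

theorem conj_exp_I_mul (x : ℝ) : starRingEnd ℂ (Complex.exp (Complex.I * x)) =
    Complex.exp (-(Complex.I * x)) := by
  rw [← Complex.exp_conj]; simp

theorem convConst_one (s b : ℝ) :
    convConst s b 1 = betaConst s b * Complex.exp (Complex.I * Real.pi / 2 * s) := by
  simp [convConst, betaConst]

theorem convConst_neg_one (s b : ℝ) :
    convConst s b (-1) = betaConst s b * Complex.exp (-(Complex.I * Real.pi / 2 * s)) := by
  simp [convConst, betaConst]

theorem conj_convConst_one (s b : ℝ) :
    starRingEnd ℂ (convConst s b 1) =
      betaConst s b * Complex.exp (-(Complex.I * Real.pi / 2 * s)) := by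
  rw [convConst_one, map_mul, Complex.conj_ofReal,
    show Complex.I * Real.pi / 2 * s = Complex.I * ((Real.pi / 2 * s : ℝ) : ℂ) by push_cast; ring,
    conj_exp_I_mul]

theorem conj_convConst_neg_one (s b : ℝ) :
    starRingEnd ℂ (convConst s b (-1)) =
      betaConst s b * Complex.exp (Complex.I * Real.pi / 2 * s) := by
  rw [convConst_neg_one, map_mul, Complex.conj_ofReal,
    show Complex.I * Real.pi / 2 * s = Complex.I * ((Real.pi / 2 * s : ℝ) : ℂ) by push_cast; ring,
    ← conj_exp_I_mul, Complex.conj_conj]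

/-- To leading order both one-sided sums are multiples of the same w = (δ + iq)^{-b}. The constants
are phases e^{±iπs/2} up to a common real factor, so they assemble into the coefficients of w and of
its conjugate. -/
theorem profile_main_eq (s b : ℝ) (B₁ B₂ a₁ a₂ w : ℂ) :
    B₁ * (a₁ * (convConst s b 1 * w) + a₂ * (convConst s b (-1) * w)) +
    B₂ * (a₁ * starRingEnd ℂ (convConst s b 1 * w) +
      a₂ * starRingEnd ℂ (convConst s b (-1) * w)) =
    betaConst s b * (upperCoeff s B₁ a₁ a₂ * w + lowerCoeff s B₂ a₁ a₂ * starRingEnd ℂ w) := by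
  rw [map_mul, map_mul, conj_convConst_one, conj_convConst_neg_one, convConst_one,
    convConst_neg_one, upperCoeff, lowerCoeff]
  ring

theorem exp_sub_one_mul_pi (b : ℝ) :
    Complex.exp (-(Complex.I * (b - 1) * Real.pi)) = -Complex.exp (-(Complex.I * Real.pi * b)) := by
  rw [show -(Complex.I * ((b : ℂ) - 1) * Real.pi) =
    -(Complex.I * Real.pi * b) + Real.pi * Complex.I by ring, Complex.exp_add, Complex.exp_pi_mul_I]
  ring

theorem norm_profile_sub_le {B₁ B₂ a₁ a₂ x₁ x₂ y₁ y₂ : ℂ} {M e : ℝ} (hB₁ : ‖B₁‖ ≤ M)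
    (hB₂ : ‖B₂‖ ≤ M) (ha₁ : ‖a₁‖ ≤ M) (ha₂ : ‖a₂‖ ≤ M) (h1 : ‖x₁ - y₁‖ ≤ e)
    (h2 : ‖x₂ - y₂‖ ≤ e) :
    ‖(B₁ * (a₁ * x₁ + a₂ * x₂) + B₂ * (a₁ * starRingEnd ℂ x₁ + a₂ * starRingEnd ℂ x₂)) -
      (B₁ * (a₁ * y₁ + a₂ * y₂) + B₂ * (a₁ * starRingEnd ℂ y₁ + a₂ * starRingEnd ℂ y₂))‖
      ≤ 4 * M ^ 2 * e := by
  have hM : 0 ≤ M := (norm_nonneg _).trans hB₁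
  have he : 0 ≤ e := (norm_nonneg _).trans h1
  have h1' : ‖starRingEnd ℂ (x₁ - y₁)‖ ≤ e := by rwa [RCLike.norm_conj]
  have h2' : ‖starRingEnd ℂ (x₂ - y₂)‖ ≤ e := by rwa [RCLike.norm_conj]
  have key : ∀ a z : ℂ, ‖a‖ ≤ M → ‖z‖ ≤ e → ‖a * z‖ ≤ M * e := fun a z ha hz => by
    rw [norm_mul]; gcongr
  have key2 : ∀ B z w : ℂ, ‖B‖ ≤ M → ‖z‖ ≤ M * e → ‖w‖ ≤ M * e → ‖B * (z + w)‖ ≤ 2 * M ^ 2 * e :=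
    fun B z w hB hz hw => by
      rw [norm_mul]
      calc ‖B‖ * ‖z + w‖ ≤ M * (M * e + M * e) := by
            gcongr
            exact (norm_add_le _ _).trans (add_le_add hz hw)
        _ = _ := by ring
  have e1 := key2 B₁ _ _ hB₁ (key a₁ _ ha₁ h1) (key a₂ _ ha₂ h2)
  have e2 := key2 B₂ _ _ hB₂ (key a₁ _ ha₁ h1') (key a₂ _ ha₂ h2')
  have : (B₁ * (a₁ * x₁ + a₂ * x₂) + B₂ * (a₁ * starRingEnd ℂ x₁ + a₂ * starRingEnd ℂ x₂)) -
      (B₁ * (a₁ * y₁ + a₂ * y₂) + B₂ * (a₁ * starRingEnd ℂ y₁ + a₂ * starRingEnd ℂ y₂)) =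
      B₁ * (a₁ * (x₁ - y₁) + a₂ * (x₂ - y₂)) +
      B₂ * (a₁ * starRingEnd ℂ (x₁ - y₁) + a₂ * starRingEnd ℂ (x₂ - y₂)) := by
    rw [map_sub, map_sub]; ring
  rw [this]
  refine (norm_add_le _ _).trans ((add_le_add e1 e2).trans (le_of_eq (by ring)))

namespace IsFilterKernel

variable {s b : ℝ} {m n : ℕ} {φ : ℝ → ℝ} {L : ℝ≥0} {R : ℝ} {σ κ : ℝ}

/-- For large q the leading part of the profile is a multiple of `jump b 0 q`, which is zero, and
only the error of `sampleSum_decay` is left. On the bounded range down to -Q the sums are merely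
bounded. The constant depends on the coefficients only through M, which allows α to vary. -/
theorem profile_bound (h : IsFilterKernel (s + b) m φ L R) (hs : 1 < s) (hb : 0 < b)
    (hex : IsExact n φ) (hn : s + b - 1 ≤ n) (M Q : ℝ) (hQ : 0 ≤ Q) :
    ∃ C, 0 ≤ C ∧ ∀ B₁ B₂ a₁ a₂ : ℂ, ‖B₁‖ ≤ M → ‖B₂‖ ≤ M → ‖a₁‖ ≤ M → ‖a₂‖ ≤ M →
      lowerCoeff s B₂ a₁ a₂ =
        Complex.exp (-(Complex.I * (b - 1) * Real.pi)) * upperCoeff s B₁ a₁ a₂ →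
      ∀ q t : ℝ, -Q ≤ q →
        ‖profile (s + b) m φ s B₁ B₂ a₁ a₂ q t‖ ≤ C * (1 + max q 0) ^ (-(b + 1)) := by
  have hR := h.one_le_radius
  obtain ⟨C₁, hC₁0, hC₁⟩ := h.sampleSum_decay hs hb (Or.inl rfl) hex hn
  obtain ⟨C₂, hC₂0, hC₂⟩ := h.sampleSum_decay hs hb (Or.inr rfl) hex hn
  obtain ⟨D₁, hD₁0, hD₁⟩ := h.sampleSum_bound (σ := 1) hs.le hb (by simp)
  obtain ⟨D₂, hD₂0, hD₂⟩ := h.sampleSum_bound (σ := -1) hs.le hb (by simp)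
  set q₀ : ℝ := 2 * (R + 1) with hq₀
  have hq₀' : 1 ≤ q₀ := by linarith
  set D : ℝ := (D₁ + D₂) * (1 + (Q + q₀)) ^ (s - 1) with hD
  have hD0 : 0 ≤ D := by positivity
  refine ⟨4 * M ^ 2 * ((C₁ + C₂) * 2 ^ (b + 1) + D * (1 + q₀) ^ (b + 1)), by positivity,
    fun B₁ B₂ a₁ a₂ hB₁ hB₂ ha₁ ha₂ hc q t hq => ?_⟩
  have hM : 0 ≤ M := (norm_nonneg _).trans hB₁
  rcases le_or_gt q₀ q with hqq | hqq
  · have hqpos : 0 < q := by linarith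
    have habs : |q| = q := abs_of_pos hqpos
    have e1 := hC₁ q t (by rw [habs]; exact hqq)
    have e2 := hC₂ q t (by rw [habs]; exact hqq)
    rw [habs] at e1 e2
    have hg0 : 0 ≤ q ^ (-(b + 1)) := by positivity
    have key := norm_profile_sub_le (e := (C₁ + C₂) * q ^ (-(b + 1))) hB₁ hB₂ ha₁ ha₂
      (e1.trans (by nlinarith)) (e2.trans (by nlinarith))
    rw [profile_main_eq, hc, conj_powKernel b (Or.inr hqpos.ne'), exp_sub_one_mul_pi] at key
    have hz : upperCoeff s B₁ a₁ a₂ * powKernel b 0 q +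
        -Complex.exp (-(Complex.I * Real.pi * b)) * upperCoeff s B₁ a₁ a₂ * powKernel b 0 (-q) =
        upperCoeff s B₁ a₁ a₂ * jump b 0 q := by
      rw [jump]; ring
    rw [hz, jump_zero hqpos, mul_zero, mul_zero, sub_zero] at key
    refine key.trans ?_
    rw [max_eq_left hqpos.le]
    have h3 : q ^ (-(b + 1)) ≤ 2 ^ (b + 1) * (1 + q) ^ (-(b + 1)) := by
      rw [Real.rpow_neg hqpos.le, Real.rpow_neg (by positivity), ← div_eq_mul_inv,
        le_div_iff₀ (by positivity), ← div_eq_inv_mul, div_le_iff₀ (by positivity),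
        ← Real.mul_rpow (by norm_num) hqpos.le]
      exact Real.rpow_le_rpow (by positivity) (by linarith) (by linarith)
    calc _ ≤ 4 * M ^ 2 * ((C₁ + C₂) * (2 ^ (b + 1) * (1 + q) ^ (-(b + 1)))) := by gcongr
      _ = 4 * M ^ 2 * ((C₁ + C₂) * 2 ^ (b + 1)) * (1 + q) ^ (-(b + 1)) := by ring
      _ ≤ _ := by
        gcongr
        have : 0 ≤ D * (1 + q₀) ^ (b + 1) := by positivity
        linarith
  · have hqa : |q| ≤ Q + q₀ := abs_le.2 ⟨by linarith, by linarith⟩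
    have hpw : (1 + |q|) ^ (s - 1) ≤ (1 + (Q + q₀)) ^ (s - 1) :=
      Real.rpow_le_rpow (by positivity) (by linarith) (by linarith)
    have hpw0 : 0 ≤ (1 + (Q + q₀)) ^ (s - 1) := by positivity
    have e1 : ‖sampleSum (s + b) m φ s 1 q t - 0‖ ≤ D := by
      rw [sub_zero]
      refine (hD₁ q t).trans ?_
      rw [hD]
      gcongr
      linarith
    have e2 : ‖sampleSum (s + b) m φ s (-1) q t - 0‖ ≤ D := by
      rw [sub_zero]
      refine (hD₂ q t).trans ?_
      rw [hD]
      gcongr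
      linarith
    have key := norm_profile_sub_le hB₁ hB₂ ha₁ ha₂ e1 e2
    simp only [mul_zero, map_zero, add_zero, sub_zero] at key
    refine key.trans ?_
    have hmax : 0 ≤ max q 0 := le_max_right _ _
    have h3 : 1 ≤ (1 + q₀) ^ (b + 1) * (1 + max q 0) ^ (-(b + 1)) := by
      rw [Real.rpow_neg (by positivity), ← div_eq_mul_inv, le_div_iff₀ (by positivity), one_mul]
      refine Real.rpow_le_rpow (by positivity) ?_ (by linarith)
      have : max q 0 ≤ q₀ := max_le hqq.le (by linarith)
      linarith
    calc 4 * M ^ 2 * D ≤ 4 * M ^ 2 * D * ((1 + q₀) ^ (b + 1) * (1 + max q 0) ^ (-(b + 1))) :=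
          le_mul_of_one_le_right (by positivity) h3
      _ = 4 * M ^ 2 * (D * (1 + q₀) ^ (b + 1)) * (1 + max q 0) ^ (-(b + 1)) := by ring
      _ ≤ _ := by
        gcongr
        have : 0 ≤ (C₁ + C₂) * 2 ^ (b + 1) := by positivity
        linarith

theorem continuous_profile (h : IsFilterKernel (s + b) m φ L R) (hs : 1 < s) (hb : 0 < b)
    (B₁ B₂ a₁ a₂ : ℂ) :
    Continuous fun p : ℝ × ℝ => profile (s + b) m φ s B₁ B₂ a₁ a₂ p.1 p.2 := by
  have h1 := h.continuous_sampleSum (σ := 1) hs.le hb (by simp)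
  have h2 := h.continuous_sampleSum (σ := -1) hs.le hb (by simp)
  unfold profile
  exact (continuous_const.mul ((continuous_const.mul h1).add (continuous_const.mul h2))).add
    (continuous_const.mul ((continuous_const.mul (Complex.continuous_conj.comp h1)).add
      (continuous_const.mul (Complex.continuous_conj.comp h2))))

theorem integral_profile (h : IsFilterKernel (s + b) m φ L R) (hs : 1 < s) (hb : 0 < b)
    (B₁ B₂ a₁ a₂ : ℂ) (q : ℝ) :
    ∫ t in (0 : ℝ)..1, profile (s + b) m φ s B₁ B₂ a₁ a₂ q t =
      B₁ * (a₁ * (∫ t in (0 : ℝ)..1, sampleSum (s + b) m φ s 1 q t) +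
        a₂ * ∫ t in (0 : ℝ)..1, sampleSum (s + b) m φ s (-1) q t) +
      B₂ * (a₁ * starRingEnd ℂ (∫ t in (0 : ℝ)..1, sampleSum (s + b) m φ s 1 q t) +
        a₂ * starRingEnd ℂ (∫ t in (0 : ℝ)..1, sampleSum (s + b) m φ s (-1) q t)) := by
  have h1 : Continuous fun t => sampleSum (s + b) m φ s 1 q t := by
    have := (h.continuous_sampleSum (σ := 1) hs.le hb (by simp)).comp (Continuous.prodMk_right q)
    simpa only [Function.comp_def] using this
  have h2 : Continuous fun t => sampleSum (s + b) m φ s (-1) q t := by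
    have := (h.continuous_sampleSum (σ := -1) hs.le hb (by simp)).comp (Continuous.prodMk_right q)
    simpa only [Function.comp_def] using this
  have h1' := Complex.continuous_conj.comp h1
  have h2' := Complex.continuous_conj.comp h2
  have hconj : ∀ f : ℝ → ℂ, starRingEnd ℂ (∫ t in (0 : ℝ)..1, f t) =
      ∫ t in (0 : ℝ)..1, starRingEnd ℂ (f t) := fun f => by
    rw [intervalIntegral.integral_of_le zero_le_one, intervalIntegral.integral_of_le zero_le_one,
      integral_conj]
  set f₁ := fun t => sampleSum (s + b) m φ s 1 q t
  set f₂ := fun t => sampleSum (s + b) m φ s (-1) q t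
  have i1 : IntervalIntegrable f₁ volume 0 1 := h1.intervalIntegrable _ _
  have i2 : IntervalIntegrable f₂ volume 0 1 := h2.intervalIntegrable _ _
  have i1' : IntervalIntegrable (fun t => starRingEnd ℂ (f₁ t)) volume 0 1 :=
    h1'.intervalIntegrable _ _
  have i2' : IntervalIntegrable (fun t => starRingEnd ℂ (f₂ t)) volume 0 1 :=
    h2'.intervalIntegrable _ _
  have he : ∀ t, profile (s + b) m φ s B₁ B₂ a₁ a₂ q t = (B₁ * a₁) * f₁ t + (B₁ * a₂) * f₂ t +
      ((B₂ * a₁) * starRingEnd ℂ (f₁ t) + (B₂ * a₂) * starRingEnd ℂ (f₂ t)) := fun t => by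
    unfold profile; ring
  rw [intervalIntegral.integral_congr (fun t _ => he t),
    intervalIntegral.integral_add ((i1.const_mul _).add (i2.const_mul _))
      ((i1'.const_mul _).add (i2'.const_mul _)),
    intervalIntegral.integral_add (i1.const_mul _) (i2.const_mul _),
    intervalIntegral.integral_add (i1'.const_mul _) (i2'.const_mul _),
    intervalIntegral.integral_const_mul, intervalIntegral.integral_const_mul,
    intervalIntegral.integral_const_mul, intervalIntegral.integral_const_mul, hconj, hconj]
  ring

theorem integral_mul_jump_eq (h : IsFilterKernel κ m φ L R) {δ : ℝ} (hδ : 0 < δ) (b q : ℝ) :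
    ∫ p, (φ p : ℂ) * jump b δ (q - p) = smoothedPow b φ δ q -
      Complex.exp (-(Complex.I * Real.pi * b)) * starRingEnd ℂ (smoothedPow b φ δ q) := by
  have hk := continuous_powKernel b hδ
  have hφ := h.continuous
  have hi : ∀ f : ℝ → ℂ, Continuous f → Integrable fun p => (φ p : ℂ) * f p := fun f hf => by
    refine Continuous.integrable_of_hasCompactSupport (by fun_prop) ?_
    exact (h.hasCompactSupport.comp_left (g := fun y : ℝ => (y : ℂ)) (by simp)).mul_right
  have hconj : starRingEnd ℂ (smoothedPow b φ δ q) = ∫ p, (φ p : ℂ) * powKernel b δ (-(q - p)) := by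
    rw [smoothedPow, ← integral_conj]
    congr 1; ext p
    rw [map_mul, Complex.conj_ofReal, conj_powKernel b (Or.inl hδ)]
  rw [hconj, smoothedPow, ← integral_const_mul,
    ← integral_sub (hi _ (by fun_prop)) ((hi _ (by fun_prop)).const_mul _)]
  congr 1; ext p
  rw [jump]; ring

/-- Under the coefficient relation the two smoothed powers in the phase average combine into φ ∗
`jump`. Keeping δ > 0 here lets the later integration in r use `integral_jump`. -/
theorem tendsto_integral_profile (h : IsFilterKernel (s + b) m φ L R) (hs : 1 < s) (hb : 0 < b)
    {B₁ B₂ a₁ a₂ : ℂ} (hc : lowerCoeff s B₂ a₁ a₂ =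
      Complex.exp (-(Complex.I * (b - 1) * Real.pi)) * upperCoeff s B₁ a₁ a₂) (q : ℝ) :
    Tendsto (fun δ => betaConst s b * upperCoeff s B₁ a₁ a₂ *
      ∫ p, (φ p : ℂ) * jump b δ (q - p)) (𝓝[>] 0)
      (𝓝 (∫ t in (0 : ℝ)..1, profile (s + b) m φ s B₁ B₂ a₁ a₂ q t)) := by
  have h1 := h.tendsto_smoothedPow hs hb (Or.inl rfl) q
  have h2 := h.tendsto_smoothedPow hs hb (Or.inr rfl) q
  have h1' := (Complex.continuous_conj.tendsto _).comp h1
  have h2' := (Complex.continuous_conj.tendsto _).comp h2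
  rw [h.integral_profile hs hb]
  refine ((((h1.const_mul a₁).add (h2.const_mul a₂)).const_mul B₁).add
    (((h1'.const_mul a₁).add (h2'.const_mul a₂)).const_mul B₂)).congr' ?_
  filter_upwards [self_mem_nhdsWithin] with δ hδ
  have hδ' : (0 : ℝ) < δ := hδ
  simp only [Function.comp_apply]
  rw [profile_main_eq, hc, exp_sub_one_mul_pi]
  rw [h.integral_mul_jump_eq hδ' b q]
  ring

theorem integral_mul_jump_bound (h : IsFilterKernel (s + b) m φ L R) (hs : 1 < s) (hb : 0 < b) :
    ∃ C, 0 ≤ C ∧ ∀ᶠ δ in 𝓝[>] (0 : ℝ), ∀ q,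
      ‖∫ p, (φ p : ℂ) * jump b δ (q - p)‖ ≤ C * (1 + |q|) ^ (s - 1) := by
  obtain ⟨C, hC0, hC⟩ := h.smoothedPow_bound hs hb
  refine ⟨2 * C, by positivity, ?_⟩
  filter_upwards [hC, self_mem_nhdsWithin] with δ hδ hδ0 q
  have hδ' : (0 : ℝ) < δ := hδ0
  rw [h.integral_mul_jump_eq hδ' b q]
  refine (norm_sub_le _ _).trans ?_
  rw [norm_mul, norm_exp_neg_I_mul_pi, one_mul, RCLike.norm_conj]
  linarith [hδ q]

end IsFilterKernel

namespace IsFilterKernel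

variable {s b : ℝ} {m n : ℕ} {φ : ℝ → ℝ} {L : ℝ≥0} {R : ℝ} {σ κ : ℝ}

theorem integral_integral_mul_jump (h : IsFilterKernel κ m φ L R) (hb : 0 < b) {δ : ℝ}
    (hδ : 0 < δ) (q : ℝ) :
    ∫ r in Ioi (0 : ℝ), (∫ p, (φ p : ℂ) * jump b δ (q + r - p)) * ((r ^ (b - 1) : ℝ) : ℂ) =
      ∫ p, (φ p : ℂ) * (Complex.I * Complex.I ^ (-(b : ℂ)) *
        ((Real.pi - 2 * Real.arctan ((q - p) / δ) : ℝ) : ℂ)) := by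
  have hR := h.one_le_radius
  have hφ := h.continuous.measurable
  have hi := integrableOn_one_add_rpow_neg_mul_rpow hb one_pos
  set F : ℝ → ℝ → ℂ := fun r p => (φ p : ℂ) * (jump b δ (q - p + r) * ((r ^ (b - 1) : ℝ) : ℂ))
    with hF
  have hint : Integrable (Function.uncurry F) ((volume.restrict (Ioi (0 : ℝ))).prod volume) := by
    have hg := ((hi.const_mul ((2 * b * δ + 2 * δ ^ (-b)) *
      (2 + 0 + (|q| + R)) ^ (b + 1)))).mul_prod h.integrable.abs
    refine hg.mono' (Measurable.aestronglyMeasurable (by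
      simp only [hF, Function.uncurry_def]; fun_prop)) ?_
    have hae : ∀ᵐ z : ℝ × ℝ ∂((volume.restrict (Ioi (0 : ℝ))).prod volume), 0 < z.1 :=
      Measure.quasiMeasurePreserving_fst.ae (ae_restrict_mem measurableSet_Ioi)
    filter_upwards [hae] with z hz
    obtain ⟨r, p⟩ := z
    simp only [Function.uncurry_apply_pair, hF] at hz ⊢
    rw [norm_mul, norm_mul, Complex.norm_real, Complex.norm_real, Real.norm_eq_abs,
      Real.norm_of_nonneg (by positivity : (0 : ℝ) ≤ r ^ (b - 1))]
    by_cases hp : R ≤ |p|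
    · rw [h.eq_zero _ hp]; simp
    · have hqp : |q - p| ≤ |q| + R := (abs_sub _ _).trans (by linarith)
      have hj := norm_jump_add_le hb hδ (S := |q| + R) (by positivity) hqp hz.le
      calc |φ p| * (‖jump b δ (q - p + r)‖ * r ^ (b - 1)) ≤
            |φ p| * (((2 * b * δ + 2 * δ ^ (-b)) * (2 + 0 + (|q| + R)) ^ (b + 1) *
              (1 + r) ^ (-(b + 1))) * r ^ (b - 1)) := by
            gcongr
        _ = _ := by ring
  have hl : ∀ r, (∫ p, (φ p : ℂ) * jump b δ (q + r - p)) * ((r ^ (b - 1) : ℝ) : ℂ) =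
      ∫ p, F r p := fun r => by
    rw [← integral_mul_const]
    congr 1; ext p
    simp only [hF]
    rw [show q + r - p = q - p + r by ring, mul_assoc]
  simp only [hl]
  rw [integral_integral_swap hint]
  congr 1; ext p
  simp only [hF]
  rw [integral_const_mul, integral_jump hb hδ]

/-- The bracket is bounded by 2π and tends to 2π or 0 according to the sign of q - p; the point p =
q is a null set. -/
theorem tendsto_integral_arctan (h : IsFilterKernel κ m φ L R) (c : ℂ) (q : ℝ) :
    Tendsto (fun δ => ∫ p, (φ p : ℂ) * (c *
        ((Real.pi - 2 * Real.arctan ((q - p) / δ) : ℝ) : ℂ))) (𝓝[>] 0)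
      (𝓝 (∫ p, (φ p : ℂ) * (c * (2 * Real.pi * stepMinus (q - p))))) := by
  have hφ := h.continuous.measurable
  refine tendsto_integral_filter_of_dominated_convergence
    (fun p => |φ p| * (‖c‖ * (2 * Real.pi)))
    (Eventually.of_forall fun δ => Measurable.aestronglyMeasurable (by fun_prop))
    (Eventually.of_forall fun δ => Eventually.of_forall fun p => ?_)
    (h.integrable.abs.mul_const _) ?_
  · rw [norm_mul, norm_mul, Complex.norm_real, Complex.norm_real, Real.norm_eq_abs, Real.norm_eq_abs]
    gcongr
    rw [abs_le]
    have h1 := Real.arctan_lt_pi_div_two ((q - p) / δ)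
    have h2 := Real.neg_pi_div_two_lt_arctan ((q - p) / δ)
    constructor <;> linarith [Real.pi_pos]
  · have h0 : ∀ᵐ p : ℝ, p ≠ q := by simp [ae_iff]
    filter_upwards [h0] with p hp
    refine Tendsto.const_mul _ (Tendsto.const_mul _ ?_)
    have hinv : Tendsto (fun δ : ℝ => δ⁻¹) (𝓝[>] 0) atTop := tendsto_inv_nhdsGT_zero
    rcases lt_or_gt_of_ne (sub_ne_zero.2 hp.symm) with hlt | hgt
    · have h1 : Tendsto (fun δ => (q - p) / δ) (𝓝[>] 0) atBot := by
        simp only [div_eq_mul_inv]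
        exact hinv.const_mul_atTop_of_neg hlt
      have h2 := (tendsto_nhds_of_tendsto_nhdsWithin Real.tendsto_arctan_atBot).comp h1
      have h3 := (Complex.continuous_ofReal.tendsto _).comp ((h2.const_mul 2).const_sub Real.pi)
      refine (h3.congr fun δ => rfl).trans (le_of_eq (congrArg _ ?_))
      rw [show stepMinus (q - p) = 1 from if_pos hlt]
      push_cast; ring
    · have h1 : Tendsto (fun δ => (q - p) / δ) (𝓝[>] 0) atTop := by
        simp only [div_eq_mul_inv]
        exact hinv.const_mul_atTop hgt
      have h2 := (tendsto_nhds_of_tendsto_nhdsWithin Real.tendsto_arctan_atTop).comp h1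
      have h3 := (Complex.continuous_ofReal.tendsto _).comp ((h2.const_mul 2).const_sub Real.pi)
      refine (h3.congr fun δ => rfl).trans (le_of_eq (congrArg _ ?_))
      rw [show stepMinus (q - p) = 0 from if_neg (not_lt.2 hgt.le)]
      push_cast; ring

/-- The dominating function for the limit δ → 0 under the integral in r. To the right of the support
of φ the cancellation in the jump gives decay, uniformly for δ ≤ 1; elsewhere the polynomial bound
of `integral_mul_jump_bound` is used on a bounded set. -/
theorem integral_mul_jump_decay (h : IsFilterKernel (s + b) m φ L R) (hs : 1 < s) (hb : 0 < b)
    (q : ℝ) :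
    ∃ C, 0 ≤ C ∧ ∀ᶠ δ in 𝓝[>] (0 : ℝ), ∀ r, 0 ≤ r →
      ‖∫ p, (φ p : ℂ) * jump b δ (q + r - p)‖ ≤ C * (1 + r) ^ (-(b + 1)) := by
  have hR := h.one_le_radius
  obtain ⟨C, hC0, hC⟩ := h.integral_mul_jump_bound hs hb
  set N : ℝ := ∫ p, |φ p| with hN
  have hN0 : 0 ≤ N := integral_nonneg fun p => abs_nonneg _
  refine ⟨(N * (2 * b) + C * (2 + R + |q|) ^ (s - 1)) * (2 + R + |q|) ^ (b + 1), by positivity, ?_⟩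
  have h1 : ∀ᶠ δ in 𝓝[>] (0 : ℝ), δ ≤ 1 :=
    eventually_nhdsWithin_of_eventually_nhds (eventually_le_nhds one_pos)
  filter_upwards [hC, h1, self_mem_nhdsWithin] with δ hδ hδ1 hδ0 r hr
  have hδ' : (0 : ℝ) < δ := hδ0
  refine le_one_add_rpow_of_bounds (v := fun q => ‖∫ p, (φ p : ℂ) * jump b δ (q - p)‖)
    hb.le (by positivity) (by positivity) (by linarith) (abs_nonneg q) (fun q hq => ?_)
    (fun q hq => ?_) le_rfl hr
  · have hqR : 0 < q - R := by linarith
    have : ‖∫ p, (φ p : ℂ) * jump b δ (q - p)‖ ≤ ∫ p, |φ p| * (2 * b * (q - R) ^ (-(b + 1))) := by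
      refine norm_integral_le_of_norm_le (h.integrable.abs.mul_const _)
        (Eventually.of_forall fun p => ?_)
      rw [norm_mul, Complex.norm_real, Real.norm_eq_abs]
      by_cases hp : R ≤ |p|
      · rw [h.eq_zero _ hp]; simp
      · have hp' := (abs_lt.1 (not_le.1 hp)).2
        gcongr
        refine (norm_jump_le_of_pos hb hδ'.le (by linarith)).trans ?_
        have h5 : (q - p) ^ (-(b + 1)) ≤ (q - R) ^ (-(b + 1)) :=
          Real.rpow_le_rpow_of_nonpos hqR (by linarith) (by linarith)
        have h6 : 2 * b * δ ≤ 2 * b := by nlinarith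
        have h7 : 0 ≤ (q - p) ^ (-(b + 1)) := Real.rpow_nonneg (by linarith) _
        gcongr
    rw [integral_mul_const] at this
    refine this.trans (le_of_eq (by ring))
  · refine (hδ q).trans ?_
    gcongr ?_ * ?_
    exact Real.rpow_le_rpow (by positivity) (by linarith) (by linarith)

/-- The phase average is replaced by its δ-regularization, Fubini puts the integral in r inside, and
there the explicit arctangent converges to the step function. -/
theorem integral_integral_profile (h : IsFilterKernel (s + b) m φ L R) (hs : 1 < s) (hb : 0 < b)
    {B₁ B₂ a₁ a₂ : ℂ} (hc : lowerCoeff s B₂ a₁ a₂ =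
      Complex.exp (-(Complex.I * (b - 1) * Real.pi)) * upperCoeff s B₁ a₁ a₂) (q : ℝ) :
    ∫ r in Ioi (0 : ℝ), (∫ t in (0 : ℝ)..1, profile (s + b) m φ s B₁ B₂ a₁ a₂ (q + r) t) *
        ((r ^ (b - 1) : ℝ) : ℂ) =
      betaConst s b * upperCoeff s B₁ a₁ a₂ * (2 * Real.pi * Complex.I * Complex.I ^ (-(b : ℂ))) *
        ∫ p, (φ p : ℂ) * stepMinus (q - p) := by
  have hi := integrableOn_one_add_rpow_neg_mul_rpow hb one_pos
  have hφ := h.continuous.measurable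
  obtain ⟨C, hC0, hC⟩ := h.integral_mul_jump_decay hs hb q
  set A : ℂ := betaConst s b * upperCoeff s B₁ a₁ a₂ with hA
  have hlim : Tendsto (fun δ => ∫ r in Ioi (0 : ℝ),
      (A * ∫ p, (φ p : ℂ) * jump b δ (q + r - p)) * ((r ^ (b - 1) : ℝ) : ℂ)) (𝓝[>] 0)
      (𝓝 (∫ r in Ioi (0 : ℝ), (∫ t in (0 : ℝ)..1,
        profile (s + b) m φ s B₁ B₂ a₁ a₂ (q + r) t) * ((r ^ (b - 1) : ℝ) : ℂ))) := by
    refine tendsto_integral_filter_of_dominated_convergence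
      (fun r => ‖A‖ * C * ((1 + r) ^ (-(b + 1)) * r ^ (b - 1)))
      (Eventually.of_forall fun δ => ?_) ?_ (hi.const_mul _)
      (Eventually.of_forall fun r => (h.tendsto_integral_profile hs hb hc (q + r)).mul_const _)
    · have : StronglyMeasurable fun r : ℝ => ∫ p, (φ p : ℂ) * jump b δ (q + r - p) := by
        apply StronglyMeasurable.integral_prod_right
        apply Measurable.stronglyMeasurable
        fun_prop
      exact ((this.const_mul A).mul (Measurable.stronglyMeasurable
        (by fun_prop))).aestronglyMeasurable
    · filter_upwards [hC] with δ hδ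
      refine (ae_restrict_mem measurableSet_Ioi).mono fun r hr => ?_
      have hr' : (0 : ℝ) < r := hr
      rw [norm_mul, norm_mul, Complex.norm_real, Real.norm_of_nonneg (by positivity)]
      calc ‖A‖ * ‖∫ p, (φ p : ℂ) * jump b δ (q + r - p)‖ * r ^ (b - 1) ≤
            ‖A‖ * (C * (1 + r) ^ (-(b + 1))) * r ^ (b - 1) := by
            gcongr
            exact hδ r hr'.le
        _ = _ := by ring
  have hlim2 := (h.tendsto_integral_arctan (Complex.I * Complex.I ^ (-(b : ℂ))) q).const_mul A
  refine (tendsto_nhds_unique hlim (hlim2.congr' ?_)).trans ?_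
  · filter_upwards [self_mem_nhdsWithin] with δ hδ
    rw [← h.integral_integral_mul_jump hb hδ, ← integral_const_mul]
    refine integral_congr_ae (Eventually.of_forall fun r => ?_)
    ring
  · rw [mul_assoc A, ← integral_const_mul (2 * Real.pi * Complex.I * Complex.I ^ (-(b : ℂ)))]
    exact congrArg (A * ·) (integral_congr_ae (Eventually.of_forall fun p => by ring))

end IsFilterKernel

/-! ### Equidistribution of irrational rotations -/

/-- The difference between the average of `f` over `M` points of a rotation orbit and its mean. -/
noncomputable def rotationDefect (θ : ℝ) (f : ℝ → ℂ) (M : ℕ) (t : ℝ) : ℂ :=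
  (M : ℂ)⁻¹ * ∑ l ∈ Finset.range M, f (t + l * θ) - ∫ x in (0 : ℝ)..1, f x

/-- The rotation averages of `f` converge to the mean uniformly. -/
def HasUniformMean (θ : ℝ) (f : ℝ → ℂ) : Prop :=
  ∀ η > 0, ∃ M₀ : ℕ, ∀ M ≥ M₀, ∀ t, ‖rotationDefect θ f M t‖ ≤ η

theorem norm_rotationDefect_le {θ : ℝ} {f : ℝ → ℂ} {C : ℝ} (hC : ∀ t, ‖f t‖ ≤ C) (M : ℕ) (t : ℝ) :
    ‖rotationDefect θ f M t‖ ≤ 2 * C := by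
  have hC0 : 0 ≤ C := (norm_nonneg _).trans (hC 0)
  have h1 : ‖(M : ℂ)⁻¹ * ∑ l ∈ Finset.range M, f (t + l * θ)‖ ≤ C := by
    rw [norm_mul, norm_inv, Complex.norm_natCast]
    rcases Nat.eq_zero_or_pos M with rfl | hM
    · simpa using hC0
    · rw [inv_mul_le_iff₀ (by positivity)]
      refine (norm_sum_le _ _).trans ((Finset.sum_le_sum fun l _ => hC _).trans (le_of_eq ?_))
      simp
  have h2 : ‖∫ x in (0 : ℝ)..1, f x‖ ≤ C := by
    have := intervalIntegral.norm_integral_le_of_norm_le_const (a := 0) (b := 1) (f := f) (C := C)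
      (fun x _ => hC x)
    simpa using this
  exact (norm_sub_le _ _).trans (by linarith)

theorem rotationDefect_add {θ : ℝ} {f g : ℝ → ℂ} (hf : Continuous f) (hg : Continuous g) (M : ℕ)
    (t : ℝ) : rotationDefect θ (fun x => f x + g x) M t =
      rotationDefect θ f M t + rotationDefect θ g M t := by
  unfold rotationDefect
  rw [intervalIntegral.integral_add (hf.intervalIntegrable _ _) (hg.intervalIntegrable _ _),
    Finset.sum_add_distrib]
  ring

theorem rotationDefect_mul {θ : ℝ} (c : ℂ) (f : ℝ → ℂ) (M : ℕ) (t : ℝ) :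
    rotationDefect θ (fun x => c * f x) M t = c * rotationDefect θ f M t := by
  unfold rotationDefect
  rw [intervalIntegral.integral_const_mul, ← Finset.mul_sum]
  ring

/-- For n ≠ 0 the orbit sum is geometric with ratio z ≠ 1 and so is at most 2 / ‖z - 1‖, whatever
the starting point t. -/
theorem hasUniformMean_exp {θ : ℝ} (hθ : Irrational θ) (n : ℤ) :
    HasUniformMean θ fun t => Complex.exp (2 * Real.pi * Complex.I * n * t) := by
  intro η hη
  rcases eq_or_ne n 0 with rfl | hn
  · refine ⟨1, fun M hM t => ?_⟩
    have : (M : ℂ) ≠ 0 := by exact_mod_cast (by omega : M ≠ 0)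
    simp [rotationDefect, this, hη.le]
  · set c : ℂ := 2 * Real.pi * Complex.I * n with hc
    have hc0 : c ≠ 0 := by
      rw [hc]
      exact mul_ne_zero Complex.two_pi_I_ne_zero (by exact_mod_cast hn)
    set z : ℂ := Complex.exp (c * θ) with hz
    have hz1 : z ≠ 1 := by
      rw [hz, Ne, Complex.exp_eq_one_iff]
      rintro ⟨k, hk⟩
      have h2 : (n : ℂ) * θ = k := by
        have := Complex.two_pi_I_ne_zero
        apply mul_left_cancel₀ this
        rw [hc] at hk
        linear_combination hk
      have h3 : (n : ℝ) * θ = k := by exact_mod_cast h2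
      refine hθ ⟨(k : ℚ) / n, ?_⟩
      push_cast
      rw [← h3]
      field_simp
    have hint : ∫ x in (0 : ℝ)..1, Complex.exp (c * x) = 0 := by
      rw [integral_exp_mul_complex hc0]
      have : Complex.exp (c * (1 : ℝ)) = 1 := by
        rw [Complex.exp_eq_one_iff]
        exact ⟨n, by rw [hc]; push_cast; ring⟩
      rw [this]; simp
    have hnorm : ∀ x : ℝ, ‖Complex.exp (c * x)‖ = 1 := fun x => by
      rw [hc, show (2 * Real.pi * Complex.I * n * x : ℂ) =
        ((2 * Real.pi * n * x : ℝ) : ℂ) * Complex.I by push_cast; ring]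
      exact Complex.norm_exp_ofReal_mul_I _
    have hd : 0 < ‖z - 1‖ := norm_pos_iff.2 (sub_ne_zero.2 hz1)
    obtain ⟨M₀, hM₀⟩ := exists_nat_gt (2 / ‖z - 1‖ / η)
    refine ⟨M₀ + 1, fun M hM t => ?_⟩
    have hMpos : (0 : ℝ) < M := by exact_mod_cast (by omega : 0 < M)
    have hsum : ∑ l ∈ Finset.range M, Complex.exp (c * ((t + l * θ : ℝ) : ℂ)) =
        Complex.exp (c * t) * ((z ^ M - 1) / (z - 1)) := by
      rw [← geom_sum_eq hz1, Finset.mul_sum]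
      refine Finset.sum_congr rfl fun l _ => ?_
      rw [hz, ← Complex.exp_nat_mul, ← Complex.exp_add]
      congr 1; push_cast; ring
    have hzM : ‖z ^ M - 1‖ ≤ 2 := by
      refine (norm_sub_le _ _).trans ?_
      rw [norm_pow, hz, hnorm]; norm_num
    rw [rotationDefect, hint, sub_zero, hsum, norm_mul, norm_mul, hnorm, one_mul, norm_div, norm_inv,
      Complex.norm_natCast, inv_mul_le_iff₀ hMpos]
    calc ‖z ^ M - 1‖ / ‖z - 1‖ ≤ 2 / ‖z - 1‖ := by gcongr
      _ ≤ M₀ * η := by rw [div_lt_iff₀ hη] at hM₀; exact hM₀.le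
      _ ≤ M * η := by gcongr; exact_mod_cast (by omega : M₀ ≤ M)

/-- Weyl's equidistribution theorem: for irrational `θ` and continuous 1-periodic `f`. -/
theorem hasUniformMean_of_irrational {θ : ℝ} (hθ : Irrational θ) {f : ℝ → ℂ} (hf : Continuous f)
    (hper : Function.Periodic f 1) : HasUniformMean θ f := by
  have hco : ∀ F : C(AddCircle (1 : ℝ), ℂ), Continuous fun t : ℝ => F t := fun F =>
    F.continuous.comp (AddCircle.continuous_mk' 1)
  -- The functions with uniform mean form a closed subspace which contains the characters, hence
  -- everything.
  let W : Submodule ℂ C(AddCircle (1 : ℝ), ℂ) :=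
    { carrier := {F | HasUniformMean θ fun t : ℝ => F t}
      add_mem' := by
        intro F G hF hG η hη
        obtain ⟨M₁, h₁⟩ := hF (η / 2) (by positivity)
        obtain ⟨M₂, h₂⟩ := hG (η / 2) (by positivity)
        refine ⟨max M₁ M₂, fun M hM t => ?_⟩
        have e := rotationDefect_add (θ := θ) (hco F) (hco G) M t
        have a₁ := h₁ M (le_of_max_le_left hM) t
        have a₂ := h₂ M (le_of_max_le_right hM) t
        simp only [ContinuousMap.add_apply]
        rw [e]
        exact (norm_add_le _ _).trans (by linarith)
      zero_mem' := fun η hη => ⟨0, fun M _ t => by simp [rotationDefect, hη.le]⟩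
      smul_mem' := by
        intro c F hF η hη
        obtain ⟨M₁, h₁⟩ := hF (η / (‖c‖ + 1)) (by positivity)
        refine ⟨M₁, fun M hM t => ?_⟩
        have a₁ := h₁ M hM t
        simp only [ContinuousMap.smul_apply, smul_eq_mul]
        rw [rotationDefect_mul, norm_mul]
        rw [le_div_iff₀ (by positivity)] at a₁
        nlinarith [norm_nonneg (rotationDefect θ (fun t : ℝ => F t) M t)] }
  have hW : IsClosed (W : Set C(AddCircle (1 : ℝ), ℂ)) := by
    refine isClosed_of_closure_subset fun F hF η hη => ?_
    -- A function bounded by η / 4 has defect at most η / 2.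
    obtain ⟨G, hG, hFG⟩ := Metric.mem_closure_iff.1 hF (η / 4) (by positivity)
    obtain ⟨M₀, hM₀⟩ := hG (η / 2) (by positivity)
    refine ⟨M₀, fun M hM t => ?_⟩
    have hb : ∀ t : ℝ, ‖F t - G t‖ ≤ η / 4 := fun t => by
      rw [← dist_eq_norm]
      exact (ContinuousMap.dist_apply_le_dist _).trans hFG.le
    rw [show (fun t : ℝ => F t) = fun t : ℝ => (F t - G t) + G t by ext; ring,
      rotationDefect_add (f := fun t : ℝ => F t - G t) ((hco F).sub (hco G)) (hco G)]
    have := norm_rotationDefect_le (θ := θ) hb M t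
    refine (norm_add_le _ _).trans ?_
    linarith [hM₀ M hM t]
  have htop : W = ⊤ := by
    rw [eq_top_iff, ← span_fourier_closure_eq_top (T := 1)]
    refine Submodule.topologicalClosure_minimal _ (Submodule.span_le.2 ?_) hW
    rintro _ ⟨n, rfl⟩
    have := hasUniformMean_exp hθ n
    show HasUniformMean θ fun t : ℝ => fourier n (t : AddCircle (1 : ℝ))
    simpa [fourier_coe_apply] using this
  let F : C(AddCircle (1 : ℝ), ℂ) := ⟨hper.lift, by
    exact hf.quotient_liftOn' _⟩
  have hF : F ∈ W := htop ▸ Submodule.mem_top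
  exact hF

/-! ### Integrals of functions of a positive definite form -/

open scoped MatrixOrder in
theorem exists_eq_transpose_mul_self {ι : Type*} [Fintype ι] [DecidableEq ι] {D : Matrix ι ι ℝ}
    (hD : D.PosDef) : ∃ S : Matrix ι ι ℝ, D = S.transpose * S := by
  obtain ⟨B, hB⟩ := CStarAlgebra.nonneg_iff_eq_star_mul_self.mp hD.posSemidef.nonneg
  exact ⟨B, by rw [hB, Matrix.star_eq_conjTranspose, Matrix.conjTranspose_eq_transpose_of_trivial]⟩

/-- Integration of a function of `‖w‖²/2`. -/
theorem integral_comp_half_norm_sq {d : ℕ} (hd : 1 ≤ d) (F : ℝ → ℂ) :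
    ∫ w : EuclideanSpace ℝ (Fin d), F (‖w‖ ^ 2 / 2) =
      (((2 * Real.pi) ^ ((d : ℝ) / 2) / Real.Gamma ((d : ℝ) / 2) : ℝ) : ℂ) *
        ∫ r in Ioi (0 : ℝ), F r * ((r ^ ((d : ℝ) / 2 - 1) : ℝ) : ℂ) := by
  have : Nonempty (Fin d) := ⟨⟨0, hd⟩⟩
  have : Nontrivial (EuclideanSpace ℝ (Fin d)) :=
    Module.nontrivial_of_finrank_pos (R := ℝ) (by simp; omega)
  set b : ℝ := (d : ℝ) / 2 with hb
  have hbpos : 0 < b := by positivity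
  have hΓ : 0 < Real.Gamma b := Real.Gamma_pos_of_pos hbpos
  have hball : (volume : Measure (EuclideanSpace ℝ (Fin d))).real (Metric.ball 0 1) =
      Real.pi ^ b / (b * Real.Gamma b) := by
    rw [Measure.real, EuclideanSpace.volume_ball, ENNReal.ofReal_one, one_pow, one_mul,
      ENNReal.toReal_ofReal (by positivity), Fintype.card_fin, Real.Gamma_add_one hbpos.ne',
      Real.sqrt_eq_rpow, ← Real.rpow_natCast, ← Real.rpow_mul Real.pi_pos.le]
    congr 2; rw [hb]; ring
  rw [integral_fun_norm_addHaar volume (fun x => F (x ^ 2 / 2)), hball, finrank_euclideanSpace_fin]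
  have h1 := integral_comp_rpow_Ioi_of_pos
    (g := fun y : ℝ => F (y / 2) * (((y / 2) ^ (b - 1) : ℝ) : ℂ)) (p := 2) two_pos
  have h2 := integral_comp_mul_left_Ioi (fun r : ℝ => F r * ((r ^ (b - 1) : ℝ) : ℂ)) 0
    (b := (2 : ℝ)⁻¹) (by norm_num)
  -- With r = y² / 2 one has y^{d-1} dy = (2r)^{b-1} dr.
  have h3 : ∫ y in Ioi (0 : ℝ), y ^ (d - 1) • F (y ^ 2 / 2) =
      ((2 ^ (b - 1) : ℝ) : ℂ) * ∫ r in Ioi (0 : ℝ), F r * ((r ^ (b - 1) : ℝ) : ℂ) := by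
    simp only [mul_zero, inv_inv] at h2
    have h4 : ∫ y in Ioi (0 : ℝ), F (y / 2) * (((y / 2) ^ (b - 1) : ℝ) : ℂ) =
        (2 : ℝ) • ∫ r in Ioi (0 : ℝ), F r * ((r ^ (b - 1) : ℝ) : ℂ) := by
      rw [← h2]
      refine integral_congr_ae (Eventually.of_forall fun y => ?_)
      simp only [div_eq_inv_mul]
    have h5 : ∫ y in Ioi (0 : ℝ), y ^ (d - 1) • F (y ^ 2 / 2) =
        ((2 ^ (b - 1) / 2 : ℝ) : ℂ) *
          ∫ y in Ioi (0 : ℝ), (2 * y ^ ((2 : ℝ) - 1)) •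
            (F (y ^ (2 : ℝ) / 2) * (((y ^ (2 : ℝ) / 2) ^ (b - 1) : ℝ) : ℂ)) := by
      rw [← integral_const_mul]
      refine setIntegral_congr_fun measurableSet_Ioi fun y hy => ?_
      have hy' : (0 : ℝ) < y := hy
      have e1 : y ^ (2 : ℝ) = y ^ 2 := by exact_mod_cast Real.rpow_natCast y 2
      have e2 : (y : ℝ) ^ (d - 1) = 2 ^ (b - 1) / 2 * ((2 * y) * (y ^ 2 / 2) ^ (b - 1)) := by
        rw [Real.div_rpow (by positivity) (by norm_num), ← Real.rpow_natCast y 2,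
          ← Real.rpow_mul hy'.le, ← Real.rpow_natCast y (d - 1), Nat.cast_sub hd,
          show ((d : ℝ) - ((1 : ℕ) : ℝ)) = 1 + ((2 : ℕ) : ℝ) * (b - 1) by push_cast; rw [hb]; ring,
          Real.rpow_add hy', Real.rpow_one]
        have : (0 : ℝ) < 2 ^ (b - 1) := by positivity
        field_simp
      simp only [e1]
      rw [show (2 : ℝ) - 1 = 1 by norm_num, Real.rpow_one, Complex.real_smul, Complex.real_smul, e2]
      push_cast
      ring
    rw [h5, h1, h4, Complex.real_smul, ← mul_assoc]
    congr 1; push_cast; ring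
  rw [h3, nsmul_eq_mul, Complex.real_smul, ← mul_assoc, ← mul_assoc]
  congr 1
  have e3 : (2 : ℝ) * 2 ^ (b - 1) = 2 ^ b := by
    rw [← Real.rpow_one_add' (by norm_num) (by linarith)]; congr 1; ring
  have e4 : (d : ℝ) * (Real.pi ^ b / (b * Real.Gamma b)) * 2 ^ (b - 1) =
      (2 * Real.pi) ^ b / Real.Gamma b := by
    rw [Real.mul_rpow (by norm_num) Real.pi_pos.le, ← e3, show (d : ℝ) = 2 * b by rw [hb]; ring]
    field_simp
  rw [← e4]; push_cast; ring

/-- Integration of a function of a positive definite quadratic form. -/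
theorem integral_comp_half_quadratic {d : ℕ} (hd : 1 ≤ d) {D : Matrix (Fin d) (Fin d) ℝ}
    (hD : D.PosDef) (F : ℝ → ℂ) :
    ∫ w : Fin d → ℝ, F (dotProduct w (D.mulVec w) / 2) =
      (((Real.sqrt D.det)⁻¹ * ((2 * Real.pi) ^ ((d : ℝ) / 2) / Real.Gamma ((d : ℝ) / 2)) : ℝ) : ℂ) *
        ∫ r in Ioi (0 : ℝ), F r * ((r ^ ((d : ℝ) / 2 - 1) : ℝ) : ℂ) := by
  -- The substitution w ↦ S w turns the form into the Euclidean norm squared, with Jacobian |det S|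
  -- = √det D.
  obtain ⟨S, hS⟩ := exists_eq_transpose_mul_self hD
  have hdet : D.det = S.det ^ 2 := by rw [hS, Matrix.det_mul, Matrix.det_transpose, sq]
  have hSdet : S.det ≠ 0 := fun h0 => by
    have := hD.det_pos
    rw [hdet, h0] at this
    simp at this
  have hsqrt : Real.sqrt D.det = |S.det| := by rw [hdet, Real.sqrt_sq_eq_abs]
  have hq : ∀ w : Fin d → ℝ, dotProduct w (D.mulVec w) =
      ‖(WithLp.toLp 2 (S.mulVec w) : EuclideanSpace ℝ (Fin d))‖ ^ 2 := fun w => by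
    rw [EuclideanSpace.real_norm_sq_eq, hS, ← Matrix.mulVec_mulVec, Matrix.dotProduct_mulVec,
      Matrix.vecMul_transpose]
    simp [dotProduct, sq]
  have hlin : ∫ w : Fin d → ℝ,
      F (‖(WithLp.toLp 2 (Matrix.toLin' S w) : EuclideanSpace ℝ (Fin d))‖ ^ 2 / 2) =
      ((|S.det|⁻¹ : ℝ) : ℂ) *
        ∫ w : Fin d → ℝ, F (‖(WithLp.toLp 2 w : EuclideanSpace ℝ (Fin d))‖ ^ 2 / 2) := by
    have hm := Real.map_matrix_volume_pi_eq_smul_volume_pi hSdet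
    have hemb : MeasurableEmbedding (Matrix.toLin' S) := by
      have hinj : Function.Injective (Matrix.toLin' S) := by
        rw [Matrix.toLin'_apply', Matrix.coe_mulVecLin]
        exact Matrix.mulVec_injective_iff_isUnit.2 ((Matrix.isUnit_iff_isUnit_det S).2
          (isUnit_iff_ne_zero.2 hSdet))
      exact (LinearMap.continuous_of_finiteDimensional _).measurableEmbedding hinj
    have := hemb.integral_map (μ := volume)
      (fun w => F (‖(WithLp.toLp 2 w : EuclideanSpace ℝ (Fin d))‖ ^ 2 / 2))
    rw [← this, hm, integral_smul_measure, ENNReal.toReal_ofReal (abs_nonneg _), abs_inv,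
      Complex.real_smul]
  have hvol := (PiLp.volume_preserving_toLp (Fin d)).integral_comp
    (MeasurableEquiv.toLp 2 (Fin d → ℝ)).measurableEmbedding
    (fun w : EuclideanSpace ℝ (Fin d) => F (‖w‖ ^ 2 / 2))
  simp only [hq]
  simp only [Matrix.toLin'_apply] at hlin
  rw [hlin, hvol, integral_comp_half_norm_sq hd, hsqrt]
  push_cast; ring

/-- Determinant of a restricted quadratic form, for the same number of rows and columns. -/
theorem det_transpose_mul_mul {ι κ : Type*} [Fintype ι] [DecidableEq ι] [Fintype κ] [DecidableEq κ]
    (e : ι ≃ κ) (X : Matrix κ ι ℝ) (M : Matrix κ κ ℝ) :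
    (X.transpose * M * X).det = M.det * (X.transpose * X).det := by
  have h1 : X.transpose * M * X = (X.submatrix e id).transpose * M.submatrix e e *
      X.submatrix e id := by
    rw [Matrix.transpose_submatrix, Matrix.submatrix_mul_equiv, Matrix.submatrix_mul_equiv,
      Matrix.submatrix_id_id]
  have h2 : X.transpose * X = (X.submatrix e id).transpose * X.submatrix e id := by
    rw [Matrix.transpose_submatrix, Matrix.submatrix_mul_equiv, Matrix.submatrix_id_id]
  rw [h1, h2, Matrix.det_mul, Matrix.det_mul, Matrix.det_mul, Matrix.det_submatrix_equiv_self]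
  ring

/-! ### Second order expansion of the phase at the critical direction -/

section Taylor

variable {E : Type*} [NormedAddCommGroup E] [NormedSpace ℝ E]

theorem iteratedFDeriv_two_smul (f : E → ℝ) (a η : E) (c : ℝ) :
    iteratedFDeriv ℝ 2 f a ![c • η, c • η] = c ^ 2 * iteratedFDeriv ℝ 2 f a ![η, η] := by
  rw [iteratedFDeriv_two_apply, iteratedFDeriv_two_apply]
  simp; ring

theorem continuous_iteratedFDeriv_two (f : E → ℝ) (a : E) :
    Continuous fun η => iteratedFDeriv ℝ 2 f a ![η, η] := by
  simp only [iteratedFDeriv_two_apply]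
  simp only [Matrix.cons_val_zero, Matrix.cons_val_one]
  fun_prop

/-- Taylor's formula of order two. -/
theorem eventually_abs_taylor_two_le {f : E → ℝ} {a : E} (hf : ContDiffAt ℝ 2 f a) {η : ℝ}
    (hη : 0 < η) :
    ∀ᶠ v in 𝓝 (0 : E), |f (a + v) - f a - fderiv ℝ f a v - iteratedFDeriv ℝ 2 f a ![v, v] / 2| ≤
      η * ‖v‖ ^ 2 := by
  have hd : ∀ᶠ x in 𝓝 a, DifferentiableAt ℝ f x :=
    (hf.eventually (by simp)).mono fun x hx => hx.differentiableAt (by norm_num)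
  have hd2 : DifferentiableAt ℝ (fderiv ℝ f) a :=
    (hf.fderiv_right (m := 1) (by norm_num)).differentiableAt (by norm_num)
  have hsymm : IsSymmSndFDerivAt ℝ f a := hf.isSymmSndFDerivAt (by simp)
  set A := fderiv ℝ (fderiv ℝ f) a with hA
  have hlo := (hasFDerivAt_iff_isLittleO_nhds_zero.1 hd2.hasFDerivAt).def hη
  have hdv : ∀ᶠ v in 𝓝 (0 : E), DifferentiableAt ℝ f (a + v) := by
    have : Tendsto (fun v : E => a + v) (𝓝 0) (𝓝 a) := by
      simpa using (continuous_const.add continuous_id).tendsto (0 : E) (f := fun v : E => a + v)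
    exact this.eventually hd
  obtain ⟨ρ, hρ, hball⟩ := Metric.eventually_nhds_iff_ball.1 (hlo.and hdv)
  filter_upwards [Metric.ball_mem_nhds (0 : E) hρ] with v hv
  -- By symmetry of the second derivative A, the derivative of this remainder is f'(a + w) - f'(a) -
  -- A w, which is o(‖w‖); the mean value inequality then gives o(‖v‖²).
  set k : E → ℝ := fun w => f (a + w) - f a - fderiv ℝ f a w - A w w / 2 with hk
  have hder : ∀ w ∈ Metric.ball (0 : E) ρ,
      HasFDerivAt k (fderiv ℝ f (a + w) - fderiv ℝ f a - A w) w := fun w hw => by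
    have h1 : HasFDerivAt (fun w => f (a + w)) (fderiv ℝ f (a + w)) w := by
      have := ((hball w hw).2.hasFDerivAt (x := a + w)).comp w ((hasFDerivAt_id w).const_add a)
      simpa [Function.comp_def] using this
    have h2 : HasFDerivAt (fun w => A w w) (A w + A.flip w) w := by
      have := (A.hasFDerivAt (x := w)).clm_apply (hasFDerivAt_id w)
      simpa using this
    have h3 : A.flip w = A w := by
      ext z
      exact hsymm z w
    rw [h3] at h2
    have h4 := ((h1.sub_const (f a)).sub (fderiv ℝ f a).hasFDerivAt).sub
      (h2.const_mul (1 / 2 : ℝ))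
    refine (h4.congr_of_eventuallyEq (Eventually.of_forall fun z => ?_)).congr_fderiv ?_
    · simp only [hk, Pi.sub_apply]; ring
    · ext z
      simp; ring
  have hv0 : ‖v‖ < ρ := by simpa using hv
  have hsub : Metric.closedBall (0 : E) ‖v‖ ⊆ Metric.ball 0 ρ := Metric.closedBall_subset_ball hv0
  have := (convex_closedBall (0 : E) ‖v‖).norm_image_sub_le_of_norm_hasFDerivWithin_le
    (f := k) (C := η * ‖v‖) (fun w hw => (hder w (hsub hw)).hasFDerivWithinAt)
    (fun w hw => ((hball w (hsub hw)).1).trans (by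
      have : ‖w‖ ≤ ‖v‖ := by simpa using hw
      gcongr)) (Metric.mem_closedBall_self (norm_nonneg _)) (y := v) (by simp)
  have hk0 : k 0 = 0 := by simp [hk]
  rw [hk0, sub_zero, sub_zero, Real.norm_eq_abs] at this
  rw [iteratedFDeriv_two_apply]
  refine this.trans (le_of_eq (by ring))

end Taylor

section Phase

variable {d : ℕ} {H : Space d → ℝ} {Θ₀ x₀ : Space d}

/-- The function `α·x₀ - H(α)`. -/
noncomputable def phase (H : Space d → ℝ) (x₀ α : Space d) : ℝ := inner ℝ α x₀ - H α

/-- Euler's relation: differentiate H(cΘ₀) = c H(Θ₀) at c = 1. -/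
theorem apply_eq_inner_gradient (hH : ∀ c : ℝ, 0 < c → ∀ ξ : Space d, ξ ≠ 0 → H (c • ξ) = c * H ξ)
    (h0 : Θ₀ ≠ 0) (hx : HasGradientAt H x₀ Θ₀) : H Θ₀ = inner ℝ Θ₀ x₀ := by
  have h1 : HasDerivAt (fun c : ℝ => c • Θ₀) Θ₀ 1 := by
    simpa using (hasDerivAt_id (1 : ℝ)).smul_const Θ₀
  have hx' : HasFDerivAt H (InnerProductSpace.toDual ℝ (Space d) x₀) ((1 : ℝ) • Θ₀) := by
    rw [one_smul]; exact hx.hasFDerivAt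
  have h2 := hx'.comp_hasDerivAt (1 : ℝ) h1
  have h3 : HasDerivAt (fun c : ℝ => c * H Θ₀) (H Θ₀) 1 := by
    simpa using (hasDerivAt_id (1 : ℝ)).mul_const (H Θ₀)
  have h4 : (H ∘ fun c : ℝ => c • Θ₀) =ᶠ[𝓝 1] fun c => c * H Θ₀ := by
    filter_upwards [lt_mem_nhds (one_pos : (0 : ℝ) < 1)] with c hc
    exact hH c hc Θ₀ h0
  have h5 := (h3.congr_of_eventuallyEq h4).unique h2
  rw [h5, real_inner_comm]
  simp

/-- The value at Θ₀ vanishes by Euler's relation and the linear term because H'(Θ₀) = x₀, so only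
the Hessian is left. The displacement v need not be tangential. -/
theorem eventually_abs_phase_sub_le (hs : ContDiffOn ℝ ∞ H {0}ᶜ)
    (hH : ∀ c : ℝ, 0 < c → ∀ ξ : Space d, ξ ≠ 0 → H (c • ξ) = c * H ξ)
    (h0 : Θ₀ ≠ 0) (hx : HasGradientAt H x₀ Θ₀) {η : ℝ} (hη : 0 < η) :
    ∀ᶠ v in 𝓝 (0 : Space d),
      |phase H x₀ (Θ₀ + v) - (-iteratedFDeriv ℝ 2 H Θ₀ ![v, v]) / 2| ≤ η * ‖v‖ ^ 2 := by
  have hc : ContDiffAt ℝ 2 H Θ₀ :=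
    (hs.contDiffAt (isOpen_compl_singleton.mem_nhds h0)).of_le (by exact WithTop.coe_le_coe.2 le_top)
  filter_upwards [eventually_abs_taylor_two_le hc hη] with v hv
  rw [← abs_neg]
  convert hv using 2
  rw [phase, inner_add_left, ← apply_eq_inner_gradient hH h0 hx, hx.hasFDerivAt.fderiv,
    InnerProductSpace.toDual_apply_apply, real_inner_comm]
  ring

end Phase

/-! ### The tangential Hessian and a quadratic lower bound for the phase -/

section Hessian

variable {d : ℕ} {H : Space d → ℝ} {Θ₀ x₀ : Space d}

/-- The coordinates in the tangent plane at `Θ₀`. -/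
noncomputable def tangentCoord (Θ₀ ζ : Space d) :
    Fin (Module.finrank ℝ (Submodule.span ℝ {Θ₀})ᗮ) → ℝ :=
  fun a => inner ℝ ((stdOrthonormalBasis ℝ (Submodule.span ℝ {Θ₀})ᗮ) a : Space d) ζ

theorem eq_sum_tangentCoord {ζ : Space d} (hζ : inner ℝ Θ₀ ζ = 0) :
    ζ = ∑ a, tangentCoord Θ₀ ζ a • ((stdOrthonormalBasis ℝ (Submodule.span ℝ {Θ₀})ᗮ) a : Space d) := by
  have hmem : ζ ∈ (Submodule.span ℝ {Θ₀})ᗮ := Submodule.mem_orthogonal_singleton_iff_inner_right.2 hζ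
  have := congrArg Subtype.val
    ((stdOrthonormalBasis ℝ (Submodule.span ℝ {Θ₀})ᗮ).sum_repr' ⟨ζ, hmem⟩)
  simpa [tangentCoord] using this.symm

theorem inner_eq_sum_tangentCoord {ζ ξ : Space d} (hζ : inner ℝ Θ₀ ζ = 0) :
    inner ℝ ζ ξ = ∑ a, tangentCoord Θ₀ ζ a * tangentCoord Θ₀ ξ a := by
  conv_lhs => rw [eq_sum_tangentCoord hζ]
  simp [sum_inner, inner_smul_left, tangentCoord]

theorem hessian_eq_sum {ζ ξ : Space d} (hζ : inner ℝ Θ₀ ζ = 0) (hξ : inner ℝ Θ₀ ξ = 0) :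
    iteratedFDeriv ℝ 2 H Θ₀ ![ζ, ξ] = ∑ a, ∑ c,
      tangentCoord Θ₀ ζ a * tangentHessian H Θ₀ a c * tangentCoord Θ₀ ξ c := by
  conv_lhs => rw [eq_sum_tangentCoord hζ, eq_sum_tangentCoord hξ, iteratedFDeriv_two_apply]
  simp only [Matrix.cons_val_zero, Matrix.cons_val_one, map_sum, map_smul, tangentHessian,
    iteratedFDeriv_two_apply, Matrix.of_apply, sum_apply,
    smul_apply, smul_eq_mul, Finset.mul_sum]
  rw [Finset.sum_comm]
  refine Finset.sum_congr rfl fun a _ => Finset.sum_congr rfl fun c _ => ?_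
  ring

theorem neg_hessian_pos (hM : (-(tangentHessian H Θ₀)).PosDef) {ζ : Space d}
    (hζ : inner ℝ Θ₀ ζ = 0) (h0 : ζ ≠ 0) : 0 < -iteratedFDeriv ℝ 2 H Θ₀ ![ζ, ζ] := by
  have hx : tangentCoord Θ₀ ζ ≠ 0 := fun h => h0 (by
    rw [eq_sum_tangentCoord hζ, h]; simp)
  have := hM.dotProduct_mulVec_pos hx
  rw [hessian_eq_sum hζ hζ]
  refine this.trans_eq ?_
  simp only [dotProduct, Matrix.mulVec, Matrix.neg_apply, Finset.mul_sum, star_trivial,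
    ← Finset.sum_neg_distrib]
  refine Finset.sum_congr rfl fun a _ => Finset.sum_congr rfl fun c _ => ?_
  ring

/-- Minimum over the compact unit sphere of the tangent plane, extended by homogeneity. -/
theorem exists_le_neg_hessian (hM : (-(tangentHessian H Θ₀)).PosDef) :
    ∃ c > 0, ∀ ζ : Space d, inner ℝ Θ₀ ζ = 0 →
      c * ‖ζ‖ ^ 2 ≤ -iteratedFDeriv ℝ 2 H Θ₀ ![ζ, ζ] := by
  set K : Set (Space d) := {ζ | inner ℝ Θ₀ ζ = 0} ∩ Metric.sphere 0 1 with hK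
  have hKc : IsCompact K := (isCompact_sphere (0 : Space d) 1).inter_left
    (isClosed_eq (by fun_prop) continuous_const)
  have hcont : Continuous fun ζ : Space d => -iteratedFDeriv ℝ 2 H Θ₀ ![ζ, ζ] :=
    (continuous_iteratedFDeriv_two H Θ₀).neg
  have hnorm : ∀ ζ : Space d, ζ ≠ 0 → inner ℝ Θ₀ ζ = 0 → ‖ζ‖⁻¹ • ζ ∈ K := fun ζ h0 hζ => by
    refine ⟨?_, ?_⟩
    · simp [inner_smul_right, hζ]
    · rw [mem_sphere_zero_iff_norm, norm_smul, norm_inv, norm_norm,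
        inv_mul_cancel₀ (norm_ne_zero_iff.2 h0)]
  rcases K.eq_empty_or_nonempty with he | hne
  · refine ⟨1, one_pos, fun ζ hζ => ?_⟩
    rcases eq_or_ne ζ 0 with rfl | h0
    · have := iteratedFDeriv_two_smul H Θ₀ 0 0
      simp only [smul_zero] at this
      rw [this]; simp
    · exact absurd (hnorm ζ h0 hζ) (by rw [he]; simp)
  · obtain ⟨ζ₀, hζ₀, hmin⟩ := hKc.exists_isMinOn hne hcont.continuousOn
    have hζ₀0 : ζ₀ ≠ 0 := fun h => by
      have := hζ₀.2
      rw [h] at this; simp at this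
    refine ⟨_, neg_hessian_pos hM hζ₀.1 hζ₀0, fun ζ hζ => ?_⟩
    rcases eq_or_ne ζ 0 with rfl | h0
    · have := iteratedFDeriv_two_smul H Θ₀ 0 0
      simp only [smul_zero] at this
      rw [this]; simp
    · have h1 := hmin (hnorm ζ h0 hζ)
      simp only [mem_ofPred_eq, iteratedFDeriv_two_smul] at h1
      have h2 : 0 < ‖ζ‖ ^ 2 := by positivity
      calc _ ≤ -((‖ζ‖⁻¹) ^ 2 * iteratedFDeriv ℝ 2 H Θ₀ ![ζ, ζ]) * ‖ζ‖ ^ 2 := by gcongr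
        _ = _ := by field_simp

/-- The phase is bounded below by a multiple of the squared distance on the sphere. -/
theorem exists_le_phase (hs : ContDiffOn ℝ ∞ H {0}ᶜ)
    (hH : ∀ c : ℝ, 0 < c → ∀ ξ : Space d, ξ ≠ 0 → H (c • ξ) = c * H ξ)
    (hΘ : ‖Θ₀‖ = 1) (hx : HasGradientAt H x₀ Θ₀) (hM : (-(tangentHessian H Θ₀)).PosDef) :
    ∃ c > 0, ∃ r > 0, ∀ α : Space d, ‖α‖ = 1 → ‖α - Θ₀‖ < r →
      c * ‖α - Θ₀‖ ^ 2 ≤ phase H x₀ α := by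
  have h0 : Θ₀ ≠ 0 := fun h => by simp [h] at hΘ
  obtain ⟨c, hc, hcb⟩ := exists_le_neg_hessian hM
  have h1 := eventually_abs_phase_sub_le hs hH h0 hx (η := c / 8) (by positivity)
  -- If Θ₀ + v lies on the sphere then ⟨Θ₀, v⟩ = -‖v‖² / 2, so P v is the tangential projection of
  -- v. The normal part is quadratic in v and changes the Hessian term only by O(‖v‖³).
  set P : Space d → Space d := fun v => v + (‖v‖ ^ 2 / 2) • Θ₀ with hP
  obtain ⟨B, hB0, hB⟩ : ∃ B > 0, ∀ v : Space d, ‖v‖ ≤ 1 →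
      |iteratedFDeriv ℝ 2 H Θ₀ ![v, v] - iteratedFDeriv ℝ 2 H Θ₀ ![P v, P v]| ≤ B * ‖v‖ ^ 3 := by
    set A := fderiv ℝ (fderiv ℝ H) Θ₀ with hA
    refine ⟨2 * ‖A‖ + 1, by positivity, fun v hv => ?_⟩
    simp only [iteratedFDeriv_two_apply, Matrix.cons_val_zero, Matrix.cons_val_one, ← hA, hP]
    have e : A v v - A (v + (‖v‖ ^ 2 / 2) • Θ₀) (v + (‖v‖ ^ 2 / 2) • Θ₀) =
        -(‖v‖ ^ 2 / 2) * (A v Θ₀ + A Θ₀ v + (‖v‖ ^ 2 / 2) * A Θ₀ Θ₀) := by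
      simp; ring
    have b1 : |A v Θ₀| ≤ ‖A‖ * ‖v‖ := by simpa [hΘ] using A.le_opNorm₂ v Θ₀
    have b2 : |A Θ₀ v| ≤ ‖A‖ * ‖v‖ := by simpa [hΘ] using A.le_opNorm₂ Θ₀ v
    have b3 : |A Θ₀ Θ₀| ≤ ‖A‖ := by simpa [hΘ] using A.le_opNorm₂ Θ₀ Θ₀
    rw [e, abs_mul, abs_neg, abs_of_nonneg (by positivity : (0 : ℝ) ≤ ‖v‖ ^ 2 / 2)]
    have b4 : |(‖v‖ ^ 2 / 2) * A Θ₀ Θ₀| ≤ ‖v‖ * ‖A‖ := by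
      rw [abs_mul, abs_of_nonneg (by positivity : (0 : ℝ) ≤ ‖v‖ ^ 2 / 2)]
      have : ‖v‖ ^ 2 / 2 ≤ ‖v‖ := by nlinarith [norm_nonneg v]
      gcongr
    have b5 := abs_add_le (A v Θ₀ + A Θ₀ v) ((‖v‖ ^ 2 / 2) * A Θ₀ Θ₀)
    have b6 := abs_add_le (A v Θ₀) (A Θ₀ v)
    calc _ ≤ ‖v‖ ^ 2 / 2 * (3 * ‖A‖ * ‖v‖) := by gcongr; linarith
      _ ≤ _ := by
        have : 0 ≤ ‖v‖ ^ 3 := by positivity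
        have : 0 ≤ ‖A‖ * ‖v‖ ^ 3 := by positivity
        nlinarith
  obtain ⟨ρ, hρ, hball⟩ := Metric.eventually_nhds_iff_ball.1 h1
  -- Budget in units of c‖v‖²: the tangential form gives 3/8, the cubic correction costs 1/16 and
  -- the Taylor error 1/8, so more than 1/8 remains.
  refine ⟨c / 8, by positivity, min ρ (min (1 / 2) (c / (8 * B))), by positivity, fun α hα hr => ?_⟩
  set v := α - Θ₀ with hv
  obtain ⟨hr1, hr2, hr3⟩ : ‖v‖ < ρ ∧ ‖v‖ < 1 / 2 ∧ ‖v‖ < c / (8 * B) := by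
    simpa [lt_min_iff] using hr
  have hαv : α = Θ₀ + v := by rw [hv]; abel
  have hin : inner ℝ Θ₀ v = -(‖v‖ ^ 2 / 2) := by
    have : ‖α‖ ^ 2 = ‖Θ₀‖ ^ 2 + 2 * inner ℝ Θ₀ v + ‖v‖ ^ 2 := by
      rw [hαv, norm_add_sq_real]
    rw [hα, hΘ] at this
    linarith
  have hPo : inner ℝ Θ₀ (P v) = 0 := by
    simp only [hP, inner_add_right, inner_smul_right, hin, real_inner_self_eq_norm_sq, hΘ]
    ring
  have hPn : 3 / 4 * ‖v‖ ^ 2 ≤ ‖P v‖ ^ 2 := by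
    have e : ‖P v‖ ^ 2 = ‖v‖ ^ 2 - ‖v‖ ^ 4 / 4 := by
      simp only [hP]
      rw [norm_add_sq_real, inner_smul_right, real_inner_comm, hin, norm_smul, hΘ,
        Real.norm_of_nonneg (by positivity : (0 : ℝ) ≤ ‖v‖ ^ 2 / 2)]
      ring
    rw [e]
    have h4 : ‖v‖ ^ 2 ≤ 1 := by nlinarith [norm_nonneg v]
    nlinarith [sq_nonneg (‖v‖)]
  have e1 := abs_le.1 (hball v (by simpa using hr1))
  have e2 := abs_le.1 (hB v (by linarith))
  have e3 := hcb _ hPo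
  rw [hαv]
  have e4 : B * ‖v‖ ^ 3 ≤ c / 8 * ‖v‖ ^ 2 := by
    have : B * ‖v‖ ≤ c / 8 := by
      rw [lt_div_iff₀ (by positivity)] at hr3
      linarith
    calc B * ‖v‖ ^ 3 = (B * ‖v‖) * ‖v‖ ^ 2 := by ring
      _ ≤ _ := by gcongr
  have e5 : c * (3 / 4 * ‖v‖ ^ 2) ≤ c * ‖P v‖ ^ 2 := by gcongr
  have e6 : 0 ≤ c * ‖v‖ ^ 2 := by positivity
  linarith [e1.1, e2.1, e2.2]

end Hessian

/-! ### Metric properties of charts of directions -/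

namespace IsDirectionChart

variable {d : ℕ} {T : Param d → Space d} {U : Set (Param d)} {Ω : Set (Space d)}
  {H : Space d → ℝ} {Θ₀ x₀ : Space d}

theorem contDiffAt (h : IsDirectionChart T U Ω) (hU : IsOpen U) {v : Param d} (hv : v ∈ U) :
    ContDiffAt ℝ ∞ T v := h.smooth.contDiffAt (hU.mem_nhds hv)

theorem differentiableAt (h : IsDirectionChart T U Ω) (hU : IsOpen U) {v : Param d} (hv : v ∈ U) :
    DifferentiableAt ℝ T v := (h.contDiffAt hU hv).differentiableAt (by simp)

theorem hasStrictFDerivAt (h : IsDirectionChart T U Ω) (hU : IsOpen U) {v : Param d} (hv : v ∈ U) :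
    HasStrictFDerivAt T (fderiv ℝ T v) v := (h.contDiffAt hU hv).hasStrictFDerivAt (by simp)

theorem norm_eq_one (h : IsDirectionChart T U Ω) (hΩ : Ω ⊆ unitSphere d) {v : Param d}
    (hv : v ∈ U) : ‖T v‖ = 1 := by
  have := hΩ (h.bijOn.mapsTo hv)
  simpa using this

theorem inner_fderiv_eq_zero (h : IsDirectionChart T U Ω) (hU : IsOpen U) (hΩ : Ω ⊆ unitSphere d)
    {v : Param d} (hv : v ∈ U) (z : Param d) : inner ℝ (T v) (fderiv ℝ T v z) = 0 := by
  have h1 := (h.differentiableAt hU hv).hasFDerivAt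
  have h2 := h1.norm_sq
  have h3 : (fun v => ‖T v‖ ^ 2) =ᶠ[𝓝 v] fun _ => (1 : ℝ) := by
    filter_upwards [hU.mem_nhds hv] with w hw
    rw [h.norm_eq_one hΩ hw, one_pow]
  have h4 := h2.unique ((hasFDerivAt_const (1 : ℝ) v).congr_of_eventuallyEq h3)
  have h5 := congrArg (fun A : Param d →L[ℝ] ℝ => A z) h4
  simpa using h5

/-- T maps into a hypersurface and cannot be open into the ambient space. Adding the radial variable
makes the differential bijective, since T(v) is normal to the image of T'(v); the open mapping form
of the inverse function theorem then replaces continuity of T⁻¹. -/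
theorem map_smul_nhds (h : IsDirectionChart T U Ω) (hU : IsOpen U) (hΩ : Ω ⊆ unitSphere d)
    {v : Param d} (hv : v ∈ U) :
    map (fun p : ℝ × Param d => p.1 • T p.2) (𝓝 (1, v)) = 𝓝 (T v) := by
  have h1 := (h.hasStrictFDerivAt hU hv)
  have h2 : HasStrictFDerivAt (fun p : ℝ × Param d => p.1 • T p.2) _ (1, v) :=
    (hasStrictFDerivAt_fst (𝕜 := ℝ) (p := ((1 : ℝ), v))).smul
      (HasStrictFDerivAt.comp (𝕜 := ℝ) ((1 : ℝ), v) (g := T) (f := Prod.snd) h1 hasStrictFDerivAt_snd)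
  have h3 := h2.map_nhds_eq_of_surj (LinearMap.range_eq_top.2 ?_)
  · simpa using h3
  · have hfin : Module.finrank ℝ (ℝ × Param d) = Module.finrank ℝ (Space d) := by simp; ring
    refine (LinearMap.injective_iff_surjective_of_finrank_eq_finrank hfin).1 ?_
    rw [injective_iff_map_eq_zero]
    rintro ⟨c, z⟩ hz
    have hz' : fderiv ℝ T v z + c • T v = 0 := by simpa using hz
    have hc : c = 0 := by
      have := congrArg (fun y => inner ℝ (T v) y) hz'
      simp only [inner_add_right, h.inner_fderiv_eq_zero hU hΩ hv, inner_smul_right,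
        real_inner_self_eq_norm_sq, h.norm_eq_one hΩ hv, inner_zero_right] at this
      simpa using this
    rw [hc, zero_smul, add_zero] at hz'
    have hz0 : z = 0 := h.immersion v hv (by rw [hz', map_zero])
    rw [hc, hz0]; rfl

/-- K is covered by finitely many cones over images of compact neighbourhoods in U. A point of K in
such a cone has radial factor 1 by comparing norms, and injectivity of T puts its parameter in the
compact set. -/
theorem exists_isCompact_of_mem (h : IsDirectionChart T U Ω) (hU : IsOpen U)
    (hΩ : Ω ⊆ unitSphere d) {K : Set (Space d)} (hK : IsCompact K) (hKΩ : K ⊆ Ω) :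
    ∃ C : Set (Param d), IsCompact C ∧ C ⊆ U ∧ ∀ v ∈ U, T v ∈ K → v ∈ C := by
  have hN : ∀ α ∈ K, ∃ C : Set (Param d), IsCompact C ∧ C ⊆ U ∧
      (fun p : ℝ × Param d => p.1 • T p.2) '' (Ioi 0 ×ˢ C) ∈ 𝓝 α := by
    intro α hα
    obtain ⟨v, hv, rfl⟩ := h.bijOn.surjOn (hKΩ hα)
    obtain ⟨C, hC, hvC, hCU⟩ := exists_compact_subset hU hv
    refine ⟨C, hC, hCU, ?_⟩
    rw [← h.map_smul_nhds hU hΩ hv]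
    exact image_mem_map (prod_mem_nhds (Ioi_mem_nhds one_pos) (mem_interior_iff_mem_nhds.1 hvC))
  choose! C hC hCU hCN using hN
  obtain ⟨t, htK, htc⟩ := hK.elim_nhds_subcover _ hCN
  refine ⟨⋃ α ∈ t, C α, t.isCompact_biUnion fun α hα => hC α (htK α hα),
    iUnion₂_subset fun α hα => hCU α (htK α hα), fun v hv hvK => ?_⟩
  obtain ⟨α, hα, ⟨ρ, w⟩, ⟨hρ, hw⟩, hρw⟩ := mem_iUnion₂.1 (htc hvK)
  have hwU := hCU α (htK α hα) hw
  simp only at hρw hw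
  have hρ' : (0 : ℝ) < ρ := hρ
  have h1 : ρ = 1 := by
    have := congrArg norm hρw
    rw [norm_smul, h.norm_eq_one hΩ hwU, h.norm_eq_one hΩ hv, Real.norm_of_nonneg hρ'.le] at this
    linarith
  rw [h1, one_smul] at hρw
  have : w = v := h.bijOn.injOn hwU hv hρw
  exact mem_iUnion₂.2 ⟨α, hα, this ▸ hw⟩

/-- Near 0 the injective differential dominates the nonlinear error; away from 0 injectivity of T
and compactness give a positive minimum. -/
theorem exists_mul_norm_le (h : IsDirectionChart T U Ω) (hU : IsOpen U) (h0 : (0 : Param d) ∈ U)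
    {C : Set (Param d)} (hC : IsCompact C) (hCU : C ⊆ U) :
    ∃ c > 0, ∀ v ∈ C, c * ‖v‖ ≤ ‖T v - T 0‖ := by
  have hs := h.hasStrictFDerivAt hU h0
  obtain ⟨K, hKpos, hK⟩ := (fderiv ℝ T 0).exists_antilipschitzWith
    (LinearMap.ker_eq_bot.2 (h.immersion 0 h0))
  have hKpos' : (0 : ℝ) < K := hKpos
  have hlo := (hasFDerivAt_iff_isLittleO_nhds_zero.1 hs.hasFDerivAt).def
    (c := (2 * K : ℝ)⁻¹) (by positivity)
  obtain ⟨ρ, hρ, hball⟩ := Metric.eventually_nhds_iff_ball.1 hlo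
  have hnear : ∀ v : Param d, ‖v‖ < ρ → (2 * K : ℝ)⁻¹ * ‖v‖ ≤ ‖T v - T 0‖ := fun v hv => by
    have h1 := hball v (by simpa using hv)
    rw [zero_add] at h1
    have h2 : ‖v‖ ≤ K * ‖fderiv ℝ T 0 v‖ := by
      simpa [dist_eq_norm] using hK.le_mul_dist v 0
    have h3 : (K : ℝ)⁻¹ * ‖v‖ ≤ ‖fderiv ℝ T 0 v‖ := by rw [inv_mul_le_iff₀ hKpos']; exact h2
    have h4 : ‖fderiv ℝ T 0 v‖ ≤ ‖T v - T 0‖ + ‖T v - T 0 - fderiv ℝ T 0 v‖ := by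
      have := norm_sub_le (T v - T 0) (T v - T 0 - fderiv ℝ T 0 v)
      simpa using this
    have h5 : (2 * K : ℝ)⁻¹ * ‖v‖ = (K : ℝ)⁻¹ * ‖v‖ / 2 := by field_simp
    linarith
  have hcont : ContinuousOn (fun v => ‖T v - T 0‖) (C \ Metric.ball 0 ρ) := fun v hv =>
    ((h.differentiableAt hU (hCU hv.1)).continuousAt.sub
      continuousAt_const).norm.continuousWithinAt
  obtain ⟨B, hB0, hB⟩ : ∃ B > 0, ∀ v ∈ C, ‖v‖ ≤ B := by
    obtain ⟨B, hB⟩ := hC.isBounded.exists_norm_le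
    exact ⟨max B 1, by positivity, fun v hv => (hB v hv).trans (le_max_left _ _)⟩
  rcases (C \ Metric.ball (0 : Param d) ρ).eq_empty_or_nonempty with he | hne
  · refine ⟨(2 * K : ℝ)⁻¹, by positivity, fun v hv => hnear v ?_⟩
    by_contra hlt
    have : v ∈ C \ Metric.ball (0 : Param d) ρ := ⟨hv, by simpa using hlt⟩
    rw [he] at this; exact this
  · obtain ⟨v₀, hv₀, hmin⟩ := (hC.diff Metric.isOpen_ball).exists_isMinOn hne hcont
    have hpos : 0 < ‖T v₀ - T 0‖ := by
      rw [norm_pos_iff, sub_ne_zero]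
      intro heq
      have := h.bijOn.injOn (hCU hv₀.1) h0 heq
      rw [this] at hv₀
      exact hv₀.2 (Metric.mem_ball_self hρ)
    refine ⟨min (2 * K : ℝ)⁻¹ (‖T v₀ - T 0‖ / B), by positivity, fun v hv => ?_⟩
    by_cases hv1 : ‖v‖ < ρ
    · exact (mul_le_mul_of_nonneg_right (min_le_left _ _) (norm_nonneg _)).trans (hnear v hv1)
    · calc _ ≤ ‖T v₀ - T 0‖ / B * B := by
            gcongr
            · exact min_le_right _ _
            · exact hB v hv
        _ = ‖T v₀ - T 0‖ := by field_simp
        _ ≤ _ := hmin (show v ∈ C \ Metric.ball 0 ρ from ⟨hv, by simpa using hv1⟩)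

/-- The differential is Lipschitz near 0. The bound is applied with ‖v‖ of order √ε and ‖z‖ = εl:
after division by ε the error is of order (1 + √ε l) √ε l, small if √ε l is. -/
theorem exists_norm_increment_le (h : IsDirectionChart T U Ω) (hU : IsOpen U)
    (h0 : (0 : Param d) ∈ U) :
    ∃ K ≥ 0, ∃ ρ > 0, ∀ v z : Param d, ‖v‖ < ρ → ‖v + z‖ < ρ →
      ‖T (v + z) - T v - fderiv ℝ T 0 z‖ ≤ K * (‖v‖ + ‖z‖) * ‖z‖ := by
  have hc : ContDiffAt ℝ 1 (fderiv ℝ T) 0 :=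
    (h.contDiffAt hU h0).fderiv_right (m := 1) (by rw [one_add_one_eq_two]; exact WithTop.coe_le_coe.2 le_top)
  obtain ⟨K, t, ht, hK⟩ := hc.exists_lipschitzOnWith
  obtain ⟨ρ, hρ, hball⟩ := Metric.mem_nhds_iff.1 (inter_mem ht (hU.mem_nhds h0))
  refine ⟨K, K.2, ρ, hρ, fun v z hv hz => ?_⟩
  have hmem : ∀ w : Param d, ‖w‖ < ρ → w ∈ t ∩ U := fun w hw => hball (by simpa using hw)
  have hseg : segment ℝ v (v + z) ⊆ Metric.ball 0 ρ :=
    (convex_ball (0 : Param d) ρ).segment_subset (by simpa using hv) (by simpa using hz)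
  have := (convex_segment v (v + z)).norm_image_sub_le_of_norm_hasFDerivWithin_le
    (f := fun w => T w - fderiv ℝ T 0 w) (f' := fun w => fderiv ℝ T w - fderiv ℝ T 0)
    (C := K * (‖v‖ + ‖z‖))
    (fun w hw => (((h.differentiableAt hU (hball (hseg hw)).2).hasFDerivAt).sub
      (fderiv ℝ T 0).hasFDerivAt).hasFDerivWithinAt)
    (fun w hw => by
      have h1 := hK.dist_le_mul w (hball (hseg hw)).1 0 (hmem 0 (by simpa using hρ)).1
      rw [dist_eq_norm, dist_eq_norm, sub_zero] at h1
      refine h1.trans ?_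
      gcongr
      obtain ⟨a, ha, rfl⟩ := segment_eq_image' ℝ v (v + z) ▸ hw
      rw [add_sub_cancel_left]
      refine (norm_add_le _ _).trans ?_
      rw [norm_smul, Real.norm_of_nonneg ha.1]
      nlinarith [norm_nonneg z, ha.2])
    (left_mem_segment ℝ v (v + z)) (right_mem_segment ℝ v (v + z))
  rw [add_sub_cancel_left] at this
  rwa [show T (v + z) - fderiv ℝ T 0 (v + z) - (T v - fderiv ℝ T 0 v) =
    T (v + z) - T v - fderiv ℝ T 0 z by rw [map_add]; abel] at this

theorem continuousAt_jacobian (h : IsDirectionChart T U Ω) (hU : IsOpen U) {v : Param d}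
    (hv : v ∈ U) : ContinuousAt (jacobian T) v := by
  have hc : ContinuousAt (fderiv ℝ T) v :=
    ((h.contDiffAt hU hv).fderiv_right (m := 1) (by rw [one_add_one_eq_two]; exact WithTop.coe_le_coe.2 le_top)).continuousAt
  have hM : ContinuousAt (fun v => (Matrix.of fun i j : Fin d =>
      inner ℝ (fderiv ℝ T v (EuclideanSpace.single i 1))
        (fderiv ℝ T v (EuclideanSpace.single j 1)) : Matrix (Fin d) (Fin d) ℝ)) v := by
    refine continuousAt_pi.2 fun i => continuousAt_pi.2 fun j => ?_
    exact (hc.clm_apply continuousAt_const).inner (hc.clm_apply continuousAt_const)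
  have hdet : Continuous fun M : Matrix (Fin d) (Fin d) ℝ => Real.sqrt M.det := by fun_prop
  exact hdet.continuousAt.comp hM

end IsDirectionChart

/-! ### The Hessian and the phase in a chart -/

/-- The matrix of minus the Hessian of `H` at `T 0`, pulled back by the chart `T`. -/
noncomputable def chartHessian {d : ℕ} (H : Space d → ℝ) (T : Param d → Space d) :
    Matrix (Fin d) (Fin d) ℝ :=
  Matrix.of fun i j => -iteratedFDeriv ℝ 2 H (T 0)
    ![fderiv ℝ T 0 (EuclideanSpace.single i 1), fderiv ℝ T 0 (EuclideanSpace.single j 1)]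

theorem map_toLp_eq_sum {d : ℕ} (A : Param d →L[ℝ] Space d) (w : Fin d → ℝ) :
    A (WithLp.toLp 2 w) = ∑ i, w i • A (EuclideanSpace.single i 1) := by
  have : (WithLp.toLp 2 w : Param d) = ∑ i, w i • EuclideanSpace.single i (1 : ℝ) := by
    ext j
    simp [Pi.single_apply]
  rw [this, map_sum]
  simp

theorem dotProduct_chartHessian {d : ℕ} (H : Space d → ℝ) (T : Param d → Space d) (w : Fin d → ℝ) :
    dotProduct w ((chartHessian H T).mulVec w) = -iteratedFDeriv ℝ 2 H (T 0)
      ![fderiv ℝ T 0 (WithLp.toLp 2 w), fderiv ℝ T 0 (WithLp.toLp 2 w)] := by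
  rw [map_toLp_eq_sum]
  simp only [chartHessian, dotProduct, Matrix.mulVec, Matrix.of_apply, iteratedFDeriv_two_apply,
    Matrix.cons_val_zero, Matrix.cons_val_one, map_sum, map_smul, sum_apply, smul_apply,
    smul_eq_mul, Finset.mul_sum, ← Finset.sum_neg_distrib]
  rw [Finset.sum_comm]
  refine Finset.sum_congr rfl fun i _ => Finset.sum_congr rfl fun j _ => ?_
  ring

namespace IsDirectionChart

variable {d : ℕ} {T : Param d → Space d} {U : Set (Param d)} {Ω : Set (Space d)}
  {H : Space d → ℝ} {x₀ : Space d}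

/-- The matrix of the differential of the chart at the origin. -/
noncomputable def _root_.DTB.chartMatrix (T : Param d → Space d) :
    Matrix (Fin (Module.finrank ℝ (Submodule.span ℝ {T 0})ᗮ)) (Fin d) ℝ :=
  Matrix.of fun a i => tangentCoord (T 0) (fderiv ℝ T 0 (EuclideanSpace.single i 1)) a

theorem chartHessian_eq (h : IsDirectionChart T U Ω) (hU : IsOpen U) (hΩ : Ω ⊆ unitSphere d)
    (h0 : (0 : Param d) ∈ U) :
    chartHessian H T = (chartMatrix T).transpose * (-tangentHessian H (T 0)) * chartMatrix T := by
  ext i j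
  rw [Matrix.mul_apply]
  simp only [Matrix.mul_apply, chartHessian, Matrix.of_apply, chartMatrix, Matrix.transpose_apply,
    Matrix.neg_apply]
  rw [hessian_eq_sum (h.inner_fderiv_eq_zero hU hΩ h0 _) (h.inner_fderiv_eq_zero hU hΩ h0 _),
    Finset.sum_comm, ← Finset.sum_neg_distrib]
  refine Finset.sum_congr rfl fun c _ => ?_
  rw [← Finset.sum_neg_distrib, Finset.sum_mul]
  refine Finset.sum_congr rfl fun a _ => ?_
  ring

theorem jacobian_eq (h : IsDirectionChart T U Ω) (hU : IsOpen U) (hΩ : Ω ⊆ unitSphere d)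
    (h0 : (0 : Param d) ∈ U) :
    jacobian T 0 = Real.sqrt ((chartMatrix T).transpose * chartMatrix T).det := by
  rw [jacobian]
  congr 2
  ext i j
  rw [Matrix.of_apply, inner_eq_sum_tangentCoord (h.inner_fderiv_eq_zero hU hΩ h0 _),
    Matrix.mul_apply]
  rfl

theorem chartHessian_posDef (h : IsDirectionChart T U Ω) (hU : IsOpen U) (hΩ : Ω ⊆ unitSphere d)
    (h0 : (0 : Param d) ∈ U) (hM : (-tangentHessian H (T 0)).PosDef) :
    (chartHessian H T).PosDef := by
  refine Matrix.PosDef.of_dotProduct_mulVec_pos ?_ fun w hw => ?_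
  · rw [h.chartHessian_eq hU hΩ h0]
    have := Matrix.isHermitian_conjTranspose_mul_mul (chartMatrix T) hM.isHermitian
    rwa [Matrix.conjTranspose_eq_transpose_of_trivial] at this
  · rw [star_trivial, dotProduct_chartHessian]
    refine neg_hessian_pos hM (h.inner_fderiv_eq_zero hU hΩ h0 _) fun hz => hw ?_
    have := h.immersion 0 h0 (hz.trans (map_zero _).symm)
    simpa using this

/-- With X the matrix of T'(0) in an orthonormal basis, the pulled-back form is Xᵀ M X and the
Jacobian is √det(Xᵀ X); the determinant of Xᵀ X cancels. Hence the limit does not depend on the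
parametrization. -/
theorem jacobian_div_sqrt (h : IsDirectionChart T U Ω) (hU : IsOpen U) (hΩ : Ω ⊆ unitSphere d)
    (h0 : (0 : Param d) ∈ U) (hM : (-tangentHessian H (T 0)).PosDef) :
    jacobian T 0 * (Real.sqrt (chartHessian H T).det)⁻¹ =
      (Real.sqrt |(tangentHessian H (T 0)).det|)⁻¹ := by
  have hfin : Module.finrank ℝ (Submodule.span ℝ {T 0})ᗮ = d := by
    have hT0 : T 0 ≠ 0 := fun h' => by
      have := h.norm_eq_one hΩ h0
      rw [h'] at this; simp at this
    exact Submodule.finrank_orthogonal_span_singleton hT0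
  have hdet : (chartHessian H T).det = (-tangentHessian H (T 0)).det *
      ((chartMatrix T).transpose * chartMatrix T).det := by
    rw [h.chartHessian_eq hU hΩ h0, det_transpose_mul_mul (finCongr hfin.symm)]
  have hpos := (h.chartHessian_posDef hU hΩ h0 hM).det_pos
  have hMpos := hM.det_pos
  have habs : |(tangentHessian H (T 0)).det| = (-tangentHessian H (T 0)).det := by
    rw [← abs_of_pos hMpos, Matrix.det_neg, abs_mul, abs_pow]; simp
  have hG : 0 < ((chartMatrix T).transpose * chartMatrix T).det := by
    rw [hdet] at hpos
    exact pos_of_mul_pos_right hpos hMpos.le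
  rw [h.jacobian_eq hU hΩ h0, hdet, habs, Real.sqrt_mul hMpos.le, mul_inv]
  have : Real.sqrt ((chartMatrix T).transpose * chartMatrix T).det ≠ 0 := (Real.sqrt_pos.2 hG).ne'
  field_simp

/-- Since the phase has no linear term in the ambient space, expanding T to first order is enough;
the second derivative of T does not enter. -/
theorem eventually_abs_phase_chart_le (h : IsDirectionChart T U Ω) (hU : IsOpen U)
    (hΩ : Ω ⊆ unitSphere d) (h0 : (0 : Param d) ∈ U) (hs : ContDiffOn ℝ ∞ H {0}ᶜ)
    (hH : ∀ c : ℝ, 0 < c → ∀ ξ : Space d, ξ ≠ 0 → H (c • ξ) = c * H ξ)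
    (hx : HasGradientAt H x₀ (T 0)) {η : ℝ} (hη : 0 < η) :
    ∀ᶠ v in 𝓝 (0 : Param d), |phase H x₀ (T v) -
      (-iteratedFDeriv ℝ 2 H (T 0) ![fderiv ℝ T 0 v, fderiv ℝ T 0 v]) / 2| ≤ η * ‖v‖ ^ 2 := by
  have hT0 : T 0 ≠ 0 := fun h' => by
    have := h.norm_eq_one hΩ h0
    rw [h'] at this; simp at this
  set A := fderiv ℝ T 0 with hA
  set B := fderiv ℝ (fderiv ℝ H) (T 0) with hB
  have hcont : ContinuousAt T 0 := (h.differentiableAt hU h0).continuousAt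
  -- Chosen so that the Taylor error at T v - T 0 and the change of the Hessian term under replacing
  -- T v - T 0 by A v add up to at most η ‖v‖².
  set c : ℝ := η / (2 * (‖A‖ + 1) ^ 2 + ‖B‖ * (2 * ‖A‖ + 1) + 1) with hc
  have hcpos : 0 < c := by positivity
  have hceq : c * (2 * (‖A‖ + 1) ^ 2 + ‖B‖ * (2 * ‖A‖ + 1) + 1) = η := by
    rw [hc]; field_simp
  have h1 : ∀ᶠ v in 𝓝 (0 : Param d), |phase H x₀ (T 0 + (T v - T 0)) -
      (-iteratedFDeriv ℝ 2 H (T 0) ![T v - T 0, T v - T 0]) / 2| ≤ c * ‖T v - T 0‖ ^ 2 := by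
    have : Tendsto (fun v => T v - T 0) (𝓝 0) (𝓝 0) := by
      simpa using hcont.tendsto.sub_const (T 0)
    exact this.eventually (eventually_abs_phase_sub_le hs hH hT0 hx hcpos)
  have h2 := (hasFDerivAt_iff_isLittleO_nhds_zero.1
    (h.differentiableAt hU h0).hasFDerivAt).def (c := min c 1) (by positivity)
  filter_upwards [h1, h2] with v hv1 hv2
  rw [zero_add] at hv2
  rw [add_sub_cancel] at hv1
  simp only [iteratedFDeriv_two_apply, Matrix.cons_val_zero, Matrix.cons_val_one, ← hB, ← hA] at *
  set ζ := T v - T 0 with hζ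
  set e := ζ - A v with he
  have he1 : ‖e‖ ≤ c * ‖v‖ := hv2.trans (by gcongr; exact min_le_left _ _)
  have he2 : ‖e‖ ≤ ‖v‖ := hv2.trans (by
    calc _ ≤ 1 * ‖v‖ := by gcongr; exact min_le_right _ _
      _ = _ := one_mul _)
  have hAv : ‖A v‖ ≤ ‖A‖ * ‖v‖ := A.le_opNorm v
  have hζe : ζ = A v + e := by rw [he]; abel
  have hζn : ‖ζ‖ ≤ (‖A‖ + 1) * ‖v‖ := by
    rw [hζe]; refine (norm_add_le _ _).trans ?_; linarith
  have hquad : |B ζ ζ - B (A v) (A v)| ≤ ‖B‖ * (2 * ‖A‖ + 1) * c * ‖v‖ ^ 2 := by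
    have e1 : B ζ ζ - B (A v) (A v) = B (A v) e + B e ζ := by
      rw [hζe]; simp only [map_add, add_apply]; ring
    rw [e1]
    have b1 : |B (A v) e| ≤ ‖B‖ * (‖A‖ * ‖v‖) * (c * ‖v‖) := by
      refine (B.le_opNorm₂ _ _).trans ?_
      gcongr
    have b2 : |B e ζ| ≤ ‖B‖ * (c * ‖v‖) * ((‖A‖ + 1) * ‖v‖) := by
      refine (B.le_opNorm₂ _ _).trans ?_
      gcongr
    refine (abs_add_le _ _).trans ((add_le_add b1 b2).trans (le_of_eq (by ring)))
  have hsq : c * ‖ζ‖ ^ 2 ≤ c * ((‖A‖ + 1) * ‖v‖) ^ 2 := by gcongr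
  have k1 := abs_le.1 hv1
  have k2 := abs_le.1 hquad
  have k3 : 0 ≤ c * ‖v‖ ^ 2 := by positivity
  have k4 : 0 ≤ ‖B‖ * (2 * ‖A‖ + 1) * c * ‖v‖ ^ 2 := by positivity
  have k5 : 0 ≤ c * ((‖A‖ + 1) * ‖v‖) ^ 2 := by positivity
  have k6 : η * ‖v‖ ^ 2 = 2 * (c * ((‖A‖ + 1) * ‖v‖) ^ 2) +
      ‖B‖ * (2 * ‖A‖ + 1) * c * ‖v‖ ^ 2 + c * ‖v‖ ^ 2 := by rw [← hceq]; ring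
  rw [k6, abs_le]
  constructor <;> linarith

end IsDirectionChart

/-! ### The filter in closed form and its scaling -/

section Kernel

variable {d : ℕ} {Bt : Space d → ℝ → ℂ} {B₀ : Space d → ℂ} {β : ℝ} {φ : ℝ → ℝ}

theorem exists_isFilterKernel (hφ : IsInterpolationKernel β φ) (hβ : 0 < β) :
    ∃ (L : ℝ≥0) (R : ℝ), IsFilterKernel (β + 1) ⌊β⌋₊ φ L R := by
  obtain ⟨L, hL⟩ := hφ.lipschitz
  obtain ⟨R, hR⟩ := hφ.compactSupport.isCompact.isBounded.exists_norm_le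
  refine ⟨L, max 1 (R + 1), ?_, ?_, by linarith, hφ.smooth, hL, le_max_left _ _, fun t ht => ?_⟩
  · linarith [Nat.floor_le hβ.le]
  · linarith [Nat.lt_floor_add_one β]
  · by_contra hne
    have h1 := hR t (subset_tsupport φ hne)
    rw [Real.norm_eq_abs] at h1
    have := (le_max_right 1 (R + 1)).trans ht
    linarith

/-- The regularized kernel in closed form. -/
theorem regularizedB_eq
    (hpos : ∀ α ∈ unitSphere d, ∀ τ : ℝ, 0 < τ → Bt α τ = ((τ ^ β : ℝ) : ℂ) * B₀ α)
    (heven : ∀ α ∈ unitSphere d, ∀ τ : ℝ, Bt (-α) (-τ) = Bt α τ) (hβ : 0 < β) {δ : ℝ} (hδ : 0 < δ)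
    {α : Space d} (hα : α ∈ unitSphere d) (p : ℝ) :
    regularizedB Bt δ α p = ((Real.Gamma (β + 1) / (2 * Real.pi) : ℝ) : ℂ) *
      (B₀ α * powKernel (β + 1) δ p + B₀ (-α) * starRingEnd ℂ (powKernel (β + 1) δ p)) := by
  have hα' : -α ∈ unitSphere d := by simpa using hα
  set f : ℝ → ℂ := fun τ =>
    (Real.exp (-δ * |τ|) : ℂ) * Bt α τ * Complex.exp (-(Complex.I * τ * p)) with hf
  have hbp : 0 < β + 1 := by linarith
  have key : ∀ x : ℝ, IntegrableOn (fun τ : ℝ => ((τ ^ β : ℝ) : ℂ) *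
      Complex.exp (-(τ * ((δ : ℂ) + Complex.I * x)))) (Ioi 0) ∧
      ∫ τ in Ioi (0 : ℝ), ((τ ^ β : ℝ) : ℂ) * Complex.exp (-(τ * ((δ : ℂ) + Complex.I * x))) =
        (Real.Gamma (β + 1) : ℂ) * powKernel (β + 1) δ x := fun x => by
    have hre : 0 < ((δ : ℂ) + Complex.I * x).re := by simpa using hδ
    have h1 := integrableOn_rpow_mul_exp_neg_mul hbp hre
    have h2 := integral_rpow_mul_exp_neg_mul hbp hre
    rw [add_sub_cancel_right] at h1 h2
    exact ⟨h1, h2⟩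
  have hR : ∀ τ ∈ Ioi (0 : ℝ), f τ = B₀ α * (((τ ^ β : ℝ) : ℂ) *
      Complex.exp (-(τ * ((δ : ℂ) + Complex.I * p)))) := fun τ hτ => by
    have hτ' : (0 : ℝ) < τ := hτ
    simp only [hf]
    rw [hpos α hα τ hτ, abs_of_pos hτ', Complex.ofReal_exp,
      show -(τ * ((δ : ℂ) + Complex.I * p)) = ((-δ * τ : ℝ) : ℂ) + -(Complex.I * τ * p) by
        push_cast; ring, Complex.exp_add]
    ring
  -- Evenness of the symbol turns negative frequencies at α into positive ones at -α with p
  -- reversed, which produces the conjugate kernel.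
  have hL : ∀ τ ∈ Ioi (0 : ℝ), f (-τ) = B₀ (-α) * (((τ ^ β : ℝ) : ℂ) *
      Complex.exp (-(τ * ((δ : ℂ) + Complex.I * ((-p : ℝ) : ℂ))))) := fun τ hτ => by
    have hτ' : (0 : ℝ) < τ := hτ
    have h1 : Bt α (-τ) = ((τ ^ β : ℝ) : ℂ) * B₀ (-α) := by
      rw [← hpos (-α) hα' τ hτ]
      have := heven (-α) hα' τ
      rwa [neg_neg] at this
    simp only [hf]
    rw [h1, abs_neg, abs_of_pos hτ', Complex.ofReal_exp,
      show -(τ * ((δ : ℂ) + Complex.I * ((-p : ℝ) : ℂ))) =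
        ((-δ * τ : ℝ) : ℂ) + -(Complex.I * ((-τ : ℝ) : ℂ) * p) by push_cast; ring, Complex.exp_add]
    ring
  have hiR : IntegrableOn f (Ioi 0) :=
    (integrableOn_congr_fun hR measurableSet_Ioi).2 ((key p).1.const_mul _)
  have hiL' : IntegrableOn (fun τ => f (-τ)) (Ioi 0) :=
    (integrableOn_congr_fun hL measurableSet_Ioi).2 ((key (-p)).1.const_mul _)
  have hiL : IntegrableOn f (Iic 0) := by
    rw [integrableOn_Iic_iff_integrableOn_Iio]
    have := (Measure.measurePreserving_neg (volume : Measure ℝ)).integrableOn_comp_preimage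
      (Homeomorph.neg ℝ).measurableEmbedding (f := f) (s := Iio 0)
    rw [show (Neg.neg : ℝ → ℝ) ⁻¹' Iio 0 = Ioi 0 by ext x; simp] at this
    exact this.1 hiL'
  have hsplit : ∫ τ, f τ = (∫ τ in Iic (0 : ℝ), f τ) + ∫ τ in Ioi (0 : ℝ), f τ :=
    (intervalIntegral.integral_Iic_add_Ioi hiL hiR).symm
  have hneg : ∫ τ in Iic (0 : ℝ), f τ = ∫ τ in Ioi (0 : ℝ), f (-τ) := by
    rw [integral_comp_neg_Ioi, neg_zero]
  rw [regularizedB, show (∫ τ : ℝ, (Real.exp (-δ * |τ|) : ℂ) * Bt α τ *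
    Complex.exp (-(Complex.I * τ * p))) = ∫ τ, f τ from rfl, hsplit, hneg,
    setIntegral_congr_fun measurableSet_Ioi hR, setIntegral_congr_fun measurableSet_Ioi hL,
    integral_const_mul, integral_const_mul, (key p).2, (key (-p)).2,
    conj_powKernel _ (Or.inl hδ)]
  push_cast
  ring

theorem powKernel_mul {κ δ ε : ℝ} (hε : 0 < ε) (hδ : 0 < δ) (x : ℝ) :
    powKernel κ δ (ε * x) = ((ε ^ (-κ) : ℝ) : ℂ) * powKernel κ (δ / ε) x := by
  have hε' : (ε : ℂ) ≠ 0 := by exact_mod_cast hε.ne'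
  have h1 : (δ : ℂ) + Complex.I * ((ε * x : ℝ) : ℂ) =
      (ε : ℂ) * (((δ / ε : ℝ) : ℂ) + Complex.I * x) := by
    push_cast; field_simp
  have h2 : ((δ / ε : ℝ) : ℂ) + Complex.I * x ≠ 0 := fun h => by
    have := congrArg Complex.re h
    simp at this
    rcases this with h | h <;> linarith
  rw [powKernel, h1, ofReal_mul_cpow_neg hε h2, powKernel]

theorem conj_psiReg {κ δ : ℝ} (t : ℝ) :
    starRingEnd ℂ (psiReg κ φ δ t) = ∫ x : ℝ, starRingEnd ℂ (powKernel κ δ x) * (φ (t - x) : ℂ) := by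
  rw [psiReg, ← integral_conj]
  congr 1; ext x
  rw [map_mul, Complex.conj_ofReal]

/-- Substituting p = t - εx, the measure contributes ε and the kernel ε^{-(β+1)}; the regularization
becomes δ / ε, which is harmless because ε is fixed while δ → 0. -/
theorem regularizedFilter_eq
    (hpos : ∀ α ∈ unitSphere d, ∀ τ : ℝ, 0 < τ → Bt α τ = ((τ ^ β : ℝ) : ℂ) * B₀ α)
    (heven : ∀ α ∈ unitSphere d, ∀ τ : ℝ, Bt (-α) (-τ) = Bt α τ) (hβ : 0 < β)
    {m : ℕ} {L : ℝ≥0} {R : ℝ} (h : IsFilterKernel (β + 1) m φ L R)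
    {δ ε : ℝ} (hδ : 0 < δ) (hε : 0 < ε) {α : Space d} (hα : α ∈ unitSphere d) (q t : ℝ) :
    regularizedFilter Bt φ δ ε q α t =
      ((Real.Gamma (β + 1) / (2 * Real.pi) * ε ^ (-β) : ℝ) : ℂ) *
      (B₀ α * psiReg (β + 1) φ (δ / ε) ((t - q) / ε) +
        B₀ (-α) * starRingEnd ℂ (psiReg (β + 1) φ (δ / ε) ((t - q) / ε))) := by
  have hδε : 0 < δ / ε := by positivity
  set x₀ : ℝ := (t - q) / ε with hx₀
  have h1 : regularizedFilter Bt φ δ ε q α t = (ε : ℂ) *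
      ∫ x : ℝ, regularizedB Bt δ α (ε * x) * (φ (x₀ - x) : ℂ) := by
    have e1 := Measure.integral_comp_mul_left
      (fun p : ℝ => regularizedB Bt δ α p * (φ (x₀ - p / ε) : ℂ)) ε
    rw [abs_of_pos (inv_pos.2 hε), Complex.real_smul] at e1
    have e2 : ∀ x : ℝ, ε * x / ε = x := fun x => by field_simp
    simp only [e2] at e1
    rw [e1, regularizedFilter, ← mul_assoc, Complex.ofReal_inv, mul_inv_cancel₀
      (by exact_mod_cast hε.ne' : (ε : ℂ) ≠ 0), one_mul,
      ← integral_sub_left_eq_self (fun p : ℝ => regularizedB Bt δ α p * (φ (x₀ - p / ε) : ℂ))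
        volume t]
    congr 1; ext p
    congr 3
    rw [hx₀]; field_simp; ring
  have hi1 := h.integrable_psiReg hδε x₀
  have hi2 : Integrable fun x : ℝ => starRingEnd ℂ (powKernel (β + 1) (δ / ε) x) *
      (φ (x₀ - x) : ℂ) := by
    have := Complex.conjCLE.toContinuousLinearMap.integrable_comp hi1
    refine this.congr (Eventually.of_forall fun x => ?_)
    simp
  rw [h1, conj_psiReg, psiReg]
  have h2 : ∀ x : ℝ, regularizedB Bt δ α (ε * x) * (φ (x₀ - x) : ℂ) =
      (((Real.Gamma (β + 1) / (2 * Real.pi) * ε ^ (-(β + 1)) : ℝ) : ℂ) * B₀ α) *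
        (powKernel (β + 1) (δ / ε) x * (φ (x₀ - x) : ℂ)) +
      (((Real.Gamma (β + 1) / (2 * Real.pi) * ε ^ (-(β + 1)) : ℝ) : ℂ) * B₀ (-α)) *
        (starRingEnd ℂ (powKernel (β + 1) (δ / ε) x) * (φ (x₀ - x) : ℂ)) := fun x => by
    rw [regularizedB_eq hpos heven hβ hδ hα, powKernel_mul hε hδ, map_mul, Complex.conj_ofReal]
    push_cast; ring
  simp only [h2]
  rw [integral_add (hi1.const_mul _) (hi2.const_mul _), integral_const_mul, integral_const_mul]
  have h3 : ε ^ (-β) = ε * ε ^ (-(β + 1)) := by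
    rw [← Real.rpow_one_add' hε.le (by linarith)]; congr 1; ring
  rw [h3]
  push_cast; ring

theorem tendsto_regularizedFilter
    (hpos : ∀ α ∈ unitSphere d, ∀ τ : ℝ, 0 < τ → Bt α τ = ((τ ^ β : ℝ) : ℂ) * B₀ α)
    (heven : ∀ α ∈ unitSphere d, ∀ τ : ℝ, Bt (-α) (-τ) = Bt α τ) (hβ : 0 < β)
    {m : ℕ} {L : ℝ≥0} {R : ℝ} (h : IsFilterKernel (β + 1) m φ L R)
    {ε : ℝ} (hε : 0 < ε) {α : Space d} (hα : α ∈ unitSphere d) (q t : ℝ) :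
    Tendsto (fun δ => regularizedFilter Bt φ δ ε q α t) (𝓝[>] 0)
      (𝓝 (((Real.Gamma (β + 1) / (2 * Real.pi) * ε ^ (-β) : ℝ) : ℂ) *
        (B₀ α * psi (β + 1) m φ ((t - q) / ε) +
          B₀ (-α) * starRingEnd ℂ (psi (β + 1) m φ ((t - q) / ε))))) := by
  have hdiv : Tendsto (fun δ : ℝ => δ / ε) (𝓝[>] 0) (𝓝[>] 0) := by
    refine tendsto_nhdsWithin_iff.2 ⟨?_, ?_⟩
    · have : Tendsto (fun δ : ℝ => δ / ε) (𝓝 0) (𝓝 (0 / ε)) := tendsto_id.div_const ε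
      rw [zero_div] at this
      exact this.mono_left nhdsWithin_le_nhds
    · filter_upwards [self_mem_nhdsWithin] with δ hδ
      exact div_pos hδ hε
  have h1 := (h.tendsto_psiReg ((t - q) / ε)).comp hdiv
  have h2 := (Complex.continuous_conj.tendsto _).comp h1
  refine Tendsto.congr' ?_ (((h1.const_mul (B₀ α)).add (h2.const_mul (B₀ (-α)))).const_mul _)
  filter_upwards [self_mem_nhdsWithin] with δ hδ
  rw [regularizedFilter_eq hpos heven hβ h hδ hε hα]
  rfl

theorem filter_eq
    (hpos : ∀ α ∈ unitSphere d, ∀ τ : ℝ, 0 < τ → Bt α τ = ((τ ^ β : ℝ) : ℂ) * B₀ α)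
    (heven : ∀ α ∈ unitSphere d, ∀ τ : ℝ, Bt (-α) (-τ) = Bt α τ) (hβ : 0 < β)
    {m : ℕ} {L : ℝ≥0} {R : ℝ} (h : IsFilterKernel (β + 1) m φ L R)
    {ε : ℝ} (hε : 0 < ε) {α : Space d} (hα : α ∈ unitSphere d) (q t : ℝ) :
    filter Bt φ ε q α t = ((Real.Gamma (β + 1) / (2 * Real.pi) * ε ^ (-β) : ℝ) : ℂ) *
        (B₀ α * psi (β + 1) m φ ((t - q) / ε) +
          B₀ (-α) * starRingEnd ℂ (psi (β + 1) m φ ((t - q) / ε))) :=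
  (tendsto_regularizedFilter hpos heven hβ h hε hα q t).limUnder_eq

end Kernel

/-! ### The sum over the samples in one direction -/

section FilteredTerm

variable {d : ℕ} {Bt : Space d → ℝ → ℂ} {B₀ a₀ : Space d → ℂ} {s b : ℝ} {φ : ℝ → ℝ}
  {H : Space d → ℝ} {g₀ : Space d → ℝ → ℂ} {m : ℕ} {L : ℝ≥0} {R : ℝ}

/-- The sum over the samples, in terms of the profile. -/
theorem hasSum_filteredTerm (hs : 1 < s) (hb : 0 < b)
    (hpos : ∀ α ∈ unitSphere d, ∀ τ : ℝ, 0 < τ → Bt α τ = ((τ ^ (s + b - 1) : ℝ) : ℂ) * B₀ α)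
    (heven : ∀ α ∈ unitSphere d, ∀ τ : ℝ, Bt (-α) (-τ) = Bt α τ)
    (h : IsFilterKernel (s + b) m φ L R) {α : Space d} (hα : α ∈ unitSphere d)
    (hg : ∀ p : ℝ, g₀ α (H α + p) =
      a₀ α * ((max p 0 ^ (s - 1) : ℝ) : ℂ) + a₀ (-α) * ((max (-p) 0 ^ (s - 1) : ℝ) : ℂ))
    {ε : ℝ} (hε : 0 < ε) (x : Space d) :
    HasSum (fun j : ℤ => filteredTerm Bt φ g₀ ε α x j)
      (((Real.Gamma (s + b) / (2 * Real.pi) * ε ^ (-b) : ℝ) : ℂ) *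
        profile (s + b) m φ s (B₀ α) (B₀ (-α)) (a₀ α) (a₀ (-α)) (phase H x α / ε)
          (inner ℝ α x / ε)) := by
  set q : ℝ := phase H x α / ε with hq
  set t : ℝ := inner ℝ α x / ε with ht
  have h' : IsFilterKernel (s + b - 1 + 1) m φ L R := by rwa [sub_add_cancel]
  have hs1 : ∀ σ : ℝ, σ = 1 ∨ σ = -1 → HasSum (fun j : ℤ => psi (s + b) m φ (t - j) *
      (sidePow (s - 1) σ (q - (t - j)) : ℂ)) (sampleSum (s + b) m φ s σ q t) := fun σ hσ =>
    (h.summable_sampleSum hs.le hb (abs_eq_one_of_sign hσ) q t).hasSum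
  have hs2 : ∀ σ : ℝ, σ = 1 ∨ σ = -1 → HasSum (fun j : ℤ =>
      starRingEnd ℂ (psi (s + b) m φ (t - j)) * (sidePow (s - 1) σ (q - (t - j)) : ℂ))
      (starRingEnd ℂ (sampleSum (s + b) m φ s σ q t)) := fun σ hσ => by
    have := (hs1 σ hσ).map (starRingEnd ℂ) Complex.continuous_conj
    convert this using 1
    ext j
    rw [Function.comp_apply, map_mul, Complex.conj_ofReal]
  have hterm : ∀ j : ℤ, filteredTerm Bt φ g₀ ε α x j =
      ((Real.Gamma (s + b) / (2 * Real.pi) * ε ^ (-b) : ℝ) : ℂ) *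
      (B₀ α * (a₀ α * (psi (s + b) m φ (t - j) * (sidePow (s - 1) 1 (q - (t - j)) : ℂ)) +
        a₀ (-α) * (psi (s + b) m φ (t - j) * (sidePow (s - 1) (-1) (q - (t - j)) : ℂ))) +
      B₀ (-α) * (a₀ α * (starRingEnd ℂ (psi (s + b) m φ (t - j)) *
          (sidePow (s - 1) 1 (q - (t - j)) : ℂ)) +
        a₀ (-α) * (starRingEnd ℂ (psi (s + b) m φ (t - j)) *
          (sidePow (s - 1) (-1) (q - (t - j)) : ℂ)))) := fun j => by
    have e1 : (inner ℝ α x - ε * j) / ε = t - j := by rw [ht]; field_simp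
    have e2 : ∀ σ : ℝ, max (σ * (ε * j - H α)) 0 ^ (s - 1) =
        ε ^ (s - 1) * sidePow (s - 1) σ (q - (t - j)) := fun σ => by
      have : σ * (ε * j - H α) = ε * (σ * (q - (t - j))) := by
        rw [hq, ht, phase]; field_simp; ring
      rw [this, sidePow, ← Real.mul_rpow hε.le (le_max_right _ _)]
      congr 1
      rw [mul_max_of_nonneg _ _ hε.le, mul_zero]
    have e3 := e2 1
    have e4 := e2 (-1)
    rw [one_mul] at e3
    rw [neg_one_mul] at e4
    have e5 := hg (ε * j - H α)
    rw [add_sub_cancel] at e5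
    rw [filteredTerm, filter_eq hpos heven (by linarith) h' hε hα, e5, e3, e4, e1, sub_add_cancel]
    -- The filter contributes ε^{-β} with β = s + b - 1, the homogeneous data ε^{s-1}.
    have e6 : ε ^ (-b) = ε ^ (-(s + b - 1)) * ε ^ (s - 1) := by
      rw [← Real.rpow_add hε]; congr 1; ring
    rw [e6]
    push_cast; ring
  simp only [hterm]
  refine HasSum.mul_left _ ?_
  exact ((((hs1 1 (Or.inl rfl)).mul_left _).add ((hs1 (-1) (Or.inr rfl)).mul_left _)).mul_left _).add
    ((((hs2 1 (Or.inl rfl)).mul_left _).add ((hs2 (-1) (Or.inr rfl)).mul_left _)).mul_left _)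

end FilteredTerm

/-! ### Riemann sums with averaging along one coordinate -/

/-- The componentwise integer part. -/
noncomputable def floorVec {d : ℕ} (w : Fin d → ℝ) : Fin d → ℤ := fun i => ⌊w i⌋

theorem measurable_floorVec {d : ℕ} : Measurable (floorVec : (Fin d → ℝ) → Fin d → ℤ) :=
  measurable_pi_lambda _ fun i => Int.measurable_floor.comp (measurable_pi_apply i)

/-- Each fibre is a unit cube. Lattice sums thereby become integrals of step functions, to which
dominated convergence applies. -/
theorem map_floorVec_volume (d : ℕ) :
    Measure.map (floorVec : (Fin d → ℝ) → Fin d → ℤ) volume = Measure.count := by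
  refine Measure.ext_of_singleton fun k => ?_
  rw [Measure.map_apply measurable_floorVec (measurableSet_singleton k), Measure.count_singleton]
  have : (floorVec : (Fin d → ℝ) → Fin d → ℤ) ⁻¹' {k} =
      Set.pi univ fun i => Ico (k i : ℝ) (k i + 1) := by
    ext w
    simp only [mem_preimage, mem_singleton_iff, floorVec, funext_iff, Int.floor_eq_iff, mem_univ_pi,
      mem_Ico]
  rw [this, volume_pi_pi]
  simp

theorem integral_comp_floorVec {d : ℕ} {f : (Fin d → ℤ) → ℂ} (hf : Summable f) :
    ∫ w : Fin d → ℝ, f (floorVec w) = ∑' k, f k := by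
  have h1 : ∫ k, f k ∂(Measure.map (floorVec : (Fin d → ℝ) → Fin d → ℤ) volume) =
      ∫ w : Fin d → ℝ, f (floorVec w) :=
    integral_map measurable_floorVec.aemeasurable Measurable.of_discrete.aestronglyMeasurable
  rw [← h1, map_floorVec_volume, integral_countable]
  · simp
  · exact integrable_count_iff.2 hf.norm

theorem integral_comp_floorVec_smul {d : ℕ} {f : (Fin d → ℤ) → ℂ} (hf : Summable f) {a : ℝ}
    (ha : 0 < a) :
    ∫ w : Fin d → ℝ, f (floorVec (a⁻¹ • w)) = (a : ℂ) ^ d * ∑' k, f k := by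
  have := Measure.integral_comp_inv_smul (volume : Measure (Fin d → ℝ)) (fun w => f (floorVec w)) a
  rw [this, integral_comp_floorVec hf, abs_of_pos (by positivity), Complex.real_smul]
  simp

theorem norm_floorVec_sub_le {d : ℕ} (w : Fin d → ℝ) :
    ‖(fun i => (floorVec w i : ℝ)) - w‖ ≤ 1 := by
  rw [pi_norm_le_iff_of_nonneg zero_le_one]
  intro i
  rw [Pi.sub_apply, Real.norm_eq_abs, floorVec, abs_le]
  constructor <;> linarith [Int.floor_le (w i), Int.lt_floor_add_one (w i)]

theorem norm_floorVec_add_single_sub_le {d : ℕ} (w : Fin d → ℝ) (i : Fin d) (l : ℕ) :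
    ‖(fun j => ((floorVec w + Pi.single i (l : ℤ) : Fin d → ℤ) j : ℝ)) - w‖ ≤ 1 + l := by
  have h1 := norm_floorVec_sub_le w
  have : (fun j => ((floorVec w + Pi.single i (l : ℤ) : Fin d → ℤ) j : ℝ)) - w =
      ((fun i => (floorVec w i : ℝ)) - w) + Pi.single i (l : ℝ) := by
    ext j
    simp only [Pi.sub_apply, Pi.add_apply, Int.cast_add]
    rcases eq_or_ne j i with rfl | hj
    · simp; ring
    · simp [hj]
  rw [this]
  refine (norm_add_le _ _).trans (add_le_add h1 (le_of_eq ?_))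
  rw [Pi.norm_single]; simp

/-- Rounding and up to M - 1 shifts of step a move the argument by at most aM ≤ 1, which changes the
weight by at most the factor 3^γ. -/
theorem norm_average_floorVec_le {d : ℕ} (i : Fin d) {a γ C : ℝ} {M : ℕ} {F : (Fin d → ℤ) → ℂ}
    (hγ0 : 0 ≤ γ) (hC : 0 ≤ C) (hax : 0 < a) (hM : 0 < M) (hM1 : a * M ≤ 1)
    (hx : ∀ k, ‖F k‖ ≤ C * (1 + ‖a • fun i => (k i : ℝ)‖) ^ (-γ)) (w : Fin d → ℝ) :
    ‖(M : ℂ)⁻¹ * ∑ l ∈ Finset.range M, F (floorVec (a⁻¹ • w) + Pi.single i (l : ℤ))‖ ≤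
      C * (3 ^ γ * (1 + ‖w‖) ^ (-γ)) := by
  have hMpos : (0 : ℝ) < M := by exact_mod_cast hM
  rw [norm_mul, norm_inv, Complex.norm_natCast, inv_mul_le_iff₀ hMpos]
  refine (norm_sum_le _ _).trans ?_
  rw [← nsmul_eq_mul]
  nth_rewrite 2 [← Finset.card_range M]
  refine Finset.sum_le_card_nsmul _ _ _ fun l hl => ?_
  have hlM : (l : ℝ) ≤ M - 1 := by
    have : l + 1 ≤ M := Finset.mem_range.1 hl
    have : ((l + 1 : ℕ) : ℝ) ≤ M := by exact_mod_cast this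
    push_cast at this; linarith
  refine (hx _).trans ?_
  gcongr
  set k : Fin d → ℝ :=
    fun j => ((floorVec (a⁻¹ • w) + Pi.single i (l : ℤ) : Fin d → ℤ) j : ℝ) with hk
  have h1 := norm_floorVec_add_single_sub_le (a⁻¹ • w) i l
  have h2 : ‖w‖ ≤ ‖a • k‖ + 1 := by
    have e : w = a • k - a • (k - a⁻¹ • w) := by
      rw [smul_sub, sub_sub_cancel, smul_smul, mul_inv_cancel₀ hax.ne', one_smul]
    calc ‖w‖ = ‖a • k - a • (k - a⁻¹ • w)‖ := by rw [← e]
      _ ≤ ‖a • k‖ + ‖a • (k - a⁻¹ • w)‖ := norm_sub_le _ _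
      _ ≤ ‖a • k‖ + a * (1 + l) := by
        rw [norm_smul a (k - _), Real.norm_of_nonneg hax.le]
        gcongr
      _ ≤ ‖a • k‖ + a * M := by gcongr; linarith
      _ ≤ _ := by linarith [hM1]
  have h3 : 1 + ‖w‖ ≤ 3 * (1 + ‖a • k‖) := by linarith [norm_nonneg (a • k)]
  rw [Real.rpow_neg (by positivity), Real.rpow_neg (by positivity), ← div_eq_mul_inv,
    le_div_iff₀ (by positivity), inv_mul_le_iff₀ (by positivity), mul_comm,
    ← Real.mul_rpow (by norm_num) (by positivity)]
  exact Real.rpow_le_rpow (by positivity) h3 hγ0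

/-- A sum over the lattice is translation invariant, so the terms may be replaced by averages of
their translates without changing the sum. -/
theorem tsum_average_eq {d : ℕ} {F : (Fin d → ℤ) → ℂ} (hF : Summable F) {M : ℕ} (hM : 0 < M)
    (v : ℕ → Fin d → ℤ) :
    (Summable fun k => (M : ℂ)⁻¹ * ∑ l ∈ Finset.range M, F (k + v l)) ∧
      ∑' k, (M : ℂ)⁻¹ * ∑ l ∈ Finset.range M, F (k + v l) = ∑' k, F k := by
  have hshift : ∀ l ∈ Finset.range M, HasSum (fun k => F (k + v l)) (∑' k, F k) := fun l _ =>
    (Equiv.hasSum_iff (f := F) (Equiv.addRight (v l))).2 hF.hasSum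
  have h1 := (hasSum_sum hshift).mul_left (M : ℂ)⁻¹
  refine ⟨h1.summable, h1.tsum_eq.trans ?_⟩
  rw [Finset.sum_const, Finset.card_range, nsmul_eq_mul, inv_mul_cancel_left₀]
  exact_mod_cast hM.ne'

theorem integral_average_floorVec {d : ℕ} {F : (Fin d → ℤ) → ℂ} (hF : Summable F) (i : Fin d)
    {M : ℕ} (hM : 0 < M) {a : ℝ} (ha : 0 < a) :
    ∫ w : Fin d → ℝ, (M : ℂ)⁻¹ * ∑ l ∈ Finset.range M,
      F (floorVec (a⁻¹ • w) + Pi.single i (l : ℤ)) = (a : ℂ) ^ d * ∑' k, F k := by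
  obtain ⟨h1, h2⟩ := tsum_average_eq hF hM fun l => (Pi.single i (l : ℤ) : Fin d → ℤ)
  rw [← h2, ← integral_comp_floorVec_smul h1 ha]

/-- Convergence of Riemann sums whose terms converge only after averaging in one direction. -/
theorem tendsto_riemannSum {d : ℕ} (i : Fin d) {ι : Type*} {𝓕 : Filter ι} [𝓕.IsCountablyGenerated]
    {a : ι → ℝ} {M : ι → ℕ} {F : ι → (Fin d → ℤ) → ℂ} {G : (Fin d → ℝ) → ℂ} {γ C : ℝ}
    (hγ : (d : ℝ) < γ) (ha : Tendsto a 𝓕 (𝓝[>] 0))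
    (hsum : ∀ᶠ x in 𝓕, Summable (F x))
    (hbound : ∀ᶠ x in 𝓕, ∀ k, ‖F x k‖ ≤ C * (1 + ‖a x • fun i => (k i : ℝ)‖) ^ (-γ))
    (hM : ∀ᶠ x in 𝓕, 0 < M x ∧ a x * M x ≤ 1)
    (hlim : ∀ w, Tendsto (fun x => (M x : ℂ)⁻¹ * ∑ l ∈ Finset.range (M x),
      F x (floorVec ((a x)⁻¹ • w) + Pi.single i (l : ℤ))) 𝓕 (𝓝 (G w))) :
    Tendsto (fun x => (a x : ℂ) ^ d * ∑' k, F x k) 𝓕 (𝓝 (∫ w, G w)) := by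
  have hγ0 : 0 ≤ γ := (Nat.cast_nonneg d).trans hγ.le
  have hapos : ∀ᶠ x in 𝓕, 0 < a x := (tendsto_nhdsWithin_iff.1 ha).2
  have ha1 : ∀ᶠ x in 𝓕, a x ≤ 1 :=
    (tendsto_nhdsWithin_iff.1 ha).1.eventually (eventually_le_nhds one_pos)
  -- Dominated convergence; the majorant (1 + ‖w‖)^{-γ} is integrable because γ > d.
  have key : Tendsto (fun x => ∫ w : Fin d → ℝ, (M x : ℂ)⁻¹ * ∑ l ∈ Finset.range (M x),
      F x (floorVec ((a x)⁻¹ • w) + Pi.single i (l : ℤ))) 𝓕 (𝓝 (∫ w, G w)) := by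
    refine tendsto_integral_filter_of_dominated_convergence
      (fun w => C * (3 ^ γ * (1 + ‖w‖) ^ (-γ))) (Eventually.of_forall fun x => ?_) ?_
      (((integrable_one_add_norm (by simpa using hγ)).const_mul _).const_mul _)
      (Eventually.of_forall hlim)
    · have h1 : Measurable fun k : Fin d → ℤ => (M x : ℂ)⁻¹ * ∑ l ∈ Finset.range (M x),
        F x (k + Pi.single i (l : ℤ)) := Measurable.of_discrete
      exact (h1.comp (measurable_floorVec.comp (measurable_const_smul _))).aestronglyMeasurable
    · filter_upwards [hbound, hM, hapos, ha1] with x hx hMx hax hax1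
      refine Eventually.of_forall fun w => ?_
      have hC : 0 ≤ C := by
        have := (norm_nonneg _).trans (hx 0)
        exact nonneg_of_mul_nonneg_left this (Real.rpow_pos_of_pos (by positivity) _)
      exact norm_average_floorVec_le i hγ0 hC hax hMx.1 hMx.2 hx w
  refine key.congr' ?_
  filter_upwards [hsum, hM, hapos] with x hx hMx hax
  exact integral_average_floorVec hx i hMx.1 hax

/-! ### The sum over the directions and its uniform majorant -/

/-- The standing assumptions on the phase, the directions, the data and the kernel. -/
structure IsLocalSetup {d : ℕ} (H : Space d → ℝ) (x₀ : Space d) (Ω : Set (Space d)) (s : ℝ)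
    (B₀ a₀ : Space d → ℂ) (T : Param d → Space d) (U : Set (Param d)) (u : ℝ → Fin d → ℝ)
    (w : ℝ → (Fin d → ℤ) → ℝ) (φ : ℝ → ℝ) (m n : ℕ) (L : ℝ≥0) (R : ℝ) : Prop where
  one_le_dim : 1 ≤ d
  smooth : ContDiffOn ℝ ∞ H {0}ᶜ
  homogeneous : ∀ c : ℝ, 0 < c → ∀ ξ : Space d, ξ ≠ 0 → H (c • ξ) = c * H ξ
  gradient : HasGradientAt H x₀ (T 0)
  posDef : (-tangentHessian H (T 0)).PosDef
  isOpen : IsOpen U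
  zero_mem : (0 : Param d) ∈ U
  offset : ∀ ε : ℝ, ∀ i : Fin d, u ε i ∈ Set.Ico (0 : ℝ) 1
  chart : IsDirectionChart T U Ω
  subset_sphere : Ω ⊆ unitSphere d
  lower : ∃ c > 0, ∀ α ∈ Ω, c * ‖α - T 0‖ ^ 2 ≤ phase H x₀ α
  one_lt : 1 < s
  kernel : IsFilterKernel (s + (d : ℝ) / 2) m φ L R
  exact : IsExact n φ
  degree : s + (d : ℝ) / 2 - 1 ≤ n
  continuousOn_symbol : ContinuousOn B₀ (unitSphere d)
  continuousOn_data : ContinuousOn a₀ (unitSphere d)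
  support : ∃ K : Set (Space d), IsCompact K ∧ K ⊆ Ω ∧ ∀ α ∈ Ω, α ∉ K → a₀ α = 0 ∧ a₀ (-α) = 0
  coeff : ∀ α ∈ Ω, lowerCoeff s (B₀ (-α)) (a₀ α) (a₀ (-α)) =
    Complex.exp (-(Complex.I * ((((d : ℝ) / 2 : ℝ) : ℂ) - 1) * Real.pi)) *
      upperCoeff s (B₀ α) (a₀ α) (a₀ (-α))
  volumes : IsCellVolume T U u w

/-- The sum over the samples in the direction `α`, up to a constant factor. -/
noncomputable def directionSum {d : ℕ} (H : Space d → ℝ) (s : ℝ) (B₀ a₀ : Space d → ℂ) (φ : ℝ → ℝ)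
    (m : ℕ) (ε : ℝ) (x α : Space d) : ℂ :=
  profile (s + (d : ℝ) / 2) m φ s (B₀ α) (B₀ (-α)) (a₀ α) (a₀ (-α)) (phase H x α / ε)
    (inner ℝ α x / ε)

open Classical in
/-- The contribution of the direction with index `k`, up to normalization. -/
noncomputable def gridTerm {d : ℕ} (H : Space d → ℝ) (s : ℝ) (B₀ a₀ : Space d → ℂ)
    (T : Param d → Space d) (U : Set (Param d)) (u : ℝ → Fin d → ℝ) (w : ℝ → (Fin d → ℤ) → ℝ)
    (φ : ℝ → ℝ) (m : ℕ) (x₀ : Space d) (ε : ℝ) (y : Space d) (k : Fin d → ℤ) : ℂ :=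
  if gridPoint ε (u ε) k ∈ U then
    directionSum H s B₀ a₀ φ m ε (x₀ + ε • y) (T (gridPoint ε (u ε) k)) * ((w ε k / ε ^ d : ℝ) : ℂ)
  else 0

theorem profile_zero (κ : ℝ) (m : ℕ) (φ : ℝ → ℝ) (s : ℝ) (B₁ B₂ : ℂ) (q t : ℝ) :
    profile κ m φ s B₁ B₂ 0 0 q t = 0 := by
  simp [profile]

theorem phase_add_smul {d : ℕ} (H : Space d → ℝ) (x₀ y α : Space d) {ε : ℝ} (hε : ε ≠ 0) :
    phase H (x₀ + ε • y) α / ε = phase H x₀ α / ε + inner ℝ α y := by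
  rw [phase, phase, inner_add_right, inner_smul_right]
  field_simp; ring

theorem exists_norm_le_of_continuousOn_sphere {d : ℕ} {F : Space d → ℂ}
    (hF : ContinuousOn F (unitSphere d)) : ∃ C, 0 ≤ C ∧ ∀ α ∈ unitSphere d, ‖F α‖ ≤ C := by
  obtain ⟨C, hC⟩ := (isCompact_sphere (0 : Space d) 1).exists_bound_of_continuousOn hF
  exact ⟨max C 0, le_max_right _ _, fun α hα => (hC α hα).trans (le_max_left _ _)⟩

theorem norm_sub_one_le_gridPoint {d : ℕ} {ε : ℝ} (hε : 0 < ε) (hε1 : ε ≤ 1) {u : Fin d → ℝ}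
    (hu : ∀ i, u i ∈ Set.Ico (0 : ℝ) 1) (k : Fin d → ℤ) :
    Real.sqrt ε * (‖Real.sqrt ε • fun i => (k i : ℝ)‖ - 1) ≤ ‖gridPoint ε u k‖ := by
  have hs : 0 < Real.sqrt ε := Real.sqrt_pos.2 hε
  have hs1 : Real.sqrt ε ≤ 1 := Real.sqrt_le_one.2 hε1
  have h1 : ‖fun i => ε * ((k i : ℝ) + u i)‖ ≤ ‖gridPoint ε u k‖ := by
    rw [pi_norm_le_iff_of_nonneg (norm_nonneg _)]
    intro i
    exact PiLp.norm_apply_le (gridPoint ε u k) i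
  have h2 : (ε • fun i => (k i : ℝ)) = (fun i => ε * ((k i : ℝ) + u i)) - ε • u := by
    ext i; simp; ring
  have h3 : ‖u‖ ≤ 1 := by
    rw [pi_norm_le_iff_of_nonneg zero_le_one]
    intro i
    rw [Real.norm_of_nonneg (hu i).1]
    exact (hu i).2.le
  have h4 : ‖ε • fun i => (k i : ℝ)‖ ≤ ‖gridPoint ε u k‖ + ε := by
    rw [h2]
    refine (norm_sub_le _ _).trans (add_le_add h1 ?_)
    rw [norm_smul, Real.norm_of_nonneg hε.le]
    nlinarith
  have h5 : ‖ε • fun i => (k i : ℝ)‖ = Real.sqrt ε * ‖Real.sqrt ε • fun i => (k i : ℝ)‖ := by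
    rw [norm_smul, norm_smul, Real.norm_of_nonneg hε.le, Real.norm_of_nonneg hs.le, ← mul_assoc,
      Real.mul_self_sqrt hε.le]
  rw [h5] at h4
  have h6 : ε ≤ Real.sqrt ε := by
    nlinarith [Real.mul_self_sqrt hε.le]
  linarith

theorem finite_gridPoint_mem {d : ℕ} {ε : ℝ} (hε : 0 < ε) {u : Fin d → ℝ}
    (hu : ∀ i, u i ∈ Set.Ico (0 : ℝ) 1) {C : Set (Param d)} (hC : Bornology.IsBounded C) :
    {k : Fin d → ℤ | gridPoint ε u k ∈ C}.Finite := by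
  obtain ⟨B, hB⟩ := hC.exists_norm_le
  have hfin : (Set.pi univ fun _ : Fin d => Icc (-⌈B / ε + 1⌉) ⌈B / ε + 1⌉).Finite :=
    Set.Finite.pi fun _ => finite_Icc _ _
  refine hfin.subset fun k hk i _ => ?_
  have h1 : |ε * ((k i : ℝ) + u i)| ≤ B :=
    (PiLp.norm_apply_le (gridPoint ε u k) i).trans (hB _ hk)
  rw [abs_mul, abs_of_pos hε, mul_comm, ← le_div_iff₀ hε, abs_le] at h1
  have h2 := hu i
  have h3 := Int.le_ceil (B / ε + 1)
  constructor
  · have : (-(⌈B / ε + 1⌉ : ℝ)) ≤ k i := by linarith [h1.1, h2.2]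
    exact_mod_cast this
  · have : (k i : ℝ) ≤ ⌈B / ε + 1⌉ := by linarith [h1.2, h2.1]
    exact_mod_cast this

namespace IsLocalSetup

variable {d : ℕ} {H : Space d → ℝ} {x₀ : Space d} {Ω : Set (Space d)} {s : ℝ}
    {B₀ a₀ : Space d → ℂ} {T : Param d → Space d} {U : Set (Param d)} {u : ℝ → Fin d → ℝ}
    {w : ℝ → (Fin d → ℤ) → ℝ} {φ : ℝ → ℝ} {m n : ℕ} {L : ℝ≥0} {R : ℝ}

theorem half_dim_pos (h : IsLocalSetup H x₀ Ω s B₀ a₀ T U u w φ m n L R) : 0 < (d : ℝ) / 2 := by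
  have : (1 : ℝ) ≤ d := by exact_mod_cast h.one_le_dim
  linarith

theorem exists_support (h : IsLocalSetup H x₀ Ω s B₀ a₀ T U u w φ m n L R) :
    ∃ C : Set (Param d), IsCompact C ∧ C ⊆ U ∧
      ∀ v ∈ U, v ∉ C → a₀ (T v) = 0 ∧ a₀ (-T v) = 0 := by
  obtain ⟨K, hK, hKΩ, hK0⟩ := h.support
  obtain ⟨C, hC, hCU, hCK⟩ := h.chart.exists_isCompact_of_mem h.isOpen h.subset_sphere hK hKΩ
  exact ⟨C, hC, hCU, fun v hv hvC => hK0 _ (h.chart.bijOn.mapsTo hv) fun hvK => hvC (hCK v hv hvK)⟩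

theorem gridTerm_eq_zero {C : Set (Param d)}
    (hC : ∀ v ∈ U, v ∉ C → a₀ (T v) = 0 ∧ a₀ (-T v) = 0) {ε : ℝ} (y : Space d) {k : Fin d → ℤ}
    (hk : gridPoint ε (u ε) k ∉ C) : gridTerm H s B₀ a₀ T U u w φ m x₀ ε y k = 0 := by
  unfold gridTerm
  split_ifs with hU
  · rw [directionSum, (hC _ hU hk).1, (hC _ hU hk).2, profile_zero, zero_mul]
  · rfl

theorem summable_gridTerm (h : IsLocalSetup H x₀ Ω s B₀ a₀ T U u w φ m n L R) {ε : ℝ} (hε : 0 < ε)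
    (y : Space d) : Summable (gridTerm H s B₀ a₀ T U u w φ m x₀ ε y) := by
  obtain ⟨C, hC, hCU, hC0⟩ := h.exists_support
  refine summable_of_hasFiniteSupport ((finite_gridPoint_mem hε (h.offset ε) hC.isBounded).subset
    fun k hk => ?_)
  by_contra hkC
  exact hk (gridTerm_eq_zero hC0 y hkC)

/-- On the support of the data the phase is at least c ‖v‖², so q grows at least like z² with z =
‖v‖ / √ε. The decay q^{-(b+1)} of the profile becomes z^{-(d+2)}, which is integrable in dimension
d. -/
theorem gridTerm_bound (h : IsLocalSetup H x₀ Ω s B₀ a₀ T U u w φ m n L R) {Y : ℝ} (hY : 0 ≤ Y) :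
    ∃ C, ∀ᶠ ε in 𝓝[>] (0 : ℝ), ∀ y, ‖y‖ ≤ Y → ∀ k,
      ‖gridTerm H s B₀ a₀ T U u w φ m x₀ ε y k‖ ≤
        C * (1 + ‖Real.sqrt ε • fun i => (k i : ℝ)‖) ^ (-((d : ℝ) + 2)) := by
  have hb := h.half_dim_pos
  set b : ℝ := (d : ℝ) / 2 with hbdef
  obtain ⟨C, hC, hCU, hC0⟩ := h.exists_support
  obtain ⟨c₁, hc₁, hT⟩ := h.chart.exists_mul_norm_le h.isOpen h.zero_mem hC hCU
  obtain ⟨c₂, hc₂, hphase⟩ := h.lower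
  obtain ⟨M₁, hM₁0, hM₁⟩ := exists_norm_le_of_continuousOn_sphere h.continuousOn_symbol
  obtain ⟨M₂, hM₂0, hM₂⟩ := exists_norm_le_of_continuousOn_sphere h.continuousOn_data
  obtain ⟨D, hD0, hD⟩ := h.kernel.profile_bound h.one_lt hb h.exact h.degree (max M₁ M₂) Y hY
  obtain ⟨Cw, ε₀, hε₀, hw⟩ := h.volumes C hC hCU
  obtain ⟨J, hJ⟩ := hC.exists_bound_of_continuousOn
    (fun v hv => (h.chart.continuousAt_jacobian h.isOpen (hCU hv)).continuousWithinAt)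
  set c : ℝ := c₂ * c₁ ^ 2 with hc
  have hcpos : 0 < c := by positivity
  -- From (2 + z)² ≤ 8 + 2z² and z² ≤ (max q 0 + Y) / c; the summand 1 in Y + 1 provides the
  -- coefficient of max q 0.
  set E : ℝ := 8 + 2 * (Y + 1) / c with hE
  have hEpos : 0 < E := by positivity
  refine ⟨D * E ^ (b + 1) * ((1 + |Cw|) * |J|), ?_⟩
  have e1 : ∀ᶠ ε in 𝓝[>] (0 : ℝ), ε < ε₀ :=
    eventually_nhdsWithin_of_eventually_nhds (eventually_lt_nhds hε₀)
  have e2 : ∀ᶠ ε in 𝓝[>] (0 : ℝ), ε ≤ 1 :=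
    eventually_nhdsWithin_of_eventually_nhds (eventually_le_nhds one_pos)
  filter_upwards [e1, e2, self_mem_nhdsWithin] with ε hεε₀ hε1 hε y hy k
  have hε' : (0 : ℝ) < ε := hε
  by_cases hk : gridPoint ε (u ε) k ∈ C
  swap
  · rw [gridTerm_eq_zero hC0 y hk, norm_zero]
    positivity
  have hkU := hCU hk
  set v := gridPoint ε (u ε) k with hv
  set α := T v with hα
  have hαΩ : α ∈ Ω := h.chart.bijOn.mapsTo hkU
  have hαS := h.subset_sphere hαΩ
  have hαS' : -α ∈ unitSphere d := by simpa using hαS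
  have hα1 : ‖α‖ = 1 := by simpa using hαS
  set z : ℝ := ‖v‖ / Real.sqrt ε with hz
  have hsq : 0 < Real.sqrt ε := Real.sqrt_pos.2 hε'
  set q : ℝ := phase H (x₀ + ε • y) α / ε with hq
  have hin : |inner ℝ α y| ≤ Y := by
    refine (abs_real_inner_le_norm α y).trans ?_
    rw [hα1, one_mul]; exact hy
  have hqz : c * z ^ 2 - Y ≤ q := by
    rw [hq, phase_add_smul H x₀ y α hε'.ne']
    have h1 : c * ‖v‖ ^ 2 ≤ phase H x₀ α := by
      refine le_trans ?_ (hphase α hαΩ)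
      calc c * ‖v‖ ^ 2 = c₂ * (c₁ * ‖v‖) ^ 2 := by rw [hc]; ring
        _ ≤ _ := by
          have := hT v hk
          gcongr
    have h2 : c * z ^ 2 = c * ‖v‖ ^ 2 / ε := by
      rw [hz, div_pow, Real.sq_sqrt hε'.le]; ring
    have h3 : c * ‖v‖ ^ 2 / ε ≤ phase H x₀ α / ε := by gcongr
    linarith [(abs_le.1 hin).1]
  have hqY : -Y ≤ q := by
    have : 0 ≤ c * z ^ 2 := by positivity
    linarith
  set ρ : ℝ := ‖Real.sqrt ε • fun i => (k i : ℝ)‖ with hρ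
  have hρ0 : 0 ≤ ρ := norm_nonneg _
  have hρz : ρ ≤ z + 1 := by
    have := norm_sub_one_le_gridPoint hε' hε1 (h.offset ε) k
    rw [← hv, mul_comm, ← le_div_iff₀ hsq] at this
    linarith
  have hmax : 0 ≤ max q 0 := le_max_right _ _
  have hkey : (1 + ρ) ^ 2 ≤ E * (1 + max q 0) := by
    have hz0 : 0 ≤ z := by positivity
    have h1 : (1 + ρ) ^ 2 ≤ 8 + 2 * z ^ 2 := by nlinarith [sq_nonneg (z - 2)]
    have h2 : z ^ 2 ≤ (max q 0 + Y) / c := by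
      rw [le_div_iff₀ hcpos]
      linarith [le_max_left q 0]
    have h3 : E * (1 + max q 0) = 8 + 2 * ((max q 0 + Y) / c) +
        (8 * max q 0 + 2 / c + 2 * Y / c * max q 0) := by rw [hE]; field_simp; ring
    have h4 : 0 ≤ 8 * max q 0 + 2 / c + 2 * Y / c * max q 0 := by positivity
    linarith
  have hpow : (1 + max q 0) ^ (-(b + 1)) ≤ E ^ (b + 1) * (1 + ρ) ^ (-((d : ℝ) + 2)) := by
    rw [Real.rpow_neg (by positivity), Real.rpow_neg (by positivity), ← div_eq_mul_inv,
      le_div_iff₀ (by positivity), inv_mul_le_iff₀ (by positivity), mul_comm,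
      ← Real.mul_rpow hEpos.le (by positivity),
      show (d : ℝ) + 2 = (2 : ℕ) * (b + 1) by rw [hbdef]; push_cast; ring, Real.rpow_mul
      (by positivity), Real.rpow_natCast]
    exact Real.rpow_le_rpow (by positivity) hkey (by linarith)
  have hprof := hD (B₀ α) (B₀ (-α)) (a₀ α) (a₀ (-α)) ((hM₁ α hαS).trans (le_max_left _ _))
    ((hM₁ _ hαS').trans (le_max_left _ _)) ((hM₂ α hαS).trans (le_max_right _ _))
    ((hM₂ _ hαS').trans (le_max_right _ _)) (h.coeff α hαΩ) q
    (inner ℝ α (x₀ + ε • y) / ε) hqY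
  have hwt : |w ε k / ε ^ d| ≤ (1 + |Cw|) * |J| := by
    have hεd : 0 < ε ^ d := by positivity
    have h1 := hw ε hε' hεε₀ k hk
    have hJ0 : 0 ≤ jacobian T v := Real.sqrt_nonneg _
    have h2 : jacobian T v ≤ |J| := by
      have := hJ v hk
      rw [Real.norm_of_nonneg hJ0] at this
      exact this.trans (le_abs_self _)
    rw [abs_div, abs_of_pos hεd, div_le_iff₀ hεd]
    have h3 : |w ε k| ≤ |w ε k - ε ^ d * jacobian T v| + |ε ^ d * jacobian T v| := by
      have := abs_add_le (w ε k - ε ^ d * jacobian T v) (ε ^ d * jacobian T v)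
      rwa [sub_add_cancel] at this
    have h4 : |ε ^ d * jacobian T v| = ε ^ d * jacobian T v := abs_of_nonneg (by positivity)
    have h5 : Cw * ε * (ε ^ d * jacobian T v) ≤ |Cw| * (ε ^ d * jacobian T v) := by
      gcongr
      calc Cw * ε ≤ |Cw| * ε := by gcongr; exact le_abs_self _
        _ ≤ |Cw| * 1 := by gcongr
        _ = _ := mul_one _
    calc |w ε k| ≤ (1 + |Cw|) * (ε ^ d * jacobian T v) := by
          rw [h4] at h3
          linarith
      _ ≤ (1 + |Cw|) * (ε ^ d * |J|) := by gcongr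
      _ = _ := by ring
  unfold gridTerm
  rw [if_pos hkU, norm_mul, Complex.norm_real, Real.norm_eq_abs, directionSum]
  calc _ ≤ (D * (1 + max q 0) ^ (-(b + 1))) * ((1 + |Cw|) * |J|) := by
        gcongr
    _ ≤ (D * (E ^ (b + 1) * (1 + ρ) ^ (-((d : ℝ) + 2)))) * ((1 + |Cw|) * |J|) := by gcongr
    _ = _ := by ring

end IsLocalSetup

/-! ### Local behaviour on blocks of neighbouring grid points -/

theorem profile_add_int (κ : ℝ) (m : ℕ) (φ : ℝ → ℝ) (s : ℝ) (B₁ B₂ a₁ a₂ : ℂ) (q t : ℝ) (n : ℤ) :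
    profile κ m φ s B₁ B₂ a₁ a₂ q (t + n) = profile κ m φ s B₁ B₂ a₁ a₂ q t := by
  simp only [profile, sampleSum_add_int]

theorem profile_mul (κ : ℝ) (m : ℕ) (φ : ℝ → ℝ) (s : ℝ) (c B₁ B₂ a₁ a₂ : ℂ) (q t : ℝ) :
    profile κ m φ s (c * B₁) (c * B₂) a₁ a₂ q t = profile κ m φ s B₁ B₂ a₁ a₂ q t * c := by
  simp only [profile]; ring

namespace IsFilterKernel

variable {s b : ℝ} {m n : ℕ} {φ : ℝ → ℝ} {L : ℝ≥0} {R : ℝ}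

theorem continuous_profile_joint (h : IsFilterKernel (s + b) m φ L R) (hs : 1 < s) (hb : 0 < b) :
    Continuous fun p : (ℂ × ℂ) × (ℂ × ℂ) × ℝ × ℝ =>
      profile (s + b) m φ s p.1.1 p.1.2 p.2.1.1 p.2.1.2 p.2.2.1 p.2.2.2 := by
  have h1 := (h.continuous_sampleSum (σ := 1) hs.le hb (by simp)).comp
    (continuous_snd.comp (continuous_snd (X := ℂ × ℂ) (Y := (ℂ × ℂ) × ℝ × ℝ)))
  have h2 := (h.continuous_sampleSum (σ := -1) hs.le hb (by simp)).comp
    (continuous_snd.comp (continuous_snd (X := ℂ × ℂ) (Y := (ℂ × ℂ) × ℝ × ℝ)))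
  have h3 := Complex.continuous_conj.comp h1
  have h4 := Complex.continuous_conj.comp h2
  simp only [Function.comp_def] at h1 h2 h3 h4
  unfold profile
  fun_prop

/-- Compactness of [0, 1] and periodicity make the continuity uniform in the phase t, which itself
has no limit. The last coordinate of p is a small perturbation of the phase. -/
theorem eventually_norm_profile_sub_lt (h : IsFilterKernel (s + b) m φ L R) (hs : 1 < s)
    (hb : 0 < b) (B₁ B₂ a₁ a₂ : ℂ) (q : ℝ) {η : ℝ} (hη : 0 < η) :
    ∀ᶠ p : (ℂ × ℂ) × (ℂ × ℂ) × ℝ × ℝ in 𝓝 ((B₁, B₂), (a₁, a₂), q, 0), ∀ t : ℝ,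
      ‖profile (s + b) m φ s p.1.1 p.1.2 p.2.1.1 p.2.1.2 p.2.2.1 (t + p.2.2.2) -
        profile (s + b) m φ s B₁ B₂ a₁ a₂ q t‖ < η := by
  have hc := h.continuous_profile_joint hs hb
  have hc1 : Continuous fun z : ((ℂ × ℂ) × (ℂ × ℂ) × ℝ × ℝ) × ℝ =>
      ‖profile (s + b) m φ s z.1.1.1 z.1.1.2 z.1.2.1.1 z.1.2.1.2 z.1.2.2.1 (z.2 + z.1.2.2.2) -
        profile (s + b) m φ s B₁ B₂ a₁ a₂ q z.2‖ := by
    have e1 := hc.comp (f := fun z : ((ℂ × ℂ) × (ℂ × ℂ) × ℝ × ℝ) × ℝ =>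
      (z.1.1, z.1.2.1, z.1.2.2.1, z.2 + z.1.2.2.2)) (by fun_prop)
    have e2 := hc.comp (f := fun z : ((ℂ × ℂ) × (ℂ × ℂ) × ℝ × ℝ) × ℝ =>
      ((B₁, B₂), (a₁, a₂), q, z.2)) (by fun_prop)
    exact (e1.sub e2).norm
  have hev : ∀ t ∈ Icc (0 : ℝ) 1, ∀ᶠ z : ((ℂ × ℂ) × (ℂ × ℂ) × ℝ × ℝ) × ℝ in
      𝓝 (((B₁, B₂), (a₁, a₂), q, 0), t),
      ‖profile (s + b) m φ s z.1.1.1 z.1.1.2 z.1.2.1.1 z.1.2.1.2 z.1.2.2.1 (z.2 + z.1.2.2.2) -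
        profile (s + b) m φ s B₁ B₂ a₁ a₂ q z.2‖ < η := fun t _ => by
    refine hc1.continuousAt.eventually (gt_mem_nhds ?_)
    simpa using hη
  filter_upwards [isCompact_Icc.eventually_forall_of_forall_eventually
    (P := fun (p : (ℂ × ℂ) × (ℂ × ℂ) × ℝ × ℝ) (t : ℝ) =>
      ‖profile (s + b) m φ s p.1.1 p.1.2 p.2.1.1 p.2.1.2 p.2.2.1 (t + p.2.2.2) -
        profile (s + b) m φ s B₁ B₂ a₁ a₂ q t‖ < η) hev] with p hp t
  have h1 := hp (Int.fract t) ⟨Int.fract_nonneg t, (Int.fract_lt_one t).le⟩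
  have h2 : t + p.2.2.2 = Int.fract t + p.2.2.2 + (⌊t⌋ : ℤ) := by
    have := Int.fract_add_floor t
    linarith
  have h3 := profile_add_int (s + b) m φ s B₁ B₂ a₁ a₂ q (Int.fract t) ⌊t⌋
  rw [Int.fract_add_floor] at h3
  rwa [h2, profile_add_int, h3]

end IsFilterKernel

/-- The block length ⌈ε^{-1/4}⌉ is a compromise: it tends to infinity, as Weyl's theorem requires,
but a block has length o(1) in the variable w = v / √ε, so that all quantities except the phase are
constant in the limit. -/
theorem tendsto_sqrt_mul_ceil :
    Tendsto (fun ε : ℝ => Real.sqrt ε * ((⌈ε ^ (-(1 / 4) : ℝ)⌉₊ : ℝ) + 1)) (𝓝[>] 0) (𝓝 0) := by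
  have h1 : Tendsto (fun ε : ℝ => ε ^ (1 / 4 : ℝ) + 2 * Real.sqrt ε) (𝓝[>] 0) (𝓝 0) := by
    have : Continuous fun ε : ℝ => ε ^ (1 / 4 : ℝ) + 2 * Real.sqrt ε :=
      (Real.continuous_rpow_const (by norm_num)).add (continuous_const.mul Real.continuous_sqrt)
    have h2 := this.tendsto 0
    rw [Real.sqrt_zero, Real.zero_rpow (by norm_num)] at h2
    simp only [mul_zero, add_zero] at h2
    exact h2.mono_left nhdsWithin_le_nhds
  refine tendsto_of_tendsto_of_tendsto_of_le_of_le' tendsto_const_nhds h1 ?_ ?_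
  · exact Eventually.of_forall fun ε => by positivity
  · filter_upwards [self_mem_nhdsWithin] with ε hε
    have hε' : (0 : ℝ) < ε := hε
    have h2 : (⌈ε ^ (-(1 / 4) : ℝ)⌉₊ : ℝ) ≤ ε ^ (-(1 / 4) : ℝ) + 1 :=
      (Nat.ceil_lt_add_one (by positivity)).le
    have h3 : Real.sqrt ε * ε ^ (-(1 / 4) : ℝ) = ε ^ (1 / 4 : ℝ) := by
      rw [Real.sqrt_eq_rpow, ← Real.rpow_add hε']; norm_num
    calc _ ≤ Real.sqrt ε * ((ε ^ (-(1 / 4) : ℝ) + 1) + 1) := by gcongr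
      _ = Real.sqrt ε * ε ^ (-(1 / 4) : ℝ) + 2 * Real.sqrt ε := by ring
      _ = _ := by rw [h3]

theorem tendsto_ceil_rpow_atTop :
    Tendsto (fun ε : ℝ => ⌈ε ^ (-(1 / 4) : ℝ)⌉₊) (𝓝[>] 0) atTop := by
  refine tendsto_nat_ceil_atTop.comp ?_
  exact tendsto_rpow_neg_nhdsGT_zero (by norm_num)

section Local

variable {d : ℕ} {H : Space d → ℝ} {x₀ : Space d} {Ω : Set (Space d)} {T : Param d → Space d}
  {U : Set (Param d)} {ι : Type*} {𝓛 : Filter ι} {ε : ι → ℝ}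

theorem tendsto_phase_div (h : IsDirectionChart T U Ω) (hU : IsOpen U)
    (hΩ : Ω ⊆ unitSphere d) (h0 : (0 : Param d) ∈ U) (hs : ContDiffOn ℝ ∞ H {0}ᶜ)
    (hH : ∀ c : ℝ, 0 < c → ∀ ξ : Space d, ξ ≠ 0 → H (c • ξ) = c * H ξ)
    (hx : HasGradientAt H x₀ (T 0)) (hε : Tendsto ε 𝓛 (𝓝[>] 0)) {Z : ι → Param d} {z : Param d}
    (hZ : Tendsto Z 𝓛 (𝓝 z)) :
    Tendsto (fun p => phase H x₀ (T (Real.sqrt (ε p) • Z p)) / ε p) 𝓛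
      (𝓝 ((-iteratedFDeriv ℝ 2 H (T 0) ![fderiv ℝ T 0 z, fderiv ℝ T 0 z]) / 2)) := by
  set Q : Param d → ℝ := fun v =>
    (-iteratedFDeriv ℝ 2 H (T 0) ![fderiv ℝ T 0 v, fderiv ℝ T 0 v]) / 2 with hQ
  have hQc : Continuous Q :=
    (((continuous_iteratedFDeriv_two H (T 0)).comp (fderiv ℝ T 0).continuous).neg).div_const 2
  have hpos : ∀ᶠ p in 𝓛, 0 < ε p := (tendsto_nhdsWithin_iff.1 hε).2
  have hsqrt : Tendsto (fun p => Real.sqrt (ε p)) 𝓛 (𝓝 0) := by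
    have := (Real.continuous_sqrt.tendsto 0).comp (tendsto_nhdsWithin_iff.1 hε).1
    rwa [Real.sqrt_zero] at this
  have hV : Tendsto (fun p => Real.sqrt (ε p) • Z p) 𝓛 (𝓝 0) := by
    have := hsqrt.smul hZ
    rwa [zero_smul] at this
  have hdiff : Tendsto (fun p => phase H x₀ (T (Real.sqrt (ε p) • Z p)) / ε p - Q (Z p)) 𝓛
      (𝓝 0) := by
    rw [Metric.tendsto_nhds]
    intro η hη
    have hb : ∀ᶠ p in 𝓛, ‖Z p‖ < ‖z‖ + 1 := hZ.norm.eventually (gt_mem_nhds (by linarith))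
    have hη' : 0 < η / (2 * (‖z‖ + 1) ^ 2) := by positivity
    filter_upwards [hV.eventually (h.eventually_abs_phase_chart_le hU hΩ h0 hs hH hx hη'), hb, hpos]
      with p hp hbp hεp
    rw [Real.dist_eq, sub_zero]
    have e1 : (-iteratedFDeriv ℝ 2 H (T 0) ![fderiv ℝ T 0 (Real.sqrt (ε p) • Z p),
        fderiv ℝ T 0 (Real.sqrt (ε p) • Z p)]) / 2 = ε p * Q (Z p) := by
      rw [map_smul, iteratedFDeriv_two_smul, Real.sq_sqrt hεp.le]
      simp only [hQ]; ring
    rw [e1, norm_smul, mul_pow, Real.norm_of_nonneg (Real.sqrt_nonneg _), Real.sq_sqrt hεp.le] at hp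
    have e2 : phase H x₀ (T (Real.sqrt (ε p) • Z p)) / ε p - Q (Z p) =
        (phase H x₀ (T (Real.sqrt (ε p) • Z p)) - ε p * Q (Z p)) / ε p := by field_simp
    rw [e2, abs_div, abs_of_pos hεp, div_lt_iff₀ hεp]
    refine hp.trans_lt ?_
    have e3 : ‖Z p‖ ^ 2 < (‖z‖ + 1) ^ 2 := by
      have := norm_nonneg (Z p)
      nlinarith
    calc η / (2 * (‖z‖ + 1) ^ 2) * (ε p * ‖Z p‖ ^ 2)
        ≤ η / (2 * (‖z‖ + 1) ^ 2) * (ε p * (‖z‖ + 1) ^ 2) := by gcongr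
      _ = η * ε p / 2 := by field_simp
      _ < η * ε p := by nlinarith [mul_pos hη hεp]
  have := hdiff.add ((hQc.tendsto z).comp hZ)
  simpa using this

/-- Along a block α·x / ε advances like an exact rotation. The nonlinearity of T contributes at most
a multiple of (‖Z‖ + √ε l) √ε l, and the displacement y enters without the factor 1 / ε, so
continuity of T handles it. -/
theorem tendsto_inner_increment (h : IsDirectionChart T U Ω) (hU : IsOpen U)
    (h0 : (0 : Param d) ∈ U) (i : Fin d) (x₀ : Space d) {y : ι → Space d} {y₀ : Space d}
    (hy : Tendsto y 𝓛 (𝓝 y₀)) (hε : Tendsto ε 𝓛 (𝓝[>] 0)) {l : ι → ℝ} (hl0 : ∀ p, 0 ≤ l p)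
    (hl : Tendsto (fun p => Real.sqrt (ε p) * l p) 𝓛 (𝓝 0)) {Z : ι → Param d} {z : Param d}
    (hZ : Tendsto Z 𝓛 (𝓝 z)) :
    Tendsto (fun p =>
      inner ℝ (T (Real.sqrt (ε p) • Z p + (ε p * l p) • EuclideanSpace.single i (1 : ℝ)))
        (x₀ + ε p • y p) / ε p - (inner ℝ (T (Real.sqrt (ε p) • Z p)) (x₀ + ε p • y p) / ε p +
        l p * inner ℝ (fderiv ℝ T 0 (EuclideanSpace.single i 1)) x₀)) 𝓛 (𝓝 0) := by
  obtain ⟨K, hK0, ρ, hρ, hK⟩ := h.exists_norm_increment_le hU h0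
  have hpos : ∀ᶠ p in 𝓛, 0 < ε p := (tendsto_nhdsWithin_iff.1 hε).2
  have hsqrt : Tendsto (fun p => Real.sqrt (ε p)) 𝓛 (𝓝 0) := by
    have := (Real.continuous_sqrt.tendsto 0).comp (tendsto_nhdsWithin_iff.1 hε).1
    rwa [Real.sqrt_zero] at this
  set e : Param d := EuclideanSpace.single i (1 : ℝ) with he
  have hen : ‖e‖ = 1 := by simp [he]
  set V : ι → Param d := fun p => Real.sqrt (ε p) • Z p with hVdef
  have hV : Tendsto V 𝓛 (𝓝 0) := by
    have := hsqrt.smul hZ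
    rwa [zero_smul] at this
  have hεl : Tendsto (fun p => ε p * l p) 𝓛 (𝓝 0) := by
    have := hsqrt.mul hl
    rw [mul_zero] at this
    refine this.congr' ?_
    filter_upwards [hpos] with p hp
    rw [← mul_assoc, Real.mul_self_sqrt hp.le]
  have hW : Tendsto (fun p => V p + (ε p * l p) • e) 𝓛 (𝓝 0) := by
    have := hV.add (hεl.smul_const e)
    rwa [zero_smul, add_zero] at this
  have hTc : ContinuousAt T 0 := (h.differentiableAt hU h0).continuousAt
  have h1 : Tendsto (fun p => inner ℝ (T (V p + (ε p * l p) • e) - T (V p)) (y p)) 𝓛 (𝓝 0) := by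
    have := ((hTc.tendsto.comp hW).sub (hTc.tendsto.comp hV)).inner hy (𝕜 := ℝ)
    rw [sub_self, inner_zero_left] at this
    exact this
  have h2 : Tendsto (fun p => ‖x₀‖ * (K * (‖Z p‖ + Real.sqrt (ε p) * l p) *
      (Real.sqrt (ε p) * l p))) 𝓛 (𝓝 0) := by
    have := (((hZ.norm.add hl).const_mul K).mul hl).const_mul ‖x₀‖
    rwa [mul_zero, mul_zero] at this
  have h3 : Tendsto (fun p => inner ℝ (T (V p + (ε p * l p) • e) - T (V p) -
      fderiv ℝ T 0 ((ε p * l p) • e)) x₀ / ε p) 𝓛 (𝓝 0) := by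
    refine squeeze_zero_norm' ?_ h2
    have n1 : ∀ᶠ p in 𝓛, ‖V p‖ < ρ := by
      have := hV.norm; rw [norm_zero] at this
      exact this.eventually (gt_mem_nhds hρ)
    have n2 : ∀ᶠ p in 𝓛, ‖V p + (ε p * l p) • e‖ < ρ := by
      have := hW.norm; rw [norm_zero] at this
      exact this.eventually (gt_mem_nhds hρ)
    filter_upwards [n1, n2, hpos] with p hp1 hp2 hp
    have hn : ‖(ε p * l p) • e‖ = ε p * l p := by
      rw [norm_smul, hen, mul_one, Real.norm_of_nonneg (mul_nonneg hp.le (hl0 p))]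
    have hb := hK (V p) ((ε p * l p) • e) hp1 hp2
    rw [hn] at hb
    rw [norm_div, Real.norm_of_nonneg hp.le, div_le_iff₀ hp]
    refine (norm_inner_le_norm _ _).trans ?_
    have hVn : ‖V p‖ = Real.sqrt (ε p) * ‖Z p‖ := by
      simp only [hVdef]
      rw [norm_smul, Real.norm_of_nonneg (Real.sqrt_nonneg _)]
    calc _ ≤ (K * (‖V p‖ + ε p * l p) * (ε p * l p)) * ‖x₀‖ := by gcongr
      _ = _ := by
        rw [hVn]
        have := Real.mul_self_sqrt hp.le
        linear_combination (-(K * ε p * l p ^ 2 * ‖x₀‖)) * this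
  have := h3.add h1
  rw [add_zero] at this
  refine this.congr' ?_
  filter_upwards [hpos] with p hp
  simp only [inner_sub_left, inner_add_right, inner_smul_right, map_smul, inner_smul_left,
    RCLike.conj_to_real]
  field_simp
  ring

end Local

theorem eventually_prod_top_inf_principal {α β : Type*} {𝓕 : Filter α} {S : Set (α × β)}
    {P : α × β → Prop} (h : ∀ᶠ p in (𝓕 ×ˢ (⊤ : Filter β)) ⊓ 𝓟 S, P p) :
    ∀ᶠ x in 𝓕, ∀ l, (x, l) ∈ S → P (x, l) := by
  rw [eventually_inf_principal, ← principal_univ, eventually_prod_principal_iff] at h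
  exact h.mono fun x hx l hl => hx l (mem_univ l) hl

theorem norm_average_sub_integral_le {M : ℕ} (hM : 0 < M) {F : ℕ → ℂ} {P : ℝ → ℂ} {θ t₀ η : ℝ}
    (hF : ∀ l < M, ‖F l - P (t₀ + l * θ)‖ ≤ η)
    (hP : ‖(M : ℂ)⁻¹ * ∑ l ∈ Finset.range M, P (t₀ + l * θ) - ∫ x in (0 : ℝ)..1, P x‖ ≤ η) :
    ‖(M : ℂ)⁻¹ * ∑ l ∈ Finset.range M, F l - ∫ x in (0 : ℝ)..1, P x‖ ≤ 2 * η := by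
  have hM' : (0 : ℝ) < M := by exact_mod_cast hM
  have h1 : ‖(M : ℂ)⁻¹ * ∑ l ∈ Finset.range M, (F l - P (t₀ + l * θ))‖ ≤ η := by
    rw [norm_mul, norm_inv, Complex.norm_natCast, inv_mul_le_iff₀ hM']
    refine (norm_sum_le _ _).trans ((Finset.sum_le_sum fun l hl =>
      hF l (Finset.mem_range.1 hl)).trans (le_of_eq ?_))
    simp
  have h2 : (M : ℂ)⁻¹ * ∑ l ∈ Finset.range M, F l - ∫ x in (0 : ℝ)..1, P x =
      (M : ℂ)⁻¹ * ∑ l ∈ Finset.range M, (F l - P (t₀ + l * θ)) +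
        ((M : ℂ)⁻¹ * ∑ l ∈ Finset.range M, P (t₀ + l * θ) - ∫ x in (0 : ℝ)..1, P x) := by
    rw [Finset.sum_sub_distrib]
    ring
  rw [h2]
  linarith [norm_add_le ((M : ℂ)⁻¹ * ∑ l ∈ Finset.range M, (F l - P (t₀ + l * θ)))
    ((M : ℂ)⁻¹ * ∑ l ∈ Finset.range M, P (t₀ + l * θ) - ∫ x in (0 : ℝ)..1, P x)]

/-- A sum that follows a periodic function along an irrational rotation has its mean as limit. -/
theorem tendsto_average_of_rotation {α : Type*} {𝓕 : Filter α} {M : α → ℕ}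
    (hM : Tendsto M 𝓕 atTop) {F : α → ℕ → ℂ} {P : ℝ → ℂ} {θ : ℝ} (hP : HasUniformMean θ P)
    (hF : ∀ η > 0, ∀ᶠ x in 𝓕, ∃ t₀ : ℝ, ∀ l < M x, ‖F x l - P (t₀ + l * θ)‖ ≤ η) :
    Tendsto (fun x => (M x : ℂ)⁻¹ * ∑ l ∈ Finset.range (M x), F x l) 𝓕
      (𝓝 (∫ x in (0 : ℝ)..1, P x)) := by
  rw [Metric.tendsto_nhds]
  intro η hη
  obtain ⟨M₀, hM₀⟩ := hP (η / 3) (by positivity)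
  filter_upwards [hF (η / 3) (by positivity), hM.eventually (eventually_ge_atTop (M₀ + 1))] with x
    ⟨t₀, hx⟩ hxM
  have hW := hM₀ (M x) (by omega) t₀
  rw [rotationDefect] at hW
  rw [dist_eq_norm]
  linarith [norm_average_sub_integral_le (by omega) hx hW]

theorem IsFilterKernel.hasUniformMean_profile {s b : ℝ} {m : ℕ} {φ : ℝ → ℝ} {L : ℝ≥0} {R : ℝ}
    (h : IsFilterKernel (s + b) m φ L R) (hs : 1 < s) (hb : 0 < b) (B₁ B₂ a₁ a₂ : ℂ) {θ : ℝ}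
    (hθ : Irrational θ) (q : ℝ) :
    HasUniformMean θ fun t => profile (s + b) m φ s B₁ B₂ a₁ a₂ q t := by
  have hc := (h.continuous_profile hs hb B₁ B₂ a₁ a₂).comp
    (continuous_const.prodMk continuous_id : Continuous fun t : ℝ => (q, t))
  refine hasUniformMean_of_irrational hθ hc fun t => ?_
  have := profile_add_int (s + b) m φ s B₁ B₂ a₁ a₂ q t 1
  rwa [Int.cast_one] at this

/-! ### Convergence of the block averages -/

section Grid

variable {d : ℕ} {ι : Type*} {𝓛 : Filter ι} {ε : ι → ℝ}

/-- The grid point with index near `w/√ε`, shifted by `l` in the direction `i`, divided by `√ε`. -/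
noncomputable def scaledGrid (u : ℝ → Fin d → ℝ) (w : Fin d → ℝ) (i : Fin d) (ε : ℝ) (l : ℕ) :
    Param d :=
  WithLp.toLp 2 fun j => Real.sqrt ε *
    (((floorVec ((Real.sqrt ε)⁻¹ • w) + Pi.single i (l : ℤ) : Fin d → ℤ) j : ℝ) + u ε j)

theorem gridPoint_eq_smul (u : ℝ → Fin d → ℝ) (w : Fin d → ℝ) (i : Fin d) {ε : ℝ} (hε : 0 < ε)
    (l : ℕ) : gridPoint ε (u ε) (floorVec ((Real.sqrt ε)⁻¹ • w) + Pi.single i (l : ℤ)) =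
      Real.sqrt ε • scaledGrid u w i ε l := by
  ext j
  simp only [gridPoint, scaledGrid, PiLp.smul_apply, smul_eq_mul, ← mul_assoc,
    Real.mul_self_sqrt hε.le]

theorem gridPoint_eq_add (u : ℝ → Fin d → ℝ) (w : Fin d → ℝ) (i : Fin d) {ε : ℝ} (hε : 0 < ε)
    (l : ℕ) : gridPoint ε (u ε) (floorVec ((Real.sqrt ε)⁻¹ • w) + Pi.single i (l : ℤ)) =
      Real.sqrt ε • scaledGrid u w i ε 0 + (ε * l) • EuclideanSpace.single i (1 : ℝ) := by
  rw [← gridPoint_eq_smul u w i hε]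
  ext j
  simp only [gridPoint, PiLp.add_apply, PiLp.smul_apply, smul_eq_mul, Pi.add_apply, Int.cast_add]
  rcases eq_or_ne j i with rfl | hj
  · simp; ring
  · simp [hj]

theorem tendsto_scaledGrid {u : ℝ → Fin d → ℝ}
    (hu : ∀ ε : ℝ, ∀ i : Fin d, u ε i ∈ Set.Ico (0 : ℝ) 1) (w : Fin d → ℝ) (i : Fin d)
    (hε : Tendsto ε 𝓛 (𝓝[>] 0)) {l : ι → ℕ}
    (hl : Tendsto (fun p => Real.sqrt (ε p) * l p) 𝓛 (𝓝 0)) :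
    Tendsto (fun p => scaledGrid u w i (ε p) (l p)) 𝓛 (𝓝 (WithLp.toLp 2 w)) := by
  refine ((PiLp.continuous_toLp 2 fun _ : Fin d => ℝ).tendsto w).comp ?_
  rw [tendsto_pi_nhds]
  intro j
  have hpos : ∀ᶠ p in 𝓛, 0 < ε p := (tendsto_nhdsWithin_iff.1 hε).2
  have hsqrt : Tendsto (fun p => Real.sqrt (ε p)) 𝓛 (𝓝 0) := by
    have := (Real.continuous_sqrt.tendsto 0).comp (tendsto_nhdsWithin_iff.1 hε).1
    rwa [Real.sqrt_zero] at this
  have hb : Tendsto (fun p => 2 * Real.sqrt (ε p) + Real.sqrt (ε p) * l p) 𝓛 (𝓝 0) := by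
    have := (hsqrt.const_mul 2).add hl
    rwa [mul_zero, add_zero] at this
  rw [tendsto_iff_norm_sub_tendsto_zero]
  refine squeeze_zero' (Eventually.of_forall fun p => norm_nonneg _) ?_ hb
  filter_upwards [hpos] with p hp
  have hs : 0 < Real.sqrt (ε p) := Real.sqrt_pos.2 hp
  have h1 := norm_floorVec_add_single_sub_le ((Real.sqrt (ε p))⁻¹ • w) i (l p)
  have h2 := (norm_le_pi_norm _ j).trans h1
  set k : ℝ := ((floorVec ((Real.sqrt (ε p))⁻¹ • w) + Pi.single i (l p : ℤ) : Fin d → ℤ) j : ℝ)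
    with hk
  have h3 : |k - (Real.sqrt (ε p))⁻¹ * w j| ≤ 1 + l p := h2
  have h4 := hu (ε p) j
  have h5 : Real.sqrt (ε p) * (k + u (ε p) j) - w j =
      Real.sqrt (ε p) * ((k - (Real.sqrt (ε p))⁻¹ * w j) + u (ε p) j) := by
    field_simp
    ring
  rw [h5, Real.norm_eq_abs, abs_mul, abs_of_pos hs]
  have h6 : |k - (Real.sqrt (ε p))⁻¹ * w j + u (ε p) j| ≤ 2 + l p := by
    refine (abs_add_le _ _).trans ?_
    rw [abs_of_nonneg h4.1]
    linarith [h4.2]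
  calc _ ≤ Real.sqrt (ε p) * (2 + l p) := by gcongr
    _ = _ := by ring

end Grid

namespace IsLocalSetup

variable {d : ℕ} {H : Space d → ℝ} {x₀ : Space d} {Ω : Set (Space d)} {s : ℝ}
    {B₀ a₀ : Space d → ℂ} {T : Param d → Space d} {U : Set (Param d)} {u : ℝ → Fin d → ℝ}
    {w : ℝ → (Fin d → ℤ) → ℝ} {φ : ℝ → ℝ} {m n : ℕ} {L : ℝ≥0} {R : ℝ}

theorem tendsto_comp_chart (h : IsLocalSetup H x₀ Ω s B₀ a₀ T U u w φ m n L R) {ι : Type*}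
    {𝓛 : Filter ι} {V : ι → Param d} (hV : Tendsto V 𝓛 (𝓝 0)) {F : Space d → ℂ}
    (hF : ContinuousOn F (unitSphere d)) :
    Tendsto (fun p => F (T (V p))) 𝓛 (𝓝 (F (T 0))) ∧
      Tendsto (fun p => F (-T (V p))) 𝓛 (𝓝 (F (-T 0))) := by
  have hT : Tendsto (fun p => T (V p)) 𝓛 (𝓝[unitSphere d] (T 0)) := by
    refine tendsto_nhdsWithin_iff.2 ⟨?_, ?_⟩
    · exact ((h.chart.differentiableAt h.isOpen h.zero_mem).continuousAt.tendsto).comp hV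
    · filter_upwards [hV.eventually (h.isOpen.mem_nhds h.zero_mem)] with p hp
      exact h.subset_sphere (h.chart.bijOn.mapsTo hp)
  have h0 : T 0 ∈ unitSphere d := h.subset_sphere (h.chart.bijOn.mapsTo h.zero_mem)
  have h0' : -T 0 ∈ unitSphere d := by simpa using h0
  refine ⟨(hF _ h0).tendsto.comp hT, (hF _ h0').tendsto.comp ?_⟩
  refine tendsto_nhdsWithin_iff.2 ⟨(tendsto_nhdsWithin_iff.1 hT).1.neg, ?_⟩
  filter_upwards [(tendsto_nhdsWithin_iff.1 hT).2] with p hp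
  simpa using hp

theorem tendsto_volume (h : IsLocalSetup H x₀ Ω s B₀ a₀ T U u w φ m n L R) {ι : Type*}
    {𝓛 : Filter ι} {ε : ι → ℝ} (hε : Tendsto ε 𝓛 (𝓝[>] 0)) {k : ι → Fin d → ℤ}
    (hV : Tendsto (fun p => gridPoint (ε p) (u (ε p)) (k p)) 𝓛 (𝓝 0)) :
    Tendsto (fun p => w (ε p) (k p) / ε p ^ d) 𝓛 (𝓝 (jacobian T 0)) := by
  obtain ⟨K, hK, h0K, hKU⟩ := exists_compact_subset h.isOpen h.zero_mem
  obtain ⟨C, ε₀, hε₀, hC⟩ := h.volumes K hK hKU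
  have hJ := (h.chart.continuousAt_jacobian h.isOpen h.zero_mem).tendsto.comp hV
  have hε0 := (tendsto_nhdsWithin_iff.1 hε).1
  have hpos : ∀ᶠ p in 𝓛, 0 < ε p := (tendsto_nhdsWithin_iff.1 hε).2
  have hz : Tendsto (fun p => C * ε p * jacobian T (gridPoint (ε p) (u (ε p)) (k p))) 𝓛 (𝓝 0) := by
    have := (hε0.const_mul C).mul hJ
    rwa [mul_zero, zero_mul] at this
  have hd : Tendsto (fun p => w (ε p) (k p) / ε p ^ d -
      jacobian T (gridPoint (ε p) (u (ε p)) (k p))) 𝓛 (𝓝 0) := by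
    refine squeeze_zero_norm' ?_ hz
    filter_upwards [hpos, hε0.eventually (gt_mem_nhds hε₀),
      hV.eventually (mem_interior_iff_mem_nhds.1 h0K)] with p hp hp0 hpK
    have h1 := hC (ε p) hp hp0 (k p) hpK
    have hpd : 0 < ε p ^ d := by positivity
    have h2 : w (ε p) (k p) / ε p ^ d - jacobian T (gridPoint (ε p) (u (ε p)) (k p)) =
        (w (ε p) (k p) - ε p ^ d * jacobian T (gridPoint (ε p) (u (ε p)) (k p))) / ε p ^ d := by
      field_simp
    rw [h2, norm_div, Real.norm_of_nonneg hpd.le, div_le_iff₀ hpd, Real.norm_eq_abs]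
    refine h1.trans (le_of_eq (by ring))
  have := hd.add hJ
  rw [zero_add] at this
  refine this.congr fun p => ?_
  simp

/-- Near the critical point the terms of the sum are close to the profile along a rotation orbit. -/
theorem eventually_norm_gridTerm_sub_le (h : IsLocalSetup H x₀ Ω s B₀ a₀ T U u w φ m n L R)
    (i : Fin d) (y₀ : Space d) (w₀ : Fin d → ℝ) {η : ℝ} (hη : 0 < η) :
    ∀ᶠ x : ℝ × Space d in 𝓝[>] 0 ×ˢ 𝓝 y₀, ∃ t₀ : ℝ, ∀ l < ⌈x.1 ^ (-(1 / 4) : ℝ)⌉₊,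
      ‖gridTerm H s B₀ a₀ T U u w φ m x₀ x.1 x.2
          (floorVec ((Real.sqrt x.1)⁻¹ • w₀) + Pi.single i (l : ℤ)) -
        profile (s + (d : ℝ) / 2) m φ s (jacobian T 0 * B₀ (T 0))
          (jacobian T 0 * B₀ (-T 0)) (a₀ (T 0)) (a₀ (-T 0))
          (dotProduct w₀ ((chartHessian H T).mulVec w₀) / 2 + inner ℝ (T 0) y₀)
          (t₀ + l * inner ℝ (fderiv ℝ T 0 (EuclideanSpace.single i 1)) x₀)‖ ≤ η := by
  have hb := h.half_dim_pos
  set b : ℝ := (d : ℝ) / 2 with hbdef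
  set θ : ℝ := inner ℝ (fderiv ℝ T 0 (EuclideanSpace.single i 1)) x₀ with hθdef
  set M : ℝ → ℕ := fun ε => ⌈ε ^ (-(1 / 4) : ℝ)⌉₊ with hM
  set 𝓕 : Filter (ℝ × Space d) := 𝓝[>] 0 ×ˢ 𝓝 y₀ with h𝓕
  -- A limit along this filter is a limit uniform in the shift l below the block length, without
  -- tracking explicit rates.
  set 𝓛 : Filter ((ℝ × Space d) × ℕ) := (𝓕 ×ˢ ⊤) ⊓ 𝓟 {p | p.2 < M p.1.1} with h𝓛
  have hle : 𝓛 ≤ 𝓕 ×ˢ ⊤ := inf_le_left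
  have hε𝓕 : Tendsto (fun x : ℝ × Space d => x.1) 𝓕 (𝓝[>] 0) := tendsto_fst
  have hε : Tendsto (fun p : (ℝ × Space d) × ℕ => p.1.1) 𝓛 (𝓝[>] 0) :=
    (tendsto_fst.comp tendsto_fst).mono_left hle
  have hy : Tendsto (fun p : (ℝ × Space d) × ℕ => p.1.2) 𝓛 (𝓝 y₀) :=
    (tendsto_snd.comp tendsto_fst).mono_left hle
  have hpos : ∀ᶠ p in 𝓛, 0 < p.1.1 := (tendsto_nhdsWithin_iff.1 hε).2
  have hlt : ∀ᶠ p in 𝓛, p.2 < M p.1.1 :=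
    (eventually_principal.2 fun p hp => hp).filter_mono inf_le_right
  have hl : Tendsto (fun p : (ℝ × Space d) × ℕ => Real.sqrt p.1.1 * (p.2 : ℝ)) 𝓛 (𝓝 0) := by
    refine squeeze_zero' (Eventually.of_forall fun p => by positivity) ?_
      (tendsto_sqrt_mul_ceil.comp hε)
    filter_upwards [hlt] with p hp
    simp only [Function.comp_apply]
    gcongr
    have : (p.2 : ℝ) < M p.1.1 := by exact_mod_cast hp
    simp only [hM] at this
    linarith
  have hl0 : Tendsto (fun p : (ℝ × Space d) × ℕ => Real.sqrt p.1.1 * ((0 : ℕ) : ℝ)) 𝓛 (𝓝 0) := by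
    simpa using tendsto_const_nhds
  set k : (ℝ × Space d) × ℕ → Fin d → ℤ := fun p =>
    floorVec ((Real.sqrt p.1.1)⁻¹ • w₀) + Pi.single i (p.2 : ℤ) with hk
  have hZ := tendsto_scaledGrid h.offset w₀ i hε hl
  have hZ0 := tendsto_scaledGrid h.offset w₀ i hε (l := fun _ => 0) hl0
  have hsqrt : Tendsto (fun p : (ℝ × Space d) × ℕ => Real.sqrt p.1.1) 𝓛 (𝓝 0) := by
    have := (Real.continuous_sqrt.tendsto 0).comp (tendsto_nhdsWithin_iff.1 hε).1
    rwa [Real.sqrt_zero] at this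
  have hVeq : ∀ᶠ p in 𝓛, Real.sqrt p.1.1 • scaledGrid u w₀ i p.1.1 p.2 =
      gridPoint p.1.1 (u p.1.1) (k p) := by
    filter_upwards [hpos] with p hp
    exact (gridPoint_eq_smul u w₀ i hp p.2).symm
  have hV : Tendsto (fun p => gridPoint p.1.1 (u p.1.1) (k p)) 𝓛 (𝓝 0) := by
    have := hsqrt.smul hZ
    rw [zero_smul] at this
    exact this.congr' hVeq
  obtain ⟨hB1, hB2⟩ := h.tendsto_comp_chart hV h.continuousOn_symbol
  obtain ⟨ha1, ha2⟩ := h.tendsto_comp_chart hV h.continuousOn_data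
  have hω := (Complex.continuous_ofReal.tendsto _).comp (h.tendsto_volume hε hV)
  -- The phase at the first point of the block. It may depend on ε and y arbitrarily, because
  -- rotation averages converge uniformly in the starting point.
  set t₀ : (ℝ × Space d) → ℝ := fun x =>
    inner ℝ (T (Real.sqrt x.1 • scaledGrid u w₀ i x.1 0)) (x₀ + x.1 • x.2) / x.1 with ht₀
  set τ : (ℝ × Space d) × ℕ → ℝ := fun p =>
    inner ℝ (T (gridPoint p.1.1 (u p.1.1) (k p))) (x₀ + p.1.1 • p.1.2) / p.1.1 -
      (t₀ p.1 + p.2 * θ) with hτ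
  have hτ0 : Tendsto τ 𝓛 (𝓝 0) := by
    refine (tendsto_inner_increment h.chart h.isOpen h.zero_mem i x₀ hy hε
      (l := fun p => (p.2 : ℝ)) (fun p => Nat.cast_nonneg _) hl hZ0).congr' ?_
    filter_upwards [hpos] with p hp
    simp only [hτ, hk, ht₀]
    rw [gridPoint_eq_add u w₀ i hp]
  set q₀ : ℝ := dotProduct w₀ ((chartHessian H T).mulVec w₀) / 2 + inner ℝ (T 0) y₀ with hq₀
  have hq : Tendsto (fun p => phase H (x₀ + p.1.1 • p.1.2) (T (gridPoint p.1.1 (u p.1.1) (k p))) /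
      p.1.1) 𝓛 (𝓝 q₀) := by
    have h1 := tendsto_phase_div h.chart h.isOpen h.subset_sphere h.zero_mem h.smooth
      h.homogeneous h.gradient hε hZ
    have h2 : Tendsto (fun p => inner ℝ (T (gridPoint p.1.1 (u p.1.1) (k p))) p.1.2) 𝓛
        (𝓝 (inner ℝ (T 0) y₀)) :=
      (((h.chart.differentiableAt h.isOpen h.zero_mem).continuousAt.tendsto).comp hV).inner hy
    have h3 := h1.add h2
    rw [hq₀, dotProduct_chartHessian]
    refine h3.congr' ?_
    filter_upwards [hpos, hVeq] with p hp hpV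
    rw [hpV, phase_add_smul H _ _ _ hp.ne']
  have hall := (((hω.mul hB1).prodMk_nhds (hω.mul hB2)).prodMk_nhds
    ((ha1.prodMk_nhds ha2).prodMk_nhds (hq.prodMk_nhds hτ0)))
  have hev : ∀ᶠ p in 𝓛, ‖gridTerm H s B₀ a₀ T U u w φ m x₀ p.1.1 p.1.2 (k p) -
      profile (s + b) m φ s (jacobian T 0 * B₀ (T 0))
      (jacobian T 0 * B₀ (-T 0)) (a₀ (T 0)) (a₀ (-T 0)) q₀ (t₀ p.1 + p.2 * θ)‖ ≤ η := by
    filter_upwards [hall.eventually (h.kernel.eventually_norm_profile_sub_lt h.one_lt hb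
      (jacobian T 0 * B₀ (T 0)) (jacobian T 0 * B₀ (-T 0)) (a₀ (T 0)) (a₀ (-T 0)) q₀
      hη), hV.eventually (h.isOpen.mem_nhds h.zero_mem)] with p hp hpU
    have h1 := (hp (t₀ p.1 + p.2 * θ)).le
    simp only [Function.comp_apply] at h1
    -- The normalized cell volume, which converges to the Jacobian, is absorbed into the two symbol
    -- coefficients.
    rw [profile_mul] at h1
    simp only [hτ, add_sub_cancel] at h1
    have hpU' : gridPoint p.1.1 (u p.1.1) (k p) ∈ U := hpU
    rw [gridTerm, if_pos hpU']
    exact h1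
  exact (eventually_prod_top_inf_principal hev).mono fun x hx => ⟨t₀ x, fun l hl => hx l hl⟩

/-- The average over shifted grid points converges to the average of the profile. -/
theorem tendsto_average_gridTerm (h : IsLocalSetup H x₀ Ω s B₀ a₀ T U u w φ m n L R) {i : Fin d}
    (hθ : Irrational (inner ℝ (fderiv ℝ T 0 (EuclideanSpace.single i 1)) x₀)) (y₀ : Space d)
    (w₀ : Fin d → ℝ) :
    Tendsto (fun p : ℝ × Space d => (⌈p.1 ^ (-(1 / 4) : ℝ)⌉₊ : ℂ)⁻¹ *
      ∑ l ∈ Finset.range ⌈p.1 ^ (-(1 / 4) : ℝ)⌉₊, gridTerm H s B₀ a₀ T U u w φ m x₀ p.1 p.2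
        (floorVec ((Real.sqrt p.1)⁻¹ • w₀) + Pi.single i (l : ℤ))) (𝓝[>] 0 ×ˢ 𝓝 y₀)
      (𝓝 (∫ t in (0 : ℝ)..1, profile (s + (d : ℝ) / 2) m φ s (jacobian T 0 * B₀ (T 0))
        (jacobian T 0 * B₀ (-T 0)) (a₀ (T 0)) (a₀ (-T 0))
        (dotProduct w₀ ((chartHessian H T).mulVec w₀) / 2 + inner ℝ (T 0) y₀) t)) := by
  have hP := h.kernel.hasUniformMean_profile h.one_lt h.half_dim_pos (jacobian T 0 * B₀ (T 0))
    (jacobian T 0 * B₀ (-T 0)) (a₀ (T 0)) (a₀ (-T 0)) hθ (dotProduct w₀ ((chartHessian H T).mulVec w₀) / 2 +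
    inner ℝ (T 0) y₀)
  have hM : Tendsto (fun p : ℝ × Space d => ⌈p.1 ^ (-(1 / 4) : ℝ)⌉₊) (𝓝[>] 0 ×ˢ 𝓝 y₀) atTop :=
    tendsto_ceil_rpow_atTop.comp tendsto_fst
  exact tendsto_average_of_rotation hM hP fun η hη => h.eventually_norm_gridTerm_sub_le i y₀ w₀ hη

end IsLocalSetup

/-! ### Matching the constants and the limit of the reconstruction -/

theorem conv_mu {d : ℕ} (H : Space d → ℝ) (B₀ a₀ : Space d → ℂ) (s : ℝ) (Θ : Space d) (φ : ℝ → ℝ)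
    (q : ℝ) : conv φ (mu H B₀ a₀ s Θ) q =
      ((2 * (2 * Real.pi) ^ ((d : ℝ) / 2) / Real.sqrt |(tangentHessian H Θ).det| : ℝ) : ℂ) *
        cPlus₃ B₀ a₀ s Θ * ∫ p, (φ p : ℂ) * stepMinus (q - p) := by
  rw [conv, ← integral_sub_left_eq_self _ volume q, ← integral_const_mul]
  refine integral_congr_ae (Eventually.of_forall fun p => ?_)
  simp only [mu, sub_sub_cancel]
  ring

theorem cPlus_eq_upperCoeff {d : ℕ} (B₀ a₀ : Space d → ℂ) (s : ℝ) (α : Space d) :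
    cPlus B₀ a₀ s α = Real.Gamma s * upperCoeff s (B₀ α) (a₀ α) (a₀ (-α)) := by
  rw [cPlus, upperCoeff, mul_assoc]

theorem cMinus_eq_lowerCoeff {d : ℕ} (B₀ a₀ : Space d → ℂ) (s : ℝ) (α : Space d) :
    cMinus B₀ a₀ s α = Real.Gamma s * lowerCoeff s (B₀ (-α)) (a₀ α) (a₀ (-α)) := by
  rw [cMinus, lowerCoeff, mul_assoc]

theorem cPlus₃_eq {d : ℕ} (B₀ a₀ : Space d → ℂ) (s : ℝ) (α : Space d) :
    cPlus₃ B₀ a₀ s α = Complex.I * Complex.I ^ (-(((d : ℝ) / 2 : ℝ) : ℂ)) * cPlus B₀ a₀ s α := by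
  have hI : Complex.I = Complex.exp (Real.pi / 2 * Complex.I) := by
    rw [Complex.exp_pi_div_two_mul_I]
  rw [cPlus₃, I_cpow_neg]
  nth_rw 2 [hI]
  rw [← Complex.exp_add]
  congr 2
  push_cast
  ring

theorem upperCoeff_mul (s : ℝ) (c B a₁ a₂ : ℂ) :
    upperCoeff s (c * B) a₁ a₂ = c * upperCoeff s B a₁ a₂ := by
  simp only [upperCoeff]; ring

theorem lowerCoeff_mul (s : ℝ) (c B a₁ a₂ : ℂ) :
    lowerCoeff s (c * B) a₁ a₂ = c * lowerCoeff s B a₁ a₂ := by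
  simp only [lowerCoeff]; ring

namespace IsLocalSetup

variable {d : ℕ} {H : Space d → ℝ} {x₀ : Space d} {Ω : Set (Space d)} {s : ℝ}
    {B₀ a₀ : Space d → ℂ} {T : Param d → Space d} {U : Set (Param d)} {u : ℝ → Fin d → ℝ}
    {w : ℝ → (Fin d → ℤ) → ℝ} {φ : ℝ → ℝ} {m n : ℕ} {L : ℝ≥0} {R : ℝ} {Bt : Space d → ℝ → ℂ}
    {g₀ : Space d → ℝ → ℂ}

/-- Γ(s + b) from the filter and Γ(b) from the radial integration cancel against Γ(s)Γ(b)/Γ(s + b),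
and the Jacobian turns the chart determinant into the tangential one. The right side is halved
because one family of directions carries half of the full operator. -/
theorem integral_average (h : IsLocalSetup H x₀ Ω s B₀ a₀ T U u w φ m n L R) (q : ℝ) :
    ((Real.Gamma (s + (d : ℝ) / 2) / (2 * Real.pi) : ℝ) : ℂ) *
      ∫ v : Fin d → ℝ, ∫ t in (0 : ℝ)..1, profile (s + (d : ℝ) / 2) m φ s
        (jacobian T 0 * B₀ (T 0)) (jacobian T 0 * B₀ (-T 0)) (a₀ (T 0)) (a₀ (-T 0))
        (dotProduct v ((chartHessian H T).mulVec v) / 2 + q) t =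
      conv φ (mu H B₀ a₀ s (T 0)) q / 2 := by
  have hb := h.half_dim_pos
  have hs := h.one_lt
  have hD := h.chart.chartHessian_posDef h.isOpen h.subset_sphere h.zero_mem h.posDef
  have hJ := h.chart.jacobian_div_sqrt h.isOpen h.subset_sphere h.zero_mem h.posDef
  have hc := h.coeff (T 0) (h.chart.bijOn.mapsTo h.zero_mem)
  have hq := integral_comp_half_quadratic h.one_le_dim hD fun r => ∫ t in (0 : ℝ)..1,
    profile (s + (d : ℝ) / 2) m φ s (jacobian T 0 * B₀ (T 0)) (jacobian T 0 * B₀ (-T 0))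
      (a₀ (T 0)) (a₀ (-T 0)) (r + q) t
  have hp := h.kernel.integral_integral_profile hs hb (B₁ := jacobian T 0 * B₀ (T 0))
    (B₂ := jacobian T 0 * B₀ (-T 0)) (a₁ := a₀ (T 0)) (a₂ := a₀ (-T 0))
    (by rw [lowerCoeff_mul, upperCoeff_mul, hc]; ring) q
  simp only [add_comm q] at hp
  rw [hq, hp, conv_mu, cPlus₃_eq, cPlus_eq_upperCoeff, upperCoeff_mul, betaConst]
  generalize (∫ p, (φ p : ℂ) * stepMinus (q - p)) = S
  generalize upperCoeff s (B₀ (T 0)) (a₀ (T 0)) (a₀ (-T 0)) = W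
  generalize Complex.I ^ (-(((d : ℝ) / 2 : ℝ) : ℂ)) = Z
  have hΓ : Real.Gamma ((d : ℝ) / 2) ≠ 0 := (Real.Gamma_pos_of_pos hb).ne'
  have hΓ' : Real.Gamma (s + (d : ℝ) / 2) ≠ 0 := (Real.Gamma_pos_of_pos (by linarith)).ne'
  have hreal : Real.Gamma (s + (d : ℝ) / 2) / (2 * Real.pi) *
      ((Real.sqrt (chartHessian H T).det)⁻¹ *
        ((2 * Real.pi) ^ ((d : ℝ) / 2) / Real.Gamma ((d : ℝ) / 2))) *
      (Real.Gamma s * Real.Gamma ((d : ℝ) / 2) / Real.Gamma (s + (d : ℝ) / 2)) * jacobian T 0 *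
        (2 * Real.pi) =
      (2 * (2 * Real.pi) ^ ((d : ℝ) / 2) / Real.sqrt |(tangentHessian H (T 0)).det|) / 2 *
        Real.Gamma s := by
    rw [div_eq_mul_inv _ (Real.sqrt |(tangentHessian H (T 0)).det|), ← hJ]
    field_simp
  have hcomplex := congrArg (fun x : ℝ => (x : ℂ)) hreal
  simp only [Complex.ofReal_mul, Complex.ofReal_div, Complex.ofReal_ofNat] at hcomplex ⊢
  linear_combination (W * Complex.I * Z * S) * hcomplex

theorem directionSum_eq (h : IsLocalSetup H x₀ Ω s B₀ a₀ T U u w φ m n L R)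
    (hpos : ∀ α ∈ unitSphere d, ∀ τ : ℝ, 0 < τ →
      Bt α τ = ((τ ^ (s + (d : ℝ) / 2 - 1) : ℝ) : ℂ) * B₀ α)
    (heven : ∀ α ∈ unitSphere d, ∀ τ : ℝ, Bt (-α) (-τ) = Bt α τ)
    (hg : ∀ α ∈ Ω, ∀ p : ℝ, g₀ α (H α + p) =
      a₀ α * ((max p 0 ^ (s - 1) : ℝ) : ℂ) + a₀ (-α) * ((max (-p) 0 ^ (s - 1) : ℝ) : ℂ))
    {ε : ℝ} (hε : 0 < ε) (x : Space d) {α : Space d} (hα : α ∈ Ω) :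
    HasSum (fun j : ℤ => filteredTerm Bt φ g₀ ε α x j)
      (((Real.Gamma (s + (d : ℝ) / 2) / (2 * Real.pi) * ε ^ (-((d : ℝ) / 2)) : ℝ) : ℂ) *
        directionSum H s B₀ a₀ φ m ε x α) :=
  hasSum_filteredTerm h.one_lt h.half_dim_pos hpos heven h.kernel (h.subset_sphere hα) (hg α hα)
    hε x

theorem mul_gridTerm_eq (h : IsLocalSetup H x₀ Ω s B₀ a₀ T U u w φ m n L R)
    (hpos : ∀ α ∈ unitSphere d, ∀ τ : ℝ, 0 < τ →
      Bt α τ = ((τ ^ (s + (d : ℝ) / 2 - 1) : ℝ) : ℂ) * B₀ α)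
    (heven : ∀ α ∈ unitSphere d, ∀ τ : ℝ, Bt (-α) (-τ) = Bt α τ)
    (hg : ∀ α ∈ Ω, ∀ p : ℝ, g₀ α (H α + p) =
      a₀ α * ((max p 0 ^ (s - 1) : ℝ) : ℂ) + a₀ (-α) * ((max (-p) 0 ^ (s - 1) : ℝ) : ℂ))
    {ε : ℝ} (hε : 0 < ε) (y : Space d) {k : Fin d → ℤ} (hk : gridPoint ε (u ε) k ∈ U) :
    (∑' j : ℤ, filteredTerm Bt φ g₀ ε (T (gridPoint ε (u ε) k)) (x₀ + ε • y) j) * (w ε k : ℂ) =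
      ((Real.Gamma (s + (d : ℝ) / 2) / (2 * Real.pi) : ℝ) : ℂ) * ((Real.sqrt ε : ℂ) ^ d *
        gridTerm H s B₀ a₀ T U u w φ m x₀ ε y k) := by
  rw [(h.directionSum_eq hpos heven hg hε _ (h.chart.bijOn.mapsTo hk)).tsum_eq, gridTerm,
    if_pos hk]
  generalize directionSum H s B₀ a₀ φ m ε (x₀ + ε • y) (T (gridPoint ε (u ε) k)) = D
  -- The exact weight of a Riemann sum of step √ε in dimension d; this balance is the meaning of κ₂
  -- = 0.
  have h1 : Real.sqrt ε ^ d = ε ^ (-((d : ℝ) / 2)) * ε ^ d := by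
    rw [Real.sqrt_eq_rpow, ← Real.rpow_natCast, ← Real.rpow_natCast, ← Real.rpow_mul hε.le,
      ← Real.rpow_add hε]
    congr 1; ring
  have h2 : Real.sqrt ε ^ d * (w ε k / ε ^ d) = ε ^ (-((d : ℝ) / 2)) * w ε k := by
    rw [h1]
    field_simp
  have h3 := congrArg (fun x : ℝ => (x : ℂ)) h2
  simp only [Complex.ofReal_mul, Complex.ofReal_pow] at h3 ⊢
  linear_combination
    (-((Real.Gamma (s + (d : ℝ) / 2) / (2 * Real.pi) : ℝ) : ℂ) * D) * h3

theorem backprojection_eq (h : IsLocalSetup H x₀ Ω s B₀ a₀ T U u w φ m n L R)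
    (hpos : ∀ α ∈ unitSphere d, ∀ τ : ℝ, 0 < τ →
      Bt α τ = ((τ ^ (s + (d : ℝ) / 2 - 1) : ℝ) : ℂ) * B₀ α)
    (heven : ∀ α ∈ unitSphere d, ∀ τ : ℝ, Bt (-α) (-τ) = Bt α τ)
    (hg : ∀ α ∈ Ω, ∀ p : ℝ, g₀ α (H α + p) =
      a₀ α * ((max p 0 ^ (s - 1) : ℝ) : ℂ) + a₀ (-α) * ((max (-p) 0 ^ (s - 1) : ℝ) : ℂ))
    {ε : ℝ} (hε : 0 < ε) (y : Space d) :
    backprojection Bt φ g₀ T U u w ε (x₀ + ε • y) =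
      ((Real.Gamma (s + (d : ℝ) / 2) / (2 * Real.pi) : ℝ) : ℂ) * ((Real.sqrt ε : ℂ) ^ d *
        ∑' k, gridTerm H s B₀ a₀ T U u w φ m x₀ ε y k) := by
  have h1 : ∑' k, gridTerm H s B₀ a₀ T U u w φ m x₀ ε y k =
      ∑' k : {k : Fin d → ℤ // gridPoint ε (u ε) k ∈ U},
        gridTerm H s B₀ a₀ T U u w φ m x₀ ε y k := by
    refine (tsum_subtype_eq_of_support_subset (s := {k | gridPoint ε (u ε) k ∈ U})
      fun k hk => ?_).symm
    by_contra hkU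
    have hkU' : gridPoint ε (u ε) k ∉ U := hkU
    exact hk (by rw [gridTerm, if_neg hkU'])
  rw [h1, backprojection, ← tsum_mul_left, ← tsum_mul_left]
  exact tsum_congr fun k => h.mul_gridTerm_eq hpos heven hg hε y k.2

theorem backprojectionConverges (h : IsLocalSetup H x₀ Ω s B₀ a₀ T U u w φ m n L R)
    (hpos : ∀ α ∈ unitSphere d, ∀ τ : ℝ, 0 < τ →
      Bt α τ = ((τ ^ (s + (d : ℝ) / 2 - 1) : ℝ) : ℂ) * B₀ α)
    (heven : ∀ α ∈ unitSphere d, ∀ τ : ℝ, Bt (-α) (-τ) = Bt α τ)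
    (hg : ∀ α ∈ Ω, ∀ p : ℝ, g₀ α (H α + p) =
      a₀ α * ((max p 0 ^ (s - 1) : ℝ) : ℂ) + a₀ (-α) * ((max (-p) 0 ^ (s - 1) : ℝ) : ℂ)) :
    BackprojectionConverges Bt φ g₀ T U u w := by
  intro ε hε x
  have hmem : ∀ k, gridPoint ε (u ε) k ∈ U → T (gridPoint ε (u ε) k) ∈ Ω := fun k hk =>
    h.chart.bijOn.mapsTo hk
  have hβ : 0 < s + (d : ℝ) / 2 - 1 := by linarith [h.half_dim_pos, h.one_lt]
  refine ⟨fun k hk => ⟨fun j => ⟨_, tendsto_regularizedFilter hpos heven hβ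
    (by simpa using h.kernel) hε (h.subset_sphere (hmem k hk)) _ _⟩,
    (h.directionSum_eq hpos heven hg hε x (hmem k hk)).summable⟩, ?_⟩
  obtain ⟨y, rfl⟩ : ∃ y, x = x₀ + ε • y := ⟨ε⁻¹ • (x - x₀), by
    rw [smul_inv_smul₀ hε.ne', add_sub_cancel]⟩
  have h1 := ((h.summable_gridTerm hε y).mul_left ((Real.sqrt ε : ℂ) ^ d)).mul_left
    ((Real.Gamma (s + (d : ℝ) / 2) / (2 * Real.pi) : ℝ) : ℂ)
  refine (h1.comp_injective (i := fun k : {k : Fin d → ℤ // gridPoint ε (u ε) k ∈ U} =>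
    (k : Fin d → ℤ)) Subtype.val_injective).congr fun k => ?_
  exact (h.mul_gridTerm_eq hpos heven hg hε y k.2).symm

/-- The limit of the reconstruction near a point. -/
theorem tendsto_backprojection (h : IsLocalSetup H x₀ Ω s B₀ a₀ T U u w φ m n L R)
    (hgen : IsGeneric T x₀)
    (hpos : ∀ α ∈ unitSphere d, ∀ τ : ℝ, 0 < τ →
      Bt α τ = ((τ ^ (s + (d : ℝ) / 2 - 1) : ℝ) : ℂ) * B₀ α)
    (heven : ∀ α ∈ unitSphere d, ∀ τ : ℝ, Bt (-α) (-τ) = Bt α τ)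
    (hg : ∀ α ∈ Ω, ∀ p : ℝ, g₀ α (H α + p) =
      a₀ α * ((max p 0 ^ (s - 1) : ℝ) : ℂ) + a₀ (-α) * ((max (-p) 0 ^ (s - 1) : ℝ) : ℂ))
    (y₀ : Space d) :
    Tendsto (fun p : ℝ × Space d => backprojection Bt φ g₀ T U u w p.1 (x₀ + p.1 • p.2))
      (𝓝[>] 0 ×ˢ 𝓝 y₀) (𝓝 (conv φ (mu H B₀ a₀ s (T 0)) (inner ℝ y₀ (T 0)) / 2)) := by
  obtain ⟨i, hi⟩ := hgen
  have hpos' : ∀ᶠ p : ℝ × Space d in 𝓝[>] 0 ×ˢ 𝓝 y₀, 0 < p.1 :=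
    tendsto_fst.eventually self_mem_nhdsWithin
  have ha : Tendsto (fun p : ℝ × Space d => Real.sqrt p.1) (𝓝[>] 0 ×ˢ 𝓝 y₀) (𝓝[>] 0) := by
    refine tendsto_nhdsWithin_iff.2 ⟨?_, ?_⟩
    · have := ((Real.continuous_sqrt.tendsto 0).mono_left nhdsWithin_le_nhds).comp
        (tendsto_fst : Tendsto Prod.fst (𝓝[>] (0 : ℝ) ×ˢ 𝓝 y₀) _)
      rwa [Real.sqrt_zero] at this
    · exact hpos'.mono fun p hp => Real.sqrt_pos.2 hp
  obtain ⟨C, hC⟩ := h.gridTerm_bound (Y := ‖y₀‖ + 1) (by positivity)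
  have hbound : ∀ᶠ p : ℝ × Space d in 𝓝[>] 0 ×ˢ 𝓝 y₀, ∀ k,
      ‖gridTerm H s B₀ a₀ T U u w φ m x₀ p.1 p.2 k‖ ≤
        C * (1 + ‖Real.sqrt p.1 • fun i => (k i : ℝ)‖) ^ (-((d : ℝ) + 2)) := by
    have h1 : ∀ᶠ y in 𝓝 y₀, ‖y‖ ≤ ‖y₀‖ + 1 :=
      (continuous_norm.tendsto y₀).eventually (eventually_le_nhds (by linarith))
    filter_upwards [tendsto_fst.eventually hC, tendsto_snd.eventually h1] with p hp hpy
    exact hp p.2 hpy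
  have hM : ∀ᶠ p : ℝ × Space d in 𝓝[>] 0 ×ˢ 𝓝 y₀,
      0 < ⌈p.1 ^ (-(1 / 4) : ℝ)⌉₊ ∧ Real.sqrt p.1 * (⌈p.1 ^ (-(1 / 4) : ℝ)⌉₊ : ℝ) ≤ 1 := by
    filter_upwards [hpos', tendsto_fst.eventually
      (tendsto_sqrt_mul_ceil.eventually (eventually_le_nhds one_pos))] with p hp hp1
    refine ⟨Nat.ceil_pos.2 (Real.rpow_pos_of_pos hp _), le_trans ?_ hp1⟩
    gcongr
    linarith
  have hsum : ∀ᶠ p : ℝ × Space d in 𝓝[>] 0 ×ˢ 𝓝 y₀,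
      Summable (gridTerm H s B₀ a₀ T U u w φ m x₀ p.1 p.2) :=
    hpos'.mono fun p hp => h.summable_gridTerm hp p.2
  have hlim := tendsto_riemannSum i (by linarith) ha hsum hbound hM
    (h.tendsto_average_gridTerm hi y₀)
  have hfin := hlim.const_mul ((Real.Gamma (s + (d : ℝ) / 2) / (2 * Real.pi) : ℝ) : ℂ)
  rw [h.integral_average, real_inner_comm] at hfin
  refine hfin.congr' ?_
  filter_upwards [hpos'] with p hp
  exact (h.backprojection_eq hpos heven hg hp p.2).symm

end IsLocalSetup

/-! ### Uniformity on bounded sets and verification of the standing assumptions -/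

theorem continuous_integral_mul_stepMinus {φ : ℝ → ℝ} (hφ : Continuous φ)
    (hc : HasCompactSupport φ) : Continuous fun q : ℝ => ∫ p, (φ p : ℂ) * stepMinus (q - p) := by
  have hi : Integrable φ := hφ.integrable_of_hasCompactSupport hc
  have hm : Measurable stepMinus := Measurable.ite measurableSet_Iio measurable_const
    measurable_const
  refine continuous_iff_continuousAt.2 fun q₀ => ?_
  refine continuousAt_of_dominated (bound := fun p => ‖φ p‖) (Eventually.of_forall fun q => ?_)
    (Eventually.of_forall fun q => Eventually.of_forall fun p => ?_) hi.norm ?_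
  · exact (Complex.measurable_ofReal.comp hφ.measurable).aestronglyMeasurable.mul
      (hm.comp (measurable_const.sub measurable_id)).aestronglyMeasurable
  · rw [norm_mul, Complex.norm_real]
    refine mul_le_of_le_one_right (norm_nonneg _) ?_
    unfold stepMinus
    split_ifs <;> simp
  · filter_upwards [Measure.ae_ne volume q₀] with p hp
    refine continuousAt_const.mul ?_
    rcases lt_or_gt_of_ne hp with h | h
    · refine (continuousAt_const (y := (0 : ℂ))).congr ?_
      filter_upwards [lt_mem_nhds h] with q hq
      rw [stepMinus, if_neg (by linarith)]
    · refine (continuousAt_const (y := (1 : ℂ))).congr ?_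
      filter_upwards [gt_mem_nhds h] with q hq
      rw [stepMinus, if_pos (by linarith)]

theorem continuous_conv_mu {d : ℕ} (H : Space d → ℝ) (B₀ a₀ : Space d → ℂ) (s : ℝ) (Θ : Space d)
    {φ : ℝ → ℝ} (hφ : Continuous φ) (hc : HasCompactSupport φ) :
    Continuous fun y : Space d => conv φ (mu H B₀ a₀ s Θ) (inner ℝ y Θ) := by
  simp only [conv_mu]
  exact continuous_const.mul ((continuous_integral_mul_stepMinus hφ hc).comp
    (continuous_id.inner continuous_const))

/-- Joint convergence at every point together with continuity of the limit is locally uniform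
convergence, hence uniform on the compact closure of V. -/
theorem tendstoUniformlyOn_of_tendsto_prod {E ι : Type*} [NormedAddCommGroup E]
    [ProperSpace E] {𝓕 : Filter ι} {F : ι → E → ℂ} {f : E → ℂ} (hf : Continuous f)
    (h : ∀ y₀, Tendsto (fun p : ι × E => F p.1 p.2) (𝓕 ×ˢ 𝓝 y₀) (𝓝 (f y₀))) {V : Set E}
    (hV : Bornology.IsBounded V) : TendstoUniformlyOn F f 𝓕 V := by
  have hl : TendstoLocallyUniformlyOn F f 𝓕 (closure V) := by
    refine tendstoLocallyUniformlyOn_iff_forall_tendsto.2 fun y₀ _ => ?_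
    rw [Metric.uniformity_eq_comap_nhds_zero, tendsto_comap_iff]
    have h1 := (((hf.tendsto y₀).comp
      (tendsto_snd (f := 𝓕))).dist (h y₀)).mono_left
        (prod_mono_right 𝓕 (nhdsWithin_le_nhds (s := closure V)))
    rw [dist_self] at h1
    exact h1
  exact ((tendstoLocallyUniformlyOn_iff_tendstoUniformlyOn_of_compact
    hV.isCompact_closure).1 hl).mono subset_closure

theorem SmoothOnSphere.continuousOn {d : ℕ} {F : Space d → ℂ} (h : SmoothOnSphere F) :
    ContinuousOn F (unitSphere d) :=
  continuousOn_iff_continuous_domRestrict.2 h.continuous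

/-- Compact supports in a small cap and its antipode. -/
theorem exists_isCompact_cap {d : ℕ} {Ω : Set (Space d)} {Θ : Space d} (hΘ : ‖Θ‖ = 1)
    (hΩ : Ω ⊆ unitSphere d) (hball : Ω ⊆ Metric.ball Θ (1 / 2)) {F : Space d → ℂ}
    (hF : SmoothCompactSupportIn F (Ω ∪ -Ω)) :
    ∃ K : Set (Space d), IsCompact K ∧ K ⊆ Ω ∧ ∀ α ∈ Ω, α ∉ K → F α = 0 ∧ F (-α) = 0 := by
  obtain ⟨_, K, hK, hKΩ, hK0⟩ := hF
  refine ⟨(K ∪ -K) ∩ Metric.closedBall Θ (1 / 2),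
    (hK.union hK.neg).inter_right Metric.isClosed_closedBall, ?_, ?_⟩
  · rintro x ⟨hx, hxb⟩
    have h1 : x ∈ Ω ∪ -Ω := by
      rcases hx with hx | hx
      · exact hKΩ hx
      · rcases hKΩ hx with h | h
        · exact Or.inr h
        · left; simpa using h
    rcases h1 with h1 | h1
    · exact h1
    · exfalso
      have h2 : dist (-x) Θ < 1 / 2 := hball h1
      have h3 : dist x Θ ≤ 1 / 2 := hxb
      rw [dist_eq_norm] at h2 h3
      -- A point and its antipode cannot both be within 1/2 of the unit vector Θ, since 2 = ‖2Θ‖.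
      have h4 : (2 : ℝ) • Θ = -((x - Θ) + (-x - Θ)) := by
        rw [two_smul]; abel
      have h5 : ‖(2 : ℝ) • Θ‖ ≤ ‖x - Θ‖ + ‖-x - Θ‖ := by
        rw [h4, norm_neg]; exact norm_add_le _ _
      rw [norm_smul, hΘ] at h5
      norm_num at h5
      linarith
  · intro α hα hαK
    have h1 : α ∉ K ∪ -K := fun h => hαK ⟨h, (Metric.ball_subset_closedBall (hball hα))⟩
    have hS := hΩ hα
    exact ⟨hK0 α hS fun h => h1 (Or.inl h), hK0 (-α) (by simpa using hS) fun h => h1 (Or.inr h)⟩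

theorem exists_isLocalSetup {d : ℕ} (hd : 1 ≤ d) {H : Space d → ℝ} {x₀ : Space d}
    {Ω : Set (Space d)} {s β : ℝ} {B₀ a₀ : Space d → ℂ} {T : Param d → Space d}
    {U : Set (Param d)} {u : ℝ → Fin d → ℝ} {w : ℝ → (Fin d → ℤ) → ℝ} {φ : ℝ → ℝ}
    (hsmooth : ContDiffOn ℝ ∞ H {0}ᶜ)
    (hhom : ∀ c : ℝ, 0 < c → ∀ ξ : Space d, ξ ≠ 0 → H (c • ξ) = c * H ξ)
    (hgrad : HasGradientAt H x₀ (T 0)) (hM : (-tangentHessian H (T 0)).PosDef)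
    (hΩ : Ω ⊆ unitSphere d) (hball : Ω ⊆ Metric.ball (T 0) (1 / 2))
    (hlower : ∃ c > 0, ∀ α ∈ Ω, c * ‖α - T 0‖ ^ 2 ≤ phase H x₀ α)
    (hs : (((d : ℝ) + 1) + 1) / 2 ≤ s) (hβ : β = s + (d : ℝ) / 2 - 1)
    (hB : SmoothOnSphere B₀) (ha : SmoothCompactSupportIn a₀ (Ω ∪ -Ω))
    (hc : ∀ α ∈ Ω, cMinus B₀ a₀ s α =
      Complex.exp (-(Complex.I * (β - s) * Real.pi)) * cPlus B₀ a₀ s α)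
    (hφ : IsInterpolationKernel β φ) (hU : IsOpen U) (h0 : (0 : Param d) ∈ U)
    (hu : ∀ ε : ℝ, ∀ i : Fin d, u ε i ∈ Set.Ico (0 : ℝ) 1)
    (hT : IsDirectionChart T U Ω) (hw : IsCellVolume T U u w) :
    ∃ m n L R, IsLocalSetup H x₀ Ω s B₀ a₀ T U u w φ m n L R := by
  have hd' : (1 : ℝ) ≤ d := by exact_mod_cast hd
  have hs1 : 1 < s := by linarith
  have hβ0 : 0 < β := by linarith
  obtain ⟨L, R, hker⟩ := exists_isFilterKernel hφ hβ0
  -- The smoothness order m = ⌊β⌋ satisfies m + 1 ≤ β + 1 < m + 2, as the regularization requires;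
  -- the exactness degree n = ⌈β⌉ satisfies s + b - 1 = β ≤ n.
  refine ⟨⌊β⌋₊, ⌈β⌉₊, L, R, hd, hsmooth, hhom, hgrad, hM, hU, h0, hu, hT, hΩ, hlower, hs1, ?_,
    hφ.exact, ?_, hB.continuousOn, ha.1.continuousOn,
    exists_isCompact_cap (hT.norm_eq_one hΩ h0) hΩ hball ha, fun α hα => ?_, hw⟩
  · rwa [show β + 1 = s + (d : ℝ) / 2 by rw [hβ]; ring] at hker
  · rw [← hβ]; exact Nat.le_ceil β
  · have hΓ : (Real.Gamma s : ℂ) ≠ 0 := by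
      exact_mod_cast (Real.Gamma_pos_of_pos (by linarith)).ne'
    have h1 := hc α hα
    rw [cMinus_eq_lowerCoeff, cPlus_eq_upperCoeff, mul_left_comm] at h1
    have h2 := mul_left_cancel₀ hΓ h1
    rw [h2, hβ]
    congr 4
    push_cast
    ring

/-! ### Antipodal symmetry -/

section Antipode

variable {d : ℕ} {T : Param d → Space d} {U : Set (Param d)} {Ω : Set (Space d)}
  {Bt : Space d → ℝ → ℂ} {φ : ℝ → ℝ} {g₀ : Space d → ℝ → ℂ} {x₀ : Space d}
  {u : ℝ → Fin d → ℝ} {w : ℝ → (Fin d → ℤ) → ℝ}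

theorem IsDirectionChart.neg (h : IsDirectionChart T U Ω) : IsDirectionChart (-T) U (-Ω) where
  smooth := h.smooth.neg
  bijOn := by
    refine ⟨fun v hv => ?_, fun v hv v' hv' hvv => ?_, fun α hα => ?_⟩
    · simpa using h.bijOn.mapsTo hv
    · exact h.bijOn.injOn hv hv' (neg_injective hvv)
    · obtain ⟨v, hv, hvα⟩ := h.bijOn.surjOn hα
      exact ⟨v, hv, by simp [hvα]⟩
  immersion := fun v hv => by
    rw [fderiv_neg]
    exact fun x y hxy => h.immersion v hv (neg_injective hxy)

theorem jacobian_neg (T : Param d → Space d) (v : Param d) : jacobian (-T) v = jacobian T v := by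
  simp only [jacobian, fderiv_neg, neg_apply, inner_neg_neg]

theorem IsCellVolume.neg (h : IsCellVolume T U u w) : IsCellVolume (-T) U u w := by
  intro K hK hKU
  simp only [jacobian_neg]
  exact h K hK hKU

theorem IsGeneric.neg (h : IsGeneric T x₀) : IsGeneric (-T) x₀ := by
  obtain ⟨i, hi⟩ := h
  refine ⟨i, ?_⟩
  rw [fderiv_neg, neg_apply, inner_neg_left]
  exact hi.neg

theorem regularizedB_neg {α : Space d} (heven : ∀ τ : ℝ, Bt (-α) (-τ) = Bt α τ) (δ p : ℝ) :
    regularizedB Bt δ (-α) (-p) = regularizedB Bt δ α p := by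
  rw [regularizedB, regularizedB, ← integral_neg_eq_self]
  congr 2
  ext τ
  rw [heven, abs_neg]
  congr 2
  push_cast
  ring

theorem regularizedFilter_neg {α : Space d} (heven : ∀ τ : ℝ, Bt (-α) (-τ) = Bt α τ)
    (hφ : ∀ t, φ (-t) = φ t) (δ ε q t : ℝ) :
    regularizedFilter Bt φ δ ε q (-α) (-t) = regularizedFilter Bt φ δ ε (-q) α t := by
  rw [regularizedFilter, regularizedFilter, ← integral_neg_eq_self]
  congr 1
  ext p
  rw [show -t - -p = -(t - p) by ring, regularizedB_neg heven,
    show (-p - q) / ε = -((p - -q) / ε) by ring, hφ]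

/-- Passing to -α reflects the p-axis. The sample points are symmetric under this reflection and the
filter and data are even, so evenness of φ is what makes the terms correspond, with j replaced by
-j. -/
theorem filteredTerm_neg {α : Space d} (heven : ∀ τ : ℝ, Bt (-α) (-τ) = Bt α τ)
    (hφ : ∀ t, φ (-t) = φ t) (hg : ∀ p, g₀ (-α) p = g₀ α (-p)) (ε : ℝ) (x : Space d) (j : ℤ) :
    filteredTerm Bt φ g₀ ε (-α) x j = filteredTerm Bt φ g₀ ε α x (-j) := by
  have h : -(ε * (j : ℝ)) = ε * ((-j : ℤ) : ℝ) := by push_cast; ring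
  rw [filteredTerm, filteredTerm, hg, h, filter, filter, inner_neg_left]
  simp only [regularizedFilter_neg heven hφ, h]

theorem summable_filteredTerm_neg {α : Space d} (heven : ∀ τ : ℝ, Bt (-α) (-τ) = Bt α τ)
    (hφ : ∀ t, φ (-t) = φ t) (hg : ∀ p, g₀ (-α) p = g₀ α (-p)) (ε : ℝ) (x : Space d)
    (h : Summable fun j => filteredTerm Bt φ g₀ ε α x j) :
    Summable fun j => filteredTerm Bt φ g₀ ε (-α) x j := by
  simp only [filteredTerm_neg heven hφ hg]
  exact (Equiv.neg ℤ).summable_iff.2 h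

theorem tsum_filteredTerm_neg {α : Space d} (heven : ∀ τ : ℝ, Bt (-α) (-τ) = Bt α τ)
    (hφ : ∀ t, φ (-t) = φ t) (hg : ∀ p, g₀ (-α) p = g₀ α (-p)) (ε : ℝ) (x : Space d) :
    ∑' j, filteredTerm Bt φ g₀ ε (-α) x j = ∑' j, filteredTerm Bt φ g₀ ε α x j := by
  simp only [filteredTerm_neg heven hφ hg]
  exact (Equiv.neg ℤ).tsum_eq fun j => filteredTerm Bt φ g₀ ε α x j

theorem backprojection_neg (hT : MapsTo T U Ω) (heven : ∀ α ∈ Ω, ∀ τ : ℝ, Bt (-α) (-τ) = Bt α τ)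
    (hφ : ∀ t, φ (-t) = φ t) (hg : ∀ α ∈ Ω, ∀ p, g₀ (-α) p = g₀ α (-p)) (ε : ℝ) (x : Space d) :
    backprojection Bt φ g₀ (-T) U u w ε x = backprojection Bt φ g₀ T U u w ε x := by
  refine tsum_congr fun k => ?_
  rw [Pi.neg_apply, tsum_filteredTerm_neg (heven _ (hT k.2)) hφ (hg _ (hT k.2))]

theorem BackprojectionConverges.neg (h : BackprojectionConverges Bt φ g₀ T U u w)
    (hT : MapsTo T U Ω) (heven : ∀ α ∈ Ω, ∀ τ : ℝ, Bt (-α) (-τ) = Bt α τ)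
    (hφ : ∀ t, φ (-t) = φ t) (hg : ∀ α ∈ Ω, ∀ p, g₀ (-α) p = g₀ α (-p)) :
    BackprojectionConverges Bt φ g₀ (-T) U u w := by
  intro ε hε x
  obtain ⟨h1, h2⟩ := h ε hε x
  refine ⟨fun k hk => ⟨fun j => ?_, ?_⟩, ?_⟩
  · obtain ⟨l, hl⟩ := (h1 k hk).1 (-j)
    refine ⟨l, hl.congr fun δ => ?_⟩
    rw [Pi.neg_apply, inner_neg_left, regularizedFilter_neg (heven _ (hT hk)) hφ]
    congr 1
    push_cast
    ring
  · exact summable_filteredTerm_neg (heven _ (hT hk)) hφ (hg _ (hT hk)) ε x (h1 k hk).2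
  · refine h2.congr fun k => ?_
    rw [Pi.neg_apply, tsum_filteredTerm_neg (heven _ (hT k.2)) hφ (hg _ (hT k.2))]

end Antipode

/-! ### The limit for the leading singularity of a Radon transform -/

section Signature

variable {d : ℕ} {H : Space d → ℝ} {Θ : Space d}

theorem matrixSignature_of_neg_posDef {ι : Type} [Fintype ι] {M : Matrix ι ι ℝ}
    (hM : (-M).PosDef) : matrixSignature M = -(Fintype.card ι : ℤ) := by
  classical
  have hH : M.IsHermitian := by simpa using hM.isHermitian.neg
  have hneg : ∀ i, hH.eigenvalues i < 0 := fun i => by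
    have h1 := hH.eigenvalues_eq i
    have h2 : (⇑(hH.eigenvectorBasis i) : ι → ℝ) ≠ 0 := fun h0 =>
      hH.eigenvectorBasis.orthonormal.ne_zero i (by ext j; exact congrFun h0 j)
    have h3 := hM.dotProduct_mulVec_pos h2
    rw [Matrix.neg_mulVec, dotProduct_neg] at h3
    rw [h1]
    simpa using h3
  rw [matrixSignature, dif_pos hH, Finset.filter_true_of_mem (p := fun i => hH.eigenvalues i < 0)
    (fun i _ => hneg i), Finset.filter_false_of_mem (p := fun i => 0 < hH.eigenvalues i)
    (fun i _ => (hneg i).not_gt)]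
  simp

theorem omega_eq (hΘ : ‖Θ‖ = 1) (hM : (-tangentHessian H Θ).PosDef) :
    omega H Θ = (Real.sqrt |(tangentHessian H Θ).det| : ℂ) *
      Complex.exp (Complex.I * Real.pi / 4 * d) / (((2 * Real.pi) ^ ((d : ℝ) / 2) : ℝ) : ℂ) := by
  have hΘ0 : Θ ≠ 0 := fun h => by simp [h] at hΘ
  have hfin : Module.finrank ℝ (Submodule.span ℝ {Θ})ᗮ = d :=
    Submodule.finrank_orthogonal_span_singleton hΘ0
  have hsig : matrixSignature (tangentHessian H Θ) = -(d : ℤ) := by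
    rw [matrixSignature_of_neg_posDef hM, Fintype.card_fin, hfin]
  rw [omega, hsig]
  congr 3
  push_cast
  ring

theorem sqrt_abs_det_pos (hM : (-tangentHessian H Θ).PosDef) :
    0 < Real.sqrt |(tangentHessian H Θ).det| := by
  have h1 := hM.det_pos
  rw [Matrix.det_neg] at h1
  exact Real.sqrt_pos.2 (abs_pos.2 (right_ne_zero_of_mul h1.ne'))

/-- The modulus of ω cancels the determinant and the power of 2π in μ. The signature is -d, so ω has
phase e^{iπd/4}, and with e^{-iπ(d-2)/4} it gives the factor i. -/
theorem mu_eq_of_cPlus {B₀ a₀ : Space d → ℂ} {s : ℝ} {v : ℂ} (hΘ : ‖Θ‖ = 1)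
    (hM : (-tangentHessian H Θ).PosDef) (hc : cPlus B₀ a₀ s Θ = B₀ Θ * (omega H Θ * v)) (t : ℝ) :
    mu H B₀ a₀ s Θ t = 2 * B₀ Θ * v * Complex.I * stepMinus t := by
  have h1 : (Real.sqrt |(tangentHessian H Θ).det| : ℂ) ≠ 0 := by
    exact_mod_cast (sqrt_abs_det_pos hM).ne'
  have h2 : (((2 * Real.pi) ^ ((d : ℝ) / 2) : ℝ) : ℂ) ≠ 0 := by
    exact_mod_cast (Real.rpow_pos_of_pos (by positivity) _).ne'
  have h3 : Complex.exp (-(Complex.I * ((((d : ℂ) + 1) - 3) / 2) * (Real.pi / 2))) *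
      Complex.exp (Complex.I * Real.pi / 4 * d) = Complex.I := by
    rw [← Complex.exp_add]
    refine Eq.trans ?_ Complex.exp_pi_div_two_mul_I
    congr 1
    ring
  rw [mu, cPlus₃, hc, omega_eq hΘ hM, Complex.ofReal_div, Complex.ofReal_mul]
  nth_rw 3 [← h3]
  field_simp
  push_cast
  ring

end Signature

section RadonLeading

variable {d : ℕ} {H : Space d → ℝ} {Θ : Space d} {v₀ : Space d → ℂ} {s : ℝ}

/-- The values at p = 1 and p = -1 are the coefficients of the one-sided powers. For non-integer s
the contributions of -Θ carry the factors i and -i and cancel, while those of Θ add up to 2 sin(πs),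
the denominator. For integer s the two terms agree because i^{2s} = (-1)^s. -/
theorem radonLeading_coeff (hs : 1 < s) :
    Real.Gamma s * (radonLeading H v₀ s Θ 1 * Complex.exp (Complex.I * Real.pi / 2 * s) +
      radonLeading H v₀ s Θ (-1) * Complex.exp (-(Complex.I * Real.pi / 2 * s))) =
      omega H Θ * v₀ Θ := by
  have hs0 : s - 1 ≠ 0 := by linarith
  have hΓ : (Real.Gamma s : ℂ) ≠ 0 := by
    exact_mod_cast (Real.Gamma_pos_of_pos (by linarith)).ne'
  unfold radonLeading
  generalize hX : omega H Θ * v₀ Θ = X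
  split_ifs with hn
  · obtain ⟨m, rfl⟩ := hn
    have hm : 1 < m := by exact_mod_cast hs
    obtain ⟨k, rfl⟩ : ∃ k, m = k + 1 := ⟨m - 1, by omega⟩
    have e1 : Complex.exp (Complex.I * Real.pi / 2 * ((k + 1 : ℕ) : ℝ)) = Complex.I ^ (k + 1) := by
      rw [show Complex.I ^ (k + 1) = Complex.exp (Real.pi / 2 * Complex.I) ^ (k + 1) by
        rw [Complex.exp_pi_div_two_mul_I], ← Complex.exp_nat_mul]
      congr 1
      push_cast
      ring
    have e2 : Complex.exp (-(Complex.I * Real.pi / 2 * ((k + 1 : ℕ) : ℝ))) =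
        (Complex.I ^ (k + 1))⁻¹ := by rw [Complex.exp_neg, e1]
    have hI : (Complex.I ^ (k + 1)) * Complex.I ^ (k + 1) = (-1) ^ (k + 1) := by
      rw [← mul_pow, Complex.I_mul_I]
    have hI0 : Complex.I ^ (k + 1) ≠ 0 := pow_ne_zero _ Complex.I_ne_zero
    have hf : ((k.factorial : ℕ) : ℂ) ≠ 0 := by exact_mod_cast k.factorial_ne_zero
    have hΓk : Real.Gamma ((k + 1 : ℕ) : ℝ) = k.factorial := by
      push_cast; exact Real.Gamma_nat_eq_factorial k
    rw [e1, e2, hΓk, Nat.floor_natCast, Real.sign_of_pos one_pos,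
      Real.sign_of_neg (by norm_num : (-1 : ℝ) < 0)]
    generalize Complex.I ^ (k + 1) = Z at *
    simp only [Nat.add_sub_cancel, one_pow]
    push_cast
    field_simp
    rw [pow_succ] at hI
    linear_combination -X * hI
  · have hsin : Real.sin (Real.pi * s) ≠ 0 := fun h0 => by
      obtain ⟨k, hk⟩ := Real.sin_eq_zero_iff.1 h0
      have hk' : (k : ℝ) = s := by
        have := Real.pi_pos.ne'
        rw [mul_comm] at hk
        exact mul_left_cancel₀ this hk
      refine hn ⟨k.toNat, ?_⟩
      have hk0 : 0 ≤ k := by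
        have : (0 : ℝ) < k := by linarith
        exact_mod_cast this.le
      rw [← hk']
      exact_mod_cast (Int.toNat_of_nonneg hk0).symm
    simp only [radonCoeff]
    rw [hX]
    generalize omega H (-Θ) * v₀ (-Θ) = Y
    have e1 : Complex.exp (Complex.I * (s - 1) * (Real.pi / 2)) =
        -Complex.I * Complex.exp (Complex.I * Real.pi / 2 * s) := by
      rw [← Complex.exp_neg_pi_div_two_mul_I, ← Complex.exp_add]
      refine congrArg Complex.exp ?_
      ring
    have e2 : Complex.exp (-(Complex.I * (s - 1) * (Real.pi / 2))) =
        Complex.I * Complex.exp (-(Complex.I * Real.pi / 2 * s)) := by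
      nth_rw 2 [← Complex.exp_pi_div_two_mul_I]
      rw [← Complex.exp_add]
      refine congrArg Complex.exp ?_
      ring
    have e3 : 2 * ((Real.sin (Real.pi * s) : ℝ) : ℂ) =
        -Complex.I * (Complex.exp (Complex.I * Real.pi / 2 * s) ^ 2 -
          Complex.exp (-(Complex.I * Real.pi / 2 * s)) ^ 2) := by
      rw [← Complex.exp_nat_mul, ← Complex.exp_nat_mul, Complex.ofReal_sin, Complex.sin,
        show ((2 : ℕ) : ℂ) * (Complex.I * Real.pi / 2 * s) = (Real.pi * s : ℝ) * Complex.I by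
          push_cast; ring,
        show ((2 : ℕ) : ℂ) * -(Complex.I * Real.pi / 2 * s) = -(Real.pi * s : ℝ) * Complex.I by
          push_cast; ring]
      ring
    have e4 : Complex.exp (Complex.I * Real.pi / 2 * s) *
        Complex.exp (-(Complex.I * Real.pi / 2 * s)) = 1 := by
      rw [← Complex.exp_add, add_neg_cancel, Complex.exp_zero]
    have e5 : ((Real.sin (Real.pi * s) : ℝ) : ℂ) ≠ 0 := by exact_mod_cast hsin
    have e6 : ∀ σ : ℂ, σ * Complex.I * (s - 1) * (Real.pi / 2) =
        σ * (Complex.I * (s - 1) * (Real.pi / 2)) := fun σ => by ring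
    norm_num [Real.zero_rpow hs0, e6]
    rw [e1, e2]
    generalize Complex.exp (Complex.I * Real.pi / 2 * s) = E at *
    generalize Complex.exp (-(Complex.I * Real.pi / 2 * s)) = E' at *
    push_cast at e3 e5
    field_simp
    linear_combination -X * e3

theorem cPlus_of_radonLeading {B₀ a₀ : Space d → ℂ} (hs : 1 < s)
    (h : ∀ p : ℝ, a₀ Θ * ((max p 0 ^ (s - 1) : ℝ) : ℂ) +
      a₀ (-Θ) * ((max (-p) 0 ^ (s - 1) : ℝ) : ℂ) = radonLeading H v₀ s Θ p) :
    cPlus B₀ a₀ s Θ = B₀ Θ * (omega H Θ * v₀ Θ) := by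
  have hs0 : s - 1 ≠ 0 := by linarith
  have h1 := h 1
  have h2 := h (-1)
  norm_num [Real.zero_rpow hs0] at h1 h2
  rw [← radonLeading_coeff hs, cPlus, h1, h2]
  ring

end RadonLeading

end DTB

end

theorem mainTheorem3 (d : ℕ) (hd : 1 ≤ d)
    (H : DTB.Space d → ℝ) (Θ₀ x₀ : DTB.Space d)
    (hH_smooth : ContDiffOn ℝ ∞ H {0}ᶜ)
    (hH_homog : ∀ c : ℝ, 0 < c → ∀ ξ : DTB.Space d, ξ ≠ 0 → H (c • ξ) = c * H ξ)
    (hΘ₀ : ‖Θ₀‖ = 1)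
    (hx₀ : HasGradientAt H x₀ Θ₀) :
    -- `Ω` is any sufficiently small neighbourhood of `Θ₀` in the sphere
    ∃ r : ℝ, 0 < r ∧ ∀ Ω : Set (DTB.Space d), Ω ⊆ Metric.ball Θ₀ r → Θ₀ ∈ Ω →
    (∃ V : Set (DTB.Space d), IsOpen V ∧ Ω = V ∩ DTB.unitSphere d) →
    (∀ α ∈ Ω, H (-α) = -H α) →
    (∀ α ∈ Ω, (-(DTB.tangentHessian H α)).PosDef) →
    -- the operator, the data, and the interpolation kernel
    ∀ (s β : ℝ), (((d : ℝ) + 1) + 1) / 2 ≤ s → β - s - (((d : ℝ) + 1) - 3) / 2 = 0 →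
    ∀ (B₀ : DTB.Space d → ℂ) (Bt : DTB.Space d → ℝ → ℂ), DTB.SmoothOnSphere B₀ →
    (∀ α ∈ DTB.unitSphere d, ∀ τ : ℝ, 0 < τ → Bt α τ = ((τ ^ β : ℝ) : ℂ) * B₀ α) →
    (∀ α ∈ DTB.unitSphere d, ∀ τ : ℝ, Bt (-α) (-τ) = Bt α τ) →
    ∀ (a₀ : DTB.Space d → ℂ) (g₀ : DTB.Space d → ℝ → ℂ),
    DTB.SmoothCompactSupportIn a₀ (Ω ∪ -Ω) →
    (∀ α ∈ Ω ∪ -Ω, ∀ p : ℝ, g₀ α (H α + p) =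
      a₀ α * ((max p 0 ^ (s - 1) : ℝ) : ℂ) + a₀ (-α) * ((max (-p) 0 ^ (s - 1) : ℝ) : ℂ)) →
    (∀ α ∈ Ω, DTB.cMinus B₀ a₀ s α =
      Complex.exp (-(Complex.I * (β - s) * Real.pi)) * DTB.cPlus B₀ a₀ s α) →
    ∀ φ : ℝ → ℝ, DTB.IsInterpolationKernel β φ →
    -- the directions in `Ω`
    ∀ (U : Set (DTB.Param d)) (u : ℝ → Fin d → ℝ), IsOpen U → 0 ∈ U →
    (∀ ε : ℝ, ∀ i : Fin d, u ε i ∈ Set.Ico (0 : ℝ) 1) →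
    ∀ (T : DTB.Param d → DTB.Space d) (w : ℝ → (Fin d → ℤ) → ℝ),
    DTB.IsDirectionChart T U Ω → T 0 = Θ₀ → DTB.IsGeneric T x₀ → DTB.IsCellVolume T U u w →
    -- the reconstruction that uses the directions in `Ω` only, doubled by evenness
    (DTB.BackprojectionConverges Bt φ g₀ T U u w ∧
      ∀ V : Set (DTB.Space d), Bornology.IsBounded V →
        TendstoUniformlyOn
          (fun (ε : ℝ) (y : DTB.Space d) =>
            2 * DTB.backprojection Bt φ g₀ T U u w ε (x₀ + ε • y))
          (fun y => DTB.conv φ (DTB.mu H B₀ a₀ s Θ₀) (inner ℝ y Θ₀)) (𝓝[>] 0) V) ∧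
    -- the reconstruction that uses the directions in `Ω` and in `-Ω`, for an even kernel
    ((∀ t : ℝ, φ (-t) = φ t) →
      ∀ (Tm : DTB.Param d → DTB.Space d) (wm : ℝ → (Fin d → ℤ) → ℝ),
      DTB.IsDirectionChart Tm U (-Ω) → Tm 0 = -Θ₀ → DTB.IsGeneric Tm x₀ →
      DTB.IsCellVolume Tm U u wm →
      DTB.BackprojectionConverges Bt φ g₀ Tm U u wm ∧
      ∀ V : Set (DTB.Space d), Bornology.IsBounded V →
        TendstoUniformlyOn
          (fun (ε : ℝ) (y : DTB.Space d) =>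
            DTB.backprojection Bt φ g₀ T U u w ε (x₀ + ε • y)
              + DTB.backprojection Bt φ g₀ Tm U u wm ε (x₀ + ε • y))
          (fun y => DTB.conv φ (DTB.mu H B₀ a₀ s Θ₀) (inner ℝ y Θ₀)) (𝓝[>] 0) V) ∧
    -- the case when the data are the leading singularity of a Radon transform
    (∀ v₀ : DTB.Space d → ℂ,
      (∀ α ∈ Ω ∪ -Ω, ∀ p : ℝ, g₀ α (H α + p) = DTB.radonLeading H v₀ s α p) →
      ∀ t : ℝ, DTB.mu H B₀ a₀ s Θ₀ t = 2 * B₀ Θ₀ * v₀ Θ₀ * Complex.I * DTB.stepMinus t) := by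
  by_cases hM : (-(DTB.tangentHessian H Θ₀)).PosDef
  swap
  -- Without definiteness at Θ₀ no Ω satisfies the hypotheses and any radius will do.
  · exact ⟨1, one_pos, fun Ω _ hΩ0 _ _ hp => absurd (hp Θ₀ hΩ0) hM⟩
  obtain ⟨c, hc, r, hr, hphase⟩ := DTB.exists_le_phase hH_smooth hH_homog hΘ₀ hx₀ hM
  -- The radius r comes from the quadratic lower bound of the phase; 1/2 separates the supports in Ω
  -- and in -Ω.
  refine ⟨min r (1 / 2), by positivity, ?_⟩
  rintro Ω hΩr hΩ0 ⟨V₀, -, hΩV⟩ hodd - s β hs hβ B₀ Bt hB hpos heven a₀ g₀ ha hg hcoef φ hφ U u hU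
    h0 hu T w hT hT0 hgen hw
  have hΩ : Ω ⊆ DTB.unitSphere d := hΩV ▸ Set.inter_subset_right
  have hball : Ω ⊆ Metric.ball Θ₀ (1 / 2) :=
    hΩr.trans (Metric.ball_subset_ball (min_le_right _ _))
  have hlower : ∃ c > 0, ∀ α ∈ Ω, c * ‖α - Θ₀‖ ^ 2 ≤ DTB.phase H x₀ α := by
    refine ⟨c, hc, fun α hα => hphase α (by simpa using hΩ hα) ?_⟩
    rw [← dist_eq_norm]
    exact (hΩr hα).trans_le (min_le_left _ _)
  have hβ' : β = s + (d : ℝ) / 2 - 1 := by linarith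
  have hpos' : ∀ α ∈ DTB.unitSphere d, ∀ τ : ℝ, 0 < τ →
      Bt α τ = ((τ ^ (s + (d : ℝ) / 2 - 1) : ℝ) : ℂ) * B₀ α := hβ' ▸ hpos
  have hgΩ : ∀ α ∈ Ω, ∀ p : ℝ, g₀ α (H α + p) =
      a₀ α * ((max p 0 ^ (s - 1) : ℝ) : ℂ) + a₀ (-α) * ((max (-p) 0 ^ (s - 1) : ℝ) : ℂ) :=
    fun α hα => hg α (Or.inl hα)
  -- Stated for any chart of Ω because it is applied both to T and to -Tm; each contributes half of
  -- the limit.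
  have key : ∀ (T : DTB.Param d → DTB.Space d) (w : ℝ → (Fin d → ℤ) → ℝ),
      DTB.IsDirectionChart T U Ω → T 0 = Θ₀ → DTB.IsGeneric T x₀ → DTB.IsCellVolume T U u w →
      DTB.BackprojectionConverges Bt φ g₀ T U u w ∧ ∀ y₀,
        Tendsto (fun p : ℝ × DTB.Space d => DTB.backprojection Bt φ g₀ T U u w p.1 (x₀ + p.1 • p.2))
          (𝓝[>] 0 ×ˢ 𝓝 y₀) (𝓝 (DTB.conv φ (DTB.mu H B₀ a₀ s Θ₀) (inner ℝ y₀ Θ₀) / 2)) := by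
    intro T w hT hT0 hgen hw
    subst hT0
    obtain ⟨m, n, L, R, hset⟩ := DTB.exists_isLocalSetup hd hH_smooth hH_homog hx₀ hM hΩ hball
      hlower hs hβ' hB ha hcoef hφ hU h0 hu hT hw
    exact ⟨hset.backprojectionConverges hpos' heven hgΩ,
      hset.tendsto_backprojection hgen hpos' heven hgΩ⟩
  have hcont := DTB.continuous_conv_mu H B₀ a₀ s Θ₀ hφ.smooth.continuous hφ.compactSupport
  obtain ⟨hconv, hlim⟩ := key T w hT hT0 hgen hw
  refine ⟨⟨hconv, fun V hV => DTB.tendstoUniformlyOn_of_tendsto_prod hcont (fun y₀ => ?_) hV⟩, ?_,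
    fun v₀ hv t => ?_⟩
  · have h1 := (hlim y₀).const_mul 2
    rwa [mul_div_cancel₀ _ two_ne_zero] at h1
  · intro heven_φ Tm wm hTm hTm0 hgenm hwm
    have hTn : DTB.IsDirectionChart (-Tm) U Ω := by simpa using hTm.neg
    obtain ⟨hconv', hlim'⟩ := key (-Tm) wm hTn (by simp [hTm0]) hgenm.neg hwm.neg
    have hev : ∀ α ∈ Ω, ∀ τ : ℝ, Bt (-α) (-τ) = Bt α τ := fun α hα => heven α (hΩ hα)
    -- Oddness of H exchanges the two one-sided powers, and the data formula exchanges their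
    -- coefficients.
    have hgneg : ∀ α ∈ Ω, ∀ p, g₀ (-α) p = g₀ α (-p) := by
      intro α hα p
      have h1 := hg (-α) (Or.inr (by simpa using hα)) (p + H α)
      have h2 := hgΩ α hα (-(p + H α))
      rw [hodd α hα, neg_neg, show -H α + (p + H α) = p by ring] at h1
      rw [neg_neg, show H α + -(p + H α) = -p by ring] at h2
      rw [h1, h2, add_comm]
    have hback : ∀ ε x, DTB.backprojection Bt φ g₀ Tm U u wm ε x =
        DTB.backprojection Bt φ g₀ (-Tm) U u wm ε x := fun ε x => by
      have := DTB.backprojection_neg (u := u) (w := wm) hTn.bijOn.mapsTo hev heven_φ hgneg ε x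
      rwa [neg_neg] at this
    refine ⟨by simpa using hconv'.neg hTn.bijOn.mapsTo hev heven_φ hgneg, fun V hV =>
      DTB.tendstoUniformlyOn_of_tendsto_prod hcont (fun y₀ => ?_) hV⟩
    simp only [hback]
    have h1 := (hlim y₀).add (hlim' y₀)
    rwa [add_halves] at h1
  · have hs1 : 1 < s := by
      have : (1 : ℝ) ≤ d := by exact_mod_cast hd
      linarith
    exact DTB.mu_eq_of_cPlus hΘ₀ hM (DTB.cPlus_of_radonLeading hs1 fun p =>
      (hgΩ Θ₀ hΩ0 p).symm.trans (hv Θ₀ (Or.inl hΩ0) p)) t
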